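/- Sign vectors on a finite set $E$ are the elements $X$ of $\{+,-,0\}^E$; write $\underline X=\{e: X_e\neq 0\}$, $X^0=E\setminus\underline X$, and $S(X,Y)=\{e:\{X_e,Y_e\}=\{+,-\}\}$. A *uniform oriented matroid* of rank $r$ on a ground set $E$ with $n$ elements is given by its set of cocircuits $\mathcal C^*\subseteq\{+,-,0\}^E$, subject to: (C1) $|\underline X|=n-r+1$ for all $X\in\mathcal C^*$; (C2) for every $I\subseteq E$ with $|I|=n-r+1$ there are exactly two $X,Y\in\mathcal C^*$ with support $I$, and $Y=-X$; (C3) for all $X,Y\in\mathcal C^*$ with $X\neq -Y$ and all $e\in S(X,Y)$ there is $Z\in\mathcal C^*$ with $Z_e=0$ and $Z_f\in\{X_f,Y_f,0\}$ for all $f\neq e$. Its *cocircuit graph* has vertex set $\mathcal C^*$, with $X,Y$ adjacent if and only if $|X^0\,\Delta\, Y^0|=2$ and $S(X,Y)=\emptyset$. An *OM-labeling* of a graph $G=(V,\mathcal E)$ is a bijection $L$ from $V$ to the set of cocircuits of a uniform oriented matroid that is an isomorphism from $G$ to its cocircuit graph. **Theorem.** There is an algorithm which, given a finite simple connected graph $G=(V,\mathcal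 E)$ (by its adjacency matrix), decides whether $G$ is isomorphic to the cocircuit graph of a uniform oriented matroid, and in the affirmative case returns the rank $r$, the number of elements $n$ and an OM-labeling $L$ of $G$, that is, the list $(L(v))_{v\in V}$ of all signed cocircuits. The number of its steps on a random access machine with uniform cost (on natural numbers, with addition, truncated subtraction, indirect addressing and branching) is bounded as follows, with an absolute implied constant. 1. If $G$ is $2(r-1)$-regular and $|V|=2\binom{n}{n-r+1}$ with $1\le r\le n$ (which holds for every connected cocircuit graph of a uniform oriented matroid of rank $r$ on $n$ elements), it is $O\big(r(n-r+1)|V|^3\big)$; in particular it is $O\big(r(n-r)|V|^3\big)$ when $n>r$. More precisely, it is $O\big((1+|D(v)|)\,r(n-r+1)|V|^2\big)$ for some vertex $v\in V$, where $D(v)=\{w\in V: d(v,w)=n-r+2\}$ and $d$ is the distance in $G$. 2. If there are no such $r$ and $n$, in which case $G$ is not a cocircuit graph, it is $O(|V|^2)$. -/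

import Mathlib

/-! ## Uniform oriented matroids and their cocircuit graphs -/

/-- Sign vectors on the ground set `Fin n`. `SignType` has the three elements `0`, `1`, `-1`;
negation of a sign vector is coordinatewise. -/
abbrev SignVec (n : ℕ) : Type := Fin n → SignType

namespace SignVec

variable {n : ℕ}

/-- The support of a sign vector. -/
def supp (X : SignVec n) : Finset (Fin n) := Finset.univ.filter fun e => X e ≠ 0

/-- The zero-support of a sign vector. -/
def zeros (X : SignVec n) : Finset (Fin n) := Finset.univ.filter fun e => X e = 0

/-- The separator: the coordinates in which one entry is `+` and the other one is `-`. -/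
def sep (X Y : SignVec n) : Finset (Fin n) :=
  Finset.univ.filter fun e => (X e = 1 ∧ Y e = -1) ∨ (X e = -1 ∧ Y e = 1)

/-- The adjacency relation of cocircuit graphs: the zero-supports have symmetric difference
of size two, and the separator is empty. -/
def Near (X Y : SignVec n) : Prop :=
  (symmDiff X.zeros Y.zeros).card = 2 ∧ sep X Y = ∅

end SignVec

/-- `C` is the set of cocircuits of a uniform oriented matroid of rank `r` on `n` elements.
The size `n - r + 1` of supports is written without subtraction. Elimination is required
for `X ≠ -Y`, as is standard (for `X = -Y` it would contradict the first two axioms). -/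
structure IsUniformOM (n r : ℕ) (C : Set (SignVec n)) : Prop where
  card_supp : ∀ X ∈ C, X.supp.card + r = n + 1
  pair : ∀ I : Finset (Fin n), I.card + r = n + 1 →
    ∃ X Y : SignVec n, X ≠ Y ∧ -X = Y ∧ {Z | Z ∈ C ∧ Z.supp = I} = {X, Y}
  elim : ∀ X ∈ C, ∀ Y ∈ C, X ≠ -Y → ∀ e ∈ SignVec.sep X Y,
    ∃ Z ∈ C, Z e = 0 ∧ ∀ f, f ≠ e → Z f = X f ∨ Z f = Y f ∨ Z f = 0

/-- The cocircuit graph on a set of sign vectors. -/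
def cocircuitGraph {n : ℕ} (C : Set (SignVec n)) : SimpleGraph C where
  Adj X Y := SignVec.Near X.1 Y.1
  symm := ⟨fun X Y h => by
    refine ⟨by rw [symmDiff_comm]; exact h.1, ?_⟩
    have h2 := h.2
    simp only [SignVec.sep, Finset.filter_eq_empty_iff] at h2 ⊢
    intro e he
    have := h2 he
    tauto⟩
  loopless := ⟨fun X h => by
    have := h.1
    simp at this⟩

/-- `G` is (isomorphic to) the cocircuit graph of some uniform oriented matroid. -/
def IsCocircuitGraph {V : Type} (G : SimpleGraph V) : Prop :=
  ∃ (n r : ℕ) (C : Set (SignVec n)), IsUniformOM n r C ∧ Nonempty (G ≃g cocircuitGraph C)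

/-- `L` is an OM-labeling of `G` of rank `r` on `n` elements: a bijection from the vertices to
the cocircuits `Set.range L` of a uniform oriented matroid, carrying adjacency in `G` to
adjacency in the cocircuit graph. -/
structure IsOMLabeling {V : Type} (G : SimpleGraph V) (n r : ℕ) (L : V → SignVec n) : Prop where
  injective : Function.Injective L
  isUniformOM : IsUniformOM n r (Set.range L)
  adj_iff : ∀ v w, G.Adj v w ↔ SignVec.Near (L v) (L w)

/-- `(r, n)` are parameters for which `G` passes the numerical test: `G` is `2 (r - 1)`-regular
and has `2 * (n choose (n - r + 1))` vertices. -/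
def HasParameters {N : ℕ} (G : SimpleGraph (Fin N)) (n r : ℕ) : Prop :=
  1 ≤ r ∧ r ≤ n ∧ (∀ v, (G.neighborSet v).ncard = 2 * (r - 1)) ∧ N = 2 * n.choose (n - r + 1)

/-- The vertices at distance `n - r + 2` from `v`: the candidates for the antipode of `v`. -/
def antipodeCandidates {N : ℕ} (G : SimpleGraph (Fin N)) (n r : ℕ) (v : Fin N) : Set (Fin N) :=
  {w | G.dist v w = n - r + 2}

/-! ## Random access machines with uniform cost

Finitely many registers of a program and an unbounded memory hold natural numbers; the operations
are constants, addition, truncated subtraction, indirect reading and writing, and branching on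
zero. Programs are structured (sequence, conditional, loop). There is no multiplication. -/

namespace RAM

/-- A configuration: the contents of the registers and of the memory cells. -/
structure State where
  reg : ℕ → ℕ
  mem : ℕ → ℕ

/-- Expressions. -/
inductive Term : Type
  | const (k : ℕ) : Term
  | reg (x : ℕ) : Term
  | load (a : Term) : Term
  | add (a b : Term) : Term
  | sub (a b : Term) : Term

namespace Term

/-- The value of an expression; `sub` is truncated subtraction. -/
def eval (s : State) : Term → ℕ
  | const k => k
  | reg x => s.reg x
  | load a => s.mem (a.eval s)
  | add a b => a.eval s + b.eval s
  | sub a b => a.eval s - b.eval s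

/-- The cost of evaluating an expression: one unit for each operation in it. -/
def cost : Term → ℕ
  | const _ => 1
  | reg _ => 1
  | load a => a.cost + 1
  | add a b => a.cost + b.cost + 1
  | sub a b => a.cost + b.cost + 1

end Term

/-- Programs. Conditions are expressions, and hold when their value is nonzero. -/
inductive Prog : Type
  | skip : Prog
  | assign (x : ℕ) (a : Term) : Prog
  | store (a b : Term) : Prog
  | seq (p q : Prog) : Prog
  | ite (c : Term) (p q : Prog) : Prog
  | loop (c : Term) (p : Prog) : Prog

/-- `Exec p s t s'`: started in `s`, the program `p` halts in `s'` after exactly `t` steps. -/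
inductive Exec : Prog → State → ℕ → State → Prop
  | skip (s : State) : Exec Prog.skip s 1 s
  | assign (x : ℕ) (a : Term) (s : State) :
      Exec (Prog.assign x a) s (a.cost + 1) ⟨Function.update s.reg x (a.eval s), s.mem⟩
  | store (a b : Term) (s : State) :
      Exec (Prog.store a b) s (a.cost + b.cost + 1)
        ⟨s.reg, Function.update s.mem (a.eval s) (b.eval s)⟩
  | seq {p q : Prog} {s s' s'' : State} {t t' : ℕ} :
      Exec p s t s' → Exec q s' t' s'' → Exec (Prog.seq p q) s (t + t') s''
  | ite_true {c : Term} {p q : Prog} {s s' : State} {t : ℕ} :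
      c.eval s ≠ 0 → Exec p s t s' → Exec (Prog.ite c p q) s (c.cost + 1 + t) s'
  | ite_false {c : Term} {p q : Prog} {s s' : State} {t : ℕ} :
      c.eval s = 0 → Exec q s t s' → Exec (Prog.ite c p q) s (c.cost + 1 + t) s'
  | loop_true {c : Term} {p : Prog} {s s' s'' : State} {t t' : ℕ} :
      c.eval s ≠ 0 → Exec p s t s' → Exec (Prog.loop c p) s' t' s'' →
      Exec (Prog.loop c p) s (c.cost + 1 + t + t') s''
  | loop_false {c : Term} {p : Prog} {s : State} :
      c.eval s = 0 → Exec (Prog.loop c p) s (c.cost + 1) s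

/-- The machine is deterministic: a program has at most one halting run from a given state, so
that its running time is well defined. -/
theorem Exec.deterministic {p : Prog} {s s₁ : State} {t₁ : ℕ} (h₁ : Exec p s t₁ s₁) :
    ∀ {s₂ : State} {t₂ : ℕ}, Exec p s t₂ s₂ → t₁ = t₂ ∧ s₁ = s₂ := by
  induction h₁ with
  | skip s => intro _ _ h; cases h; exact ⟨rfl, rfl⟩
  | assign x a s => intro _ _ h; cases h; exact ⟨rfl, rfl⟩
  | store a b s => intro _ _ h; cases h; exact ⟨rfl, rfl⟩
  | seq _ _ ihp ihq =>
    intro _ _ h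
    cases h with
    | seq hp hq =>
      obtain ⟨rfl, rfl⟩ := ihp hp
      obtain ⟨rfl, rfl⟩ := ihq hq
      exact ⟨rfl, rfl⟩
  | ite_true hc _ ih =>
    intro _ _ h
    cases h with
    | ite_true _ hp => obtain ⟨rfl, rfl⟩ := ih hp; exact ⟨rfl, rfl⟩
    | ite_false hc' _ => exact absurd hc' hc
  | ite_false hc _ ih =>
    intro _ _ h
    cases h with
    | ite_true hc' _ => exact absurd hc hc'
    | ite_false _ hp => obtain ⟨rfl, rfl⟩ := ih hp; exact ⟨rfl, rfl⟩
  | loop_true hc _ _ ihp ihl =>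
    intro _ _ h
    cases h with
    | loop_true _ hp hl =>
      obtain ⟨rfl, rfl⟩ := ihp hp
      obtain ⟨rfl, rfl⟩ := ihl hl
      exact ⟨rfl, rfl⟩
    | loop_false hc' => exact absurd hc' hc
  | loop_false hc =>
    intro _ _ h
    cases h with
    | loop_true hc' _ _ => exact absurd hc hc'
    | loop_false _ => exact ⟨rfl, rfl⟩

open Classical in
/-- The input: register `0` holds the number `N` of vertices, the memory holds the adjacency
matrix of `G` row by row, and everything else is zero. -/
noncomputable def input {N : ℕ} (G : SimpleGraph (Fin N)) : State where
  reg x := if x = 0 then N else 0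
  mem a := if ∃ i j : Fin N, a = i.val * N + j.val ∧ G.Adj i j then 1 else 0

/-- The code of a sign. -/
def signCode : SignType → ℕ
  | SignType.zero => 0
  | SignType.pos => 1
  | SignType.neg => 2

/-- The final state rejects. -/
def State.Rejects (s : State) : Prop := s.reg 0 = 0

/-- The final state accepts and returns the labeling `L`: register `0` holds `1`, registers `1`
and `2` hold `r` and `n`, and from the address in register `3` on the memory holds the list of the
sign vectors `L 0, …, L (N - 1)`, each of them by its `n` entries. -/
def State.Returns {N : ℕ} (s : State) (n r : ℕ) (L : Fin N → SignVec n) : Prop :=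
  s.reg 0 = 1 ∧ s.reg 1 = r ∧ s.reg 2 = n ∧
    ∀ (i : Fin N) (e : Fin n), s.mem (s.reg 3 + (i.val * n + e.val)) = signCode (L i e)

end RAM

/-! Regularity gives `r` and the number of vertices then gives `n` (`HasParameters.unique`); both
are found with a table of binomial coefficients. Below, `h = r - 1`.

In a cocircuit graph nearly everything can be read off from distances. A step of the graph makes one
zero coordinate nonzero and one nonzero coordinate zero, so the distance from `X` to `Y` is at least
the number of nonzero coordinates of `X` in which `Y` differs (`card_gap_le`). On a coline, where
the zero sets differ by one exchange, the bound is attained: the distance is one more than the size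
of the separator (`dist_eq`). Hence antipodes have distance `n - r + 2` (`dist_anti`), the vertices
on a coline with `v` are those other than `v` and `-v` for which the distances to `v` and `-v` add
up to `n - r + 2` (`coline_iff`), and among the neighbours of `-v` only `-u` has distance `n - r +
2` from a neighbour `u` of `v` (`anti_rule`). One guess for the antipode of the vertex `0` thus
determines all antipodes; the candidates account for the factor `1 + |D(v)|`.

Once antipodes are known, the elements are named at the vertex `0`: its zeros by the `r - 1` lines
through it, its support by the vertices behind one of its neighbours (`exists_elements`). The zero
sets of the other vertices follow by induction on the number of their elements outside the zero set
of the vertex `0` (`zero_iff_of_mem`, `zero_iff_of_notMem`). Signs are propagated from one seed for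
each element, because separation is visible as betweenness on a coline (`mem_sep_iff`). The result
agrees with any given labeling up to relabelling and reorientation, which preserve labelings
(`IsOMLabeling.reorient`).

A wrong guess, or a graph that is no cocircuit graph, is caught by a check of pairs of vertices
(`IsOMLabeling.of_pairs`). Counting shows that each support occurs exactly twice, and walks as short
as the separators allow give elimination on colines. That this implies full elimination
(`IsModularOM.isUniformOM`) rests on the connectedness of the set of cocircuits with prescribed
zeros and signs (`region_connected`).

For the time bound the algorithm is written in a language of bounded loops over `N` by `N` matrices
and compiled to the machine (`Cmd.runs_compile`). The cost is a constant times the largest product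
of nested loop bounds (`Cmd.cost_le`). There are at most `min h (n - h)` levels, so a pass over all
elements on all levels costs `n * min h (n - h)`, which is of the order of `h * (n - h)`
(`succ_mul_min_le`). -/

/-! ## A loop language over matrices, and its compilation to random access machines -/

namespace RAM

/-- Expressions of the loop language: constants, variables, variables bound by aggregates,
entries of matrices, sums and truncated differences, conditionals, and aggregates (the sum, or the
maximum) over all values of a bound variable below the value of a variable. The bound variables
are numbered by their nesting depth. -/
inductive Expr : Type
  | const (k : ℕ) : Expr
  | var (x : ℕ) : Expr
  | loc (d : ℕ) : Expr
  | arr (k : ℕ) (i j : Expr) : Expr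
  | add (a b : Expr) : Expr
  | sub (a b : Expr) : Expr
  | ite (c a b : Expr) : Expr
  | agg (op : Bool) (b : ℕ) (e : Expr) : Expr

/-- The memory of the loop language: variables, square matrices whose size is the value of
variable `0`, and an output tape. -/
structure Store where
  var : ℕ → ℕ
  arr : ℕ → ℕ → ℕ → ℕ
  out : ℕ → ℕ

namespace Store

/-- Access to an entry of a matrix, where indices are truncated to the size. -/
def get (s : Store) (k i j : ℕ) : ℕ := s.arr k (min i (s.var 0 - 1)) (min j (s.var 0 - 1))

/-- Assignment to a variable. -/
def setv (s : Store) (x v : ℕ) : Store := ⟨Function.update s.var x v, s.arr, s.out⟩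

/-- Assignment to an entry of a matrix. -/
def put (s : Store) (k i j v : ℕ) : Store :=
  ⟨s.var, fun k' i' j' => if k' = k ∧ i' = min i (s.var 0 - 1) ∧ j' = min j (s.var 0 - 1) then v
    else s.arr k' i' j', s.out⟩

/-- Assignment to a cell of the output tape. -/
def emit (s : Store) (i v : ℕ) : Store := ⟨s.var, s.arr, Function.update s.out i v⟩

end Store

/-- The value of an aggregate: the sum if `op` is true, else the maximum. -/
def aggr (op : Bool) (n : ℕ) (f : ℕ → ℕ) : ℕ :=
  if op then ∑ i ∈ Finset.range n, f i else (Finset.range n).sup f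

/-- One step in the evaluation of an aggregate. -/
def aggrStep (op : Bool) (a b : ℕ) : ℕ := if op then a + b else a + (b - a)

theorem aggr_zero (op : Bool) (f : ℕ → ℕ) : aggr op 0 f = 0 := by
  cases op <;> simp [aggr]

theorem aggr_succ (op : Bool) (n : ℕ) (f : ℕ → ℕ) :
    aggr op (n + 1) f = aggrStep op (aggr op n f) (f n) := by
  cases op
  · simp only [aggr, aggrStep, Bool.false_eq_true, if_false, Finset.range_add_one,
      Finset.sup_insert]
    omega
  · simp [aggr, aggrStep, Finset.sum_range_succ]

namespace Expr

/-- The value of an expression; `d` is the nesting depth and `ρ` gives the values of the bound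
variables. -/
def eval (s : Store) : Expr → ℕ → (ℕ → ℕ) → ℕ
  | const k, _, _ => k
  | var x, _, _ => s.var x
  | loc i, _, ρ => ρ i
  | arr k i j, d, ρ => s.get k (eval s i d ρ) (eval s j d ρ)
  | add a b, d, ρ => eval s a d ρ + eval s b d ρ
  | sub a b, d, ρ => eval s a d ρ - eval s b d ρ
  | ite c a b, d, ρ => if eval s c d ρ ≠ 0 then eval s a d ρ else eval s b d ρ
  | agg op b e, d, ρ => aggr op (s.var b) fun i => eval s e (d + 1) (Function.update ρ d i)

/-- A bound for the cost of evaluating an expression, for given values of the variables. -/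
def ec (β : ℕ → ℕ) : Expr → ℕ
  | const _ => 40
  | var _ => 40
  | loc _ => 40
  | arr _ i j => ec β i + ec β j + 40
  | add a b => ec β a + ec β b + 40
  | sub a b => ec β a + ec β b + 40
  | ite c a b => ec β c + ec β a + ec β b + 40
  | agg _ b e => (β b + 1) * (ec β e + 40)

end Expr

/-- The number of matrices. -/
def numArr : ℕ := 32

namespace Expr

/-- Well-formedness of expressions. -/
def wf : Expr → ℕ → Bool
  | const _, _ => true
  | var _, _ => true
  | loc i, d => decide (i < d)
  | arr k i j, d => decide (k < numArr) && wf i d && wf j d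
  | add a b, d => wf a d && wf b d
  | sub a b, d => wf a d && wf b d
  | ite c a b, d => wf c d && wf a d && wf b d
  | agg _ _ e, d => wf e (d + 1)

/-- The term that truncates an index to the size of the matrices. -/
def clip (e : Term) : Term :=
  Term.sub e (Term.sub e (Term.sub (Term.reg 0) (Term.const 1)))

/-- The address of an entry of a matrix. The registers `4 * k + 1` hold the addresses of the
matrices, and matrix `1` starts with the table of the offsets of the rows. -/
def addr (k : ℕ) (i j : Term) : Term :=
  Term.add (Term.reg (4 * k + 1)) (Term.add (Term.load (Term.add (Term.reg 5) (clip i))) (clip j))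

/-- The compiled expression leaves its value in register `4 * t + 3`. -/
def compile : Expr → ℕ → ℕ → Prog
  | const k, _, t => Prog.assign (4 * t + 3) (Term.const k)
  | var x, _, t => Prog.assign (4 * t + 3) (Term.reg (4 * x))
  | loc i, _, t => Prog.assign (4 * t + 3) (Term.reg (4 * i + 2))
  | arr k i j, d, t => Prog.seq (compile i d t) (Prog.seq (compile j d (t + 1))
      (Prog.assign (4 * t + 3)
        (Term.load (addr k (Term.reg (4 * t + 3)) (Term.reg (4 * (t + 1) + 3))))))
  | add a b, d, t => Prog.seq (compile a d t) (Prog.seq (compile b d (t + 1))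
      (Prog.assign (4 * t + 3) (Term.add (Term.reg (4 * t + 3)) (Term.reg (4 * (t + 1) + 3)))))
  | sub a b, d, t => Prog.seq (compile a d t) (Prog.seq (compile b d (t + 1))
      (Prog.assign (4 * t + 3) (Term.sub (Term.reg (4 * t + 3)) (Term.reg (4 * (t + 1) + 3)))))
  | ite c a b, d, t => Prog.seq (compile c d t)
      (Prog.ite (Term.reg (4 * t + 3)) (compile a d t) (compile b d t))
  | agg op b e, d, t => Prog.seq (Prog.assign (4 * t + 3) (Term.const 0))
      (Prog.seq (Prog.assign (4 * d + 2) (Term.const 0))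
        (Prog.loop (Term.sub (Term.reg (4 * b)) (Term.reg (4 * d + 2)))
          (Prog.seq (compile e (d + 1) (t + 1))
            (Prog.seq (Prog.assign (4 * t + 3)
              (if op then Term.add (Term.reg (4 * t + 3)) (Term.reg (4 * (t + 1) + 3))
                else Term.add (Term.reg (4 * t + 3))
                  (Term.sub (Term.reg (4 * (t + 1) + 3)) (Term.reg (4 * t + 3)))))
              (Prog.assign (4 * d + 2) (Term.add (Term.reg (4 * d + 2)) (Term.const 1)))))))

end Expr

/-- `p` halts from `σ` within `T` steps in a state that satisfies `Q`. -/
def Runs (p : Prog) (σ : State) (T : ℕ) (Q : State → Prop) : Prop :=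
  ∃ t σ', Exec p σ t σ' ∧ t ≤ T ∧ Q σ'

/-! ### Rules for executions with a bound on the time. -/

namespace Runs

theorem mono {p : Prog} {σ : State} {T T' : ℕ} {Q Q' : State → Prop} (h : Runs p σ T Q)
    (hT : T ≤ T') (hQ : ∀ σ', Q σ' → Q' σ') : Runs p σ T' Q' := by
  obtain ⟨t, σ', h1, h2, h3⟩ := h
  exact ⟨t, σ', h1, h2.trans hT, hQ _ h3⟩

theorem seq {p q : Prog} {σ : State} {T T' : ℕ} {Q Q' : State → Prop} (h : Runs p σ T Q)
    (h' : ∀ σ', Q σ' → Runs q σ' T' Q') : Runs (Prog.seq p q) σ (T + T') Q' := by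
  obtain ⟨t, σ', h1, h2, h3⟩ := h
  obtain ⟨t', σ'', h1', h2', h3'⟩ := h' _ h3
  exact ⟨_, _, Exec.seq h1 h1', by omega, h3'⟩

theorem assign {x : ℕ} {a : Term} {σ : State} {T : ℕ} {Q : State → Prop} (hT : a.cost + 1 ≤ T)
    (h : Q ⟨Function.update σ.reg x (a.eval σ), σ.mem⟩) : Runs (Prog.assign x a) σ T Q :=
  ⟨_, _, Exec.assign x a σ, hT, h⟩

theorem store {a b : Term} {σ : State} {T : ℕ} {Q : State → Prop} (hT : a.cost + b.cost + 1 ≤ T)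
    (h : Q ⟨σ.reg, Function.update σ.mem (a.eval σ) (b.eval σ)⟩) : Runs (Prog.store a b) σ T Q :=
  ⟨_, _, Exec.store a b σ, hT, h⟩

theorem ite {c : Term} {p q : Prog} {σ : State} {T : ℕ} {Q : State → Prop}
    (hp : c.eval σ ≠ 0 → Runs p σ T Q) (hq : c.eval σ = 0 → Runs q σ T Q) :
    Runs (Prog.ite c p q) σ (c.cost + 1 + T) Q := by
  by_cases h : c.eval σ = 0
  · obtain ⟨t, σ', h1, h2, h3⟩ := hq h
    exact ⟨_, _, Exec.ite_false h h1, by omega, h3⟩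
  · obtain ⟨t, σ', h1, h2, h3⟩ := hp h
    exact ⟨_, _, Exec.ite_true h h1, by omega, h3⟩

/-- All compiled loops count up to a bound, and their condition is the number `n - i` of rounds
left. It serves at once as the test for termination and as the variant, so the proof is by induction
on that number. -/
theorem loop {c : Term} {p : Prog} {n : ℕ} (T : ℕ → ℕ) (I : ℕ → State → Prop)
    (hc : ∀ i σ, I i σ → c.eval σ = n - i)
    (hp : ∀ i σ, i < n → I i σ → Runs p σ (T i) (I (i + 1))) {σ : State} (h0 : I 0 σ) :
    Runs (Prog.loop c p) σ ((∑ i ∈ Finset.range n, (T i + c.cost + 1)) + c.cost + 1) (I n) := by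
  have key : ∀ k i σ, i + k = n → I i σ →
      Runs (Prog.loop c p) σ ((∑ j ∈ Finset.range k, (T (i + j) + c.cost + 1)) + c.cost + 1)
        (I n) := by
    intro k
    induction k with
    | zero =>
      intro i σ hi h
      have : i = n := by omega
      subst this
      exact ⟨_, _, Exec.loop_false (by rw [hc _ _ h]; omega), by simp, h⟩
    | succ k ih =>
      intro i σ hi h
      obtain ⟨t, σ', h1, h2, h3⟩ := hp i σ (by omega) h
      obtain ⟨t', σ'', h1', h2', h3'⟩ := ih (i + 1) σ' (by omega) h3
      refine ⟨_, _, Exec.loop_true (by rw [hc _ _ h]; omega) h1 h1', ?_, h3'⟩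
      rw [Finset.sum_range_succ']
      have : ∀ j, i + 1 + j = i + (j + 1) := fun j => by omega
      simp only [this] at h2'
      simp only [add_zero]
      omega
  simpa using key n 0 σ (by omega) h0

end Runs

/-- The machine state `σ` represents the store `s`. -/
structure Rel (s : Store) (σ : State) : Prop where
  pos : 0 < s.var 0
  var : ∀ x, σ.reg (4 * x) = s.var x
  base : ∀ k ≤ numArr, σ.reg (4 * k + 1) = k * (s.var 0 * s.var 0)
  arr : ∀ k < numArr, ∀ i < s.var 0, ∀ j < s.var 0,
    σ.mem (k * (s.var 0 * s.var 0) + (i * s.var 0 + j)) = s.arr k i j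
  row : ∀ i < s.var 0, σ.mem (s.var 0 * s.var 0 + i) = i * s.var 0
  out : ∀ i, σ.mem (numArr * (s.var 0 * s.var 0) + i) = s.out i

theorem Rel.of_agree {s : Store} {σ τ : State} (h : Rel s σ) (hm : τ.mem = σ.mem)
    (hv : ∀ x, τ.reg (4 * x) = σ.reg (4 * x))
    (hb : ∀ k, τ.reg (4 * k + 1) = σ.reg (4 * k + 1)) : Rel s τ where
  pos := h.pos
  var x := by rw [hv, h.var]
  base k hk := by rw [hb, h.base k hk]
  arr k hk i hi j hj := by rw [hm, h.arr k hk i hi j hj]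
  row i hi := by rw [hm, h.row i hi]
  out i := by rw [hm, h.out]

/-- The registers that the evaluation of an expression at depth `d` with target `t` preserves. -/
def Keeps (d t : ℕ) (σ τ : State) : Prop :=
  τ.mem = σ.mem ∧ (∀ x, τ.reg (4 * x) = σ.reg (4 * x)) ∧
    (∀ k, τ.reg (4 * k + 1) = σ.reg (4 * k + 1)) ∧
    (∀ i < d, τ.reg (4 * i + 2) = σ.reg (4 * i + 2)) ∧
    (∀ i < t, τ.reg (4 * i + 3) = σ.reg (4 * i + 3))

theorem Keeps.rel {d t : ℕ} {s : Store} {σ τ : State} (h : Keeps d t σ τ) (hr : Rel s σ) :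
    Rel s τ := hr.of_agree h.1 h.2.1 h.2.2.1

theorem Keeps.trans {d t d' t' : ℕ} {σ τ υ : State} (h : Keeps d t σ τ) (h' : Keeps d' t' τ υ)
    (hd : d ≤ d') (ht : t ≤ t') : Keeps d t σ υ := by
  obtain ⟨h1, h2, h3, h4, h5⟩ := h
  obtain ⟨g1, g2, g3, g4, g5⟩ := h'
  refine ⟨g1.trans h1, fun x => (g2 x).trans (h2 x), fun x => (g3 x).trans (h3 x),
    fun i hi => (g4 i (by omega)).trans (h4 i hi), fun i hi => (g5 i (by omega)).trans (h5 i hi)⟩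

theorem Keeps.update_temp {d t t' : ℕ} (σ : State) (v : ℕ) (ht : t ≤ t') :
    Keeps d t σ ⟨Function.update σ.reg (4 * t' + 3) v, σ.mem⟩ := by
  refine ⟨rfl, ?_, ?_, ?_, ?_⟩ <;> intros <;>
    exact Function.update_of_ne (by omega) _ _

theorem Keeps.update_loc {d d' t : ℕ} (σ : State) (v : ℕ) (hd : d ≤ d') :
    Keeps d t σ ⟨Function.update σ.reg (4 * d' + 2) v, σ.mem⟩ := by
  refine ⟨rfl, ?_, ?_, ?_, ?_⟩ <;> intros <;>
    exact Function.update_of_ne (by omega) _ _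

/-- With truncated subtraction, `e - (e - m)` is the minimum of `e` and `m`. Clipping keeps every
access inside its matrix, so the simulation needs no hypothesis on the indices. -/
theorem eval_clip {s : Store} {σ : State} (h : Rel s σ) (e : Term) :
    (Expr.clip e).eval σ = min (e.eval σ) (s.var 0 - 1) := by
  have := h.var 0
  simp only [Nat.mul_zero] at this
  simp only [Expr.clip, Term.eval, this]
  omega

theorem eval_addr {s : Store} {σ : State} (h : Rel s σ) {k : ℕ} (hk : k ≤ numArr) (i j : Term) :
    (Expr.addr k i j).eval σ = k * (s.var 0 * s.var 0) +
      (min (i.eval σ) (s.var 0 - 1) * s.var 0 + min (j.eval σ) (s.var 0 - 1)) := by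
  have h1 := h.base 1 (by simp [numArr])
  have hp := h.pos
  simp only [Nat.mul_one, Nat.reduceAdd, Nat.one_mul] at h1
  simp only [Expr.addr, Term.eval, eval_clip h, h.base k hk, h1]
  rw [h.row _ (by omega)]

theorem eval_load_addr {s : Store} {σ : State} (h : Rel s σ) {k : ℕ} (hk : k < numArr)
    (i j : Term) : (Term.load (Expr.addr k i j)).eval σ = s.get k (i.eval σ) (j.eval σ) := by
  have hp := h.pos
  simp only [Term.eval, eval_addr h hk.le]
  rw [h.arr k hk _ (by omega) _ (by omega)]
  rfl

/-- The registers `4 * t + 3` form an evaluation stack, and the registers `4 * d + 2` hold the bound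
variables. `Keeps` is carried through the induction so that the value of a left operand, and the
running value of an aggregate, survive the evaluation of what comes next. -/
theorem Expr.runs_compile {s : Store} (e : Expr) : ∀ (d t : ℕ) (ρ : ℕ → ℕ) (σ : State),
    e.wf d = true → Rel s σ → (∀ i < d, σ.reg (4 * i + 2) = ρ i) →
    Runs (e.compile d t) σ (e.ec s.var) fun τ => Keeps d t σ τ ∧
      τ.reg (4 * t + 3) = e.eval s d ρ := by
  induction e with
  | const k =>
    intro d t ρ σ _ hr hρ
    exact Runs.assign (by simp [Term.cost, ec]) ⟨Keeps.update_temp _ _ le_rfl, by simp [Term.eval, eval]⟩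
  | var x =>
    intro d t ρ σ _ hr hρ
    exact Runs.assign (by simp [Term.cost, ec])
      ⟨Keeps.update_temp _ _ le_rfl, by simp [Term.eval, eval, hr.var]⟩
  | loc i =>
    intro d t ρ σ hw hr hρ
    refine Runs.assign (by simp [Term.cost, ec])
      ⟨Keeps.update_temp _ _ le_rfl, ?_⟩
    simp only [wf, decide_eq_true_eq] at hw
    simp [Term.eval, eval, hρ i hw]
  | arr k i j ihi ihj =>
    intro d t ρ σ hw hr hρ
    simp only [wf, Bool.and_eq_true, decide_eq_true_eq] at hw
    refine ((ihi d t ρ σ hw.1.2 hr hρ).seq fun τ hτ => (ihj d (t + 1) ρ τ hw.2 (hτ.1.rel hr)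
      fun i hi => by rw [hτ.1.2.2.2.1 i hi, hρ i hi]).seq (T' := 40) fun υ hυ =>
        Runs.assign ?_ ?_).mono (by simp only [ec]; omega) fun _ h => h
    · simp [Term.cost, Expr.addr, Expr.clip]
    · refine ⟨(hτ.1.trans hυ.1 le_rfl (by omega)).trans (Keeps.update_temp _ _ le_rfl) le_rfl le_rfl,
        ?_⟩
      rw [eval_load_addr (hυ.1.rel (hτ.1.rel hr)) hw.1.1]
      simp [Term.eval, eval, hυ.2, hυ.1.2.2.2.2 t (by omega), hτ.2]
  | add a b iha ihb =>
    intro d t ρ σ hw hr hρ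
    simp only [wf, Bool.and_eq_true] at hw
    refine ((iha d t ρ σ hw.1 hr hρ).seq fun τ hτ => (ihb d (t + 1) ρ τ hw.2 (hτ.1.rel hr)
      fun i hi => by rw [hτ.1.2.2.2.1 i hi, hρ i hi]).seq (T' := 40) fun υ hυ =>
        Runs.assign ?_ ?_).mono (by simp only [ec]; omega) fun _ h => h
    · simp [Term.cost]
    · refine ⟨(hτ.1.trans hυ.1 le_rfl (by omega)).trans (Keeps.update_temp _ _ le_rfl) le_rfl le_rfl,
        ?_⟩
      simp [Term.eval, eval, hυ.2, hυ.1.2.2.2.2 t (by omega), hτ.2]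
  | sub a b iha ihb =>
    intro d t ρ σ hw hr hρ
    simp only [wf, Bool.and_eq_true] at hw
    refine ((iha d t ρ σ hw.1 hr hρ).seq fun τ hτ => (ihb d (t + 1) ρ τ hw.2 (hτ.1.rel hr)
      fun i hi => by rw [hτ.1.2.2.2.1 i hi, hρ i hi]).seq (T' := 40) fun υ hυ =>
        Runs.assign ?_ ?_).mono (by simp only [ec]; omega) fun _ h => h
    · simp [Term.cost]
    · refine ⟨(hτ.1.trans hυ.1 le_rfl (by omega)).trans (Keeps.update_temp _ _ le_rfl) le_rfl le_rfl,
        ?_⟩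
      simp [Term.eval, eval, hυ.2, hυ.1.2.2.2.2 t (by omega), hτ.2]
  | ite c a b ihc iha ihb =>
    intro d t ρ σ hw hr hρ
    simp only [wf, Bool.and_eq_true] at hw
    refine ((ihc d t ρ σ hw.1.1 hr hρ).seq fun τ hτ => Runs.ite
      (T := ec s.var a + ec s.var b) (fun h => ?_) fun h => ?_).mono
        (by simp only [ec, Term.cost]; omega) fun _ h => h
    · refine (iha d t ρ τ hw.1.2 (hτ.1.rel hr)
        fun i hi => by rw [hτ.1.2.2.2.1 i hi, hρ i hi]).mono (by omega) fun υ hυ =>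
          ⟨hτ.1.trans hυ.1 le_rfl le_rfl, ?_⟩
      simp only [Term.eval, hτ.2] at h
      simp only [eval, if_pos h, hυ.2]
    · refine (ihb d t ρ τ hw.2 (hτ.1.rel hr)
        fun i hi => by rw [hτ.1.2.2.2.1 i hi, hρ i hi]).mono (by omega) fun υ hυ =>
          ⟨hτ.1.trans hυ.1 le_rfl le_rfl, ?_⟩
      simp only [Term.eval, hτ.2] at h
      simp only [eval, h, ne_eq, not_true_eq_false, if_false, hυ.2]
  | agg op b e ih =>
    intro d t ρ σ hw hr hρ
    simp only [wf] at hw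
    set f : ℕ → ℕ := fun i => eval s e (d + 1) (Function.update ρ d i) with hf
    have hl := fun υ => Runs.loop (n := s.var b) (σ := υ)
      (c := Term.sub (Term.reg (4 * b)) (Term.reg (4 * d + 2)))
      (p := Prog.seq (compile e (d + 1) (t + 1))
            (Prog.seq (Prog.assign (4 * t + 3)
              (if op then Term.add (Term.reg (4 * t + 3)) (Term.reg (4 * (t + 1) + 3))
                else Term.add (Term.reg (4 * t + 3))
                  (Term.sub (Term.reg (4 * (t + 1) + 3)) (Term.reg (4 * t + 3)))))
              (Prog.assign (4 * d + 2) (Term.add (Term.reg (4 * d + 2)) (Term.const 1)))))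
      (fun _ => e.ec s.var + 12)
      (fun i τ => Keeps d t σ τ ∧ τ.reg (4 * d + 2) = i ∧ τ.reg (4 * t + 3) = aggr op i f)
      (fun i τ h => by simp [Term.eval, h.2.1, h.1.2.1, hr.var])
      (fun i τ hi h => by
        refine ((ih (d + 1) (t + 1) (Function.update ρ d i) τ hw (h.1.rel hr) ?_).seq
          (T' := 6 + 5) fun υ hυ => Runs.seq (Q := fun υ => Keeps d t σ υ ∧ υ.reg (4 * d + 2) = i ∧
            υ.reg (4 * t + 3) = aggr op (i + 1) f) (Runs.assign ?_ ?_) fun w hw =>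
              Runs.assign ?_ ?_).mono (by omega) fun _ h => h
        · intro j hj
          by_cases hjd : j = d
          · subst hjd; simp [h.2.1]
          · rw [h.1.2.2.2.1 j (by omega), hρ j (by omega), Function.update_of_ne hjd]
        · cases op <;> simp [Term.cost]
        · refine ⟨(h.1.trans hυ.1 (by omega) (by omega)).trans (Keeps.update_temp _ _ le_rfl)
            le_rfl le_rfl, ?_, ?_⟩
          · change Function.update _ _ _ _ = _
            rw [Function.update_of_ne (by omega), hυ.1.2.2.2.1 d (by omega), h.2.1]
          · rw [aggr_succ]
            cases op <;>
              simp [Term.eval, aggrStep, hυ.2, hυ.1.2.2.2.2 t (by omega), h.2.2, hf]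
        · simp [Term.cost]
        · refine ⟨hw.1.trans (Keeps.update_loc _ _ le_rfl) le_rfl le_rfl, ?_, ?_⟩
          · simp [Term.eval, hw.2.1]
          · change Function.update _ _ _ _ = _
            rw [Function.update_of_ne (by omega), hw.2.2])
    refine (Runs.seq (T := 2) (Q := fun τ => Keeps d t σ τ ∧ τ.reg (4 * t + 3) = 0)
      (Runs.assign ?_ ?_) fun τ hτ => Runs.seq (T := 2) (Runs.assign ?_ ?_) fun υ hυ =>
        (hl υ hυ).mono le_rfl fun _ h => ⟨h.1, ?_⟩).mono ?_ fun _ h => h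
    · simp [Term.cost]
    · exact ⟨Keeps.update_temp _ _ le_rfl, by simp [Term.eval]⟩
    · simp [Term.cost]
    · refine ⟨hτ.1.trans (Keeps.update_loc _ _ le_rfl) le_rfl le_rfl, by simp [Term.eval], ?_⟩
      change Function.update _ _ _ _ = _
      rw [Function.update_of_ne (by omega), hτ.2, aggr_zero]
    · simp only [Term.cost, ec, Finset.sum_const, Finset.card_range, smul_eq_mul]
      nlinarith
    · exact h.2.2
  
/-- Programs of the loop language. -/
inductive Cmd : Type
  | skip : Cmd
  | set (x : ℕ) (e : Expr) : Cmd
  | put (k : ℕ) (i j e : Expr) : Cmd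
  | emit (i e : Expr) : Cmd
  | seq (p q : Cmd) : Cmd
  | ite (c : Expr) (p q : Cmd) : Cmd
  | rep (x b : ℕ) (p : Cmd) : Cmd

/-- Iteration of a map on stores, with a variable counting the rounds. -/
def iter (f : Store → Store) (x : ℕ) (s : Store) : ℕ → Store
  | 0 => s
  | i + 1 => f ((iter f x s i).setv x i)

namespace Cmd

/-- The store after the execution of a program. -/
def den : Cmd → Store → Store
  | skip, s => s
  | set x e, s => s.setv x (e.eval s 0 fun _ => 0)
  | put k i j e, s => s.put k (i.eval s 0 fun _ => 0) (j.eval s 0 fun _ => 0)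
      (e.eval s 0 fun _ => 0)
  | emit i e, s => s.emit (i.eval s 0 fun _ => 0) (e.eval s 0 fun _ => 0)
  | seq p q, s => den q (den p s)
  | ite c p q, s => if c.eval s 0 (fun _ => 0) ≠ 0 then den p s else den q s
  | rep x b p, s => (iter (den p) x s (s.var b)).setv x (s.var b)

/-- A bound for the running time. -/
def cost : Cmd → Store → ℕ
  | skip, _ => 1
  | set _ e, s => e.ec s.var + 40
  | put _ i j e, s => i.ec s.var + j.ec s.var + e.ec s.var + 40
  | emit i e, s => i.ec s.var + e.ec s.var + 40
  | seq p q, s => cost p s + cost q (den p s)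
  | ite c p q, s => c.ec s.var + 40 + if c.eval s 0 (fun _ => 0) ≠ 0 then cost p s else cost q s
  | rep x b p, s => (∑ i ∈ Finset.range (s.var b), (cost p ((iter (den p) x s i).setv x i) + 40)) + 40

/-- The variables to which a program assigns. -/
def wv : Cmd → List ℕ
  | skip => []
  | set x _ => [x]
  | put _ _ _ _ => []
  | emit _ _ => []
  | seq p q => wv p ++ wv q
  | ite _ p q => wv p ++ wv q
  | rep x _ p => x :: wv p

/-- The matrices to which a program assigns. -/
def wa : Cmd → List ℕ
  | skip => []
  | set _ _ => []
  | put k _ _ _ => [k]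
  | emit _ _ => []
  | seq p q => wa p ++ wa q
  | ite _ p q => wa p ++ wa q
  | rep _ _ p => wa p

/-- Well-formedness of programs. -/
def wf : Cmd → Bool
  | skip => true
  | set x e => decide (x ≠ 0) && e.wf 0
  | put k i j e => decide (k < numArr) && decide (k ≠ 1) && i.wf 0 && j.wf 0 && e.wf 0
  | emit i e => i.wf 0 && e.wf 0
  | seq p q => wf p && wf q
  | ite c p q => c.wf 0 && wf p && wf q
  | rep x b p => decide (x ≠ 0) && decide (x ≠ b) && decide (x ∉ wv p) && decide (b ∉ wv p) && wf p

/-- The compiled program. -/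
def compile : Cmd → Prog
  | skip => Prog.skip
  | set x e => Prog.seq (e.compile 0 0) (Prog.assign (4 * x) (Term.reg 3))
  | put k i j e => Prog.seq (i.compile 0 0) (Prog.seq (j.compile 0 1) (Prog.seq (e.compile 0 2)
      (Prog.store (Expr.addr k (Term.reg 3) (Term.reg 7)) (Term.reg 11))))
  | emit i e => Prog.seq (i.compile 0 0) (Prog.seq (e.compile 0 1)
      (Prog.store (Term.add (Term.reg (4 * numArr + 1)) (Term.reg 3)) (Term.reg 7)))
  | seq p q => Prog.seq (compile p) (compile q)
  | ite c p q => Prog.seq (c.compile 0 0) (Prog.ite (Term.reg 3) (compile p) (compile q))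
  | rep x b p => Prog.seq (Prog.assign (4 * x) (Term.const 0))
      (Prog.loop (Term.sub (Term.reg (4 * b)) (Term.reg (4 * x)))
        (Prog.seq (compile p)
          (Prog.assign (4 * x) (Term.add (Term.reg (4 * x)) (Term.const 1)))))

theorem den_var (p : Cmd) : ∀ (s : Store) {x : ℕ}, x ∉ p.wv → (p.den s).var x = s.var x := by
  induction p with
  | skip => intro s x _; rfl
  | set y e =>
    intro s x hx
    simp only [wv, List.mem_singleton] at hx
    exact Function.update_of_ne hx _ _
  | put k i j e => intro s x _; rfl
  | emit i e => intro s x _; rfl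
  | seq p q ihp ihq =>
    intro s x hx
    simp only [wv, List.mem_append, not_or] at hx
    simp only [den]
    rw [ihq _ hx.2, ihp _ hx.1]
  | ite c p q ihp ihq =>
    intro s x hx
    simp only [wv, List.mem_append, not_or] at hx
    simp only [den]
    split_ifs
    · exact ihp _ hx.1
    · exact ihq _ hx.2
  | rep y b p ih =>
    intro s x hx
    simp only [wv, List.mem_cons, not_or] at hx
    have : ∀ i, (iter (den p) y s i).var x = s.var x := by
      intro i
      induction i with
      | zero => rfl
      | succ i ihi =>
        simp only [iter]
        rw [ih _ hx.2]
        exact (Function.update_of_ne hx.1 _ _).trans ihi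
    exact (Function.update_of_ne hx.1 _ _).trans (this _)

theorem den_arr (p : Cmd) : ∀ (s : Store) {k : ℕ}, k ∉ p.wa → (p.den s).arr k = s.arr k := by
  induction p with
  | skip => intro s x _; rfl
  | set y e => intro s x hx; rfl
  | put k' i j e =>
    intro s k hk
    simp only [wa, List.mem_singleton] at hk
    funext i j
    simp [den, Store.put, hk]
  | emit i e => intro s x _; rfl
  | seq p q ihp ihq =>
    intro s x hx
    simp only [wa, List.mem_append, not_or] at hx
    simp only [den]
    rw [ihq _ hx.2, ihp _ hx.1]
  | ite c p q ihp ihq =>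
    intro s x hx
    simp only [wa, List.mem_append, not_or] at hx
    simp only [den]
    split_ifs
    · exact ihp _ hx.1
    · exact ihq _ hx.2
  | rep y b p ih =>
    intro s x hx
    simp only [wa] at hx
    have : ∀ i, (iter (den p) y s i).arr x = s.arr x := by
      intro i
      induction i with
      | zero => rfl
      | succ i ihi =>
        simp only [iter]
        rw [ih _ hx]
        exact ihi
    exact this _

end Cmd

/-! ### Correctness of compiled programs. -/

/-- In base `N` the numbers `j` and `i` are the last two digits of the address, and `k` is the rest;
comparing residues modulo `N` twice recovers them. -/
theorem addr_inj {N k i j k' i' j' : ℕ} (hi : i < N) (hj : j < N) (hi' : i' < N) (hj' : j' < N)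
    (h : k * (N * N) + (i * N + j) = k' * (N * N) + (i' * N + j')) :
    k = k' ∧ i = i' ∧ j = j' := by
  have h1 : N * (k * N + i) + j = N * (k' * N + i') + j' := by linarith
  have hN : 0 < N := by omega
  have h2 : j = j' := by
    have := congrArg (· % N) h1
    simpa [Nat.mul_add_mod, Nat.mod_eq_of_lt hj, Nat.mod_eq_of_lt hj'] using this
  subst h2
  have h3 : N * k + i = N * k' + i' := by
    have := Nat.eq_of_mul_eq_mul_left hN (Nat.add_right_cancel h1)
    linarith
  have h4 : i = i' := by
    have := congrArg (· % N) h3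
    simpa [Nat.mul_add_mod, Nat.mod_eq_of_lt hi, Nat.mod_eq_of_lt hi'] using this
  subst h4
  exact ⟨Nat.eq_of_mul_eq_mul_left hN (Nat.add_right_cancel h3), rfl, rfl⟩

theorem addr_lt {N k i j : ℕ} (hi : i < N) (hj : j < N) (hk : k < numArr) :
    k * (N * N) + (i * N + j) < numArr * (N * N) := by
  have h1 : i * N + j < N * N := by nlinarith
  nlinarith

theorem Rel.setv {s : Store} {σ τ : State} (h : Rel s σ) {x v : ℕ} (hx : x ≠ 0)
    (hm : τ.mem = σ.mem) (hv : ∀ y, y ≠ x → τ.reg (4 * y) = σ.reg (4 * y))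
    (hx' : τ.reg (4 * x) = v)
    (hb : ∀ k, τ.reg (4 * k + 1) = σ.reg (4 * k + 1)) : Rel (s.setv x v) τ := by
  have h0 : (s.setv x v).var 0 = s.var 0 := Function.update_of_ne hx.symm _ _
  refine ⟨?_, ?_, ?_, ?_, ?_, ?_⟩
  · rw [h0]; exact h.pos
  · intro y
    by_cases hy : y = x
    · subst hy; simp [Store.setv, hx']
    · rw [hv y hy, h.var]; exact (Function.update_of_ne hy _ _).symm
  · intro k hk; rw [h0, hb, h.base k hk]
  · rw [h0]; intro k hk i hi j hj; rw [hm, h.arr k hk i hi j hj]; rfl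
  · rw [h0]; intro i hi; rw [hm, h.row i hi]
  · rw [h0]; intro i; rw [hm, h.out]; rfl

theorem Cmd.runs_compile (p : Cmd) : ∀ (s : Store) (σ : State), p.wf = true → Rel s σ →
    Runs p.compile σ (p.cost s) fun τ => Rel (p.den s) τ := by
  induction p with
  | skip => intro s σ _ hr; exact ⟨_, _, Exec.skip σ, le_rfl, hr⟩
  | set x e =>
    intro s σ hw hr
    simp only [wf, Bool.and_eq_true, decide_eq_true_eq] at hw
    refine (e.runs_compile 0 0 (fun _ => 0) σ hw.2 hr (by simp)).seq fun τ hτ =>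
      Runs.assign (by simp [Term.cost]) ?_
    refine (hτ.1.rel hr).setv hw.1 rfl (fun y hy => Function.update_of_ne (by omega) _ _) ?_
      fun k => Function.update_of_ne (by omega) _ _
    have := hτ.2
    simp only [Nat.mul_zero, Nat.zero_add] at this
    simp [Term.eval, this]
  | put k i j e =>
    intro s σ hw hr
    simp only [wf, Bool.and_eq_true, decide_eq_true_eq] at hw
    obtain ⟨⟨⟨⟨hk, hk1⟩, hi⟩, hj⟩, he⟩ := hw
    refine ((i.runs_compile 0 0 (fun _ => 0) σ hi hr (by simp)).seq fun τ hτ =>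
      (j.runs_compile 0 1 (fun _ => 0) τ hj (hτ.1.rel hr) (by simp)).seq fun υ hυ =>
      (e.runs_compile 0 2 (fun _ => 0) υ he (hυ.1.rel (hτ.1.rel hr)) (by simp)).seq (T' := 40)
        fun w hw => Runs.store (by simp [Term.cost, Expr.addr, Expr.clip]) ?_).mono
        (by simp only [cost]; omega) fun _ h => h
    have hrw := hw.1.rel (hυ.1.rel (hτ.1.rel hr))
    have e1 : w.reg 3 = i.eval s 0 fun _ => 0 := by
      have := hτ.2
      rw [← hυ.1.2.2.2.2 0 (by omega), ← hw.1.2.2.2.2 0 (by omega)] at this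
      simpa using this
    have e2 : w.reg 7 = j.eval s 0 fun _ => 0 := by
      have := hυ.2
      rw [← hw.1.2.2.2.2 1 (by omega)] at this
      simpa using this
    have e3 : w.reg 11 = e.eval s 0 fun _ => 0 := by simpa using hw.2
    have hp := hr.pos
    rw [eval_addr hrw hk.le]
    simp only [Term.eval, e1, e2, e3]
    refine ⟨hr.pos, hrw.var, hrw.base, ?_, ?_, ?_⟩
    · intro k' hk' i' hi' j' hj'
      change i' < s.var 0 at hi'
      change j' < s.var 0 at hj'
      simp only [den, Store.put]
      by_cases hc : k' = k ∧ i' = min (i.eval s 0 fun _ => 0) (s.var 0 - 1) ∧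
          j' = min (j.eval s 0 fun _ => 0) (s.var 0 - 1)
      · rw [if_pos hc]
        obtain ⟨rfl, rfl, rfl⟩ := hc
        simp
      · rw [if_neg hc, Function.update_of_ne, hrw.arr k' hk' i' hi' j' hj']
        intro h
        exact hc (addr_inj hi' hj' (by omega) (by omega) h)
    · intro i' hi'
      change i' < s.var 0 at hi'
      simp only [den, Store.put]
      rw [Function.update_of_ne, hrw.row i' hi']
      intro h
      -- The table of row offsets is the first row of matrix `1`, so a collision would force `k =
      -- 1`, which `wf` forbids.
      have := addr_inj (N := s.var 0) (k := 1) (i := 0) (j := i') (k' := k)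
        (i' := min (i.eval s 0 fun _ => 0) (s.var 0 - 1))
        (j' := min (j.eval s 0 fun _ => 0) (s.var 0 - 1)) hp hi' (by omega) (by omega)
        (by simpa using h)
      omega
    · intro q
      simp only [den, Store.put]
      rw [Function.update_of_ne, hrw.out]
      have := addr_lt (N := s.var 0) (k := k) (i := min (i.eval s 0 fun _ => 0) (s.var 0 - 1))
        (j := min (j.eval s 0 fun _ => 0) (s.var 0 - 1)) (by omega) (by omega) hk
      omega
  | emit i e =>
    intro s σ hw hr
    simp only [wf, Bool.and_eq_true] at hw
    refine ((i.runs_compile 0 0 (fun _ => 0) σ hw.1 hr (by simp)).seq fun τ hτ =>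
      (e.runs_compile 0 1 (fun _ => 0) τ hw.2 (hτ.1.rel hr) (by simp)).seq (T' := 40) fun υ hυ =>
        Runs.store (by simp [Term.cost]) ?_).mono
        (by simp only [cost]; omega) fun _ h => h
    have hrw := hυ.1.rel (hτ.1.rel hr)
    have e1 : υ.reg 3 = i.eval s 0 fun _ => 0 := by
      have := hτ.2
      rw [← hυ.1.2.2.2.2 0 (by omega)] at this
      simpa using this
    have e2 : υ.reg 7 = e.eval s 0 fun _ => 0 := by simpa using hυ.2
    simp only [Term.eval, e1, e2, hrw.base numArr le_rfl]
    refine ⟨hr.pos, hrw.var, hrw.base, ?_, ?_, ?_⟩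
    · intro k' hk' i' hi' j' hj'
      simp only [den, Store.emit] at hi' hj' ⊢
      have := addr_lt (N := s.var 0) hi' hj' hk'
      rw [Function.update_of_ne (by omega), hrw.arr k' hk' i' hi' j' hj']
    · intro i' hi'
      simp only [den, Store.emit] at hi' ⊢
      have := addr_lt (N := s.var 0) (k := 1) (i := 0) (j := i') hr.pos hi' (by simp [numArr])
      rw [Function.update_of_ne (by omega), hrw.row i' hi']
    · intro q
      simp only [den, Store.emit]
      by_cases hq : q = i.eval s 0 fun _ => 0
      · subst hq; simp
      · rw [Function.update_of_ne (by omega), Function.update_of_ne hq, hrw.out]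
  | seq p q ihp ihq =>
    intro s σ hw hr
    simp only [wf, Bool.and_eq_true] at hw
    exact (ihp s σ hw.1 hr).seq fun τ hτ => ihq _ τ hw.2 hτ
  | ite c p q ihp ihq =>
    intro s σ hw hr
    simp only [wf, Bool.and_eq_true] at hw
    refine ((c.runs_compile 0 0 (fun _ => 0) σ hw.1.1 hr (by simp)).seq fun τ hτ => Runs.ite
      (T := if c.eval s 0 (fun _ => 0) ≠ 0 then cost p s else cost q s) (fun h => ?_) fun h =>
        ?_).mono (by simp only [cost, Term.cost]; omega) fun _ h => h
    · have h1 := hτ.2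
      simp only [Nat.mul_zero, Nat.zero_add] at h1
      simp only [Term.eval, h1] at h
      simp only [den, if_pos h]
      exact ihp s τ hw.1.2 (hτ.1.rel hr)
    · have h1 := hτ.2
      simp only [Nat.mul_zero, Nat.zero_add] at h1
      simp only [Term.eval, h1] at h
      simp only [den, h, ne_eq, not_true_eq_false, if_false]
      exact ihq s τ hw.2 (hτ.1.rel hr)
  | rep x b p ih =>
    intro s σ hw hr
    simp only [wf, Bool.and_eq_true, decide_eq_true_eq] at hw
    obtain ⟨⟨⟨⟨hx, hxb⟩, hxp⟩, hbp⟩, hp⟩ := hw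
    -- Neither the body nor the loop variable touches the bound, so the machine, which reads the
    -- bound again in each round, performs the number of rounds fixed at the start.
    have hb : ∀ i, (iter (den p) x s i).var b = s.var b := by
      intro i
      induction i with
      | zero => rfl
      | succ i ihi =>
        simp only [iter]
        rw [den_var _ _ hbp]
        exact (Function.update_of_ne (Ne.symm hxb) _ _).trans ihi
    refine (Runs.seq (T := 2) (Q := fun τ => Rel (s.setv x 0) τ) (Runs.assign ?_ ?_) fun τ hτ =>
      Runs.loop (n := s.var b) (fun i => cost p ((iter (den p) x s i).setv x i) + 4)
        (fun i τ => Rel ((iter (den p) x s i).setv x i) τ) ?_ ?_ hτ).mono ?_ fun _ h => h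
    · simp [Term.cost]
    · exact hr.setv hx rfl (fun y hy => Function.update_of_ne (by omega) _ _)
        (by simp [Term.eval]) fun k => Function.update_of_ne (by omega) _ _
    · intro i τ h
      simp only [Term.eval, h.var]
      simp only [Store.setv, Function.update_self, Function.update_of_ne (Ne.symm hxb), hb]
    · intro i τ hi h
      refine (ih _ τ hp h).seq fun υ hυ => Runs.assign (by simp [Term.cost]) ?_
      refine hυ.setv hx rfl (fun y hy => Function.update_of_ne (by omega) _ _) ?_
        fun k => Function.update_of_ne (by omega) _ _
      simp only [Term.eval, hυ.var, den_var _ _ hxp, Store.setv, Function.update_self]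
    · simp only [Term.cost, cost]
      have : ∀ i ∈ Finset.range (s.var b), cost p ((iter (den p) x s i).setv x i) + 4 + (1 + 1 + 1)
          + 1 ≤ cost p ((iter (den p) x s i).setv x i) + 40 := fun i _ => by omega
      have := Finset.sum_le_sum this
      omega

end RAM


/-! ## Modular elimination in uniform oriented matroids -/

namespace SignVec

variable {n : ℕ}

theorem mem_zeros {X : SignVec n} {e : Fin n} : e ∈ X.zeros ↔ X e = 0 := by simp [zeros]

theorem mem_supp {X : SignVec n} {e : Fin n} : e ∈ X.supp ↔ X e ≠ 0 := by simp [supp]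

theorem mem_sep {X Y : SignVec n} {e : Fin n} : e ∈ sep X Y ↔ X e ≠ 0 ∧ Y e = -X e := by
  simp only [sep, Finset.mem_filter, Finset.mem_univ, true_and]
  generalize X e = x
  generalize Y e = y
  revert x y
  decide

theorem sep_neg_left (X Y : SignVec n) : sep (-X) Y = sep X (-Y) := by
  ext e
  simp only [mem_sep, Pi.neg_apply]
  generalize X e = x
  generalize Y e = y
  revert x y
  decide

theorem zeros_neg (X : SignVec n) : (-X).zeros = X.zeros := by
  ext e
  simp only [mem_zeros, Pi.neg_apply]
  generalize X e = x
  revert x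
  decide

theorem supp_eq_compl (X : SignVec n) : X.supp = X.zerosᶜ := by
  ext e; simp [mem_supp, mem_zeros]

theorem card_zeros_add_card_supp (X : SignVec n) : X.zeros.card + X.supp.card = n := by
  rw [supp_eq_compl, Finset.card_compl, Fintype.card_fin]
  have := Finset.card_le_univ X.zeros
  simp at this
  omega

/-- Paths of length `k` in the cocircuit graph whose vertices lie in `Q`. -/
inductive NearChain (Q : Set (SignVec n)) : ℕ → SignVec n → SignVec n → Prop
  | nil {X : SignVec n} : X ∈ Q → NearChain Q 0 X X
  | snoc {k : ℕ} {X Y Z : SignVec n} : NearChain Q k X Y → Near Y Z → Z ∈ Q →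
      NearChain Q (k + 1) X Z

theorem NearChain.mono {Q Q' : Set (SignVec n)} (hQ : Q ⊆ Q') {k : ℕ} {X Y : SignVec n}
    (h : NearChain Q k X Y) : NearChain Q' k X Y := by
  induction h with
  | nil hX => exact .nil (hQ hX)
  | snoc _ h1 h2 ih => exact .snoc ih h1 (hQ h2)

theorem NearChain.trans {Q : Set (SignVec n)} {k l : ℕ} {X Y Z : SignVec n}
    (h : NearChain Q k X Y) (h' : NearChain Q l Y Z) : NearChain Q (k + l) X Z := by
  induction h' with
  | nil _ => exact h
  | snoc _ h1 h2 ih => exact .snoc (ih h) h1 h2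

/-- Neighbours have an empty separator, so a coordinate cannot change its sign along a path without
passing through zero. This is how paths produce elimination. -/
theorem NearChain.eq_or_exists_zero {Q : Set (SignVec n)} {k : ℕ} {X Y : SignVec n}
    (h : NearChain Q k X Y) {e : Fin n} (he : X e ≠ 0) : Y e = X e ∨ ∃ Z ∈ Q, Z e = 0 := by
  induction h with
  | nil _ => exact Or.inl rfl
  | @snoc k X Y Z _ h1 h2 ih =>
    rcases ih he with ih | ih
    · by_cases hZ : Z e = 0
      · exact Or.inr ⟨_, h2, hZ⟩
      · left
        have : e ∉ sep Y Z := by rw [h1.2]; simp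
        rw [mem_sep] at this
        rw [← ih] at he ⊢
        revert this he hZ
        generalize Y e = y
        generalize Z e = z
        revert y z
        decide
    · exact Or.inr ih

theorem near_of_card_sdiff {X Y : SignVec n} (h1 : (X.zeros \ Y.zeros).card = 1)
    (hc : X.zeros.card = Y.zeros.card) (hs : sep X Y = ∅) : Near X Y := by
  refine ⟨?_, hs⟩
  have h2 := Finset.card_sdiff_add_card_inter X.zeros Y.zeros
  have h3 := Finset.card_sdiff_add_card_inter Y.zeros X.zeros
  rw [Finset.inter_comm] at h3
  rw [symmDiff_def, Finset.sup_eq_union, Finset.card_union_of_disjoint disjoint_sdiff_sdiff]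
  omega

end SignVec

open SignVec

/-- Like `IsUniformOM`, but elimination is required only for cocircuits on a common coline. -/
structure IsModularOM (n r : ℕ) (C : Set (SignVec n)) : Prop where
  card_supp : ∀ X ∈ C, X.supp.card + r = n + 1
  pair : ∀ I : Finset (Fin n), I.card + r = n + 1 →
    ∃ X Y : SignVec n, X ≠ Y ∧ -X = Y ∧ {Z | Z ∈ C ∧ Z.supp = I} = {X, Y}
  elim : ∀ X ∈ C, ∀ Y ∈ C, (X.zeros \ Y.zeros).card = 1 → ∀ e ∈ SignVec.sep X Y,
    ∃ Z ∈ C, Z e = 0 ∧ ∀ f, f ≠ e → Z f = X f ∨ Z f = Y f ∨ Z f = 0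

theorem IsUniformOM.isModularOM {n r : ℕ} {C : Set (SignVec n)} (h : IsUniformOM n r C) :
    IsModularOM n r C where
  card_supp := h.card_supp
  pair := h.pair
  elim X hX Y hY hXY e he := by
    refine h.elim X hX Y hY ?_ e he
    rintro rfl
    simp [zeros_neg] at hXY

/-! ### Consequences of elimination on colines. -/

namespace IsModularOM

variable {n r : ℕ} {C : Set (SignVec n)} (h : IsModularOM n r C)
include h

theorem card_zeros {X : SignVec n} (hX : X ∈ C) : X.zeros.card + 1 = r := by
  have := card_zeros_add_card_supp X
  have := h.card_supp X hX
  omega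

theorem neg_mem {X : SignVec n} (hX : X ∈ C) : -X ∈ C := by
  obtain ⟨Y, Z, -, rfl, hYZ⟩ := h.pair X.supp (h.card_supp X hX)
  have h1 : X ∈ ({Y, -Y} : Set (SignVec n)) := by rw [← hYZ]; exact ⟨hX, rfl⟩
  have h2 : -X ∈ ({Y, -Y} : Set (SignVec n)) := by
    rcases h1 with h1 | h1 <;> simp_all
  rw [← hYZ] at h2
  exact h2.1

theorem eq_or_eq_neg {X Y : SignVec n} (hX : X ∈ C) (hY : Y ∈ C) (hXY : X.zeros = Y.zeros) :
    X = Y ∨ X = -Y := by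
  obtain ⟨U, Z, -, rfl, hYZ⟩ := h.pair X.supp (h.card_supp X hX)
  have h1 : X ∈ ({U, -U} : Set (SignVec n)) := by rw [← hYZ]; exact ⟨hX, rfl⟩
  have h2 : Y ∈ ({U, -U} : Set (SignVec n)) := by
    rw [← hYZ]; exact ⟨hY, by rw [supp_eq_compl, supp_eq_compl, hXY]⟩
  rcases h1 with h1 | h1 <;> rcases h2 with h2 | h2 <;> simp_all

theorem eq_of_zeros_eq {X Y : SignVec n} (hX : X ∈ C) (hY : Y ∈ C) (hXY : X.zeros = Y.zeros)
    {e : Fin n} (he : X e ≠ 0) (hs : X e = Y e) : X = Y := by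
  rcases h.eq_or_eq_neg hX hY hXY with h1 | h1
  · exact h1
  · exfalso
    rw [h1, Pi.neg_apply] at hs he
    revert hs he
    generalize Y e = y
    revert y
    decide

/-- If the zero vector were a cocircuit, then `pair` for the empty support would require two
distinct sign vectors that vanish everywhere. -/
theorem exists_ne_zero {X : SignVec n} (hX : X ∈ C) : ∃ b, X b ≠ 0 := by
  by_contra hb
  push Not at hb
  have h1 := h.card_supp X hX
  have h4 : X.supp = ∅ := by
    ext f; simp [mem_supp, hb]
  obtain ⟨Z, Z', hne, rfl, hz⟩ := h.pair ∅ (by rw [← h4]; exact h1)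
  apply hne
  have h5 : Z ∈ {W | W ∈ C ∧ W.supp = ∅} := by rw [hz]; simp
  funext f
  have : f ∉ Z.supp := by rw [h5.2]; simp
  rw [mem_supp, not_not] at this
  simp [this]

theorem exists_zeros_eq {B : Finset (Fin n)} (hB : B.card + 1 = r) {a : Fin n} (ha : a ∉ B)
    {s : SignType} (hs : s ≠ 0) : ∃ X ∈ C, X.zeros = B ∧ X a = s := by
  have h1 : (Bᶜ).card + r = n + 1 := by
    have := Finset.card_add_card_compl B
    rw [Fintype.card_fin] at this
    omega
  obtain ⟨X, Y, -, rfl, hYZ⟩ := h.pair _ h1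
  have h2 : X ∈ {Z | Z ∈ C ∧ Z.supp = Bᶜ} := by rw [hYZ]; simp
  have h3 : X.zeros = B := by
    have := h2.2
    rw [supp_eq_compl] at this
    exact compl_injective this
  have h4 : X a ≠ 0 := by rwa [ne_eq, ← mem_zeros, h3]
  by_cases h5 : X a = s
  · exact ⟨X, h2.1, h3, h5⟩
  · refine ⟨-X, h.neg_mem h2.1, by rw [zeros_neg, h3], ?_⟩
    rw [Pi.neg_apply]
    revert h4 h5 hs
    generalize X a = x
    revert x s
    decide

theorem card_inter_of_sdiff {X Y : SignVec n} (hX : X ∈ C) :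
    (X.zeros ∩ Y.zeros).card + (X.zeros \ Y.zeros).card + 1 = r := by
  have := h.card_zeros hX
  have := Finset.card_sdiff_add_card_inter X.zeros Y.zeros
  omega

theorem card_sdiff_comm {X Y : SignVec n} (hX : X ∈ C) (hY : Y ∈ C) :
    (X.zeros \ Y.zeros).card = (Y.zeros \ X.zeros).card := by
  have h1 := h.card_inter_of_sdiff hX (Y := Y)
  have h2 := h.card_inter_of_sdiff hY (Y := X)
  rw [Finset.inter_comm] at h2
  omega

theorem near {X Y : SignVec n} (hX : X ∈ C) (hY : Y ∈ C) :
    Near X Y ↔ (X.zeros \ Y.zeros).card = 1 ∧ sep X Y = ∅ := by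
  have h1 := h.card_sdiff_comm hX hY
  constructor
  · rintro ⟨h2, h3⟩
    refine ⟨?_, h3⟩
    rw [symmDiff_def, Finset.sup_eq_union, Finset.card_union_of_disjoint disjoint_sdiff_sdiff] at h2
    omega
  · rintro ⟨h2, h3⟩
    have := h.card_zeros hX
    have := h.card_zeros hY
    exact near_of_card_sdiff h2 (by omega) h3

/-- Elimination on a coline, with the zero set of the result. -/
theorem elim_zeros {X Y : SignVec n} (hX : X ∈ C) (hY : Y ∈ C)
    (hXY : (X.zeros \ Y.zeros).card = 1) {e : Fin n} (he : e ∈ sep X Y) :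
    ∃ Z ∈ C, Z.zeros = insert e (X.zeros ∩ Y.zeros) ∧
      (∀ f, Z f = X f ∨ Z f = Y f ∨ Z f = 0) ∧
      (X.zeros \ Z.zeros).card = 1 ∧ (Z.zeros \ Y.zeros).card = 1 := by
  obtain ⟨Z, hZ, h0, hf⟩ := h.elim X hX Y hY hXY e he
  have hf' : ∀ f, Z f = X f ∨ Z f = Y f ∨ Z f = 0 := fun f => by
    by_cases hfe : f = e
    · subst hfe; exact Or.inr (Or.inr h0)
    · exact hf f hfe
  have hz : Z.zeros = insert e (X.zeros ∩ Y.zeros) := by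
    symm
    -- By uniformity the inclusion suffices: the intersection has `r - 2` elements and `e` lies
    -- outside it, so the left side already has the `r - 1` elements of a zero set.
    apply Finset.eq_of_subset_of_card_le
    · intro f hf
      rw [Finset.mem_insert, Finset.mem_inter, mem_zeros, mem_zeros] at hf
      rw [mem_zeros]
      rcases hf with rfl | ⟨h1, h2⟩
      · exact h0
      · rcases hf' f with h3 | h3 | h3 <;> simp_all
    · rw [Finset.card_insert_of_notMem]
      · have h1 := h.card_inter_of_sdiff hX (Y := Y)
        have h2 := h.card_zeros hZ
        omega
      · rw [mem_sep] at he
        simp [mem_zeros, he.1]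
  rw [mem_sep] at he
  have h1 : (X.zeros \ Z.zeros).card = 1 := by
    rw [← hXY]
    congr 1
    ext f
    simp only [hz, Finset.mem_sdiff, Finset.mem_insert, Finset.mem_inter, mem_zeros]
    constructor
    · rintro ⟨h1, h2⟩; exact ⟨h1, fun h3 => h2 (Or.inr ⟨h1, h3⟩)⟩
    · rintro ⟨h1, h2⟩
      refine ⟨h1, ?_⟩
      rintro (rfl | h3)
      · exact he.1 h1
      · exact h2 h3.2
  have h2 : (Z.zeros \ Y.zeros).card = 1 := by
    rw [Finset.card_eq_one]
    refine ⟨e, ?_⟩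
    ext f
    simp only [hz, Finset.mem_sdiff, Finset.mem_insert, Finset.mem_inter, mem_zeros,
      Finset.mem_singleton]
    constructor
    · rintro ⟨h1 | h1, h2⟩
      · exact h1
      · exact absurd h1.2 h2
    · rintro rfl
      refine ⟨Or.inl rfl, ?_⟩
      rw [he.2]
      have := he.1
      revert this
      generalize X f = x
      revert x
      decide
  exact ⟨Z, hZ, hz, hf', h1, h2⟩

-- As `Z` takes in each coordinate the value of `X`, the value of `Y`, or zero, the separators from
-- `X` to `Z` and from `Z` to `Y` are disjoint subsets of the separator of `X` and `Y`; neither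
-- contains `e`. This drives every recursion along a coline.
omit h in
theorem card_sep_add_card_sep {X Y Z : SignVec n} {e : Fin n} (he : e ∈ sep X Y) (h0 : Z e = 0)
    (hf : ∀ f, Z f = X f ∨ Z f = Y f ∨ Z f = 0) :
    (sep X Z).card + (sep Z Y).card + 1 ≤ (sep X Y).card := by
  have hd : Disjoint (sep X Z) (sep Z Y) := by
    rw [Finset.disjoint_left]
    intro f h1 h2
    rw [mem_sep] at h1 h2
    have := hf f
    revert h1 h2 this
    generalize X f = x
    generalize Y f = y
    generalize Z f = z
    revert x y z
    decide
  rw [← Finset.card_union_of_disjoint hd, ← Finset.card_insert_of_notMem (a := e)]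
  · apply Finset.card_le_card
    intro f hff
    rw [Finset.mem_insert, Finset.mem_union] at hff
    rcases hff with rfl | hff
    · exact he
    · rw [mem_sep, mem_sep] at hff
      rw [mem_sep]
      have := hf f
      revert hff this
      generalize X f = x
      generalize Y f = y
      generalize Z f = z
      revert x y z
      decide
  · simp [mem_sep, h0]
    intro h1 h2
    exact absurd h2.symm (by revert h1; generalize X e = x; revert x; decide)

/-- Two cocircuits on a common coline are joined by a path along the coline. -/
theorem exists_nearChain {X Y : SignVec n} (hX : X ∈ C) (hY : Y ∈ C)
    (hXY : (X.zeros \ Y.zeros).card = 1) : ∃ k ≤ (sep X Y).card + 1,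
      NearChain {Z | Z ∈ C ∧ ∀ f, Z f = X f ∨ Z f = Y f ∨ Z f = 0} k X Y := by
  induction hk : (sep X Y).card using Nat.strong_induction_on generalizing X Y with
  | _ k ih =>
  subst hk
  rcases (sep X Y).eq_empty_or_nonempty with hs | ⟨e, he⟩
  · exact ⟨1, by omega, .snoc (.nil ⟨hX, fun f => Or.inl rfl⟩)
      ((h.near hX hY).2 ⟨hXY, hs⟩) ⟨hY, fun f => Or.inr (Or.inl rfl)⟩⟩
  · obtain ⟨Z, hZ, hz, hf, h1, h2⟩ := h.elim_zeros hX hY hXY he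
    have h0 : Z e = 0 := by rw [← mem_zeros, hz]; simp
    have hc := card_sep_add_card_sep he h0 hf
    -- Cutting at `Z` costs an additional one in the length of the path, which is paid for by the
    -- element `e` missing from both parts of the separator.
    obtain ⟨k1, hk1, c1⟩ := ih _ (by omega) hX hZ h1 rfl
    obtain ⟨k2, hk2, c2⟩ := ih _ (by omega) hZ hY h2 rfl
    refine ⟨k1 + k2, by omega, (c1.mono ?_).trans (c2.mono ?_)⟩
    · rintro W ⟨hW, hWf⟩
      refine ⟨hW, fun f => ?_⟩
      rcases hWf f with h3 | h3 | h3
      · exact Or.inl h3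
      · rw [h3]; exact hf f
      · exact Or.inr (Or.inr h3)
    · rintro W ⟨hW, hWf⟩
      refine ⟨hW, fun f => ?_⟩
      rcases hWf f with h3 | h3 | h3
      · rw [h3]; exact hf f
      · exact Or.inr (Or.inl h3)
      · exact Or.inr (Or.inr h3)

/-- Exchange of an element of the zero set. -/
theorem exists_exchange {X : SignVec n} (hX : X ∈ C) {a b : Fin n} (ha : X a = 0) (hb : X b ≠ 0)
    {s : SignType} (hs : s ≠ 0) :
    ∃ Z ∈ C, Z.zeros = insert b (X.zeros.erase a) ∧ Z a = s := by
  have hab : a ≠ b := by rintro rfl; exact hb ha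
  refine h.exists_zeros_eq ?_ (by simp [hab]) hs
  rw [Finset.card_insert_of_notMem (by simp [mem_zeros, hb]),
    Finset.card_erase_of_mem (mem_zeros.2 ha)]
  have h1 := h.card_zeros hX
  have h2 : 0 < X.zeros.card := Finset.card_pos.2 ⟨a, mem_zeros.2 ha⟩
  omega

omit h in
theorem sdiff_exchange {X Z : SignVec n} {a b : Fin n} (ha : X a = 0) (hb : X b ≠ 0)
    (hz : Z.zeros = insert b (X.zeros.erase a)) : X.zeros \ Z.zeros = {a} := by
  ext f
  simp only [hz, Finset.mem_sdiff, Finset.mem_insert, Finset.mem_erase, mem_zeros,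
    Finset.mem_singleton]
  constructor
  · rintro ⟨h1, h2⟩; by_contra hf; exact h2 (Or.inr ⟨hf, h1⟩)
  · rintro rfl
    refine ⟨ha, ?_⟩
    rintro (rfl | h1)
    · exact hb ha
    · exact h1.1 rfl

/-- The set of the cocircuits that vanish on `A` and have the signs `σ` or `0` on `F`. -/
def _root_.SignVec.region (C : Set (SignVec n)) (A F : Finset (Fin n)) (σ : Fin n → SignType) :
    Set (SignVec n) := {Z | Z ∈ C ∧ A ⊆ Z.zeros ∧ ∀ f ∈ F, Z f = 0 ∨ Z f = σ f}

/-- Without sign conditions a path can be built coline by coline: exchange an element of the zero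
set of `X` for one of the zero set of `Y`, which leaves the common zeros alone, and go on by
induction on the size of the difference. -/
theorem region_connected_aux (A : Finset (Fin n)) (σ : Fin n → SignType) : ∀ d,
    ∀ X ∈ region C A ∅ σ, ∀ Y ∈ region C A ∅ σ, X ≠ -Y → (X.zeros \ Y.zeros).card = d →
    ∃ l, NearChain (region C A ∅ σ) l X Y := by
  intro d
  induction d with
  | zero =>
    intro X hX Y hY hne hd
    have h1 : X.zeros = Y.zeros := by
      have h2 := h.card_sdiff_comm hX.1 hY.1
      rw [hd] at h2
      rw [Finset.card_eq_zero, Finset.sdiff_eq_empty_iff_subset] at hd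
      have h2 := h2.symm
      rw [Finset.card_eq_zero, Finset.sdiff_eq_empty_iff_subset] at h2
      exact hd.antisymm h2
    rcases h.eq_or_eq_neg hX.1 hY.1 h1 with rfl | h2
    · exact ⟨0, .nil hX⟩
    · exact absurd h2 hne
  | succ d ih =>
    intro X hX Y hY hne hd
    have hch : ∀ U ∈ region C A ∅ σ, ∀ V ∈ region C A ∅ σ, (U.zeros \ V.zeros).card = 1 →
        ∃ l, NearChain (region C A ∅ σ) l U V := by
      intro U hU V hV hUV
      obtain ⟨l, -, hl⟩ := h.exists_nearChain hU.1 hV.1 hUV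
      refine ⟨l, hl.mono ?_⟩
      rintro W ⟨hW, hWf⟩
      refine ⟨hW, fun f hf => ?_, by simp⟩
      have h1 := mem_zeros.1 (hU.2.1 hf)
      have h2 := mem_zeros.1 (hV.2.1 hf)
      rw [mem_zeros]
      rcases hWf f with h3 | h3 | h3 <;> simp_all
    -- On a common coline no exchange is made: its result would have the zero set of `Y` and might
    -- be `-Y`, to which the induction hypothesis does not apply.
    rcases Nat.eq_zero_or_pos d with rfl | hpos
    · exact hch X hX Y hY (by omega)
    · have hd' := hd
      obtain ⟨a, ha⟩ : (X.zeros \ Y.zeros).Nonempty := Finset.card_pos.1 (by omega)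
      obtain ⟨b, hb⟩ : (Y.zeros \ X.zeros).Nonempty := Finset.card_pos.1 (by
        rw [← h.card_sdiff_comm hX.1 hY.1]; omega)
      simp only [Finset.mem_sdiff, mem_zeros] at ha hb
      obtain ⟨W, hW, hWz, -⟩ := h.exists_exchange hX.1 ha.1 hb.2 (s := 1) (by decide)
      have hWr : W ∈ region C A ∅ σ := by
        refine ⟨hW, fun f hf => ?_, by simp⟩
        rw [hWz, Finset.mem_insert, Finset.mem_erase]
        refine Or.inr ⟨?_, hX.2.1 hf⟩
        rintro rfl
        exact ha.2 (mem_zeros.1 (hY.2.1 hf))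
      have h2 : (W.zeros \ Y.zeros).card = d := by
        have : W.zeros \ Y.zeros = (X.zeros \ Y.zeros).erase a := by
          ext f
          simp only [hWz, Finset.mem_sdiff, Finset.mem_insert, Finset.mem_erase, mem_zeros]
          constructor
          · rintro ⟨rfl | h1, h2⟩
            · exact absurd hb.1 h2
            · exact ⟨h1.1, h1.2, h2⟩
          · rintro ⟨h1, h2, h3⟩; exact ⟨Or.inr ⟨h1, h2⟩, h3⟩
        rw [this, Finset.card_erase_of_mem (by simp [mem_zeros, ha]), hd]
        omega
      obtain ⟨l1, c1⟩ := hch X hX W hWr (by rw [sdiff_exchange ha.1 hb.2 hWz]; simp)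
      obtain ⟨l2, c2⟩ := ih W hWr Y hY (by
        rintro rfl
        rw [zeros_neg] at h2
        simp at h2
        omega) h2
      exact ⟨_, c1.trans c2⟩

/-- Any two cocircuits of a region that are not antipodal are joined by a path inside it. -/
theorem region_connected : ∀ (k : ℕ) (A F : Finset (Fin n)) (σ : Fin n → SignType),
    A.card + 1 + k = r → (∀ f ∈ F, σ f ≠ 0) → ∀ X ∈ region C A F σ, ∀ Y ∈ region C A F σ, X ≠ -Y →
    ∃ l, NearChain (region C A F σ) l X Y := by
  intro k
  induction k with
  | zero =>
    intro A F σ hA _ X hX Y hY hne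
    have h1 : ∀ Z ∈ region C A F σ, A = Z.zeros := fun Z hZ =>
      Finset.eq_of_subset_of_card_le hZ.2.1 (by have := h.card_zeros hZ.1; omega)
    rcases h.eq_or_eq_neg hX.1 hY.1 ((h1 X hX).symm.trans (h1 Y hY)) with rfl | h2
    · exact ⟨0, .nil hX⟩
    · exact absurd h2 hne
  | succ k ih =>
    intro A F σ hA hσ
    -- If zero sets have just one element outside `A`, two members with distinct zero sets lie on a
    -- coline, and the path along it takes only values of its two ends or zero, so it respects the
    -- signs.
    rcases Nat.eq_zero_or_pos k with rfl | hk
    · intro X hX Y hY hne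
      have h1 : (X.zeros \ Y.zeros).card ≤ 1 := by
        have h2 := h.card_inter_of_sdiff hX.1 (Y := Y)
        have h3 := Finset.card_le_card (Finset.subset_inter hX.2.1 hY.2.1)
        omega
      rcases Nat.lt_or_ge (X.zeros \ Y.zeros).card 1 with h2 | h2
      · obtain ⟨l, hl⟩ := h.region_connected_aux A σ 0 X ⟨hX.1, hX.2.1, by simp⟩ Y
          ⟨hY.1, hY.2.1, by simp⟩ hne (by omega)
        have h3 : X.zeros = Y.zeros := by
          have h4 := h.card_sdiff_comm hX.1 hY.1
          have h5 : (X.zeros \ Y.zeros).card = 0 := by omega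
          rw [h5] at h4
          have h4 := h4.symm
          rw [Finset.card_eq_zero, Finset.sdiff_eq_empty_iff_subset] at h4 h5
          exact h5.antisymm h4
        rcases h.eq_or_eq_neg hX.1 hY.1 h3 with rfl | h2
        · exact ⟨0, .nil hX⟩
        · exact absurd h2 hne
      · obtain ⟨l, -, hl⟩ := h.exists_nearChain hX.1 hY.1 (by omega)
        refine ⟨l, hl.mono ?_⟩
        rintro W ⟨hW, hWf⟩
        refine ⟨hW, fun f hf => ?_, fun f hf => ?_⟩
        · have h1 := mem_zeros.1 (hX.2.1 hf)
          have h2 := mem_zeros.1 (hY.2.1 hf)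
          rw [mem_zeros]
          rcases hWf f with h3 | h3 | h3 <;> simp_all
        · rcases hWf f with h3 | h3 | h3
          · rw [h3]; exact hX.2.2 f hf
          · rw [h3]; exact hY.2.2 f hf
          · exact Or.inl h3
    -- The sign conditions are imposed one at a time. A path that respects `F` is repaired for a new
    -- element `p`: each excursion to the wrong side of `p` begins and ends at cocircuits that
    -- vanish at `p`, and is replaced by a detour inside the region of `insert p A`, where `k` is
    -- smaller by one.
    · induction F using Finset.induction_on with
      | empty =>
        intro X hX Y hY hne
        exact h.region_connected_aux A σ _ X hX Y hY hne rfl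
      | insert p F hp ihF =>
        intro X hX Y hY hne
        have hp0 : σ p ≠ 0 := hσ p (by simp)
        have hle : region C A (insert p F) σ ⊆ region C A F σ := fun Z hZ =>
          ⟨hZ.1, hZ.2.1, fun f hf => hZ.2.2 f (Finset.mem_insert_of_mem hf)⟩
        have hin : ∀ Z ∈ region C A F σ, (Z p = 0 ∨ Z p = σ p) → Z ∈ region C A (insert p F) σ := by
          intro Z hZ h1
          refine ⟨hZ.1, hZ.2.1, fun f hf => ?_⟩
          rcases Finset.mem_insert.1 hf with rfl | hf
          · exact h1
          · exact hZ.2.2 f hf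
        have hle' : region C (insert p A) F σ ⊆ region C A (insert p F) σ := fun Z hZ =>
          hin Z ⟨hZ.1, (Finset.subset_insert p A).trans hZ.2.1, hZ.2.2⟩
            (Or.inl (mem_zeros.1 (hZ.2.1 (by simp))))
        obtain ⟨l, hl⟩ := ihF (fun f hf => hσ f (Finset.mem_insert_of_mem hf)) X (hle hX) Y (hle hY)
          hne
        -- paths between two cocircuits that vanish at `p`
        have hpath : p ∉ A → ∀ U ∈ region C A F σ, ∀ V ∈ region C A F σ, U p = 0 → V p = 0 →
            ∃ l, NearChain (region C A (insert p F) σ) l U V := by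
          intro hpA U hU V hV hU0 hV0
          have hm : ∀ W ∈ region C A F σ, W p = 0 → W ∈ region C (insert p A) F σ := by
            intro W hW hW0
            refine ⟨hW.1, fun f hf => ?_, hW.2.2⟩
            rcases Finset.mem_insert.1 hf with rfl | hf
            · exact mem_zeros.2 hW0
            · exact hW.2.1 hf
          have hcard : (insert p A).card + 1 + k = r := by
            rw [Finset.card_insert_of_notMem hpA]; omega
          have hσF : ∀ f ∈ F, σ f ≠ 0 := fun f hf => hσ f (Finset.mem_insert_of_mem hf)
          have hU' := hm U hU hU0
          have hV' := hm V hV hV0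
          -- If the two ends are antipodal, a third cocircuit `W` is inserted. Both ends respect `σ`
          -- on `F`, hence vanish on `F`; so an exchange at a zero `a` outside `insert p A` stays in
          -- the region when the sign at `a` is chosen according to `σ`. Such an `a` exists because
          -- `k` is positive.
          by_cases hUV : U = -V
          · obtain ⟨a, ha⟩ : (U.zeros \ insert p A).Nonempty := by
              have h1 := Finset.card_sdiff_add_card_inter U.zeros (insert p A)
              have h2 := Finset.card_le_card (Finset.inter_subset_right
                (s₁ := U.zeros) (s₂ := insert p A))
              have h3 := h.card_zeros hU.1
              exact Finset.card_pos.1 (by omega)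
            rw [Finset.mem_sdiff, mem_zeros] at ha
            obtain ⟨b, hb⟩ := h.exists_ne_zero hU.1
            obtain ⟨W, hW, hWz, hWa⟩ := h.exists_exchange hU.1 ha.1 hb
              (s := if a ∈ F then σ a else 1) (by
                split_ifs with hF
                · exact hσF a hF
                · decide)
            have hW' : W ∈ region C (insert p A) F σ := by
              refine ⟨hW, fun f hf => ?_, fun f hf => ?_⟩
              · rw [hWz, Finset.mem_insert, Finset.mem_erase]
                refine Or.inr ⟨?_, hU'.2.1 hf⟩
                rintro rfl
                exact ha.2 hf
              · by_cases hfa : f = a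
                · subst hfa
                  rw [if_pos hf] at hWa
                  exact Or.inr hWa
                · left
                  rw [← mem_zeros, hWz, Finset.mem_insert, Finset.mem_erase]
                  refine Or.inr ⟨hfa, mem_zeros.2 ?_⟩
                  have h1 := hU.2.2 f hf
                  have h2 := hV.2.2 f hf
                  have h3 := hσF f hf
                  rw [hUV, Pi.neg_apply] at h1 ⊢
                  revert h1 h2 h3
                  generalize V f = v
                  generalize σ f = s
                  revert v s
                  decide
            have hbW : W b = 0 := by rw [← mem_zeros, hWz]; simp
            obtain ⟨l1, c1⟩ := ih _ F σ hcard hσF U hU' W hW' (by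
              rintro rfl; apply hb; simp [hbW])
            obtain ⟨l2, c2⟩ := ih _ F σ hcard hσF W hW' V hV' (by
              rintro rfl; apply hb; rw [hUV]; exact hbW)
            exact ⟨_, (c1.trans c2).mono hle'⟩
          · obtain ⟨l, hl⟩ := ih _ F σ hcard hσF U hU' V hV' hUV
            exact ⟨l, hl.mono hle'⟩
        -- The invariant along the old path: either the repaired path has reached `Z`, or `Z` is on
        -- the wrong side and the repaired path waits at the point `U` where that side was entered.
        have key : ∀ Z, NearChain (region C A F σ) l X Z →
            (∃ l, NearChain (region C A (insert p F) σ) l X Z) ∨ (Z p = -σ p ∧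
              ∃ U ∈ region C A F σ, U p = 0 ∧ ∃ l, NearChain (region C A (insert p F) σ) l X U) := by
          intro Z hZ
          clear hl
          induction hZ with
          | nil _ => exact Or.inl ⟨0, .nil hX⟩
          | @snoc k X Z Z' hc h1 h2 ih' =>
            have hsep : p ∉ sep Z Z' := by rw [h1.2]; simp
            rw [mem_sep] at hsep
            have hZm : Z ∈ region C A F σ := by
              cases hc with
              | nil h => exact h
              | snoc _ _ h => exact h
            rcases ih' hX hne with ⟨l, hl⟩ | ⟨hZp, U, hU, hU0, l, hl⟩
            · have hZm' : Z ∈ region C A (insert p F) σ := by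
                cases hl with
                | nil h => exact h
                | snoc _ _ h => exact h
              by_cases hZ' : Z' p = 0 ∨ Z' p = σ p
              · exact Or.inl ⟨_, .snoc hl h1 (hin _ h2 hZ')⟩
              · have h3 := hZm'.2.2 p (by simp)
                have h4 : Z p = 0 ∧ Z' p = -σ p := by
                  revert hZ' h3 hsep hp0
                  generalize Z p = z
                  generalize Z' p = z'
                  generalize σ p = s
                  revert z z' s
                  decide
                exact Or.inr ⟨h4.2, Z, hZm, h4.1, l, hl⟩
            · have h4 : Z' p = 0 ∨ Z' p = -σ p := by
                rw [hZp] at hsep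
                revert hsep hp0
                generalize Z' p = z'
                generalize σ p = s
                revert z' s
                decide
              rcases h4 with h4 | h4
              · have hpA : p ∉ A := by
                  intro hpA
                  have := mem_zeros.1 (hZm.2.1 hpA)
                  rw [hZp] at this
                  revert this hp0
                  generalize σ p = s
                  revert s
                  decide
                obtain ⟨l', hl'⟩ := hpath hpA U hU Z' h2 hU0 h4
                exact Or.inl ⟨_, hl.trans hl'⟩
              · exact Or.inr ⟨h4, U, hU, hU0, l, hl⟩
        rcases key Y hl with h1 | ⟨h1, -⟩
        · exact h1
        · exfalso
          have h2 := hY.2.2 p (by simp)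
          rw [h1] at h2
          revert h2 hp0
          generalize σ p = s
          revert s
          decide

/-- Elimination on colines implies elimination. -/
theorem isUniformOM : IsUniformOM n r C where
  card_supp := h.card_supp
  pair := h.pair
  elim X hX Y hY hne e he := by
    -- The region consists of the cocircuits that vanish where both `X` and `Y` do and that agree
    -- with them, up to zeros, outside the separator. Any member is admissible for the elimination
    -- except that it must also vanish at `e`.
    set A := X.zeros ∩ Y.zeros
    set F := Finset.univ.filter fun f => f ∉ A ∧ f ∉ sep X Y with hF
    set σ : Fin n → SignType := fun f => if X f ≠ 0 then X f else Y f with hσ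
    have hXY : ∀ f, f ∈ F → σ f ≠ 0 ∧ (X f = 0 ∨ X f = σ f) ∧ (Y f = 0 ∨ Y f = σ f) ∧
        (σ f = X f ∨ σ f = Y f) := by
      intro f hf
      simp only [hF, A, Finset.mem_filter, Finset.mem_univ, true_and, Finset.mem_inter, mem_zeros,
        mem_sep] at hf
      simp only [hσ]
      revert hf
      generalize X f = x
      generalize Y f = y
      revert x y
      decide
    obtain ⟨l, hl⟩ := h.region_connected (r - 1 - A.card) A F σ
      (by have := h.card_inter_of_sdiff hX (Y := Y); simp only [A]; omega)
      (fun f hf => (hXY f hf).1) X ⟨hX, Finset.inter_subset_left, fun f hf => (hXY f hf).2.1⟩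
      Y ⟨hY, Finset.inter_subset_right, fun f hf => (hXY f hf).2.2.1⟩ hne
    rw [mem_sep] at he
    -- The coordinate `e` has opposite signs at the two ends of the path, so some cocircuit on the
    -- path vanishes there.
    rcases hl.eq_or_exists_zero he.1 with h1 | ⟨Z, hZ, h0⟩
    · exfalso
      rw [h1] at he
      revert he
      generalize X e = x
      revert x
      decide
    · refine ⟨Z, hZ.1, h0, fun f _ => ?_⟩
      by_cases hfA : f ∈ A
      · exact Or.inr (Or.inr (mem_zeros.1 (hZ.2.1 hfA)))
      · by_cases hfs : f ∈ sep X Y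
        · rw [mem_sep] at hfs
          revert hfs
          generalize X f = x
          generalize Y f = y
          generalize Z f = z
          revert x y z
          decide
        · have hf : f ∈ F := by simp [hF, hfA, hfs]
          rcases hZ.2.2 f hf with h1 | h1
          · exact Or.inr (Or.inr h1)
          · rcases (hXY f hf).2.2.2 with h2 | h2
            · exact Or.inl (h1.trans h2)
            · exact Or.inr (Or.inl (h1.trans h2))

end IsModularOM


/-! ## Distances in cocircuit graphs -/

open SignVec

namespace SignVec

variable {n : ℕ}

/-- The elements that must vanish on every path from `X` to `Y`. -/
def gap (X Y : SignVec n) : Finset (Fin n) := Finset.univ.filter fun f => X f ≠ 0 ∧ Y f ≠ X f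

theorem mem_gap {X Y : SignVec n} {f : Fin n} : f ∈ gap X Y ↔ X f ≠ 0 ∧ Y f ≠ X f := by
  simp [gap]

theorem card_gap (X Y : SignVec n) :
    (gap X Y).card = (sep X Y).card + (Y.zeros \ X.zeros).card := by
  rw [← Finset.card_union_of_disjoint]
  · congr 1
    ext f
    simp only [mem_gap, Finset.mem_union, mem_sep, Finset.mem_sdiff, mem_zeros]
    generalize X f = x
    generalize Y f = y
    revert x y
    decide
  · rw [Finset.disjoint_left]
    intro f
    simp only [mem_sep, Finset.mem_sdiff, mem_zeros]
    generalize X f = x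
    generalize Y f = y
    revert x y
    decide

theorem Near.exchange {X Y : SignVec n} (h : Near X Y) (hc : X.zeros.card = Y.zeros.card) :
    ∃ a b, X a = 0 ∧ Y a ≠ 0 ∧ X b ≠ 0 ∧ Y b = 0 ∧ ∀ f, f ≠ a → f ≠ b → Y f = X f := by
  obtain ⟨h1, h2⟩ := h
  rw [symmDiff_def, Finset.sup_eq_union, Finset.card_union_of_disjoint disjoint_sdiff_sdiff] at h1
  have h3 := Finset.card_sdiff_add_card_inter X.zeros Y.zeros
  have h4 := Finset.card_sdiff_add_card_inter Y.zeros X.zeros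
  rw [Finset.inter_comm] at h4
  obtain ⟨a, ha⟩ := Finset.card_eq_one.1 (show (X.zeros \ Y.zeros).card = 1 by omega)
  obtain ⟨b, hb⟩ := Finset.card_eq_one.1 (show (Y.zeros \ X.zeros).card = 1 by omega)
  have ha' := fun f => Finset.ext_iff.1 ha f
  have hb' := fun f => Finset.ext_iff.1 hb f
  simp only [Finset.mem_sdiff, mem_zeros, Finset.mem_singleton] at ha' hb'
  refine ⟨a, b, ((ha' a).2 rfl).1, ((ha' a).2 rfl).2, ((hb' b).2 rfl).2, ((hb' b).2 rfl).1, ?_⟩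
  intro f hfa hfb
  have h5 := mt (ha' f).1 hfa
  have h6 := mt (hb' f).1 hfb
  have h7 : f ∉ sep X Y := by rw [h2]; simp
  rw [mem_sep] at h7
  revert h5 h6 h7
  generalize X f = x
  generalize Y f = y
  revert x y
  decide

/-- A step changes only two coordinates: `a` becomes nonzero and `b` becomes zero. Only `b` can
leave the gap, so the size of the gap is a lower bound for distances. -/
theorem card_gap_le {X X' Y : SignVec n} (h : Near X X') (hc : X.zeros.card = X'.zeros.card) :
    (gap X Y).card ≤ (gap X' Y).card + 1 := by
  obtain ⟨a, b, h1, h2, h3, h4, h5⟩ := h.exchange hc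
  refine (Finset.card_le_card (t := insert b (gap X' Y)) ?_).trans (Finset.card_insert_le _ _)
  intro f hf
  rw [mem_gap] at hf
  rw [Finset.mem_insert, mem_gap]
  by_cases hfb : f = b
  · exact Or.inl hfb
  · have hfa : f ≠ a := by rintro rfl; exact hf.1 h1
    rw [h5 f hfa hfb]
    exact Or.inr hf

/-- If the new nonzero coordinate did not agree with `Y`, it would enter the gap and make up for the
one that leaves. Thus a step that shortens the gap moves towards `Y` in the coordinate it switches
on. -/
theorem eq_of_card_gap_lt {X X' Y : SignVec n} (h : Near X X')
    (hc : X.zeros.card = X'.zeros.card) (hlt : (gap X' Y).card < (gap X Y).card) {a : Fin n}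
    (ha : X a = 0) (ha' : X' a ≠ 0) : Y a = X' a := by
  obtain ⟨a', b, h1, h2, h3, h4, h5⟩ := h.exchange hc
  have haa : a = a' := by
    by_contra hne
    have hab : a ≠ b := by rintro rfl; exact h3 ha
    exact ha' ((h5 a hne hab).trans ha)
  subst haa
  by_contra hY
  have hm : a ∈ gap X' Y := mem_gap.2 ⟨ha', hY⟩
  have : gap X Y ⊆ insert b ((gap X' Y).erase a) := by
    intro f hf
    rw [mem_gap] at hf
    rw [Finset.mem_insert, Finset.mem_erase, mem_gap]
    by_cases hfb : f = b
    · exact Or.inl hfb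
    · have hfa : f ≠ a := by rintro rfl; exact hf.1 h1
      rw [h5 f hfa hfb]
      exact Or.inr ⟨hfa, hf⟩
  have h6 := (Finset.card_le_card this).trans (Finset.card_insert_le _ _)
  rw [Finset.card_erase_of_mem hm] at h6
  have := Finset.card_pos.2 ⟨a, hm⟩
  omega

theorem gap_self (X : SignVec n) : gap X X = ∅ := by
  simp [gap]

/-- The number of coordinates in the common support bounds the sum of the separations from a pair
of antipodes. -/
theorem card_sep_add_card_sep_neg (X Y : SignVec n) :
    (sep X Y).card + (sep Y (-X)).card = ((X.zeros ∪ Y.zeros)ᶜ).card := by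
  rw [← Finset.card_union_of_disjoint]
  · congr 1
    ext f
    simp only [Finset.mem_union, mem_sep, Finset.mem_compl, mem_zeros, Pi.neg_apply]
    generalize X f = x
    generalize Y f = y
    revert x y
    decide
  · rw [Finset.disjoint_left]
    intro f
    simp only [mem_sep, Pi.neg_apply]
    generalize X f = x
    generalize Y f = y
    revert x y
    decide

end SignVec

/-! ### Neighbours along a coline. -/

namespace IsModularOM

variable {n r : ℕ} {C : Set (SignVec n)} (h : IsModularOM n r C)
include h

/-- Start with any cocircuit of the coline on the right side of `a`. As long as something separates
it from `X`, elimination gives another one on the same side with a smaller separator; it is adjacent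
to `X` once the separator is empty. -/
theorem exists_near {X : SignVec n} (hX : X ∈ C) {a : Fin n} (ha : X a = 0) {s : SignType}
    (hs : s ≠ 0) : ∃ Y ∈ C, Near X Y ∧ Y a = s := by
  obtain ⟨b, hb⟩ := h.exists_ne_zero hX
  obtain ⟨Y₀, hY₀, hz₀, hs₀⟩ := h.exists_exchange hX ha hb hs
  have hd₀ : (X.zeros \ Y₀.zeros).card = 1 := by rw [sdiff_exchange ha hb hz₀]; simp
  have key : ∀ k, ∀ Y ∈ C, (X.zeros \ Y.zeros).card = 1 → Y a = s → (sep X Y).card = k →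
      ∃ Y ∈ C, Near X Y ∧ Y a = s := by
    intro k
    induction k using Nat.strong_induction_on with
    | _ k ih =>
    rintro Y hY hd hYa rfl
    rcases (sep X Y).eq_empty_or_nonempty with h1 | ⟨e, he⟩
    · exact ⟨Y, hY, (h.near hX hY).2 ⟨hd, h1⟩, hYa⟩
    · obtain ⟨Z, hZ, hz, hf, h1, h2⟩ := h.elim_zeros hX hY hd he
      have h0 : Z e = 0 := by rw [← mem_zeros, hz]; simp
      have hc := card_sep_add_card_sep he h0 hf
      refine ih _ (by omega) Z hZ h1 ?_ rfl
      have hZa : Z a ≠ 0 := by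
        intro hZa
        rw [← mem_zeros, hz, Finset.mem_insert, Finset.mem_inter, mem_zeros, mem_zeros] at hZa
        rcases hZa with rfl | hZa
        · rw [mem_sep] at he; exact he.1 ha
        · exact hs (hYa.symm.trans hZa.2)
      rcases hf a with h3 | h3 | h3
      · exact absurd (h3.trans ha) hZa
      · exact h3.trans hYa
      · exact absurd h3 hZa
  exact key _ Y₀ hY₀ hd₀ hs₀ rfl

/-- If `U` follows `X` on a coline, and `Y` lies on the same side, then the element that vanishes
in `U` separates `X` from `Y`. -/
theorem mem_sep_of_near {X U Y : SignVec n} (hX : X ∈ C) (hU : U ∈ C) (hY : Y ∈ C)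
    {a c : Fin n} (ha : X a = 0) (hUa : U a ≠ 0) (hXc : X c ≠ 0) (hUc : U c = 0)
    (hf : ∀ f, f ≠ a → f ≠ c → U f = X f) (hd : (X.zeros \ Y.zeros).card = 1)
    (hYa : Y a = U a) (hne : Y ≠ U) : c ∈ sep X Y := by
  have hz : X.zeros \ Y.zeros = {a} := by
    obtain ⟨a', ha'⟩ := Finset.card_eq_one.1 hd
    have : a ∈ X.zeros \ Y.zeros := by simp [mem_zeros, ha, hYa, hUa]
    rw [ha', Finset.mem_singleton] at this
    rw [ha', this]
  have hXY : ∀ f, f ≠ a → X f = 0 → Y f = 0 := by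
    intro f hfa hXf
    by_contra hYf
    have : f ∈ X.zeros \ Y.zeros := by simp [mem_zeros, hXf, hYf]
    rw [hz, Finset.mem_singleton] at this
    exact hfa this
  have hXU : ∀ f, f ≠ a → X f = 0 → U f = 0 := by
    intro f hfa hXf
    rw [hf f hfa (by rintro rfl; exact hXc hXf), hXf]
  have hUz : (U.zeros \ Y.zeros).card ≤ 1 := by
    apply (Finset.card_le_card (t := {c}) ?_).trans (by simp)
    intro f
    simp only [Finset.mem_sdiff, mem_zeros, Finset.mem_singleton]
    rintro ⟨h1, h2⟩
    by_contra hfc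
    have hfa : f ≠ a := by rintro rfl; exact hUa h1
    rw [hf f hfa hfc] at h1
    exact h2 (hXY f hfa h1)
  have hUz1 : (U.zeros \ Y.zeros).card = 1 := by
    by_contra h1
    have h2 : (U.zeros \ Y.zeros).card = 0 := by omega
    have h3 := h.card_sdiff_comm hU hY
    rw [h2] at h3
    have h3 := h3.symm
    rw [Finset.card_eq_zero, Finset.sdiff_eq_empty_iff_subset] at h2 h3
    exact hne (h.eq_of_zeros_eq hU hY (h2.antisymm h3) hUa hYa.symm).symm
  have hYc : Y c ≠ 0 := by
    obtain ⟨c', hc'⟩ := Finset.card_eq_one.1 hUz1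
    have h1 : c' ∈ U.zeros \ Y.zeros := by rw [hc']; simp
    simp only [Finset.mem_sdiff, mem_zeros] at h1
    have : c' = c := by
      by_contra hne
      have hfa : c' ≠ a := by rintro rfl; exact hUa h1.1
      exact h1.2 (hXY c' hfa ((hf c' hfa hne).symm.trans h1.1))
    rw [← this]; exact h1.2
  by_contra hc
  have hcc : Y c = X c := by
    rw [mem_sep] at hc
    revert hc hXc hYc
    generalize X c = x
    generalize Y c = y
    revert x y
    decide
  -- Suppose that `Y` agrees with `X` at `c`. Eliminating `a` between `Y` and `-U` gives a cocircuit
  -- with the zero set and the sign at `c` of `X`, hence `X` itself. At the element `b` where `Y`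
  -- vanishes and `X` does not, its value would have to be zero or the opposite of that of `X`.
  have hnU := h.neg_mem hU
  obtain ⟨Z, hZ, hZz, hZf, -, -⟩ := h.elim_zeros hY hnU (X := Y) (Y := -U) (e := a)
    (by rw [zeros_neg, ← h.card_sdiff_comm hU hY]; exact hUz1)
    (by rw [mem_sep, hYa]; exact ⟨hUa, rfl⟩)
  have hZX : X.zeros = Z.zeros := by
    apply Finset.eq_of_subset_of_card_le
    · intro f hff
      rw [mem_zeros] at hff
      rw [hZz, zeros_neg, Finset.mem_insert, Finset.mem_inter, mem_zeros, mem_zeros]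
      by_cases hfa : f = a
      · exact Or.inl hfa
      · exact Or.inr ⟨hXY f hfa hff, hXU f hfa hff⟩
    · have := h.card_zeros hX
      have := h.card_zeros hZ
      omega
  have hZc : Z c ≠ 0 := by rwa [ne_eq, ← mem_zeros, ← hZX, mem_zeros]
  have hZc' : X c = Z c := by
    rcases hZf c with h1 | h1 | h1
    · rw [h1, hcc]
    · rw [Pi.neg_apply, hUc] at h1; exact absurd h1 (by simpa using hZc)
    · exact absurd h1 hZc
  have hXZ := h.eq_of_zeros_eq hX hZ hZX hXc hZc'
  subst hXZ
  obtain ⟨b, hb⟩ := Finset.card_eq_one.1 ((h.card_sdiff_comm hX hY).symm.trans hd)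
  have hb1 : b ∈ Y.zeros \ X.zeros := by rw [hb]; simp
  simp only [Finset.mem_sdiff, mem_zeros] at hb1
  have hba : b ≠ a := by rintro rfl; exact hb1.2 ha
  have hbc : b ≠ c := by rintro rfl; exact hYc hb1.1
  have hUb := hf b hba hbc
  rcases hZf b with h1 | h1 | h1
  · exact hb1.2 (h1.trans hb1.1)
  · rw [Pi.neg_apply, hUb] at h1
    have := hb1.2
    revert h1 this
    generalize X b = x
    revert x
    decide
  · exact hb1.2 h1

/-- A second neighbour on the same side of the coline would, by `mem_sep_of_near`, be separated from
`X`. So a neighbour is determined by the zero that it loses and the sign there. -/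
theorem near_unique {X Y Y' : SignVec n} (hX : X ∈ C) (hY : Y ∈ C) (hY' : Y' ∈ C) (h1 : Near X Y)
    (h2 : Near X Y') {a : Fin n} (ha : X a = 0) (ha' : Y a ≠ 0) (hs : Y a = Y' a) : Y = Y' := by
  have hc1 : X.zeros.card = Y.zeros.card := by
    have := h.card_zeros hX
    have := h.card_zeros hY
    omega
  obtain ⟨a₁, c, g1, g2, g3, g4, g5⟩ := h1.exchange hc1
  have : a = a₁ := by
    by_contra hne
    exact ha' ((g5 a hne (by rintro rfl; exact g3 ha)).trans ha)
  subst this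
  by_contra hne
  have h3 := h.mem_sep_of_near hX hY hY' g1 g2 g3 g4 g5 ((h.near hX hY').1 h2).1 hs.symm
    (Ne.symm hne)
  rw [h2.2] at h3
  simp at h3

end IsModularOM

/-! ### Distances in a labeled graph, and the recognition of antipodes and colines. -/

namespace IsOMLabeling

variable {V : Type} {G : SimpleGraph V} {n r : ℕ} {L : V → SignVec n}

section
variable (hL : IsOMLabeling G n r L)
include hL

theorem modular : IsModularOM n r (Set.range L) := hL.isUniformOM.isModularOM

theorem card_zeros (v : V) : (L v).zeros.card + 1 = r := hL.modular.card_zeros ⟨v, rfl⟩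

theorem card_zeros_eq (v w : V) : (L v).zeros.card = (L w).zeros.card := by
  have := hL.card_zeros v
  have := hL.card_zeros w
  omega

theorem exists_neg (v : V) : ∃ w, L w = -L v := hL.modular.neg_mem ⟨v, rfl⟩

theorem le_size (v : V) : r ≤ n := by
  obtain ⟨b, hb⟩ := hL.modular.exists_ne_zero ⟨v, rfl⟩
  have h1 := hL.modular.card_supp _ ⟨v, rfl⟩
  have h2 : 0 < (L v).supp.card := Finset.card_pos.2 ⟨b, mem_supp.2 hb⟩
  omega

theorem card_gap_le_length {v w : V} (p : G.Walk v w) : (gap (L v) (L w)).card ≤ p.length := by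
  induction p with
  | nil => simp [gap_self]
  | @cons u v w hadj p ih =>
    have := card_gap_le (Y := L w) ((hL.adj_iff _ _).1 hadj) (hL.card_zeros_eq _ _)
    rw [SimpleGraph.Walk.length_cons]
    exact this.trans (by omega)

theorem exists_walk {Q : Set (SignVec n)} (hQ : Q ⊆ Set.range L) {k : ℕ} {X Y : SignVec n}
    (hc : NearChain Q k X Y) : ∀ {v w : V}, L v = X → L w = Y → ∃ p : G.Walk v w, p.length = k := by
  induction hc with
  | nil hX =>
    intro v w hv hw
    obtain rfl := hL.injective (hv.trans hw.symm)
    exact ⟨.nil, rfl⟩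
  | @snoc k X Y Z hc h1 h2 ih =>
    intro v w hv hw
    have hY : Y ∈ Q := by
      cases hc with
      | nil h => exact h
      | snoc _ _ h => exact h
    obtain ⟨u, hu⟩ := hQ hY
    obtain ⟨p, hp⟩ := ih hv hu
    have : G.Adj u w := by rw [hL.adj_iff, hu, hw]; exact h1
    exact ⟨p.concat this, by simp [hp]⟩

theorem dist_le {v w : V} (h : ((L v).zeros \ (L w).zeros).card = 1) :
    G.dist v w ≤ (sep (L v) (L w)).card + 1 := by
  obtain ⟨k, hk, hc⟩ := hL.modular.exists_nearChain ⟨v, rfl⟩ ⟨w, rfl⟩ h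
  obtain ⟨p, hp⟩ := hL.exists_walk (fun Z hZ => hZ.1) hc rfl rfl
  exact (SimpleGraph.dist_le p).trans (by omega)

variable (hG : G.Connected)
include hG

theorem card_gap_le_dist (v w : V) : (gap (L v) (L w)).card ≤ G.dist v w := by
  obtain ⟨p, hp⟩ := hG.exists_walk_length_eq_dist v w
  rw [← hp]
  exact hL.card_gap_le_length p

/-- The path along the coline is as short as the bound by the gap allows, since the gap consists of
the separator and the one new zero. -/
theorem dist_eq {v w : V} (h : ((L v).zeros \ (L w).zeros).card = 1) :
    G.dist v w = (sep (L v) (L w)).card + 1 := by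
  apply (hL.dist_le h).antisymm
  have h1 := hL.card_gap_le_dist hG v w
  rw [card_gap, ← hL.modular.card_sdiff_comm ⟨v, rfl⟩ ⟨w, rfl⟩, h] at h1
  exact h1

/-- An edge exchanges a zero, but in rank `1` there are none; and a vertex and its antipode need to
be joined by a walk. -/
theorem two_le_rank : 2 ≤ r := by
  obtain ⟨v⟩ := hG.nonempty
  obtain ⟨w, hw⟩ := hL.exists_neg v
  have h1 := hL.card_zeros v
  by_contra hr
  have hne : v ≠ w := by
    rintro rfl
    obtain ⟨b, hb⟩ := hL.modular.exists_ne_zero ⟨v, rfl⟩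
    have := congrFun hw b
    rw [Pi.neg_apply] at this
    revert this hb
    generalize L v b = x
    revert x
    decide
  obtain ⟨p⟩ := hG.preconnected v w
  cases p with
  | nil => exact hne rfl
  | cons hadj p =>
    obtain ⟨a, -, ha, -⟩ := ((hL.adj_iff _ _).1 hadj).exchange (hL.card_zeros_eq _ _)
    have := Finset.card_pos.2 ⟨a, mem_zeros.2 ha⟩
    omega

end

section
variable (hL : IsOMLabeling G n r L) (hG : G.Connected) {a : V → V} (ha : ∀ v, L (a v) = -L v)
include hL hG ha

omit hG in
theorem anti_anti (v : V) : a (a v) = v := hL.injective (by rw [ha, ha, neg_neg])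

omit hG in
theorem anti_ne (v : V) : v ≠ a v := by
  intro hv
  obtain ⟨b, hb⟩ := hL.modular.exists_ne_zero ⟨v, rfl⟩
  have := congrFun (ha v) b
  rw [← hv, Pi.neg_apply] at this
  revert this hb
  generalize L v b = x
  revert x
  decide

omit hG in
theorem eq_or_eq_anti {v w : V} (h : (L v).zeros = (L w).zeros) : v = w ∨ v = a w := by
  rcases hL.modular.eq_or_eq_neg ⟨v, rfl⟩ ⟨w, rfl⟩ h with h1 | h1
  · exact Or.inl (hL.injective h1)
  · exact Or.inr (hL.injective (by rw [ha, h1]))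

omit hG in
theorem adj_anti {v w : V} (h : G.Adj v w) : G.Adj (a v) (a w) := by
  rw [hL.adj_iff] at h ⊢
  rw [ha, ha]
  refine ⟨by rw [zeros_neg, zeros_neg]; exact h.1, ?_⟩
  rw [sep_neg_left, neg_neg]
  exact h.2

omit ha hG in
theorem card_compl_union {v w : V} :
    (((L v).zeros ∪ (L w).zeros)ᶜ).card + ((L v).zeros \ (L w).zeros).card + r = n + 1 := by
  have h1 := Finset.card_add_card_compl ((L v).zeros ∪ (L w).zeros)
  rw [Fintype.card_fin] at h1
  have h2 := Finset.card_sdiff_add_card (L v).zeros (L w).zeros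
  have h3 := hL.card_zeros w
  omega

/-- For `w` on a coline with `v`, the separators of `v`, `w` and of `w`, `-v` partition the common
support of size `n - r`, and going through `w` costs two more. Conversely, after one step to `u` no
coordinate of the support of `u` agrees with `-v`, so `n - r + 1` further steps are needed. -/
theorem dist_anti (v : V) : G.dist v (a v) = n - r + 2 := by
  have hrn := hL.le_size v
  apply le_antisymm
  · obtain ⟨b, hb⟩ := hL.modular.exists_ne_zero ⟨v, rfl⟩
    have h1 := hL.two_le_rank hG
    have h2 := hL.card_zeros v
    obtain ⟨x, hx⟩ := Finset.card_pos.1 (show 0 < (L v).zeros.card by omega)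
    rw [mem_zeros] at hx
    obtain ⟨_, ⟨w, rfl⟩, hz, -⟩ := hL.modular.exists_exchange ⟨v, rfl⟩ hx hb (s := 1) (by decide)
    have h3 : ((L v).zeros \ (L w).zeros).card = 1 := by
      rw [IsModularOM.sdiff_exchange hx hb hz]; simp
    have h4 := hL.dist_le h3
    have h5 : ((L w).zeros \ (L (a v)).zeros).card = 1 := by
      rw [ha, zeros_neg, ← hL.modular.card_sdiff_comm ⟨v, rfl⟩ ⟨w, rfl⟩, h3]
    have h6 := hL.dist_le h5
    have h7 := hG.dist_triangle (u := v) (v := w) (w := a v)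
    have h8 := card_sep_add_card_sep_neg (L v) (L w)
    have h9 := hL.card_compl_union (v := v) (w := w)
    rw [ha] at h6
    omega
  · obtain ⟨p, hp⟩ := hG.exists_walk_length_eq_dist v (a v)
    rw [← hp]
    have hne := hL.anti_ne ha v
    have hav := ha v
    clear hp
    revert p hne hav
    generalize a v = x
    intro p hne hav
    cases p with
    | nil => exact absurd rfl hne
    | @cons _ u _ hadj p' =>
      rw [SimpleGraph.Walk.length_cons]
      have h1 := hL.card_gap_le_length p'
      have h2 : gap (L u) (L x) = (L u).supp := by
        ext f
        rw [mem_gap, mem_supp, hav]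
        refine ⟨fun h => h.1, fun h => ⟨h, fun h3 => ?_⟩⟩
        have h4 : f ∉ sep (L v) (L u) := by rw [((hL.adj_iff _ _).1 hadj).2]; simp
        rw [mem_sep] at h4
        rw [Pi.neg_apply] at h3
        revert h h3 h4
        generalize L v f = x
        generalize L u f = y
        revert x y
        decide
      rw [h2] at h1
      have h3 := hL.modular.card_supp _ ⟨u, rfl⟩
      omega

/-- The vertices on a common coline with `v`. -/
theorem coline_iff {v w : V} : ((L v).zeros \ (L w).zeros).card = 1 ↔
    G.dist v w + G.dist w (a v) = n - r + 2 ∧ G.dist v w ≠ 0 ∧ G.dist v w ≠ n - r + 2 := by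
  have hrn := hL.le_size v
  have h8 := card_sep_add_card_sep_neg (L v) (L w)
  have h9 := hL.card_compl_union (v := v) (w := w)
  have hc := hL.modular.card_sdiff_comm ⟨v, rfl⟩ ⟨w, rfl⟩
  constructor
  · intro h
    have h1 := hL.dist_eq hG h
    have h2 := hL.dist_eq hG (v := w) (w := a v) (by rw [ha, zeros_neg, ← hc, h])
    rw [ha] at h2
    omega
  · rintro ⟨h1, h2, h3⟩
    -- If the zero sets differ by `k` exchanges, the two gaps have `(n - r + 1 - k) + 2 * k`
    -- elements together. This is at most the sum of the distances, whence `k ≤ 1`; and `k = 0`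
    -- would mean `w = v` or `w = -v`.
    have h4 := hL.card_gap_le_dist hG v w
    have h5 := hL.card_gap_le_dist hG w (a v)
    rw [card_gap, ha, zeros_neg] at h5
    rw [card_gap] at h4
    have h6 : ((L v).zeros \ (L w).zeros).card ≠ 0 := by
      intro h7
      have h10 : (L w).zeros = (L v).zeros := by
        rw [h7] at hc
        have hc := hc.symm
        rw [Finset.card_eq_zero, Finset.sdiff_eq_empty_iff_subset] at h7 hc
        exact hc.antisymm h7
      rcases hL.eq_or_eq_anti ha h10 with rfl | rfl
      · simp at h2
      · exact h3 (hL.dist_anti hG ha v)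
    omega

/-- Write `x = -u'` with `u'` another neighbour of `v`. If `u` and `u'` lie on a common coline, or
are antipodal, the distance is too small by the preceding formulas. Otherwise they exchange
different zeros `i`, `i'` for different elements `b`, `b'`, and a suitable `w` gives a path from `u`
through `w` to `-u'` of length at most `n - r + 1`. So antipodes propagate along edges. -/
theorem anti_rule {v u x : V} (hvu : G.Adj v u) (hx : G.Adj (a v) x) :
    G.dist u x = n - r + 2 ↔ x = a u := by
  have hrn := hL.le_size v
  constructor
  swap
  · rintro rfl; exact hL.dist_anti hG ha u
  intro hdist
  by_contra hxu
  obtain ⟨u', rfl⟩ : ∃ u', x = a u' := ⟨a x, (hL.anti_anti ha x).symm⟩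
  have hvu' : G.Adj v u' := by
    have := hL.adj_anti ha hx
    rwa [hL.anti_anti ha, hL.anti_anti ha] at this
  have huu' : u' ≠ u := by rintro rfl; exact hxu rfl
  have h9 := hL.card_compl_union (v := u) (w := a u')
  have hle : (sep (L u) (L (a u'))).card ≤ (((L u).zeros ∪ (L (a u')).zeros)ᶜ).card := by
    have := card_sep_add_card_sep_neg (L u) (L (a u'))
    omega
  rcases Nat.lt_trichotomy ((L u).zeros \ (L (a u')).zeros).card 1 with h1 | h1 | h1
  · have hc := hL.modular.card_sdiff_comm ⟨u, rfl⟩ ⟨a u', rfl⟩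
    have h7 : ((L u).zeros \ (L (a u')).zeros).card = 0 := by omega
    have h10 : (L u).zeros = (L (a u')).zeros := by
      rw [h7] at hc
      have hc := hc.symm
      rw [Finset.card_eq_zero, Finset.sdiff_eq_empty_iff_subset] at h7 hc
      exact h7.antisymm hc
    rcases hL.eq_or_eq_anti ha h10 with h2 | h2
    · rw [← h2] at hdist; simp at hdist
    · rw [hL.anti_anti ha] at h2; exact huu' h2.symm
  · have := hL.dist_eq hG h1
    omega
  · obtain ⟨i, b, g1, g2, g3, g4, g5⟩ :=
      ((hL.adj_iff _ _).1 hvu).exchange (hL.card_zeros_eq _ _)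
    obtain ⟨i', b', k1, k2, k3, k4, k5⟩ :=
      ((hL.adj_iff _ _).1 hvu').exchange (hL.card_zeros_eq _ _)
    rw [ha, zeros_neg] at h1
    have hib : i ≠ b := by rintro rfl; exact g3 g1
    have hib' : i ≠ b' := by rintro rfl; exact k3 g1
    have hi'b : i' ≠ b := by rintro rfl; exact g3 k1
    have hi'b' : i' ≠ b' := by rintro rfl; exact k3 k1
    have hii : i ≠ i' := by
      rintro rfl
      have : (L u).zeros \ (L u').zeros ⊆ {b} := by
        intro f
        simp only [Finset.mem_sdiff, mem_zeros, Finset.mem_singleton]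
        rintro ⟨h2, h3⟩
        by_contra hfb
        have hfi : f ≠ i := by rintro rfl; exact g2 h2
        rw [g5 f hfi hfb] at h2
        by_cases hfb' : f = b'
        · subst hfb'; exact h3 k4
        · rw [k5 f hfi hfb'] at h3; exact h3 h2
      have := Finset.card_le_card this
      simp at this
      omega
    have hbb : b ≠ b' := by
      rintro rfl
      have : (L u).zeros \ (L u').zeros ⊆ {i'} := by
        intro f
        simp only [Finset.mem_sdiff, mem_zeros, Finset.mem_singleton]
        rintro ⟨h2, h3⟩
        by_contra hfi'
        have hfb : f ≠ b := by rintro rfl; exact h3 k4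
        have hfi : f ≠ i := by rintro rfl; exact g2 h2
        rw [g5 f hfi hfb] at h2
        rw [k5 f hfi' hfb] at h3; exact h3 h2
      have := Finset.card_le_card this
      simp at this
      omega
    have hcard : (insert b' ((L v).zeros.erase i)).card + 1 = r := by
      rw [Finset.card_insert_of_notMem (by simp [mem_zeros, k3]),
        Finset.card_erase_of_mem (mem_zeros.2 g1)]
      have h1 := hL.card_zeros v
      have h2 : 0 < (L v).zeros.card := Finset.card_pos.2 ⟨i, mem_zeros.2 g1⟩
      omega
    -- The middle vertex: its zero set mixes the exchange of `u` at `i` with that of `u'` at `b'`,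
    -- so it is on a coline with both. The sign at `b` is chosen so that `b` does not separate `w`
    -- from `-u'`.
    obtain ⟨_, ⟨w, rfl⟩, hwz, hwb⟩ := hL.modular.exists_zeros_eq hcard (a := b)
      (by simp [hbb, mem_zeros, g3]) (s := -L v b)
      (by revert g3; generalize L v b = x; revert x; decide)
    have hw0 : ∀ f, L w f = 0 ↔ f = b' ∨ (f ≠ i ∧ L v f = 0) := by
      intro f
      rw [← mem_zeros, hwz]
      simp [mem_zeros]
    have hu0 : ∀ f, L u f = 0 ↔ f = b ∨ (f ≠ i ∧ L v f = 0) := by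
      intro f
      by_cases hfi : f = i
      · subst hfi; simp [g2, hib]
      · by_cases hfb : f = b
        · subst hfb; simp [g4]
        · rw [g5 f hfi hfb]; simp [hfi, hfb]
    have hu0' : ∀ f, L u' f = 0 ↔ f = b' ∨ (f ≠ i' ∧ L v f = 0) := by
      intro f
      by_cases hfi : f = i'
      · subst hfi; simp [k2, hi'b']
      · by_cases hfb : f = b'
        · subst hfb; simp [k4]
        · rw [k5 f hfi hfb]; simp [hfi, hfb]
    -- Eliminating `b` between `v` and `w` yields a cocircuit with the zero set of `u` and the same
    -- sign at `b'`, hence `u` itself; its sign at `i` comes from `w`.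
    have hwi : L w i = L u i := by
      by_contra hne
      have hwi0 : L w i ≠ 0 := by rw [ne_eq, hw0]; simp [hib']
      have hwi : L w i = -L u i := by
        revert hne hwi0 g2
        generalize L w i = x
        generalize L u i = y
        revert x y
        decide
      have hvw : (L v).zeros \ (L w).zeros = {i} := IsModularOM.sdiff_exchange g1 k3 hwz
      obtain ⟨Z, hZ, hZz, hZf, -, -⟩ := hL.modular.elim_zeros ⟨v, rfl⟩ ⟨w, rfl⟩
        (e := b) (by rw [hvw]; simp) (by rw [mem_sep]; exact ⟨g3, hwb⟩)
      have hZ0 : ∀ f, Z f = 0 ↔ L u f = 0 := by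
        intro f
        rw [← mem_zeros, hZz, Finset.mem_insert, Finset.mem_inter, mem_zeros, mem_zeros, hw0, hu0]
        constructor
        · rintro (h2 | ⟨h2, rfl | h3⟩)
          · exact Or.inl h2
          · exact absurd h2 k3
          · exact Or.inr h3
        · rintro (h2 | h2)
          · exact Or.inl h2
          · exact Or.inr ⟨h2.2, Or.inr h2⟩
      have hZi : Z i = -L u i := by
        rcases hZf i with h2 | h2 | h2
        · exact absurd ((hZ0 i).1 (h2.trans g1)) g2
        · exact h2.trans hwi
        · exact absurd ((hZ0 i).1 h2) g2
      have hub' : L u b' = L v b' := g5 b' (Ne.symm hib') (Ne.symm hbb)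
      have hZb' : Z b' = L v b' := by
        rcases hZf b' with h2 | h2 | h2
        · exact h2
        · rw [(hw0 b').2 (Or.inl rfl)] at h2
          have := (hZ0 b').1 h2
          rw [hub'] at this
          exact absurd this k3
        · have := (hZ0 b').1 h2
          rw [hub'] at this
          exact absurd this k3
      have hZu : Z.zeros = (L u).zeros := by
        ext f; rw [mem_zeros, mem_zeros, hZ0]
      have h2 := hL.modular.eq_of_zeros_eq hZ ⟨u, rfl⟩ hZu (e := b') (by rw [hZb']; exact k3)
        (by rw [hZb', hub'])
      rw [h2] at hZi
      revert hZi g2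
      generalize L u i = y
      revert y
      decide
    have d1 := hL.dist_le (v := u) (w := w) (by
      rw [show (L u).zeros \ (L w).zeros = {b} from ?_]
      · simp
      ext f
      simp only [Finset.mem_sdiff, mem_zeros, Finset.mem_singleton, hw0, hu0]
      constructor
      · rintro ⟨h2 | h2, h3⟩
        · exact h2
        · exact absurd (Or.inr h2) h3
      · rintro rfl
        refine ⟨Or.inl rfl, ?_⟩
        rintro (h2 | h2)
        · exact hbb h2
        · exact g3 h2.2)
    have d2 := hL.dist_le (v := w) (w := a u') (by
      rw [ha, zeros_neg, show (L w).zeros \ (L u').zeros = {i'} from ?_]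
      · simp
      ext f
      simp only [Finset.mem_sdiff, mem_zeros, Finset.mem_singleton, hw0, hu0']
      constructor
      · rintro ⟨h2 | h2, h3⟩
        · exact absurd (Or.inl h2) h3
        · by_contra hne
          exact h3 (Or.inr ⟨hne, h2.2⟩)
      · rintro rfl
        refine ⟨Or.inr ⟨hii.symm, k1⟩, ?_⟩
        rintro (h2 | h2)
        · exact hi'b' h2
        · exact h2.1 rfl)
    rw [ha] at d2
    have d3 := hG.dist_triangle (u := u) (v := w) (w := a u')
    have hdj : Disjoint (sep (L u) (L w)) (sep (L w) (-L u')) := by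
      rw [Finset.disjoint_left]
      intro f h2 h3
      rw [mem_sep] at h2 h3
      rw [Pi.neg_apply] at h3
      have hfb : f ≠ b := by rintro rfl; exact h2.1 g4
      have hfb' : f ≠ b' := by rintro rfl; exact h3.1 ((hw0 _).2 (Or.inl rfl))
      have hfi : f ≠ i := by
        rintro rfl
        rw [hwi] at h2
        revert h2
        generalize L u f = y
        revert y
        decide
      have hfi' : f ≠ i' := by
        rintro rfl
        exact h2.1 ((hu0 f).2 (Or.inr ⟨hii.symm, k1⟩))
      rw [g5 f hfi hfb] at h2
      rw [k5 f hfi' hfb'] at h3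
      revert h2 h3
      generalize L v f = y
      generalize L w f = z
      revert y z
      decide
    -- The two separators are disjoint and avoid the `r + 1` elements consisting of `b`, `b'` and
    -- the zeros of `v`. So they have at most `n - r - 1` elements together, and the path has length
    -- at most `n - r + 1`.
    have hsub : sep (L u) (L w) ∪ sep (L w) (-L u') ⊆ (insert b (insert b' (L v).zeros))ᶜ := by
      intro f hf
      rw [Finset.mem_compl, Finset.mem_insert, Finset.mem_insert, mem_zeros]
      rw [Finset.mem_union, mem_sep, mem_sep, Pi.neg_apply] at hf
      rintro (rfl | rfl | h2)
      · rcases hf with hf | hf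
        · exact hf.1 g4
        · rw [hwb, k5 f (Ne.symm hi'b) hbb] at hf
          revert hf
          generalize L v f = y
          revert y
          decide
      · have := (hw0 f).2 (Or.inl rfl)
        rcases hf with hf | hf
        · rw [this] at hf
          revert hf
          generalize L u f = y
          revert y
          decide
        · exact hf.1 this
      · by_cases hfi : f = i
        · subst hfi
          have h3 := (hu0' f).2 (Or.inr ⟨hii, g1⟩)
          rw [hwi, h3] at hf
          revert hf
          generalize L u f = y
          revert y
          decide
        · have h3 := (hu0 f).2 (Or.inr ⟨hfi, h2⟩)
          have h4 := (hw0 f).2 (Or.inr ⟨hfi, h2⟩)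
          rcases hf with hf | hf
          · exact hf.1 h3
          · exact hf.1 h4
    have hcd := Finset.card_le_card hsub
    have hun := Finset.card_le_univ (insert b (insert b' (L v).zeros))
    rw [Finset.card_insert_of_notMem (by simp [hbb, mem_zeros, g3]),
      Finset.card_insert_of_notMem (by simp [mem_zeros, k3]), Fintype.card_fin] at hun
    rw [Finset.card_union_of_disjoint hdj, Finset.card_compl, Fintype.card_fin,
      Finset.card_insert_of_notMem (by simp [hbb, mem_zeros, g3]),
      Finset.card_insert_of_notMem (by simp [mem_zeros, k3])] at hcd
    have := hL.card_zeros v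
    omega

omit ha in
/-- The vertices that follow the neighbour `u` of `v` on a coline. -/
theorem follows_iff {v u y : V} (hvu : G.Adj v u) (hy : ((L v).zeros \ (L y).zeros).card = 1)
    {i : Fin n} (hi : L v i = 0) (hui : L u i ≠ 0) :
    G.dist v y = 1 + G.dist u y ↔ L y i = L u i := by
  have hdy := hL.dist_eq hG hy
  have hN := (hL.adj_iff _ _).1 hvu
  constructor
  · intro h1
    have h2 := hL.card_gap_le_dist hG u y
    -- On the coline the distance from `v` to `y` equals the size of the gap, so a step that
    -- shortens the distance also shortens the gap.
    refine eq_of_card_gap_lt hN (hL.card_zeros_eq _ _) ?_ hi hui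
    rw [card_gap (L v), ← hL.modular.card_sdiff_comm ⟨v, rfl⟩ ⟨y, rfl⟩, hy]
    omega
  · intro h1
    have ht := hG.dist_triangle (u := v) (v := u) (w := y)
    rw [SimpleGraph.dist_eq_one_iff_adj.2 hvu] at ht
    apply ht.antisymm
    by_cases hne : y = u
    · subst hne
      simp [hdy]
    · obtain ⟨i', c, g1, g2, g3, g4, g5⟩ := hN.exchange (hL.card_zeros_eq _ _)
      have : i = i' := by
        by_contra hii
        exact hui ((g5 i hii (by rintro rfl; exact g3 hi)).trans hi)
      subst this
      -- The element `c` that becomes zero in `u` separates `v` from `y`. It no longer separates `u`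
      -- from `y`, and nothing new does, so the distance drops by one.
      have hc := hL.modular.mem_sep_of_near ⟨v, rfl⟩ ⟨u, rfl⟩ ⟨y, rfl⟩ g1 g2 g3 g4 g5 hy h1
        (fun h => hne (hL.injective h))
      have hc' := hc
      rw [mem_sep] at hc
      have hd : ((L u).zeros \ (L y).zeros).card = 1 := by
        rw [Finset.card_eq_one]
        refine ⟨c, ?_⟩
        ext f
        simp only [Finset.mem_sdiff, mem_zeros, Finset.mem_singleton]
        constructor
        · rintro ⟨h2, h3⟩
          by_contra hfc
          have hfi : f ≠ i := by rintro rfl; exact g2 h2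
          rw [g5 f hfi hfc] at h2
          obtain ⟨j, hj⟩ := Finset.card_eq_one.1 hy
          have m1 : f ∈ (L v).zeros \ (L y).zeros := by simp [mem_zeros, h2, h3]
          have m2 : i ∈ (L v).zeros \ (L y).zeros := by simp [mem_zeros, hi, h1, hui]
          rw [hj, Finset.mem_singleton] at m1 m2
          exact hfi (m1.trans m2.symm)
        · rintro rfl
          refine ⟨g4, ?_⟩
          rw [hc.2]
          revert g3
          generalize L v f = x
          revert x
          decide
      have h2 := hL.dist_le hd
      have h3 : sep (L u) (L y) ⊆ (sep (L v) (L y)).erase c := by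
        intro f hf
        rw [mem_sep] at hf
        rw [Finset.mem_erase, mem_sep]
        have hfc : f ≠ c := by rintro rfl; exact hf.1 g4
        have hfi : f ≠ i := by
          rintro rfl
          rw [h1] at hf
          revert hf
          generalize L u f = x
          revert x
          decide
        rw [g5 f hfi hfc] at hf
        exact ⟨hfc, hf⟩
      have h4 := Finset.card_le_card h3
      rw [Finset.card_erase_of_mem hc'] at h4
      have := Finset.card_pos.2 ⟨c, hc'⟩
      omega

omit ha in
/-- The criterion for separation in terms of the cocircuits that vanish at the element. -/
theorem mem_sep_iff {y w : V} (hyw : ((L y).zeros \ (L w).zeros).card = 1) {e : Fin n}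
    (hy : L y e ≠ 0) : e ∈ sep (L y) (L w) ↔
      ∃ z, ((L z).zeros \ (L y).zeros).card = 1 ∧ ((L z).zeros \ (L w).zeros).card = 1 ∧
        L z e = 0 ∧ G.dist y z + G.dist z w = G.dist y w := by
  constructor
  · intro he
    obtain ⟨_, ⟨z, rfl⟩, hz, hf, h1, h2⟩ := hL.modular.elim_zeros ⟨y, rfl⟩ ⟨w, rfl⟩ hyw he
    have h0 : L z e = 0 := by rw [← mem_zeros, hz]; simp
    have hc := IsModularOM.card_sep_add_card_sep he h0 hf
    refine ⟨z, by rw [hL.modular.card_sdiff_comm ⟨z, rfl⟩ ⟨y, rfl⟩, h1], h2, h0, ?_⟩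
    have ht := hG.dist_triangle (u := y) (v := z) (w := w)
    have d1 := hL.dist_eq hG hyw
    have d2 := hL.dist_eq hG h1
    have d3 := hL.dist_eq hG h2
    omega
  · rintro ⟨z, h1, h2, h0, hd⟩
    have d1 := hL.dist_eq hG hyw
    have d2 := hL.dist_eq hG (v := y) (w := z)
      (by rw [hL.modular.card_sdiff_comm ⟨y, rfl⟩ ⟨z, rfl⟩, h1])
    have d3 := hL.dist_eq hG h2
    by_contra he
    -- Only `e` vanishes in `z` but not in `y`. If `e` does not separate `y` from `w`, each element
    -- that does must be separated on the way to `z` or from `z`; then the distance from `y` to `w`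
    -- is less than the sum of the other two.
    have : sep (L y) (L w) ⊆ sep (L y) (L z) ∪ sep (L z) (L w) := by
      intro f hf
      rw [Finset.mem_union, mem_sep, mem_sep]
      have hf' := hf
      rw [mem_sep] at hf
      by_cases hz : L z f = 0
      · exfalso
        obtain ⟨j, hj⟩ := Finset.card_eq_one.1 h1
        have m1 : f ∈ (L z).zeros \ (L y).zeros := by simp [mem_zeros, hz, hf.1]
        have m2 : e ∈ (L z).zeros \ (L y).zeros := by simp [mem_zeros, h0, hy]
        rw [hj, Finset.mem_singleton] at m1 m2
        rw [m1, ← m2] at hf'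
        exact he hf'
      · revert hf hz
        generalize L y f = y
        generalize L z f = z
        generalize L w f = w
        revert y z w
        decide
    have := (Finset.card_le_card this).trans (Finset.card_union_le _ _)
    omega

end

end IsOMLabeling


/-! ## Parameters of cocircuit graphs, and recognition of labelings -/

open SignVec

namespace IsOMLabeling

variable {N : ℕ} {G : SimpleGraph (Fin N)} {n r : ℕ} {L : Fin N → SignVec n}

theorem card_fiber (hL : IsOMLabeling G n r L) {I : Finset (Fin n)} (hI : I.card + r = n + 1) :
    (Finset.univ.filter fun v => (L v).supp = I).card = 2 := by
  obtain ⟨X, Y, hne, rfl, hXY⟩ := hL.modular.pair I hI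
  have h1 : X ∈ {Z | Z ∈ Set.range L ∧ Z.supp = I} := by rw [hXY]; simp
  have h2 : -X ∈ {Z | Z ∈ Set.range L ∧ Z.supp = I} := by rw [hXY]; simp
  obtain ⟨⟨v, hv⟩, h1'⟩ := h1
  obtain ⟨⟨w, hw⟩, h2'⟩ := h2
  rw [Finset.card_eq_two]
  refine ⟨v, w, by rintro rfl; exact hne (hv.symm.trans hw), ?_⟩
  ext u
  simp only [Finset.mem_filter, Finset.mem_univ, true_and, Finset.mem_insert, Finset.mem_singleton]
  constructor
  · intro hu
    have h3 : L u ∈ ({X, -X} : Set (SignVec n)) := by rw [← hXY]; exact ⟨⟨u, rfl⟩, hu⟩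
    rcases h3 with h3 | h3
    · exact Or.inl (hL.injective (h3.trans hv.symm))
    · exact Or.inr (hL.injective (h3.trans hw.symm))
  · rintro (rfl | rfl)
    · rw [hv, h1']
    · rw [hw, h2']

theorem card_vertices (hL : IsOMLabeling G n r L) (hr : r ≤ n) :
    N = 2 * n.choose (n - r + 1) := by
  have h1 := Finset.card_eq_sum_card_fiberwise (f := fun v => (L v).supp)
    (s := (Finset.univ : Finset (Fin N))) (t := Finset.powersetCard (n - r + 1) Finset.univ) (by
      intro v _
      have := hL.modular.card_supp _ ⟨v, rfl⟩
      rw [Finset.mem_coe, Finset.mem_powersetCard]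
      refine ⟨Finset.subset_univ _, ?_⟩
      dsimp only
      omega)
  rw [Finset.sum_congr rfl (g := fun _ => 2) (fun I hI => hL.card_fiber (by
    rw [Finset.mem_powersetCard] at hI; omega))] at h1
  simp only [Finset.card_univ, Fintype.card_fin, Finset.sum_const, Finset.card_powersetCard,
    smul_eq_mul] at h1
  omega

/-- By `exists_near` and `near_unique`, the neighbours correspond to the pairs of a zero of `v` and
a sign. -/
theorem card_neighborSet (hL : IsOMLabeling G n r L) (v : Fin N) :
    (G.neighborSet v).ncard = 2 * (r - 1) := by
  have hv : L v ∈ Set.range L := ⟨v, rfl⟩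
  have hex : ∀ (a : Fin n) (s : SignType), L v a = 0 → s ≠ 0 → ∃ u, G.Adj v u ∧ L u a = s := by
    intro a s ha hs
    obtain ⟨_, ⟨u, rfl⟩, h1, h2⟩ := hL.modular.exists_near hv ha hs
    exact ⟨u, (hL.adj_iff _ _).2 h1, h2⟩
  have : Nonempty (Fin N) := ⟨v⟩
  choose! f hf hfs using hex
  have hcard : ((L v).zeros ×ˢ ({1, -1} : Finset SignType)).card = 2 * (r - 1) := by
    rw [Finset.card_product, Finset.card_pair (by decide)]
    have := hL.card_zeros v
    omega
  rw [← hcard, ← Set.ncard_coe_finset]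
  symm
  have hs : ∀ s ∈ ({1, -1} : Finset SignType), s ≠ 0 := by decide
  have hs' : ∀ s : SignType, s ≠ 0 → s ∈ ({1, -1} : Finset SignType) := by decide
  refine Set.ncard_congr (fun p _ => f p.1 p.2) ?_ ?_ ?_
  · rintro ⟨a, s⟩ h
    simp only [Finset.mem_coe, Finset.mem_product, mem_zeros] at h
    exact hf a s h.1 (hs s h.2)
  · rintro ⟨a, s⟩ ⟨a', s'⟩ h h' heq
    simp only [Finset.mem_coe, Finset.mem_product, mem_zeros] at h h' heq
    have e1 := hfs a s h.1 (hs s h.2)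
    have e2 := hfs a' s' h'.1 (hs s' h'.2)
    have haa : a = a' := by
      obtain ⟨i, b, g1, g2, g3, g4, g5⟩ :=
        ((hL.adj_iff _ _).1 (hf a s h.1 (hs s h.2))).exchange (hL.card_zeros_eq _ _)
      have key : ∀ x, L v x = 0 → L (f a s) x ≠ 0 → x = i := by
        intro x h1 h2
        by_contra hxi
        exact h2 ((g5 x hxi (by rintro rfl; exact g3 h1)).trans h1)
      rw [key a h.1 (by rw [e1]; exact hs s h.2),
        key a' h'.1 (by rw [heq, e2]; exact hs s' h'.2)]
    subst haa
    rw [heq, e2] at e1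
    rw [e1]
  · intro u hu
    have hu' : G.Adj v u := hu
    have hN := (hL.adj_iff _ _).1 hu'
    obtain ⟨i, b, g1, g2, -⟩ := hN.exchange (hL.card_zeros_eq _ _)
    refine ⟨(i, L u i), ?_, ?_⟩
    · simp only [Finset.mem_coe, Finset.mem_product, mem_zeros]
      exact ⟨g1, hs' _ g2⟩
    · symm
      exact hL.injective (hL.modular.near_unique hv ⟨u, rfl⟩ ⟨_, rfl⟩ hN
        ((hL.adj_iff _ _).1 (hf i _ g1 g2)) g1 g2 (hfs i _ g1 g2).symm)

theorem hasParameters (hL : IsOMLabeling G n r L) (v : Fin N) : HasParameters G n r :=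
  ⟨by have := hL.card_zeros v; omega, hL.le_size v, hL.card_neighborSet,
    hL.card_vertices (hL.le_size v)⟩

end IsOMLabeling

theorem IsCocircuitGraph.exists_isOMLabeling {V : Type} {G : SimpleGraph V}
    (h : IsCocircuitGraph G) : ∃ n r L, IsOMLabeling G n r L := by
  obtain ⟨n, r, C, hC, ⟨φ⟩⟩ := h
  refine ⟨n, r, fun v => (φ v).1, fun v w h => φ.injective (Subtype.ext h), ?_, ?_⟩
  · convert hC
    ext X
    constructor
    · rintro ⟨v, rfl⟩; exact (φ v).2
    · intro hX; exact ⟨φ.symm ⟨X, hX⟩, by simp⟩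
  · intro v w
    exact φ.map_adj_iff.symm

theorem IsOMLabeling.isCocircuitGraph {V : Type} {G : SimpleGraph V} {n r : ℕ} {L : V → SignVec n}
    (h : IsOMLabeling G n r L) : IsCocircuitGraph G :=
  ⟨n, r, Set.range L, h.isUniformOM, ⟨⟨Equiv.ofInjective L h.injective, by
    intro v w
    exact (h.adj_iff v w).symm⟩⟩⟩

/-- Along a walk that is as short as possible, every separated element vanishes at a vertex. -/
theorem exists_elim_of_walk {V : Type} {G : SimpleGraph V} {n r : ℕ} {L : V → SignVec n}
    (hz : ∀ v, (L v).zeros.card + 1 = r) (hadj : ∀ v w, G.Adj v w → Near (L v) (L w))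
    {v w : V} (p : G.Walk v w) (hp : p.length ≤ (gap (L v) (L w)).card) {e : Fin n}
    (he : e ∈ sep (L v) (L w)) :
    ∃ z, L z e = 0 ∧ ∀ f, L z f = L v f ∨ L z f = L w f ∨ L z f = 0 := by
  have hlen : ∀ {v w : V} (p : G.Walk v w), (gap (L v) (L w)).card ≤ p.length := by
    intro v w p
    induction p with
    | nil => simp [gap_self]
    | @cons u v w h p ih =>
      have := card_gap_le (Y := L w) (hadj _ _ h) (by have := hz u; have := hz v; omega)
      rw [SimpleGraph.Walk.length_cons]
      exact this.trans (by omega)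
  induction p with
  | @nil u =>
    rw [mem_sep] at he
    exfalso
    revert he
    generalize L u e = x
    revert x
    decide
  | @cons v u w h p ih =>
    rw [SimpleGraph.Walk.length_cons] at hp
    have hN := hadj _ _ h
    have hc : (L v).zeros.card = (L u).zeros.card := by have := hz u; have := hz v; omega
    have h1 := card_gap_le (Y := L w) hN hc
    have h2 := hlen p
    obtain ⟨a, b, g1, g2, g3, g4, g5⟩ := hN.exchange hc
    -- The walk has no more steps than the gap has elements, so each step shortens the gap; the
    -- coordinate that becomes nonzero already agrees with the end of the walk. Thus `u` has only
    -- values of the two ends or zero.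
    have hwa := eq_of_card_gap_lt hN hc (Y := L w) (by omega) g1 g2
    have hu : ∀ f, L u f = L v f ∨ L u f = L w f ∨ L u f = 0 := by
      intro f
      by_cases hfa : f = a
      · subst hfa; exact Or.inr (Or.inl hwa.symm)
      · by_cases hfb : f = b
        · subst hfb; exact Or.inr (Or.inr g4)
        · exact Or.inl (g5 f hfa hfb)
    by_cases heu : e ∈ sep (L u) (L w)
    · obtain ⟨z, hz0, hzf⟩ := ih (by omega) heu
      refine ⟨z, hz0, fun f => ?_⟩
      rcases hzf f with h3 | h3 | h3
      · rw [h3]; exact hu f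
      · exact Or.inr (Or.inl h3)
      · exact Or.inr (Or.inr h3)
    · refine ⟨u, ?_, hu⟩
      rw [mem_sep] at he heu
      have hea : e ≠ a := by rintro rfl; exact he.1 g1
      have h3 : L u e = L v e ∨ L u e = 0 := by
        by_cases hfb : e = b
        · subst hfb; exact Or.inr g4
        · exact Or.inl (g5 e hea hfb)
      revert h3 he heu
      generalize L u e = x
      generalize L v e = y
      generalize L w e = z
      revert x y z
      decide

/-- Recognition of labelings by conditions on pairs of vertices. -/
theorem IsOMLabeling.of_pairs {N : ℕ} {G : SimpleGraph (Fin N)} (hG : G.Connected) {n r : ℕ}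
    {L : Fin N → SignVec n} (hrn : r ≤ n) (hN : N = 2 * n.choose (n - r + 1))
    (hsupp : ∀ v, (L v).supp.card = n - r + 1) (hinj : Function.Injective L)
    (hpair : ∀ v w, (L v).zeros = (L w).zeros → L v = L w ∨ L v = -L w)
    (hadj : ∀ v w, G.Adj v w ↔ Near (L v) (L w))
    (hdist : ∀ v w, (symmDiff (L v).zeros (L w).zeros).card = 2 →
      G.dist v w ≤ (sep (L v) (L w)).card + 1) : IsOMLabeling G n r L := by
  have hz : ∀ v, (L v).zeros.card + 1 = r := by
    intro v
    have := card_zeros_add_card_supp (L v)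
    have := hsupp v
    omega
  have hfib : ∀ I : Finset (Fin n), (Finset.univ.filter fun v => (L v).supp = I).card ≤ 2 := by
    intro I
    by_contra hlt
    push Not at hlt
    obtain ⟨u, hu, v, hv, w, hw, huv, huw, hvw⟩ := Finset.two_lt_card.1 hlt
    simp only [Finset.mem_filter, Finset.mem_univ, true_and] at hu hv hw
    have hz' : ∀ {x y : Fin N}, (L x).supp = I → (L y).supp = I → (L x).zeros = (L y).zeros := by
      intro x y hx hy
      rw [supp_eq_compl] at hx hy
      exact compl_injective (hx.trans hy.symm)
    have h1 := (hpair v u (hz' hv hu)).resolve_left fun h => huv (hinj h.symm)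
    have h2 := (hpair w u (hz' hw hu)).resolve_left fun h => huw (hinj h.symm)
    exact hvw (hinj (h1.trans h2.symm))
  -- The number of vertices is twice the number of possible supports, and none is used more than
  -- twice, so all are used exactly twice.
  have hfib2 : ∀ I : Finset (Fin n), I.card = n - r + 1 →
      (Finset.univ.filter fun v => (L v).supp = I).card = 2 := by
    have h1 := Finset.card_eq_sum_card_fiberwise (f := fun v => (L v).supp)
      (s := (Finset.univ : Finset (Fin N))) (t := Finset.powersetCard (n - r + 1) Finset.univ) (by
        intro v _
        rw [Finset.mem_coe, Finset.mem_powersetCard]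
        exact ⟨Finset.subset_univ _, hsupp v⟩)
    intro I hI
    by_contra hne
    have h2 : ∑ b ∈ Finset.powersetCard (n - r + 1) (Finset.univ : Finset (Fin n)),
        (Finset.univ.filter fun v => (L v).supp = b).card <
        ∑ b ∈ Finset.powersetCard (n - r + 1) (Finset.univ : Finset (Fin n)), 2 := by
      refine Finset.sum_lt_sum (fun b _ => hfib b) ⟨I, ?_, lt_of_le_of_ne (hfib I) hne⟩
      rw [Finset.mem_powersetCard]
      exact ⟨Finset.subset_univ _, hI⟩
    simp only [Finset.sum_const, Finset.card_powersetCard, smul_eq_mul, Finset.card_univ,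
      Fintype.card_fin] at h1 h2
    omega
  have hmod : IsModularOM n r (Set.range L) := by
    refine ⟨?_, ?_, ?_⟩
    · rintro _ ⟨v, rfl⟩
      have := hsupp v
      omega
    · intro I hI
      obtain ⟨v, w, hvw, hset⟩ := Finset.card_eq_two.1 (hfib2 I (by omega))
      have hm := fun u => Finset.ext_iff.1 hset u
      simp only [Finset.mem_filter, Finset.mem_univ, true_and, Finset.mem_insert,
        Finset.mem_singleton] at hm
      have hv := (hm v).2 (Or.inl rfl)
      have hw := (hm w).2 (Or.inr rfl)
      have h1 : L v = -L w := (hpair v w (by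
        rw [supp_eq_compl] at hv hw
        exact compl_injective (hv.trans hw.symm))).resolve_left fun h => hvw (hinj h)
      refine ⟨L v, L w, fun h => hvw (hinj h), by rw [h1, neg_neg], ?_⟩
      ext Z
      simp only [Set.mem_ofPred_eq, Set.mem_insert_iff, Set.mem_singleton_iff]
      constructor
      · rintro ⟨⟨u, rfl⟩, hu⟩
        rcases (hm u).1 hu with rfl | rfl
        · exact Or.inl rfl
        · exact Or.inr rfl
      · rintro (rfl | rfl)
        · exact ⟨⟨v, rfl⟩, hv⟩
        · exact ⟨⟨w, rfl⟩, hw⟩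
    · rintro _ ⟨v, rfl⟩ _ ⟨w, rfl⟩ hvw e he
      have h1 := Finset.card_sdiff_add_card_inter (L v).zeros (L w).zeros
      have h2 := Finset.card_sdiff_add_card_inter (L w).zeros (L v).zeros
      rw [Finset.inter_comm] at h2
      have h3 := hz v
      have h4 := hz w
      have h5 : ((L w).zeros \ (L v).zeros).card = 1 := by omega
      have h6 := hdist v w (by
        rw [symmDiff_def, Finset.sup_eq_union,
          Finset.card_union_of_disjoint disjoint_sdiff_sdiff, h5, hvw])
      -- By `hdist` a shortest walk is no longer than the gap of its ends.
      obtain ⟨p, hp⟩ := hG.exists_walk_length_eq_dist v w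
      obtain ⟨z, hz0, hzf⟩ := exists_elim_of_walk hz (fun v w h => (hadj v w).1 h) p
        (by rw [card_gap, h5, hp]; exact h6) he
      exact ⟨L z, ⟨z, rfl⟩, hz0, fun f _ => hzf f⟩
  exact ⟨hinj, hmod.isUniformOM, hadj⟩

/-! ## Levels with respect to a set of elements -/

namespace IsOMLabeling

variable {V : Type} {G : SimpleGraph V} {n r : ℕ} {L : V → SignVec n} (hL : IsOMLabeling G n r L)
include hL

theorem sdiff_coline {y w : V} (h : ((L w).zeros \ (L y).zeros).card = 1) :
    ∃ a b, L w a = 0 ∧ L y a ≠ 0 ∧ L y b = 0 ∧ L w b ≠ 0 ∧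
      (L y).zeros = insert b ((L w).zeros.erase a) := by
  have h' := h
  rw [hL.modular.card_sdiff_comm ⟨w, rfl⟩ ⟨y, rfl⟩] at h'
  obtain ⟨a, ha⟩ := Finset.card_eq_one.1 h
  obtain ⟨b, hb⟩ := Finset.card_eq_one.1 h'
  have ha' := fun f => Finset.ext_iff.1 ha f
  have hb' := fun f => Finset.ext_iff.1 hb f
  simp only [Finset.mem_sdiff, mem_zeros, Finset.mem_singleton] at ha' hb'
  refine ⟨a, b, ((ha' a).2 rfl).1, ((ha' a).2 rfl).2, ((hb' b).2 rfl).1, ((hb' b).2 rfl).2, ?_⟩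
  ext f
  simp only [Finset.mem_insert, Finset.mem_erase, mem_zeros]
  have h1 := ha' f
  have h2 := hb' f
  have h3 := ((ha' a).2 rfl).2
  by_cases hfa : f = a
  · subst hfa; tauto
  · tauto

theorem level_le (B : Finset (Fin n)) {y w : V} (h : ((L w).zeros \ (L y).zeros).card = 1) :
    ((L y).zeros \ B).card ≤ ((L w).zeros \ B).card + 1 := by
  obtain ⟨a, b, -, -, -, -, h5⟩ := hL.sdiff_coline h
  refine (Finset.card_le_card (t := insert b ((L w).zeros \ B)) ?_).trans
    (Finset.card_insert_le _ _)
  intro f hf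
  rw [Finset.mem_sdiff, h5, Finset.mem_insert, Finset.mem_erase] at hf
  rw [Finset.mem_insert, Finset.mem_sdiff]
  tauto

/-- Exchange of an element outside `B` by an element of `B`. -/
theorem exists_lower {B : Finset (Fin n)} {y : V} {a b : Fin n} (ha : L y a ≠ 0) (haB : a ∈ B)
    (hb : L y b = 0) (hbB : b ∉ B) : ∃ w, ((L w).zeros \ (L y).zeros).card = 1 ∧
      ((L w).zeros \ B).card + 1 = ((L y).zeros \ B).card ∧
      (L w).zeros = insert a ((L y).zeros.erase b) := by
  obtain ⟨_, ⟨w, rfl⟩, hz, -⟩ := hL.modular.exists_exchange ⟨y, rfl⟩ hb ha (s := 1) (by decide)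
  refine ⟨w, ?_, ?_, hz⟩
  · rw [hL.modular.card_sdiff_comm ⟨w, rfl⟩ ⟨y, rfl⟩, IsModularOM.sdiff_exchange hb ha hz]
    simp
  · have : (L w).zeros \ B = ((L y).zeros \ B).erase b := by
      ext f
      simp only [hz, Finset.mem_sdiff, Finset.mem_insert, Finset.mem_erase, mem_zeros]
      constructor
      · rintro ⟨rfl | h1, h2⟩
        · exact absurd haB h2
        · exact ⟨h1.1, h1.2, h2⟩
      · tauto
    have hm : b ∈ (L y).zeros \ B := by simp [mem_zeros, hb, hbB]
    rw [this, Finset.card_erase_of_mem hm]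
    have := Finset.card_pos.2 ⟨b, hm⟩
    omega

/-- The level `((L y).zeros \ B).card` is also the number of elements of `B` on which `y` does not
vanish. A level of at least two leaves a choice that avoids `f`. -/
theorem exists_of_level {B : Finset (Fin n)} (hB : B.card + 1 = r) {k : ℕ} {y : V}
    (hk : k < ((L y).zeros \ B).card) (f : Fin n) (hk1 : f ∈ B → 1 ≤ k) :
    ∃ a ∈ B, L y a ≠ 0 ∧ a ≠ f := by
  have h1 : ((L y).zeros \ B).card = (B \ (L y).zeros).card := by
    have h1 := Finset.card_sdiff_add_card_inter (L y).zeros B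
    have h2 := Finset.card_sdiff_add_card_inter B (L y).zeros
    rw [Finset.inter_comm] at h2
    have := hL.card_zeros y
    omega
  obtain ⟨a, ha⟩ : ((B \ (L y).zeros).erase f).Nonempty := by
    rw [← Finset.card_pos]
    by_cases hf : f ∈ B \ (L y).zeros
    · rw [Finset.card_erase_of_mem hf]
      rw [Finset.mem_sdiff] at hf
      have := hk1 hf.1
      omega
    · rw [Finset.erase_eq_of_notMem hf]; omega
  rw [Finset.mem_erase, Finset.mem_sdiff, mem_zeros] at ha
  exact ⟨a, ha.2.1, ha.2.2, ha.1⟩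

omit hL in
theorem exists_of_level' {B : Finset (Fin n)} {k : ℕ} {y : V}
    (hk : k < ((L y).zeros \ B).card) (f : Fin n) (hk1 : f ∉ B → 1 ≤ k) :
    ∃ b, b ∉ B ∧ L y b = 0 ∧ b ≠ f := by
  obtain ⟨a, ha⟩ : (((L y).zeros \ B).erase f).Nonempty := by
    rw [← Finset.card_pos]
    by_cases hf : f ∈ (L y).zeros \ B
    · rw [Finset.card_erase_of_mem hf]
      rw [Finset.mem_sdiff] at hf
      have := hk1 hf.2
      omega
    · rw [Finset.erase_eq_of_notMem hf]; omega
  rw [Finset.mem_erase, Finset.mem_sdiff, mem_zeros] at ha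
  exact ⟨a, ha.2.2, ha.2.1, ha.1⟩

/-- A vertex of positive level has a neighbour on the previous level; moreover one that does not
vanish at a prescribed element outside `B` where the vertex does not vanish. -/
theorem exists_level_pred {B : Finset (Fin n)} (hB : B.card + 1 = r) {k : ℕ} {y : V}
    (hk : ((L y).zeros \ B).card = k + 1) : ∃ w, ((L w).zeros \ (L y).zeros).card = 1 ∧
      ((L w).zeros \ B).card = k ∧ ∀ f, f ∉ B → L y f ≠ 0 → L w f ≠ 0 := by
  obtain ⟨b, hb⟩ := Finset.card_pos.1 (show 0 < ((L y).zeros \ B).card by omega)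
  rw [Finset.mem_sdiff, mem_zeros] at hb
  obtain ⟨a, haB, ha, -⟩ := hL.exists_of_level hB (k := 0) (y := y) (by omega) b
    (fun h => absurd h hb.2)
  obtain ⟨w, h1, h2, h3⟩ := hL.exists_lower ha haB hb.1 hb.2
  refine ⟨w, h1, by omega, fun f hf hyf hwf => ?_⟩
  rw [← mem_zeros, h3, Finset.mem_insert, Finset.mem_erase, mem_zeros] at hwf
  rcases hwf with rfl | hwf
  · exact hf haB
  · exact hyf hwf.2

/-- Going down one level exchanges a zero outside `B` for an element of `B`, so zeros in `B`
persist. If `y` does not vanish at `f`, then on level two or higher another element of `B` can be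
brought in, and `f` stays nonzero. -/
theorem zero_iff_of_mem {B : Finset (Fin n)} (hB : B.card + 1 = r) {k : ℕ} {y : V}
    (hk : ((L y).zeros \ B).card = k + 2) {f : Fin n} (hf : f ∈ B) :
    L y f = 0 ↔ ∀ w, ((L w).zeros \ (L y).zeros).card = 1 → ((L w).zeros \ B).card = k + 1 →
      L w f = 0 := by
  constructor
  · intro hy w hw hwk
    obtain ⟨a, b, h1, h2, h3, h4, h5⟩ := hL.sdiff_coline hw
    by_contra hne
    have hfb : f = b := by
      rw [← mem_zeros, h5, Finset.mem_insert, Finset.mem_erase, mem_zeros] at hy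
      rcases hy with hy | hy
      · exact hy
      · exact absurd hy.2 hne
    subst hfb
    have : (L y).zeros \ B ⊆ (L w).zeros \ B := by
      intro g hg
      rw [Finset.mem_sdiff, h5, Finset.mem_insert, Finset.mem_erase] at hg
      rw [Finset.mem_sdiff]
      rcases hg with ⟨rfl | hg, hgB⟩
      · exact absurd hf hgB
      · exact ⟨hg.2, hgB⟩
    have := Finset.card_le_card this
    omega
  · intro h
    by_contra hy
    obtain ⟨a, haB, ha, haf⟩ := hL.exists_of_level hB (k := 1) (y := y) (by omega) f
      (fun _ => le_rfl)
    obtain ⟨b, hbB, hb, -⟩ := exists_of_level' (L := L) (B := B) (k := 1) (y := y) (by omega) f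
      (fun _ => le_rfl)
    obtain ⟨w, h1, h2, h3⟩ := hL.exists_lower ha haB hb hbB
    have := h w h1 (by omega)
    rw [← mem_zeros, h3, Finset.mem_insert, Finset.mem_erase, mem_zeros] at this
    rcases this with h4 | h4
    · exact haf h4.symm
    · exact hy h4.2

/-- Going down one level brings in no zero outside `B`. If `y` vanishes at `f`, then on level two or
higher another zero outside `B` can be given up instead of `f`. -/
theorem zero_iff_of_notMem {B : Finset (Fin n)} (hB : B.card + 1 = r) {k : ℕ} {y : V}
    (hk : ((L y).zeros \ B).card = k + 2) {f : Fin n} (hf : f ∉ B) :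
    L y f = 0 ↔ ∃ w, ((L w).zeros \ (L y).zeros).card = 1 ∧ ((L w).zeros \ B).card = k + 1 ∧
      L w f = 0 := by
  constructor
  · intro hy
    obtain ⟨a, haB, ha, -⟩ := hL.exists_of_level hB (k := 1) (y := y) (by omega) f
      (fun _ => le_rfl)
    obtain ⟨b, hbB, hb, hbf⟩ := exists_of_level' (L := L) (B := B) (k := 1) (y := y) (by omega) f
      (fun _ => le_rfl)
    obtain ⟨w, h1, h2, h3⟩ := hL.exists_lower ha haB hb hbB
    refine ⟨w, h1, by omega, ?_⟩
    rw [← mem_zeros, h3, Finset.mem_insert, Finset.mem_erase, mem_zeros]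
    exact Or.inr ⟨hbf.symm, hy⟩
  · rintro ⟨w, hw, hwk, hw0⟩
    obtain ⟨a, b, h1, h2, h3, h4, h5⟩ := hL.sdiff_coline hw
    rw [← mem_zeros, h5, Finset.mem_insert, Finset.mem_erase, mem_zeros]
    by_contra hne
    push Not at hne
    have hfa : f = a := by
      by_contra hfa
      exact hne.2 hfa hw0
    subst hfa
    have : insert f ((L y).zeros \ B) ⊆ insert b ((L w).zeros \ B) := by
      intro g hg
      rw [Finset.mem_insert, Finset.mem_sdiff, h5, Finset.mem_insert, Finset.mem_erase] at hg
      rw [Finset.mem_insert, Finset.mem_sdiff, mem_zeros]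
      rcases hg with rfl | ⟨hg | hg, hgB⟩
      · exact Or.inr ⟨h1, hf⟩
      · exact Or.inl hg
      · exact Or.inr ⟨mem_zeros.1 hg.2, hgB⟩
    have := (Finset.card_le_card this).trans (Finset.card_insert_le _ _)
    rw [Finset.card_insert_of_notMem (by simp [mem_zeros, h2])] at this
    omega

end IsOMLabeling


/-! ## Reasoning about programs of the loop language -/

namespace RAM

namespace Expr

/-- `a = b`, as a truth value. -/
def eqE (a b : Expr) : Expr := ite (add (sub a b) (sub b a)) (const 0) (const 1)

/-- `a < b`, as a truth value. -/
def ltE (a b : Expr) : Expr := sub b a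

/-- Conjunction. -/
def andE (a b : Expr) : Expr := ite a b (const 0)

/-- Disjunction. -/
def orE (a b : Expr) : Expr := ite a (const 1) b

/-- Negation. -/
def notE (a : Expr) : Expr := ite a (const 0) (const 1)

/-- Bounded existential quantification. -/
def exE (b : ℕ) (e : Expr) : Expr := agg true b e

variable (s : Store) (a b c : Expr) (d : ℕ) (ρ : ℕ → ℕ)

@[simp] theorem eval_const (k : ℕ) : eval s (const k) d ρ = k := rfl
@[simp] theorem eval_var (x : ℕ) : eval s (var x) d ρ = s.var x := rfl
@[simp] theorem eval_loc (i : ℕ) : eval s (loc i) d ρ = ρ i := rfl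
@[simp] theorem eval_arr (k : ℕ) : eval s (arr k a b) d ρ = s.get k (eval s a d ρ) (eval s b d ρ) :=
  rfl
@[simp] theorem eval_add : eval s (add a b) d ρ = eval s a d ρ + eval s b d ρ := rfl
@[simp] theorem eval_sub : eval s (sub a b) d ρ = eval s a d ρ - eval s b d ρ := rfl
@[simp] theorem eval_ite : eval s (ite c a b) d ρ =
    if eval s c d ρ ≠ 0 then eval s a d ρ else eval s b d ρ := rfl
@[simp] theorem eval_agg (op : Bool) (x : ℕ) : eval s (agg op x a) d ρ =
    aggr op (s.var x) fun i => eval s a (d + 1) (Function.update ρ d i) := rfl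

theorem truth_eqE : eval s (eqE a b) d ρ ≠ 0 ↔ eval s a d ρ = eval s b d ρ := by
  by_cases h : eval s a d ρ = eval s b d ρ
  · have h2 : eval s (add (sub a b) (sub b a)) d ρ = 0 := by simp [h]
    rw [eqE, eval_ite, if_neg (not_not.2 h2)]
    simp [h]
  · have h2 : eval s (add (sub a b) (sub b a)) d ρ ≠ 0 := by
      simp only [eval_add, eval_sub]; omega
    rw [eqE, eval_ite, if_pos h2]
    simp [h]

theorem truth_ltE : eval s (ltE a b) d ρ ≠ 0 ↔ eval s a d ρ < eval s b d ρ := by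
  simp only [ltE, eval_sub]
  omega

theorem truth_andE : eval s (andE a b) d ρ ≠ 0 ↔ eval s a d ρ ≠ 0 ∧ eval s b d ρ ≠ 0 := by
  simp only [andE, eval_ite, eval_const]
  split_ifs <;> tauto

theorem truth_orE : eval s (orE a b) d ρ ≠ 0 ↔ eval s a d ρ ≠ 0 ∨ eval s b d ρ ≠ 0 := by
  simp only [orE, eval_ite, eval_const]
  split_ifs <;> simp_all

theorem truth_notE : eval s (notE a) d ρ ≠ 0 ↔ ¬ eval s a d ρ ≠ 0 := by
  simp only [notE, eval_ite, eval_const]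
  split_ifs <;> simp_all

theorem truth_exE (x : ℕ) : eval s (exE x a) d ρ ≠ 0 ↔
    ∃ i < s.var x, eval s a (d + 1) (Function.update ρ d i) ≠ 0 := by
  simp [exE, aggr, Finset.sum_eq_zero_iff]

/-- The expression does not read the matrix `k`. -/
def noArr (k : ℕ) : Expr → Bool
  | const _ => true
  | var _ => true
  | loc _ => true
  | arr k' i j => decide (k' ≠ k) && noArr k i && noArr k j
  | add a b => noArr k a && noArr k b
  | sub a b => noArr k a && noArr k b
  | ite c a b => noArr k c && noArr k a && noArr k b
  | agg _ _ e => noArr k e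

theorem eval_congr {s t : Store} (hv : s.var = t.var) {k : ℕ}
    (ha : ∀ k', k' ≠ k → s.arr k' = t.arr k') (e : Expr) (he : e.noArr k = true) :
    ∀ d ρ, eval s e d ρ = eval t e d ρ := by
  induction e with
  | const => intros; rfl
  | var x => intros; simp [hv]
  | loc => intros; rfl
  | arr k' i j ihi ihj =>
    simp only [noArr, Bool.and_eq_true, decide_eq_true_eq] at he
    intro d ρ
    simp only [eval_arr, ihi he.1.2, ihj he.2, Store.get, ha _ he.1.1, hv]
  | add a b iha ihb =>
    simp only [noArr, Bool.and_eq_true] at he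
    intro d ρ
    simp only [eval_add, iha he.1, ihb he.2]
  | sub a b iha ihb =>
    simp only [noArr, Bool.and_eq_true] at he
    intro d ρ
    simp only [eval_sub, iha he.1, ihb he.2]
  | ite c a b ihc iha ihb =>
    simp only [noArr, Bool.and_eq_true] at he
    intro d ρ
    simp only [eval_ite, ihc he.1.1, iha he.1.2, ihb he.2]
  | agg op b e ih =>
    simp only [noArr] at he
    intro d ρ
    simp only [eval_agg, ih he, hv]

end Expr

/-- Picking an index by a maximum. -/
theorem aggr_max_pick (n : ℕ) (P : ℕ → Prop) [DecidablePred P] (g : ℕ → ℕ) :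
    ((aggr false n fun i => if P i then g i + 1 else 0) = 0 ∧ ∀ i < n, ¬ P i) ∨
      ∃ i < n, P i ∧ (aggr false n fun i => if P i then g i + 1 else 0) = g i + 1 := by
  induction n with
  | zero => left; simp [aggr_zero]
  | succ n ih =>
    rw [aggr_succ]
    simp only [aggrStep, Bool.false_eq_true, if_false]
    rcases ih with ⟨h1, h2⟩ | ⟨i, hi, h1, h2⟩
    · rw [h1]
      by_cases hP : P n
      · right
        exact ⟨n, by omega, hP, by simp [hP]⟩
      · left
        refine ⟨by simp [hP], fun i hi => ?_⟩
        rcases Nat.lt_succ_iff_lt_or_eq.1 hi with h | rfl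
        · exact h2 i h
        · exact hP
    · right
      rw [h2]
      by_cases hP : P n ∧ g i < g n
      · exact ⟨n, by omega, hP.1, by rw [if_pos hP.1]; omega⟩
      · refine ⟨i, by omega, h1, ?_⟩
        split_ifs with hn
        · have : ¬ g i < g n := fun h => hP ⟨hn, h⟩
          omega
        · omega

theorem aggr_sum_eq_card (n : ℕ) (P : ℕ → Prop) [DecidablePred P] :
    (aggr true n fun i => if P i then 1 else 0) = ((Finset.range n).filter P).card := by
  simp only [aggr, if_true, Finset.card_filter]

theorem Store.get_eq {s : Store} {N : ℕ} (h : s.var 0 = N) (k : ℕ) {i j : ℕ} (hi : i < N)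
    (hj : j < N) : s.get k i j = s.arr k i j := by
  simp only [Store.get, h]
  rw [min_eq_left (by omega), min_eq_left (by omega)]

@[simp] theorem Store.setv_arr (s : Store) (x v : ℕ) : (s.setv x v).arr = s.arr := rfl

theorem Store.setv_var (s : Store) (x v y : ℕ) :
    (s.setv x v).var y = if y = x then v else s.var y := by
  simp [Store.setv, Function.update_apply]

theorem Store.put_arr {s : Store} {N : ℕ} (h : s.var 0 = N) (k : ℕ) {i j : ℕ} (hi : i < N)
    (hj : j < N) (v k' i' j' : ℕ) : (s.put k i j v).arr k' i' j' =
      if k' = k ∧ i' = i ∧ j' = j then v else s.arr k' i' j' := by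
  simp only [Store.put, h]
  rw [min_eq_left (by omega), min_eq_left (by omega)]

namespace Cmd

/-- The induction principle for loops. -/
theorem rep_induction {x b : ℕ} {p : Cmd} {s : Store} (I : ℕ → Store → Prop)
    (hset : ∀ i t v, I i t → I i (t.setv x v)) (h0 : I 0 s)
    (hstep : ∀ i < s.var b, ∀ t, (∀ y, y ≠ x → y ∉ p.wv → t.var y = s.var y) →
      (∀ k, k ∉ p.wa → t.arr k = s.arr k) → t.var x = i → I i t → I (i + 1) (p.den t)) :
    I (s.var b) ((rep x b p).den s) := by
  have key : ∀ i ≤ s.var b, I i (iter p.den x s i) ∧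
      (∀ y, y ≠ x → y ∉ p.wv → (iter p.den x s i).var y = s.var y) ∧
      (∀ k, k ∉ p.wa → (iter p.den x s i).arr k = s.arr k) := by
    intro i
    induction i with
    | zero => intro _; exact ⟨h0, fun _ _ _ => rfl, fun _ _ => rfl⟩
    | succ i ih =>
      intro hi
      obtain ⟨h1, h2, h3⟩ := ih (by omega)
      have h4 : ∀ y, y ≠ x → y ∉ p.wv → ((iter p.den x s i).setv x i).var y = s.var y := by
        intro y hy hyp
        rw [Store.setv_var, if_neg hy, h2 y hy hyp]
      refine ⟨hstep i (by omega) _ h4 h3 (by simp [Store.setv_var]) (hset _ _ _ h1), ?_, ?_⟩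
      · intro y hy hyp
        simp only [iter]
        rw [den_var _ _ hyp, h4 y hy hyp]
      · intro k hk
        simp only [iter]
        rw [den_arr _ _ hk]
        exact h3 k hk
  exact hset _ _ _ (key _ le_rfl).1

/-- Assignment to all entries of a rectangle. The loop variables are `20` and `21`. -/
def fill (k bx b : ℕ) (e : Expr) : Cmd :=
  rep 20 bx (rep 21 b (put k (Expr.var 20) (Expr.var 21) e))

/-- As `e` does not read the matrix that is being filled, each entry may be evaluated in the initial
store with only the two loop variables changed. -/
theorem den_fill {k bx b : ℕ} {e : Expr} {s : Store} {N : ℕ} (hN : s.var 0 = N)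
    (hx : s.var bx ≤ N) (hb : s.var b ≤ N) (hb20 : b ≠ 20) (hb21 : b ≠ 21)
    (he : e.noArr k = true) {i j : ℕ} (hi : i < s.var bx) (hj : j < s.var b) :
    ((fill k bx b e).den s).arr k i j =
      e.eval ((s.setv 20 i).setv 21 j) 0 fun _ => 0 := by
  refine rep_induction (x := 20) (b := bx)
    (p := rep 21 b (put k (Expr.var 20) (Expr.var 21) e)) (s := s)
    (fun i t => ∀ i' < i, ∀ j < s.var b,
      t.arr k i' j = e.eval ((s.setv 20 i').setv 21 j) 0 fun _ => 0) (fun _ _ _ h => h)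
    (by simp) ?_ i hi j hj
  intro i hi t hv ha hti hI
  simp only [wv, wa, List.mem_cons, List.not_mem_nil, or_false] at hv ha
  have htb : t.var b = s.var b := hv b hb20 hb21
  have := rep_induction (x := 21) (b := b) (p := put k (Expr.var 20) (Expr.var 21) e) (s := t)
    (fun j t' => (∀ i' j', (i' = i → j' ≥ j) → t'.arr k i' j' = t.arr k i' j') ∧
      ∀ j' < j, t'.arr k i j' = e.eval ((s.setv 20 i).setv 21 j') 0 fun _ => 0)
    (fun _ _ _ h => h) (by simp) ?_
  · rw [htb] at this
    intro i' hi' j hj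
    rcases Nat.lt_succ_iff_lt_or_eq.1 hi' with h | rfl
    · rw [this.1 i' j (by omega)]
      exact hI i' h j hj
    · exact this.2 j hj
  · rintro j hj t' hv' ha' htj' ⟨h1, h2⟩
    simp only [wv, wa, List.mem_cons, List.not_mem_nil, or_false, not_false_eq_true] at hv' ha'
    have h0 : t'.var 0 = N := by
      rw [hv' 0 (by omega) trivial, hv 0 (by omega) (by omega), hN]
    have h20 : t'.var 20 = i := by rw [hv' 20 (by omega) trivial, hti]
    have hval : e.eval t' 0 (fun _ => 0) =
        e.eval ((s.setv 20 i).setv 21 j) 0 fun _ => 0 := by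
      refine Expr.eval_congr (funext fun y => ?_) (k := k) (fun k' hk' => ?_) e he _ _
      · rw [Store.setv_var, Store.setv_var]
        split_ifs with h3 h4
        · rw [h3, htj']
        · rw [h4, h20]
        · rw [hv' y h3 trivial, hv y h4 h3]
      · rw [ha' k' hk', ha k' hk']; rfl
    simp only [den, Expr.eval_var, hval, h20, htj']
    constructor
    · intro i' j' hij
      rw [Store.put_arr h0 k (by omega) (by omega), if_neg (by omega)]
      exact h1 i' j' (by omega)
    · intro j' hj'
      rw [Store.put_arr h0 k (by omega) (by omega)]
      rcases Nat.lt_succ_iff_lt_or_eq.1 hj' with h | rfl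
      · rw [if_neg (by omega)]; exact h2 j' h
      · simp

/-- Collection of the indices with a given property into a column of a matrix. The variable `22`
counts, and the column is given by the variable `20`. -/
def collect (k : ℕ) (c : Expr) : Cmd :=
  seq (set 22 (Expr.const 0)) (rep 21 0 (ite c
    (seq (put k (Expr.var 22) (Expr.var 20) (Expr.var 21))
      (set 22 (Expr.add (Expr.var 22) (Expr.const 1)))) skip))

/-- The condition is evaluated in the middle of the loop, when the two counters and the matrix `k`
have already changed; hence the quantification over stores in `hP`. The indices are recorded in
increasing order, which later yields injectivity. -/
theorem den_collect {k : ℕ} {c : Expr} {s : Store} {N : ℕ} (hN : s.var 0 = N)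
    (hcol : s.var 20 < N) (P : ℕ → Prop) [DecidablePred P]
    (hP : ∀ w < N, ∀ t : Store, (∀ y, y ≠ 21 → y ≠ 22 → t.var y = s.var y) → t.var 21 = w →
      (∀ k', k' ≠ k → t.arr k' = s.arr k') → (c.eval t 0 (fun _ => 0) ≠ 0 ↔ P w)) :
    ((collect k c).den s).var 22 = ((Finset.range N).filter P).card ∧
    (∀ j < ((Finset.range N).filter P).card, ((collect k c).den s).arr k j (s.var 20) < N ∧
      P (((collect k c).den s).arr k j (s.var 20))) ∧
    (∀ j j', j < j' → j' < ((Finset.range N).filter P).card →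
      ((collect k c).den s).arr k j (s.var 20) < ((collect k c).den s).arr k j' (s.var 20)) ∧
    (∀ w < N, P w → ∃ j < ((Finset.range N).filter P).card,
      ((collect k c).den s).arr k j (s.var 20) = w) ∧
    (∀ i j, j ≠ s.var 20 → ((collect k c).den s).arr k i j = s.arr k i j) := by
  set s' := s.setv 22 0 with hs'
  have hN' : s'.var 0 = N := by simp [hs', Store.setv_var, hN]
  have hden : (collect k c).den s = (rep 21 0 (ite c
    (seq (put k (Expr.var 22) (Expr.var 20) (Expr.var 21))
      (set 22 (Expr.add (Expr.var 22) (Expr.const 1)))) skip)).den s' := by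
    simp [collect, den, hs']
  have := rep_induction (x := 21) (b := 0) (p := ite c
    (seq (put k (Expr.var 22) (Expr.var 20) (Expr.var 21))
      (set 22 (Expr.add (Expr.var 22) (Expr.const 1)))) skip) (s := s')
    (fun w t => t.var 22 = ((Finset.range w).filter P).card ∧
      (∀ j < ((Finset.range w).filter P).card, t.arr k j (s.var 20) < w ∧
        P (t.arr k j (s.var 20))) ∧
      (∀ j j', j < j' → j' < ((Finset.range w).filter P).card →
        t.arr k j (s.var 20) < t.arr k j' (s.var 20)) ∧
      (∀ w' < w, P w' → ∃ j < ((Finset.range w).filter P).card, t.arr k j (s.var 20) = w') ∧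
      (∀ i j, j ≠ s.var 20 → t.arr k i j = s.arr k i j)) ?_ ?_ ?_
  · rw [hden]
    rw [hN'] at this
    exact this
  · rintro i t v ⟨h1, h2⟩
    exact ⟨by simp [Store.setv_var, h1], h2⟩
  · exact ⟨by simp [hs', Store.setv_var], by simp, by simp, by simp, fun _ _ _ => rfl⟩
  · rintro w hw t hv ha htw ⟨h1, h2, h3, h4, h5⟩
    rw [hN'] at hw
    simp only [wv, wa, List.mem_append, List.mem_cons, List.not_mem_nil, or_false,
      false_or] at hv ha
    have hv' : ∀ y, y ≠ 21 → y ≠ 22 → t.var y = s.var y := by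
      intro y hy hy'
      rw [hv y hy hy', hs', Store.setv_var, if_neg hy']
    have hc := hP w hw t hv' htw (fun k' hk' => ha k' hk')
    have ht0 : t.var 0 = N := (hv' 0 (by omega) (by omega)).trans hN
    have ht20 : t.var 20 = s.var 20 := hv' 20 (by omega) (by omega)
    have hcard : ((Finset.range w).filter P).card ≤ w :=
      (Finset.card_filter_le _ _).trans (by simp)
    rw [Finset.range_add_one, Finset.filter_insert]
    by_cases hPw : P w
    · rw [if_pos hPw, Finset.card_insert_of_notMem (by simp)]
      simp only [den, if_pos (hc.2 hPw), Expr.eval_add, Expr.eval_var, Expr.eval_const, h1, ht20,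
        htw, Store.setv_arr]
      have hput : ∀ i j, (t.put k ((Finset.range w).filter P).card (s.var 20) w).arr k i j =
          if i = ((Finset.range w).filter P).card ∧ j = s.var 20 then w else t.arr k i j := by
        intro i j
        rw [Store.put_arr ht0 k (by omega) hcol]
        simp
      refine ⟨?_, ?_, ?_, ?_, ?_⟩
      · rw [Store.setv_var, if_pos rfl]; simp [Store.put, h1]
      · intro j hj
        rw [hput]
        rcases Nat.lt_succ_iff_lt_or_eq.1 hj with h | rfl
        · rw [if_neg (by omega)]
          exact ⟨by have := (h2 j h).1; omega, (h2 j h).2⟩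
        · simp [hPw]
      · intro j j' hjj hj'
        rw [hput, hput, if_neg (by omega)]
        rcases Nat.lt_succ_iff_lt_or_eq.1 hj' with h | rfl
        · rw [if_neg (by omega)]; exact h3 j j' hjj h
        · simp only [and_self, if_true]; exact (h2 j hjj).1
      · intro w' hw' hPw'
        rcases Nat.lt_succ_iff_lt_or_eq.1 hw' with h | rfl
        · obtain ⟨j, hj, hjw⟩ := h4 w' h hPw'
          exact ⟨j, by omega, by rw [hput, if_neg (by omega), hjw]⟩
        · exact ⟨_, Nat.lt_succ_self _, by rw [hput]; simp⟩
      · intro i j hj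
        rw [hput, if_neg (by omega), h5 i j hj]
    · rw [if_neg hPw]
      simp only [den, if_neg (mt hc.1 hPw)]
      refine ⟨h1, fun j hj => ⟨by have := (h2 j hj).1; omega, (h2 j hj).2⟩, h3, ?_, h5⟩
      intro w' hw' hPw'
      rcases Nat.lt_succ_iff_lt_or_eq.1 hw' with h | rfl
      · exact h4 w' h hPw'
      · exact absurd hPw' hPw

end Cmd

/-! ### Running times -/

namespace Expr

/-- The variables that bound the aggregates of an expression. -/
def bv : Expr → List ℕ
  | const _ => []
  | var _ => []
  | loc _ => []
  | arr _ i j => bv i ++ bv j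
  | add a b => bv a ++ bv b
  | sub a b => bv a ++ bv b
  | ite c a b => bv c ++ bv a ++ bv b
  | agg _ b e => b :: bv e

/-- The weight of an expression, a bound for the cost of each evaluation of a part of it. -/
def wt : Expr → ℕ
  | const _ => 40
  | var _ => 40
  | loc _ => 40
  | arr _ i j => wt i + wt j + 40
  | add a b => wt a + wt b + 40
  | sub a b => wt a + wt b + 40
  | ite c a b => wt c + wt a + wt b + 40
  | agg _ _ e => wt e + 40

/-- All parts of the expression are evaluated at most `g` times, if the expression is evaluated
`acc` times. -/
def Fits (β : ℕ → ℕ) (g : ℕ) : Expr → ℕ → Prop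
  | const _, acc => acc ≤ g
  | var _, acc => acc ≤ g
  | loc _, acc => acc ≤ g
  | arr _ i j, acc => Fits β g i acc ∧ Fits β g j acc
  | add a b, acc => Fits β g a acc ∧ Fits β g b acc
  | sub a b, acc => Fits β g a acc ∧ Fits β g b acc
  | ite c a b, acc => Fits β g c acc ∧ Fits β g a acc ∧ Fits β g b acc
  | agg _ b e, acc => Fits β g e (acc * (β b + 1))

theorem Fits.le {β : ℕ → ℕ} {g : ℕ} {e : Expr} : ∀ {acc : ℕ}, Fits β g e acc → acc ≤ g := by
  induction e with
  | const | var | loc => intro acc h; exact h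
  | arr k i j ihi ihj => intro acc h; exact ihi h.1
  | add a b iha ihb => intro acc h; exact iha h.1
  | sub a b iha ihb => intro acc h; exact iha h.1
  | ite c a b ihc iha ihb => intro acc h; exact ihc h.1
  | agg op b e ih => intro acc h; have := ih h; nlinarith

/-- Each part contributes its own constant at most `g` times. The multiplicity `acc` is carried
through the induction because a nested aggregate multiplies it. -/
theorem Fits.ec_le {β : ℕ → ℕ} {g : ℕ} {e : Expr} : ∀ {acc : ℕ}, Fits β g e acc →
    acc * e.ec β ≤ e.wt * g := by
  induction e with
  | const | var | loc => intro acc h; simp only [ec, wt]; simp only [Fits] at h; omega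
  | arr k i j ihi ihj =>
    intro acc h
    have h1 := ihi h.1
    have h2 := ihj h.2
    have h3 := h.1.le
    simp only [ec, wt]
    nlinarith
  | add a b ihi ihj =>
    intro acc h
    have h1 := ihi h.1
    have h2 := ihj h.2
    have h3 := h.1.le
    simp only [ec, wt]
    nlinarith
  | sub a b ihi ihj =>
    intro acc h
    have h1 := ihi h.1
    have h2 := ihj h.2
    have h3 := h.1.le
    simp only [ec, wt]
    nlinarith
  | ite c a b ihc iha ihb =>
    intro acc h
    have h0 := ihc h.1
    have h1 := iha h.2.1
    have h2 := ihb h.2.2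
    have h3 := h.1.le
    simp only [ec, wt]
    nlinarith
  | agg op b e ih =>
    intro acc h
    have h1 := ih h
    have h2 : acc * (β b + 1) ≤ g := Fits.le (e := e) h
    simp only [ec, wt]
    nlinarith

/-- The lists of the bounds of nested aggregates. -/
def nests : Expr → List (List ℕ)
  | const _ => [[]]
  | var _ => [[]]
  | loc _ => [[]]
  | arr _ i j => nests i ∪ nests j
  | add a b => nests a ∪ nests b
  | sub a b => nests a ∪ nests b
  | ite c a b => nests c ∪ (nests a ∪ nests b)
  | agg _ b e => (nests e).map (b :: ·)

theorem fits_of_nests {β : ℕ → ℕ} {g : ℕ} {e : Expr} : ∀ {acc : ℕ},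
    (∀ l ∈ e.nests, acc * (l.map fun b => β b + 1).prod ≤ g) → Fits β g e acc := by
  induction e with
  | const | var | loc => intro acc h; simpa [Fits, nests] using h
  | arr k i j ihi ihj =>
    intro acc h
    simp only [nests, List.mem_union_iff] at h
    exact ⟨ihi fun l hl => h l (Or.inl hl), ihj fun l hl => h l (Or.inr hl)⟩
  | add i j ihi ihj =>
    intro acc h
    simp only [nests, List.mem_union_iff] at h
    exact ⟨ihi fun l hl => h l (Or.inl hl), ihj fun l hl => h l (Or.inr hl)⟩
  | sub i j ihi ihj =>
    intro acc h
    simp only [nests, List.mem_union_iff] at h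
    exact ⟨ihi fun l hl => h l (Or.inl hl), ihj fun l hl => h l (Or.inr hl)⟩
  | ite c i j ihc ihi ihj =>
    intro acc h
    simp only [nests, List.mem_union_iff] at h
    exact ⟨ihc fun l hl => h l (Or.inl hl), ihi fun l hl => h l (Or.inr (Or.inl hl)),
      ihj fun l hl => h l (Or.inr (Or.inr hl))⟩
  | agg op b e ih =>
    intro acc h
    refine ih fun l hl => ?_
    have := h (b :: l) (by simpa [nests] using hl)
    simpa [mul_assoc] using this

theorem ec_congr {β β' : ℕ → ℕ} {e : Expr} (h : ∀ b ∈ e.bv, β b = β' b) : e.ec β = e.ec β' := by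
  induction e with
  | const | var | loc => rfl
  | arr k i j ihi ihj =>
    simp only [bv, List.mem_append] at h
    simp only [ec, ihi fun b hb => h b (Or.inl hb), ihj fun b hb => h b (Or.inr hb)]
  | add i j ihi ihj =>
    simp only [bv, List.mem_append] at h
    simp only [ec, ihi fun b hb => h b (Or.inl hb), ihj fun b hb => h b (Or.inr hb)]
  | sub i j ihi ihj =>
    simp only [bv, List.mem_append] at h
    simp only [ec, ihi fun b hb => h b (Or.inl hb), ihj fun b hb => h b (Or.inr hb)]
  | ite c i j ihc ihi ihj =>
    simp only [bv, List.mem_append] at h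
    simp only [ec, ihc fun b hb => h b (Or.inl (Or.inl hb)),
      ihi fun b hb => h b (Or.inl (Or.inr hb)), ihj fun b hb => h b (Or.inr hb)]
  | agg op b e ih =>
    simp only [bv, List.mem_cons] at h
    simp only [ec, ih fun b hb => h b (Or.inr hb), h b (Or.inl rfl)]

end Expr

namespace Cmd

/-- The variables that bound the loops of a program. -/
def bv : Cmd → List ℕ
  | skip => []
  | set _ e => e.bv
  | put _ i j e => i.bv ++ j.bv ++ e.bv
  | emit i e => i.bv ++ e.bv
  | seq p q => bv p ++ bv q
  | ite c p q => c.bv ++ bv p ++ bv q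
  | rep _ b p => b :: bv p

/-- A bound for the running time that depends only on the bounds of the loops. -/
def sc (β : ℕ → ℕ) : Cmd → ℕ
  | skip => 1
  | set _ e => e.ec β + 40
  | put _ i j e => i.ec β + j.ec β + e.ec β + 40
  | emit i e => i.ec β + e.ec β + 40
  | seq p q => sc β p + sc β q
  | ite c p q => c.ec β + 40 + (sc β p + sc β q)
  | rep _ b p => (β b + 1) * (sc β p + 40)

/-- The weight of a program, a bound for the cost of each execution of a part of it. -/
def wt : Cmd → ℕ
  | skip => 1
  | set _ e => e.wt + 40
  | put _ i j e => i.wt + j.wt + e.wt + 40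
  | emit i e => i.wt + e.wt + 40
  | seq p q => wt p + wt q
  | ite c p q => c.wt + 40 + (wt p + wt q)
  | rep _ _ p => wt p + 40

/-- All parts of the program are executed at most `g` times, if the program is executed `acc`
times. -/
def Fits (β : ℕ → ℕ) (g : ℕ) : Cmd → ℕ → Prop
  | skip, acc => acc ≤ g
  | set _ e, acc => e.Fits β g acc
  | put _ i j e, acc => i.Fits β g acc ∧ j.Fits β g acc ∧ e.Fits β g acc
  | emit i e, acc => i.Fits β g acc ∧ e.Fits β g acc
  | seq p q, acc => Fits β g p acc ∧ Fits β g q acc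
  | ite c p q, acc => c.Fits β g acc ∧ Fits β g p acc ∧ Fits β g q acc
  | rep _ b p, acc => Fits β g p (acc * (β b + 1))

theorem Fits.le {β : ℕ → ℕ} {g : ℕ} {p : Cmd} : ∀ {acc : ℕ}, Fits β g p acc → acc ≤ g := by
  induction p with
  | skip => intro acc h; exact h
  | set x e => intro acc h; exact Expr.Fits.le (e := e) h
  | put k i j e => intro acc h; exact h.1.le
  | emit i e => intro acc h; exact h.1.le
  | seq p q ihp ihq => intro acc h; exact ihp h.1
  | ite c p q ihp ihq => intro acc h; exact h.1.le
  | rep x b p ih => intro acc h; have := ih h; nlinarith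

theorem Fits.sc_le {β : ℕ → ℕ} {g : ℕ} {p : Cmd} : ∀ {acc : ℕ}, Fits β g p acc →
    acc * p.sc β ≤ p.wt * g := by
  induction p with
  | skip => intro acc h; simp only [sc, wt]; simp only [Fits] at h; omega
  | set x e =>
    intro acc h
    have h1 := Expr.Fits.ec_le (e := e) h
    have h2 := Expr.Fits.le (e := e) h
    simp only [sc, wt]
    nlinarith
  | put k i j e =>
    intro acc h
    have h1 := h.1.ec_le
    have h2 := h.2.1.ec_le
    have h3 := h.2.2.ec_le
    have h4 := h.1.le
    simp only [sc, wt]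
    nlinarith
  | emit i e =>
    intro acc h
    have h1 := h.1.ec_le
    have h2 := h.2.ec_le
    have h4 := h.1.le
    simp only [sc, wt]
    nlinarith
  | seq p q ihp ihq =>
    intro acc h
    have h1 := ihp h.1
    have h2 := ihq h.2
    simp only [sc, wt]
    nlinarith
  | ite c p q ihp ihq =>
    intro acc h
    have h1 := ihp h.2.1
    have h2 := ihq h.2.2
    have h3 := h.1.ec_le
    have h4 := h.1.le
    simp only [sc, wt]
    nlinarith
  | rep x b p ih =>
    intro acc h
    have h1 := ih h
    have h2 : acc * (β b + 1) ≤ g := Fits.le (p := p) h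
    simp only [sc, wt]
    nlinarith

/-- The lists of the bounds of nested loops and aggregates. -/
def nests : Cmd → List (List ℕ)
  | skip => [[]]
  | set _ e => e.nests
  | put _ i j e => i.nests ∪ (j.nests ∪ e.nests)
  | emit i e => i.nests ∪ e.nests
  | seq p q => nests p ∪ nests q
  | ite c p q => c.nests ∪ (nests p ∪ nests q)
  | rep _ b p => (nests p).map (b :: ·)

theorem fits_of_nests {β : ℕ → ℕ} {g : ℕ} {p : Cmd} : ∀ {acc : ℕ},
    (∀ l ∈ p.nests, acc * (l.map fun b => β b + 1).prod ≤ g) → Fits β g p acc := by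
  induction p with
  | skip => intro acc h; simpa [Fits, nests] using h
  | set x e => intro acc h; exact Expr.fits_of_nests (e := e) h
  | put k i j e =>
    intro acc h
    simp only [nests, List.mem_union_iff] at h
    exact ⟨Expr.fits_of_nests fun l hl => h l (Or.inl hl),
      Expr.fits_of_nests fun l hl => h l (Or.inr (Or.inl hl)),
      Expr.fits_of_nests fun l hl => h l (Or.inr (Or.inr hl))⟩
  | emit i e =>
    intro acc h
    simp only [nests, List.mem_union_iff] at h
    exact ⟨Expr.fits_of_nests fun l hl => h l (Or.inl hl),
      Expr.fits_of_nests fun l hl => h l (Or.inr hl)⟩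
  | seq p q ihp ihq =>
    intro acc h
    simp only [nests, List.mem_union_iff] at h
    exact ⟨ihp fun l hl => h l (Or.inl hl), ihq fun l hl => h l (Or.inr hl)⟩
  | ite c p q ihp ihq =>
    intro acc h
    simp only [nests, List.mem_union_iff] at h
    exact ⟨Expr.fits_of_nests fun l hl => h l (Or.inl hl), ihp fun l hl => h l (Or.inr (Or.inl hl)),
      ihq fun l hl => h l (Or.inr (Or.inr hl))⟩
  | rep x b p ih =>
    intro acc h
    refine ih fun l hl => ?_
    have := h (b :: l) (by simpa [nests] using hl)
    simpa [mul_assoc] using this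

theorem sc_congr {β β' : ℕ → ℕ} {p : Cmd} (h : ∀ b ∈ p.bv, β b = β' b) : p.sc β = p.sc β' := by
  induction p with
  | skip => rfl
  | set x e => simp only [sc, Expr.ec_congr h]
  | put k i j e =>
    simp only [bv, List.mem_append] at h
    simp only [sc, Expr.ec_congr (e := i) fun b hb => h b (Or.inl (Or.inl hb)),
      Expr.ec_congr (e := j) fun b hb => h b (Or.inl (Or.inr hb)),
      Expr.ec_congr (e := e) fun b hb => h b (Or.inr hb)]
  | emit i e =>
    simp only [bv, List.mem_append] at h
    simp only [sc, Expr.ec_congr (e := i) fun b hb => h b (Or.inl hb),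
      Expr.ec_congr (e := e) fun b hb => h b (Or.inr hb)]
  | seq p q ihp ihq =>
    simp only [bv, List.mem_append] at h
    simp only [sc, ihp fun b hb => h b (Or.inl hb), ihq fun b hb => h b (Or.inr hb)]
  | ite c p q ihp ihq =>
    simp only [bv, List.mem_append] at h
    simp only [sc, Expr.ec_congr (e := c) fun b hb => h b (Or.inl (Or.inl hb)),
      ihp fun b hb => h b (Or.inl (Or.inr hb)), ihq fun b hb => h b (Or.inr hb)]
  | rep x b p ih =>
    simp only [bv, List.mem_cons] at h
    simp only [sc, ih fun b hb => h b (Or.inr hb), h b (Or.inl rfl)]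

/-- A program that assigns to none of its loop bounds has all of them fixed by the initial store, so
every round of a loop has the same static bound. -/
theorem cost_le_sc {p : Cmd} : ∀ {s : Store}, (∀ x ∈ p.wv, x ∉ p.bv) →
    p.cost s ≤ p.sc s.var := by
  induction p with
  | skip | set | put | emit => intro s _; exact le_rfl
  | seq p q ihp ihq =>
    intro s h
    simp only [wv, bv, List.mem_append, not_or] at h
    simp only [cost, sc]
    have h1 := ihp (s := s) fun x hx => (h x (Or.inl hx)).1
    have h2 := ihq (s := p.den s) fun x hx => (h x (Or.inr hx)).2
    rw [sc_congr (β' := s.var) fun b hb =>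
      den_var p s fun hbp => (h b (Or.inl hbp)).2 hb] at h2
    omega
  | ite c p q ihp ihq =>
    intro s h
    simp only [wv, bv, List.mem_append, not_or] at h
    simp only [cost, sc]
    have h1 := ihp (s := s) fun x hx => (h x (Or.inl hx)).1.2
    have h2 := ihq (s := s) fun x hx => (h x (Or.inr hx)).2
    split_ifs <;> omega
  | rep x b p ih =>
    intro s h
    simp only [wv, bv, List.mem_cons, not_or] at h
    have key : ∀ i y, y ≠ x → y ∉ p.wv → (iter p.den x s i).var y = s.var y := by
      intro i
      induction i with
      | zero => intro _ _ _; rfl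
      | succ i ihi =>
        intro y hy hyp
        simp only [iter]
        rw [den_var _ _ hyp, Store.setv_var, if_neg hy, ihi y hy hyp]
    have h1 : ∀ i ∈ Finset.range (s.var b), p.cost ((iter p.den x s i).setv x i) + 40 ≤
        p.sc s.var + 40 := by
      intro i _
      have h2 := ih (s := (iter p.den x s i).setv x i) fun y hy => (h y (Or.inr hy)).2
      rw [sc_congr (β' := s.var)] at h2
      · omega
      · intro y hy
        have hyx : y ≠ x := by rintro rfl; exact (h y (Or.inl rfl)).2 hy
        rw [Store.setv_var, if_neg hyx]
        exact key i y hyx fun hyp => (h y (Or.inr hyp)).2 hy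
    have h2 := Finset.sum_le_sum h1
    simp only [Finset.sum_const, Finset.card_range, smul_eq_mul] at h2
    simp only [cost, sc]
    nlinarith

/-- All factors are at least one, so loops missing from a nest only make the product smaller. -/
theorem prod_le_of_subperm {β : ℕ → ℕ} {l l' : List ℕ} (h : l.Subperm l') :
    (l.map fun b => β b + 1).prod ≤ (l'.map fun b => β b + 1).prod := by
  obtain ⟨l'', h1, h2⟩ := h
  rw [← (h1.map _).prod_eq]
  refine Nat.le_of_dvd (List.prod_pos fun x hx => ?_) (h2.map _).prod_dvd_prod
  obtain ⟨b, -, rfl⟩ := List.mem_map.1 hx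
  omega

/-- This separates the combinatorics of a program from arithmetic: a closed computation compares all
nests of loops with a few templates `T`, and only the products of these templates remain to be
bounded. -/
theorem cost_le {p : Cmd} {s : Store} (h : ∀ x ∈ p.wv, x ∉ p.bv) (T : List (List ℕ))
    (hT : ∀ l ∈ p.nests, ∃ t ∈ T, l.Subperm t) {g : ℕ}
    (hg : ∀ t ∈ T, (t.map fun b => s.var b + 1).prod ≤ g) : p.cost s ≤ p.wt * g := by
  have h1 := cost_le_sc (s := s) h
  have h2 := Fits.sc_le (β := s.var) (g := g) (p := p) (acc := 1) (fits_of_nests fun l hl => by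
    obtain ⟨t, ht, hlt⟩ := hT l hl
    rw [one_mul]
    exact (prod_le_of_subperm hlt).trans (hg t ht))
  omega

end Cmd

/-! ### Preparation of the memory -/

/-- The program that computes the addresses of the matrices. -/
def bases : ℕ → Prog
  | 0 => Prog.skip
  | k + 1 => Prog.seq (bases k)
      (Prog.assign (4 * (k + 1) + 1) (Term.add (Term.reg (4 * k + 1)) (Term.reg 5)))

/-- The program that prepares the memory for compiled programs. -/
def prologue : Prog :=
  Prog.seq (Prog.loop (Term.sub (Term.reg 0) (Term.reg 2))
      (Prog.seq (Prog.assign 5 (Term.add (Term.reg 5) (Term.reg 0)))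
        (Prog.assign 2 (Term.add (Term.reg 2) (Term.const 1)))))
    (Prog.seq (Prog.assign 2 (Term.const 0))
      (Prog.seq (Prog.loop (Term.sub (Term.reg 0) (Term.reg 2))
        (Prog.seq (Prog.store (Term.add (Term.reg 5) (Term.reg 2)) (Term.reg 3))
          (Prog.seq (Prog.assign 3 (Term.add (Term.reg 3) (Term.reg 0)))
            (Prog.assign 2 (Term.add (Term.reg 2) (Term.const 1))))))
        (bases numArr)))

theorem runs_bases {σ : State} (h1 : σ.reg 1 = 0) (k : ℕ) : Runs (bases k) σ (4 * k + 1) fun τ =>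
    τ.mem = σ.mem ∧ (∀ x, (∀ k, x ≠ 4 * k + 1) → τ.reg x = σ.reg x) ∧ τ.reg 5 = σ.reg 5 ∧
      ∀ i ≤ k, τ.reg (4 * i + 1) = i * σ.reg 5 := by
  induction k with
  | zero =>
    refine ⟨_, _, Exec.skip σ, by omega, rfl, fun _ _ => rfl, rfl, fun i hi => ?_⟩
    obtain rfl : i = 0 := by omega
    simpa using h1
  | succ k ih =>
    refine (ih.seq (T' := 4) fun τ hτ => Runs.assign (by simp [Term.cost]) ?_).mono (by omega)
      fun _ h => h
    obtain ⟨g1, g2, g3, g4⟩ := hτ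
    have hval : (Term.add (Term.reg (4 * k + 1)) (Term.reg 5)).eval τ = (k + 1) * σ.reg 5 := by
      simp only [Term.eval, g4 k le_rfl, g3]
      ring
    rw [hval]
    refine ⟨g1, fun x hx => ?_, ?_, fun i hi => ?_⟩
    · change Function.update _ _ _ _ = _
      rw [Function.update_of_ne (hx _), g2 x hx]
    · change Function.update _ _ _ _ = _
      -- Register `5` is the increment and also the base address of matrix `1`; the assignment for
      -- `k = 0` writes back the value that it already has.
      by_cases hk : k = 0
      · subst hk; simp
      · rw [Function.update_of_ne (by omega), g3]
    · change Function.update _ _ _ _ = _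
      by_cases hik : i = k + 1
      · subst hik; simp
      · rw [Function.update_of_ne (by omega), g4 i (by omega)]

-- In the absence of multiplication, `N * N` and the offsets `i * N` of the rows are obtained by `N`
-- additions each. The input already lies where matrix `0` is expected.
open Classical in
theorem runs_prologue {N : ℕ} (hN : 0 < N) (G : SimpleGraph (Fin N)) :
    Runs prologue (input G) (30 * N + 200) fun σ => ∃ s : Store, Rel s σ ∧ s.var 0 = N ∧
      ∀ i j : Fin N, s.arr 0 i j = if G.Adj i j then 1 else 0 := by
  have hl1 : Runs (Prog.loop (Term.sub (Term.reg 0) (Term.reg 2))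
      (Prog.seq (Prog.assign 5 (Term.add (Term.reg 5) (Term.reg 0)))
        (Prog.assign 2 (Term.add (Term.reg 2) (Term.const 1))))) (input G) _ _ :=
    Runs.loop (n := N) (fun _ => 8) (fun i τ => τ.mem = (input G).mem ∧ τ.reg 0 = N ∧
      τ.reg 1 = 0 ∧ τ.reg 2 = i ∧ τ.reg 3 = 0 ∧ τ.reg 5 = i * N)
      (fun i τ h => by simp [Term.eval, h])
      (fun i τ hi h => by
        obtain ⟨g1, g2, g3, g4, g5, g6⟩ := h
        refine Runs.seq (T := 4) (T' := 4) (Q := fun υ => υ.mem = (input G).mem ∧ υ.reg 0 = N ∧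
          υ.reg 1 = 0 ∧ υ.reg 2 = i ∧ υ.reg 3 = 0 ∧ υ.reg 5 = (i + 1) * N)
          (Runs.assign (by simp [Term.cost]) ?_) fun υ h => Runs.assign (by simp [Term.cost]) ?_
        · simp [Term.eval, g1, g2, g3, g4, g5, g6]; ring
        · obtain ⟨g1, g2, g3, g4, g5, g6⟩ := h
          simp [Term.eval, g1, g2, g3, g4, g5, g6])
      (by simp [input])
  have hl2 : ∀ σ : State, (σ.mem = (input G).mem ∧ σ.reg 0 = N ∧
      σ.reg 1 = 0 ∧ σ.reg 2 = 0 ∧ σ.reg 3 = 0 ∧ σ.reg 5 = N * N) →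
      Runs (Prog.loop (Term.sub (Term.reg 0) (Term.reg 2))
        (Prog.seq (Prog.store (Term.add (Term.reg 5) (Term.reg 2)) (Term.reg 3))
          (Prog.seq (Prog.assign 3 (Term.add (Term.reg 3) (Term.reg 0)))
            (Prog.assign 2 (Term.add (Term.reg 2) (Term.const 1)))))) σ _ _ := fun σ hσ =>
    Runs.loop (n := N) (fun _ => 13) (fun i τ => (∀ q < N * N, τ.mem q = (input G).mem q) ∧
      (∀ j < i, τ.mem (N * N + j) = j * N) ∧ τ.reg 0 = N ∧
      τ.reg 1 = 0 ∧ τ.reg 2 = i ∧ τ.reg 3 = i * N ∧ τ.reg 5 = N * N)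
      (fun i τ h => by simp [Term.eval, h])
      (fun i τ hi h => by
        obtain ⟨g1, g1', g2, g3, g4, g5, g6⟩ := h
        refine Runs.seq (T := 5) (T' := 8) (Q := fun υ => (∀ q < N * N, υ.mem q = (input G).mem q) ∧
          (∀ j < i + 1, υ.mem (N * N + j) = j * N) ∧ υ.reg 0 = N ∧
          υ.reg 1 = 0 ∧ υ.reg 2 = i ∧ υ.reg 3 = i * N ∧ υ.reg 5 = N * N)
          (Runs.store (by simp [Term.cost]) ?_) fun υ h => Runs.seq (T := 4) (T' := 4)
          (Q := fun υ => (∀ q < N * N, υ.mem q = (input G).mem q) ∧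
          (∀ j < i + 1, υ.mem (N * N + j) = j * N) ∧ υ.reg 0 = N ∧
          υ.reg 1 = 0 ∧ υ.reg 2 = i ∧ υ.reg 3 = (i + 1) * N ∧ υ.reg 5 = N * N)
          (Runs.assign (by simp [Term.cost]) ?_) fun υ h =>
          Runs.assign (by simp [Term.cost]) ?_
        · refine ⟨fun q hq => ?_, fun j hj => ?_, g2, g3, g4, g5, g6⟩
          · simp only [Term.eval, g6, g4]
            rw [Function.update_of_ne (by omega), g1 q hq]
          · simp only [Term.eval, g6, g4, g5]
            by_cases hji : j = i
            · subst hji; simp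
            · rw [Function.update_of_ne (by omega), g1' j (by omega)]
        · obtain ⟨g1, g1', g2, g3, g4, g5, g6⟩ := h
          refine ⟨g1, g1', ?_⟩
          simp [Term.eval, g2, g3, g4, g5, g6]; ring
        · obtain ⟨g1, g1', g2, g3, g4, g5, g6⟩ := h
          refine ⟨g1, g1', ?_⟩
          simp [Term.eval, g2, g3, g4, g5, g6])
      (by obtain ⟨g1, g2, g3, g4, g5, g6⟩ := hσ; simp [g1, g2, g3, g4, g5, g6])
  refine (hl1.seq fun σ h => Runs.seq (T := 2) (Q := fun σ => σ.mem = (input G).mem ∧ σ.reg 0 = N ∧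
      σ.reg 1 = 0 ∧ σ.reg 2 = 0 ∧ σ.reg 3 = 0 ∧ σ.reg 5 = N * N) (Runs.assign ?_ ?_) fun τ hτ =>
      (hl2 τ hτ).seq fun υ hυ => (runs_bases hυ.2.2.2.1 numArr).mono le_rfl fun w hw => ?_).mono ?_
      fun _ h => h
  · simp [Term.cost]
  · obtain ⟨g1, g2, g3, g4, g5, g6⟩ := h
    simp [Term.eval, g1, g2, g3, g5, g6]
  · obtain ⟨g1, g1', g2, g3, g4, g5, g6⟩ := hυ
    obtain ⟨k1, k2, k3, k4⟩ := hw
    have h0 : w.reg 0 = N := by rw [k2 0 (by omega), g2]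
    -- The store is read off from the machine, whatever the other matrices contain; only the base
    -- addresses and the table of rows require an argument.
    refine ⟨⟨fun x => w.reg (4 * x), fun k i j => w.mem (k * (N * N) + (i * N + j)),
      fun i => w.mem (numArr * (N * N) + i)⟩, ⟨?_, fun x => rfl, ?_, ?_, ?_, ?_⟩, ?_, ?_⟩
    · simpa [h0] using hN
    · intro k hk
      simp only [Nat.mul_zero, h0]
      rw [k4 k hk, g6]
    · simp only [Nat.mul_zero, h0]
      intros; trivial
    · simp only [Nat.mul_zero, h0]
      intro i hi
      rw [k1, g1' i hi]
    · simp only [Nat.mul_zero, h0]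
      intros; trivial
    · simpa using h0
    · intro i j
      have hlt : (i : ℕ) * N + j < N * N := by
        have := i.2; have := j.2; nlinarith
      simp only [Nat.zero_mul, Nat.zero_add, k1]
      rw [g1 _ hlt]
      simp only [input]
      congr 1
      apply propext
      constructor
      · rintro ⟨i', j', h1, h2⟩
        obtain ⟨-, h3, h4⟩ := addr_inj (k := 0) (k' := 0) i.2 j.2 i'.2 j'.2 (by simpa using h1)
        rw [Fin.ext h3, Fin.ext h4]
        exact h2
      · intro h
        exact ⟨i, j, rfl, h⟩
  · simp [Term.cost, numArr]
    omega

end RAM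


/-! ## Recognition of the elements around a vertex -/

open SignVec

/-- The zero-supports of two vertices differ by the exchange of one element. -/
def Exchange {V : Type} {n : ℕ} (L : V → SignVec n) (v w : V) : Prop :=
  ((L v).zeros \ (L w).zeros).card = 1

theorem Exchange.unique {V : Type} {n : ℕ} {L : V → SignVec n} {v w : V} (h : Exchange L v w)
    {i j : Fin n} (hi : L v i = 0) (hi' : L w i ≠ 0) (hj : L v j = 0) (hj' : L w j ≠ 0) : i = j :=
  Finset.card_le_one.1 (le_of_eq h) i (by simp [mem_zeros, hi, hi']) j (by simp [mem_zeros, hj, hj'])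

/-- The vertex `y` lies behind the neighbour `u` of `v`. -/
def Behind {V : Type} (G : SimpleGraph V) {n : ℕ} (L : V → SignVec n) (v u y : V) : Prop :=
  Exchange L v y ∧ G.dist v y = 1 + G.dist u y

/-- The neighbour `u` of `v` is the first one in its line. -/
def IsFirst {N : ℕ} (G : SimpleGraph (Fin N)) {n : ℕ} (L : Fin N → SignVec n) (a : Fin N → Fin N)
    (v u : Fin N) : Prop :=
  G.Adj v u ∧ ∀ u' < u, G.Adj v u' → ¬ Behind G L v u (a u')

namespace IsOMLabeling

variable {N : ℕ} {G : SimpleGraph (Fin N)} {n r : ℕ} {L : Fin N → SignVec n}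
  (hL : IsOMLabeling G n r L) (hG : G.Connected) {a : Fin N → Fin N} (ha : ∀ v, L (a v) = -L v)

section
include hL

theorem exchange_comm {v w : Fin N} : Exchange L v w ↔ Exchange L w v := by
  unfold Exchange
  rw [hL.modular.card_sdiff_comm ⟨v, rfl⟩ ⟨w, rfl⟩]

theorem exchange_zeros {v w : Fin N} (h : Exchange L v w) : ∃ i b, L v i = 0 ∧ L w i ≠ 0 ∧
    L w b = 0 ∧ L v b ≠ 0 ∧ ∀ f, L w f = 0 ↔ f = b ∨ (f ≠ i ∧ L v f = 0) := by
  obtain ⟨i, b, h1, h2, h3, h4, h5⟩ := hL.sdiff_coline h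
  refine ⟨i, b, h1, h2, h3, h4, fun f => ?_⟩
  rw [← mem_zeros, h5, Finset.mem_insert, Finset.mem_erase, mem_zeros]

theorem exchange_of_adj {v u : Fin N} (h : G.Adj v u) : Exchange L v u := by
  have h1 := (hL.adj_iff v u).1 h
  obtain ⟨i, b, h2, h3, h4, h5, h6⟩ := h1.exchange (hL.card_zeros_eq v u)
  unfold Exchange
  rw [Finset.card_eq_one]
  refine ⟨i, ?_⟩
  ext f
  simp only [Finset.mem_sdiff, mem_zeros, Finset.mem_singleton]
  constructor
  · rintro ⟨h7, h8⟩
    by_contra hf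
    have hfb : f ≠ b := by rintro rfl; exact h4 h7
    exact h8 ((h6 f hf hfb).trans h7)
  · rintro rfl
    exact ⟨h2, h3⟩

/-- This limits the number of rounds in all passes over levels. -/
theorem card_sdiff_le {B : Finset (Fin n)} (hB : B.card + 1 = r) (y : Fin N) :
    ((L y).zeros \ B).card ≤ min (r - 1) (n - r + 1) := by
  have h1 := Finset.card_le_card (Finset.sdiff_subset (s := (L y).zeros) (t := B))
  have h2 := hL.card_zeros y
  have h3 : ((L y).zeros \ B).card ≤ (Bᶜ).card := by
    apply Finset.card_le_card
    intro f hf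
    rw [Finset.mem_sdiff] at hf
    simpa using hf.2
  have h4 := Finset.card_add_card_compl B
  rw [Fintype.card_fin] at h4
  have h5 := hL.le_size y
  omega

include hG ha

/-- The two neighbours of `v` on one line have opposite signs at the zero that they lose, so the
antipode of one lies behind the other. Lines can thus be recognized from distances and antipodes. -/
theorem behind_anti_iff {v u u' : Fin N} (hu : G.Adj v u) (hu' : G.Adj v u') {i : Fin n}
    (hi : L v i = 0) (hui : L u i ≠ 0) : Behind G L v u (a u') ↔ L u' i = -L u i := by
  have h1 : Exchange L v (a u') := by
    have := hL.exchange_of_adj hu'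
    unfold Exchange at this ⊢
    rwa [ha, zeros_neg]
  unfold Behind
  rw [hL.follows_iff hG hu h1 hi hui, ha, Pi.neg_apply, neg_eq_iff_eq_neg]
  exact and_iff_right h1

/-- Of the two neighbours on the line, the one with the smaller index qualifies. -/
theorem exists_isFirst {v : Fin N} {i : Fin n} (hi : L v i = 0) :
    ∃ u, IsFirst G L a v u ∧ L u i ≠ 0 := by
  obtain ⟨_, ⟨u, rfl⟩, h1, h2⟩ := hL.modular.exists_near ⟨v, rfl⟩ hi (s := 1) (by decide)
  obtain ⟨_, ⟨w, rfl⟩, h3, h4⟩ := hL.modular.exists_near ⟨v, rfl⟩ hi (s := -1) (by decide)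
  have hu0 : L u i ≠ 0 := by rw [h2]; decide
  have hw0 : L w i ≠ 0 := by rw [h4]; decide
  have hu := (hL.adj_iff v u).2 h1
  have hw := (hL.adj_iff v w).2 h3
  rcases lt_or_ge w u with h | h
  · refine ⟨w, ⟨hw, fun u' hu' hu'' hb => ?_⟩, hw0⟩
    rw [hL.behind_anti_iff hG ha hw hu'' hi hw0, h4, neg_neg] at hb
    have := hL.modular.near_unique ⟨v, rfl⟩ ⟨u, rfl⟩ ⟨u', rfl⟩ h1 ((hL.adj_iff _ _).1 hu'') hi hu0
      (h2.trans hb.symm)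
    rw [hL.injective this] at h
    exact absurd hu' h.not_gt
  · refine ⟨u, ⟨hu, fun u' hu' hu'' hb => ?_⟩, hu0⟩
    rw [hL.behind_anti_iff hG ha hu hu'' hi hu0, h2] at hb
    have := hL.modular.near_unique ⟨v, rfl⟩ ⟨w, rfl⟩ ⟨u', rfl⟩ h3 ((hL.adj_iff _ _).1 hu'') hi hw0
      (h4.trans hb.symm)
    rw [hL.injective this] at h
    exact absurd hu' h.not_gt

theorem isFirst_unique {v u u' : Fin N} (hu : IsFirst G L a v u) (hu' : IsFirst G L a v u')
    {i : Fin n} (hi : L v i = 0) (hui : L u i ≠ 0) (hui' : L u' i ≠ 0) : u = u' := by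
  by_cases h : L u i = L u' i
  · exact hL.injective (hL.modular.near_unique ⟨v, rfl⟩ ⟨u, rfl⟩ ⟨u', rfl⟩ ((hL.adj_iff _ _).1 hu.1)
      ((hL.adj_iff _ _).1 hu'.1) hi hui h)
  · have h' : L u' i = -L u i := by
      revert hui hui' h
      generalize L u i = x
      generalize L u' i = y
      revert x y
      decide
    exfalso
    rcases lt_trichotomy u u' with hlt | rfl | hlt
    · exact hu'.2 u hlt hu.1 ((hL.behind_anti_iff hG ha hu'.1 hu.1 hi hui').2 (by rw [h', neg_neg]))
    · exact h rfl
    · exact hu.2 u' hlt hu'.1 ((hL.behind_anti_iff hG ha hu.1 hu'.1 hi hui).2 h')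

theorem le_card_isFirst (v : Fin N) [DecidablePred (IsFirst G L a v)] :
    r - 1 ≤ (Finset.univ.filter (IsFirst G L a v)).card := by
  have h1 := hL.card_zeros v
  have h2 : ∀ i : Fin n, ∃ u, i ∈ (L v).zeros → IsFirst G L a v u ∧ L u i ≠ 0 := by
    intro i
    by_cases hi : i ∈ (L v).zeros
    · obtain ⟨u, hu⟩ := hL.exists_isFirst hG ha (mem_zeros.1 hi)
      exact ⟨u, fun _ => hu⟩
    · exact ⟨v, fun h => absurd h hi⟩
  choose f hf using h2
  have h3 : (L v).zeros.card ≤ (Finset.univ.filter (IsFirst G L a v)).card := by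
    refine Finset.card_le_card_of_injOn f (fun i hi => by simpa using (hf i hi).1) ?_
    intro i hi j hj hij
    have hi' := hf i hi
    have hj' := hf j hj
    rw [← hij] at hj'
    exact Exchange.unique (hL.exchange_of_adj hi'.1.1) (mem_zeros.1 hi) hi'.2 (mem_zeros.1 hj)
      hj'.2
  omega

omit ha in
theorem behind_iff {v u y : Fin N} (hu : G.Adj v u) {i : Fin n} (hi : L v i = 0) (hui : L u i ≠ 0) :
    Behind G L v u y ↔ Exchange L v y ∧ L y i = L u i :=
  and_congr_right fun h => hL.follows_iff hG hu h hi hui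

-- A vertex behind `u` lies on the coline of `v` and `u`, on the side of `u`. Each element of the
-- support of `v` is brought in by exactly one such vertex, so these vertices can name the support;
-- see also `behind_unique`.
omit ha in
theorem exists_behind {v u : Fin N} (hu : G.Adj v u) {b : Fin n} (hb : L v b ≠ 0) :
    ∃ y, Behind G L v u y ∧ L y b = 0 := by
  obtain ⟨i, -, hi, hui, -⟩ := hL.exchange_zeros (hL.exchange_of_adj hu)
  obtain ⟨_, ⟨y, rfl⟩, h1, h2⟩ := hL.modular.exists_exchange ⟨v, rfl⟩ hi hb hui
  have h3 : Exchange L v y := by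
    unfold Exchange
    rw [IsModularOM.sdiff_exchange hi hb h1]
    simp
  refine ⟨y, (hL.behind_iff hG hu hi hui).2 ⟨h3, h2⟩, ?_⟩
  rw [← mem_zeros, h1]
  simp

omit ha in
theorem le_card_behind {v u : Fin N} [DecidablePred (Behind G L v u)] (hu : G.Adj v u) :
    n - r + 1 ≤ (Finset.univ.filter (Behind G L v u)).card := by
  have h1 := hL.card_zeros v
  have hs := hL.le_size v
  have h0 := card_zeros_add_card_supp (L v)
  have h2 : ∀ b : Fin n, ∃ y, b ∈ (L v).supp → Behind G L v u y ∧ L y b = 0 := by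
    intro b
    by_cases hb : b ∈ (L v).supp
    · obtain ⟨y, hy⟩ := hL.exists_behind hG hu (mem_supp.1 hb)
      exact ⟨y, fun _ => hy⟩
    · exact ⟨v, fun h => absurd h hb⟩
  choose f hf using h2
  have h3 : (L v).supp.card ≤ (Finset.univ.filter (Behind G L v u)).card := by
    refine Finset.card_le_card_of_injOn f (fun i hi => by simpa using (hf i hi).1) ?_
    intro b hb c hc hbc
    have hb' := hf b hb
    have hc' := hf c hc
    rw [← hbc] at hc'
    exact Exchange.unique (hL.exchange_comm.1 hb'.1.1) hb'.2 (mem_supp.1 hb) hc'.2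
      (mem_supp.1 hc)
  omega

omit ha in
theorem behind_unique {v u y y' : Fin N} (hu : G.Adj v u) (hy : Behind G L v u y)
    (hy' : Behind G L v u y') {b : Fin n} (hb : L v b ≠ 0) (hyb : L y b = 0) (hyb' : L y' b = 0) :
    y = y' := by
  obtain ⟨i, -, hi, hui, -⟩ := hL.exchange_zeros (hL.exchange_of_adj hu)
  rw [hL.behind_iff hG hu hi hui] at hy hy'
  obtain ⟨j, c, h1, h2, h3, h4, h5⟩ := hL.exchange_zeros hy.1
  obtain ⟨j', c', h1', h2', h3', h4', h5'⟩ := hL.exchange_zeros hy'.1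
  obtain rfl : i = j := Exchange.unique hy.1 hi (by rw [hy.2]; exact hui) h1 h2
  obtain rfl : i = j' := Exchange.unique hy'.1 hi (by rw [hy'.2]; exact hui) h1' h2'
  obtain rfl : b = c := by rcases (h5 b).1 hyb with h | h; exacts [h, absurd h.2 hb]
  obtain rfl : b = c' := by rcases (h5' b).1 hyb' with h | h; exacts [h, absurd h.2 hb]
  refine hL.injective (hL.modular.eq_of_zeros_eq ⟨y, rfl⟩ ⟨y', rfl⟩ ?_ (e := i) ?_ ?_)
  · ext f
    rw [mem_zeros, mem_zeros, h5, h5']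
  · rw [hy.2]; exact hui
  · rw [hy.2, hy'.2]

omit hL hG in
theorem exchange_anti_right {v y : Fin N} : Exchange L v (a y) ↔ Exchange L v y := by
  unfold Exchange
  rw [ha, zeros_neg]

/-- An exchange at `v` makes `i` nonzero exactly if it takes place on the line of `u`, and then
either the result or its antipode is on the side of `u`. -/
theorem zero_iff_not_behind {v u y : Fin N} (hu : G.Adj v u) (hy : Exchange L v y) {i : Fin n}
    (hi : L v i = 0) (hui : L u i ≠ 0) :
    L y i = 0 ↔ ¬ Behind G L v u y ∧ ¬ Behind G L v u (a y) := by
  rw [hL.behind_iff hG hu hi hui, hL.behind_iff hG hu hi hui, exchange_anti_right ha, ha,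
    Pi.neg_apply, and_iff_right hy, and_iff_right hy]
  revert hui
  generalize L u i = x
  generalize L y i = z
  revert x z
  decide

/-- If `y` lies on the line of `u` and vanishes at `b`, it has the zero set of `p`. On another line,
both `y` and `p` are exchanges at `v` that lose different zeros, and they differ by a single
exchange exactly if they bring in the same element. -/
theorem zero_iff_behind {v u p y : Fin N} (hu : G.Adj v u) (hp : Behind G L v u p)
    (hy : Exchange L v y) {b : Fin n} (hb : L v b ≠ 0) (hpb : L p b = 0) :
    L y b = 0 ↔ y = p ∨ a y = p ∨ (Exchange L y p ∧ ¬ Behind G L v u y ∧ ¬ Behind G L v u (a y)) := by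
  obtain ⟨i, -, hi, hui, -⟩ := hL.exchange_zeros (hL.exchange_of_adj hu)
  rw [← hL.zero_iff_not_behind hG ha hu hy hi hui]
  rw [hL.behind_iff hG hu hi hui] at hp
  have hpi : L p i ≠ 0 := by rw [hp.2]; exact hui
  obtain ⟨j, c, h1, h2, h3, h4, h5⟩ := hL.exchange_zeros hy
  obtain ⟨j', c', h1', h2', h3', h4', h5'⟩ := hL.exchange_zeros hp.1
  obtain rfl : i = j' := Exchange.unique hp.1 hi hpi h1' h2'
  obtain rfl : b = c' := by rcases (h5' b).1 hpb with h | h; exacts [h, absurd h.2 hb]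
  constructor
  · intro hyb
    obtain rfl : b = c := by rcases (h5 b).1 hyb with h | h; exacts [h, absurd h.2 hb]
    by_cases hij : i = j
    · subst hij
      have hz : (L y).zeros = (L p).zeros := by ext f; rw [mem_zeros, mem_zeros, h5, h5']
      rcases hL.eq_or_eq_anti ha hz with h | h
      · exact Or.inl h
      · right; left; rw [h, hL.anti_anti ha]
    · right; right
      have hyi : L y i = 0 := (h5 i).2 (Or.inr ⟨hij, hi⟩)
      refine ⟨?_, hyi⟩
      unfold Exchange
      rw [Finset.card_eq_one]
      refine ⟨i, ?_⟩
      ext f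
      simp only [Finset.mem_sdiff, mem_zeros, Finset.mem_singleton]
      constructor
      · rintro ⟨h7, h8⟩
        rw [h5] at h7
        rw [h5'] at h8
        tauto
      · rintro rfl
        exact ⟨hyi, hpi⟩
  · rintro (rfl | rfl | ⟨h6, h7⟩)
    · exact hpb
    · rw [ha, Pi.neg_apply] at hpb
      simpa using hpb
    · by_contra hyb
      have hcb : c ≠ b := by rintro rfl; exact hyb h3
      have : L p c ≠ 0 := by
        intro h
        rcases (h5' c).1 h with h | h
        exacts [hcb h, h4 h.2]
      have := Exchange.unique h6 h7 hpi h3 this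
      rw [this] at hi
      exact h4 hi

end

end IsOMLabeling

/-! ## The parameters of a graph -/

theorem Nat.le_choose_of_lt {n h : ℕ} (h0 : 1 ≤ h) (hn : h < n) : n ≤ n.choose h := by
  induction n generalizing h with
  | zero => omega
  | succ n ih =>
    obtain ⟨h, rfl⟩ : ∃ k, h = k + 1 := ⟨h - 1, by omega⟩
    rw [Nat.choose_succ_succ']
    have h1 := Nat.choose_pos (n := n) (k := h) (by omega)
    rcases Nat.lt_or_ge (h + 1) n with h2 | h2
    · have := ih h0 h2; omega
    · obtain rfl : n = h + 1 := by omega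
      simp

theorem Nat.choose_lt_choose_of_lt {n n' h : ℕ} (h0 : 1 ≤ h) (hn : h ≤ n) (hnn : n < n') :
    n.choose h < n'.choose h := by
  induction n', hnn using Nat.le_induction with
  | base =>
    obtain ⟨h, rfl⟩ : ∃ k, h = k + 1 := ⟨h - 1, by omega⟩
    have h1 := Nat.choose_pos (n := n) (k := h) (by omega)
    rw [Nat.choose_succ_succ' n h]
    omega
  | succ k hk ih =>
    obtain ⟨h, rfl⟩ : ∃ k, h = k + 1 := ⟨h - 1, by omega⟩
    rw [Nat.choose_succ_succ' k h]
    omega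

namespace HasParameters

variable {N : ℕ} {G : SimpleGraph (Fin N)} {n r : ℕ} (h : HasParameters G n r)
include h

theorem card_eq : N = 2 * n.choose (r - 1) := by
  obtain ⟨h1, h2, -, h4⟩ := h
  have : n - r + 1 = n - (r - 1) := by omega
  rw [this, Nat.choose_symm (by omega)] at h4
  exact h4

theorem two_le (hG : G.Connected) : 2 ≤ r := by
  by_contra hr
  have hr1 : r = 1 := by have := h.1; omega
  have h2 := h.card_eq
  subst hr1
  simp only [Nat.sub_self, Nat.choose_zero_right, mul_one] at h2
  subst h2
  obtain ⟨p⟩ := hG.preconnected 0 1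
  cases p with
  | cons hadj p =>
    have := h.2.2.1 0
    simp only [Nat.sub_self, mul_zero] at this
    rw [Set.ncard_eq_zero] at this
    exact (Set.ext_iff.1 this _).1 hadj

/-- This allows `n` to be found among the indices of a matrix, and rows of length `n` to be stored
in matrices of size `N`. -/
theorem lt_card (hG : G.Connected) : n < N := by
  have h1 := h.two_le hG
  have h2 := h.card_eq
  have h3 := Nat.le_choose_of_lt (n := n) (h := r - 1) (by omega) (by have := h.2.1; omega)
  have := h.2.1
  omega

/-- The degree determines `r`, which is at least `2`; then `n.choose (r - 1)` is strictly increasing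
for `n ≥ r - 1`. -/
theorem unique (hG : G.Connected) {n' r' : ℕ} (h' : HasParameters G n' r') : n = n' ∧ r = r' := by
  have h1 := h.two_le hG
  have h1' := h'.two_le hG
  have h2 := h.card_eq
  have h2' := h'.card_eq
  obtain ⟨v⟩ := hG.nonempty
  have h3 := h.2.2.1 v
  rw [h'.2.2.1 v] at h3
  obtain rfl : r = r' := by omega
  refine ⟨?_, rfl⟩
  have h4 := h.2.1
  have h4' := h'.2.1
  rcases lt_trichotomy n n' with h5 | h5 | h5
  · have := Nat.choose_lt_choose_of_lt (h := r - 1) (by omega) (by omega) h5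
    omega
  · exact h5
  · have := Nat.choose_lt_choose_of_lt (h := r - 1) (by omega) (by omega) h5
    omega

end HasParameters


/-! ## The parameters, the neighbours and the distances -/

namespace RAM

open RAM.Expr RAM.Cmd

theorem exists_lt_iff_fin {a : ℕ} {P : ℕ → Prop} : (∃ i < a, P i) ↔ ∃ i : Fin a, P i := by
  rw [Fin.exists_iff]
  simp only [exists_prop]

theorem card_filter_range (a : ℕ) (P : ℕ → Prop) [DecidablePred P] :
    ((Finset.range a).filter P).card = (Finset.univ.filter fun i : Fin a => P i).card := by
  rw [← Finset.card_map Fin.valEmbedding]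
  congr 1
  ext i
  simp only [Finset.mem_filter, Finset.mem_range, Finset.mem_map, Finset.mem_univ, true_and,
    Fin.valEmbedding_apply]
  exact ⟨fun h => ⟨⟨i, h.1⟩, h.2, rfl⟩, fun ⟨j, h1, h2⟩ => h2 ▸ ⟨j.2, h1⟩⟩

theorem Store.get_fin {s : Store} {N a b : ℕ} (h : s.var 0 = N) (k : ℕ) (i : Fin a) (j : Fin b)
    (ha : a ≤ N) (hb : b ≤ N) : s.get k i j = s.arr k i j :=
  Store.get_eq h k (i.2.trans_le ha) (j.2.trans_le hb)

theorem Store.get_setv (s : Store) {x : ℕ} (hx : x ≠ 0) (v : ℕ) : (s.setv x v).get = s.get := by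
  funext k i j
  simp [Store.get, Store.setv, Function.update_of_ne hx.symm]

namespace Expr

/-- The number of values of the bound variable with a given property. -/
def countE (b : ℕ) (c : Expr) : Expr := agg true b (ite c (const 1) (const 0))

/-- A value at an index with a given property, increased by one, or zero if there is none. -/
def pickV (b : ℕ) (c e : Expr) : Expr := agg false b (ite c (add e (const 1)) (const 0))

/-- An index with a given property, increased by one, or zero if there is none. -/
def pickE (b : ℕ) (d : ℕ) (c : Expr) : Expr := pickV b c (loc d)

open Classical in
theorem eval_countE {s : Store} {b a : ℕ} (hb : s.var b = a) (c : Expr) (d : ℕ) (ρ : ℕ → ℕ)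
    {P : Fin a → Prop} (hP : ∀ i : Fin a, eval s c (d + 1) (Function.update ρ d i) ≠ 0 ↔ P i) :
    eval s (countE b c) d ρ = (Finset.univ.filter P).card := by
  rw [countE, eval_agg, hb]
  simp only [eval_ite, eval_const]
  rw [← Finset.filter_congr fun i _ => hP i, ← card_filter_range a
    fun i => eval s c (d + 1) (Function.update ρ d i) ≠ 0, ← aggr_sum_eq_card]

theorem eval_pickV {s : Store} {b a : ℕ} (hb : s.var b = a) (c e : Expr) (d : ℕ) (ρ : ℕ → ℕ)
    {P : Fin a → Prop} (hP : ∀ i : Fin a, eval s c (d + 1) (Function.update ρ d i) ≠ 0 ↔ P i) :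
    (eval s (pickV b c e) d ρ = 0 ∧ ∀ i, ¬ P i) ∨ ∃ i : Fin a, P i ∧
      eval s (pickV b c e) d ρ = eval s e (d + 1) (Function.update ρ d i) + 1 := by
  rw [pickV, eval_agg, hb]
  simp only [eval_ite, eval_const, eval_add]
  rcases aggr_max_pick a (fun i => eval s c (d + 1) (Function.update ρ d i) ≠ 0)
    (fun i => eval s e (d + 1) (Function.update ρ d i)) with h | h
  · left
    refine ⟨by convert h.1, fun i hi => h.2 i i.2 ((hP i).2 hi)⟩
  · right
    obtain ⟨i, h1, h2, h3⟩ := h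
    exact ⟨⟨i, h1⟩, (hP ⟨i, h1⟩).1 h2, by convert h3⟩

theorem eval_pickE {s : Store} {b a : ℕ} (hb : s.var b = a) (c : Expr) (d : ℕ) (ρ : ℕ → ℕ)
    {P : Fin a → Prop} (hP : ∀ i : Fin a, eval s c (d + 1) (Function.update ρ d i) ≠ 0 ↔ P i) :
    (eval s (pickE b d c) d ρ = 0 ∧ ∀ i, ¬ P i) ∨ ∃ i, P i ∧ eval s (pickE b d c) d ρ = i + 1 := by
  simpa [pickE] using eval_pickV hb c (loc d) d ρ hP

end Expr

namespace Cmd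

theorem den_fill_fin {k bx b : ℕ} {e : Expr} {s : Store} {N a a' : ℕ} (hN : s.var 0 = N)
    (hx : s.var bx = a) (hb : s.var b = a') (ha : a ≤ N) (ha' : a' ≤ N)
    (hbv : b ≠ 20 ∧ b ≠ 21 ∧ e.noArr k = true) (i : Fin a) (j : Fin a') :
    ((fill k bx b e).den s).arr k i j = e.eval ((s.setv 20 i).setv 21 j) 0 fun _ => 0 :=
  den_fill hN (by omega) (by omega) hbv.1 hbv.2.1 hbv.2.2 (by omega) (by omega)

/-- Simultaneous assignment to all entries of a rectangle, by means of the matrix `2`. -/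
def upd (k bx b : ℕ) (e : Expr) : Cmd :=
  seq (fill 2 bx b e) (fill k bx b (arr 2 (var 20) (var 21)))

theorem den_upd {k bx b : ℕ} {e : Expr} {s : Store} {N a a' : ℕ} (hN : s.var 0 = N)
    (hx : s.var bx = a) (hb : s.var b = a') (ha : a ≤ N) (ha' : a' ≤ N)
    (hbv : bx ≠ 20 ∧ bx ≠ 21 ∧ b ≠ 20 ∧ b ≠ 21 ∧ e.noArr 2 = true ∧ k ≠ 2) (i : Fin a) (j : Fin a') :
    ((upd k bx b e).den s).arr k i j = e.eval ((s.setv 20 i).setv 21 j) 0 fun _ => 0 := by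
  obtain ⟨h1, h2, h3, h4, h5, h6⟩ := hbv
  have hf : ∀ y, y ≠ 20 → y ≠ 21 → ((fill 2 bx b e).den s).var y = s.var y := fun y hy hy' =>
    den_var _ _ (by simp [fill, wv, hy, hy'])
  have h0 := (hf 0 (by omega) (by omega)).trans hN
  rw [upd, den, den_fill_fin h0 ((hf _ h1 h2).trans hx) ((hf _ h3 h4).trans hb) ha ha'
    ⟨h3, h4, by simp [noArr, h6.symm]⟩]
  rw [← den_fill_fin hN hx hb ha ha' ⟨h3, h4, h5⟩, eval_arr, eval_var, eval_var,
    Store.get_setv _ (by omega), Store.get_setv _ (by omega)]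
  simp only [Store.setv_var]
  exact Store.get_fin h0 2 i j ha ha'

end Cmd

/-- The table of the binomial coefficients, in the matrix `17`. -/
def binomials : Cmd :=
  rep 10 0 (rep 21 0 (put 17 (var 10) (var 21) (Expr.ite (var 10) (Expr.ite (var 21)
    (add (arr 17 (sub (var 10) (const 1)) (var 21))
      (arr 17 (sub (var 10) (const 1)) (sub (var 21) (const 1)))) (const 1))
    (Expr.ite (var 21) (const 0) (const 1)))))

theorem den_binomials {s : Store} {N : ℕ} (hN : s.var 0 = N) {i j : ℕ} (hi : i < N) (hj : j < N) :
    (binomials.den s).arr 17 i j = i.choose j := by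
  have := rep_induction (x := 10) (b := 0) (s := s)
    (p := rep 21 0 (put 17 (var 10) (var 21) (Expr.ite (var 10) (Expr.ite (var 21)
    (add (arr 17 (sub (var 10) (const 1)) (var 21))
      (arr 17 (sub (var 10) (const 1)) (sub (var 21) (const 1)))) (const 1))
    (Expr.ite (var 21) (const 0) (const 1)))))
    (fun i t => ∀ i' < i, ∀ j < N, t.arr 17 i' j = i'.choose j) (fun _ _ _ h => h) (by simp) ?_
  · rw [hN] at this
    exact this i hi j hj
  · intro i hi t hv _ hti hI
    rw [hN] at hi
    simp only [wv, List.mem_cons, List.not_mem_nil, or_false] at hv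
    have ht0 : t.var 0 = N := (hv 0 (by omega) (by omega)).trans hN
    have := rep_induction (x := 21) (b := 0) (s := t) (p := put 17 (var 10) (var 21) (Expr.ite (var 10)
      (Expr.ite (var 21) (add (arr 17 (sub (var 10) (const 1)) (var 21))
      (arr 17 (sub (var 10) (const 1)) (sub (var 21) (const 1)))) (const 1))
      (Expr.ite (var 21) (const 0) (const 1))))
      (fun j t' => (∀ i' < i, ∀ j < N, t'.arr 17 i' j = i'.choose j) ∧
        ∀ j' < j, t'.arr 17 i j' = i.choose j') (fun _ _ _ h => h) ⟨hI, by simp⟩ ?_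
    · rw [ht0] at this
      intro i' hi' j hj
      rcases Nat.lt_succ_iff_lt_or_eq.1 hi' with h | rfl
      · exact this.1 i' h j hj
      · exact this.2 j hj
    · rintro j hj t' hv' - htj ⟨h1, h2⟩
      rw [ht0] at hj
      simp only [wv, List.not_mem_nil, not_false_eq_true] at hv'
      have h0 : t'.var 0 = N := (hv' 0 (by omega) trivial).trans ht0
      have h10 : t'.var 10 = i := (hv' 10 (by omega) trivial).trans hti
      have hval : eval t' (Expr.ite (var 10)
        (Expr.ite (var 21) (add (arr 17 (sub (var 10) (const 1)) (var 21))
        (arr 17 (sub (var 10) (const 1)) (sub (var 21) (const 1)))) (const 1))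
        (Expr.ite (var 21) (const 0) (const 1))) 0 (fun _ => 0) = i.choose j := by
        simp only [eval_ite, eval_var, eval_const, eval_add, eval_arr, eval_sub, h10, htj]
        rcases Nat.eq_zero_or_pos i with rfl | hi0
        · rcases Nat.eq_zero_or_pos j with rfl | hj0
          · simp
          · obtain ⟨j, rfl⟩ : ∃ k, j = k + 1 := ⟨j - 1, by omega⟩
            simp
        · obtain ⟨i, rfl⟩ : ∃ k, i = k + 1 := ⟨i - 1, by omega⟩
          rcases Nat.eq_zero_or_pos j with rfl | hj0
          · simp
          · obtain ⟨j, rfl⟩ : ∃ k, j = k + 1 := ⟨j - 1, by omega⟩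
            simp only [ne_eq, Nat.add_eq_zero_iff, one_ne_zero, and_false, not_false_eq_true,
              if_true, Nat.add_sub_cancel]
            rw [Store.get_eq h0 17 (by omega) (by omega), Store.get_eq h0 17 (by omega) (by omega),
              h1 i (by omega) _ (by omega), h1 i (by omega) _ (by omega), Nat.choose_succ_succ',
              add_comm]
      simp only [den, hval, eval_var, h10, htj]
      constructor
      · intro i' hi' j' hj'
        rw [Store.put_arr h0 17 (by omega) (by omega), if_neg (by omega)]
        exact h1 i' hi' j' hj'
      · intro j' hj'
        rw [Store.put_arr h0 17 (by omega) (by omega)]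
        rcases Nat.lt_succ_iff_lt_or_eq.1 hj' with h | rfl
        · rw [if_neg (by omega)]; exact h2 j' h
        · simp

/-- The computation of the parameters: variable `8` tells whether there are any, and the variables
from `2` to `7` are `2 * h`, `h`, `n`, `n - h + 1`, `n - h`, `min h (n - h)`, where `h = r - 1`. -/
def params : Cmd :=
  seq binomials <| seq (set 1 (const 1)) <| seq (set 9 (const 0)) <|
  seq (set 2 (countE 0 (arr 0 (const 0) (loc 0)))) <|
  seq (set 3 (pickE 0 0 (eqE (add (loc 0) (loc 0)) (var 2)))) <|
  seq (set 3 (sub (var 3) (const 1))) <|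
  seq (set 11 (notE (exE 0 (notE (eqE (countE 0 (arr 0 (loc 0) (loc 1))) (var 2)))))) <|
  seq (set 8 (pickE 0 0 (andE (eqE (add (var 3) (var 3)) (var 2)) (andE (var 11)
    (andE (ltE (var 3) (loc 0)) (eqE (add (arr 17 (loc 0) (var 3)) (arr 17 (loc 0) (var 3)))
      (var 0))))))) <|
  seq (set 4 (sub (var 8) (const 1))) <| seq (set 6 (sub (var 4) (var 3))) <|
  seq (set 5 (add (var 6) (const 1))) (set 7 (sub (var 3) (sub (var 3) (var 6))))

-- The searches run over numbers below `N` only. This is enough: the degree of a vertex is less than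
-- `N`, and so is `n` by `HasParameters.lt_card`.
open Classical in
theorem den_params {N : ℕ} {G : SimpleGraph (Fin N)} (hG : G.Connected) {s : Store}
    (hN : s.var 0 = N) (hadj : ∀ i j : Fin N, s.arr 0 i j = if G.Adj i j then 1 else 0) :
    ((params.den s).var 8 = 0 ∧ ¬ ∃ n r, HasParameters G n r) ∨
    ((params.den s).var 8 ≠ 0 ∧ ∃ n h, HasParameters G n (h + 1) ∧
      (params.den s).var 2 = 2 * h ∧ (params.den s).var 3 = h ∧ (params.den s).var 4 = n ∧
      (params.den s).var 5 = n - h + 1 ∧ (params.den s).var 6 = n - h ∧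
      (params.den s).var 7 = min h (n - h)) := by
  have hpos : 0 < N := Fin.pos hG.nonempty.some
  have hdeg : ∀ u : Fin N, (G.neighborSet u).ncard = (Finset.univ.filter (G.Adj u)).card := by
    intro u
    rw [← Set.ncard_coe_finset]
    congr 1
    ext w
    simp
  have hc : ∀ t : Store, t.arr 0 = s.arr 0 → t.var 0 = N → ∀ (e : Expr) (d : ℕ) (ρ : ℕ → ℕ)
      (u : Fin N), (∀ i, eval t e (d + 1) (Function.update ρ d i) = u) →
      eval t (countE 0 (arr 0 e (loc d))) d ρ = (G.neighborSet u).ncard := by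
    intro t ht ht0 e d ρ u he
    rw [hdeg, eval_countE ht0 (P := G.Adj u)]
    intro i
    rw [eval_arr, he, eval_loc, Function.update_self, Store.get_fin ht0 _ _ _ le_rfl le_rfl, ht,
      hadj]
    simp
  set v0 : Fin N := ⟨0, hpos⟩
  obtain ⟨D, hD⟩ : ∃ D, D = (G.neighborSet v0).ncard := ⟨_, rfl⟩
  have hDN : D < N := by
    rw [hD, hdeg]
    refine (Finset.card_lt_card (t := Finset.univ) ?_).trans_eq (by simp)
    refine Finset.filter_ssubset.2 ⟨v0, Finset.mem_univ _, G.loopless.irrefl v0⟩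
  -- the store after each assignment
  obtain ⟨s1, hs1⟩ : ∃ s1, s1 = ((binomials.den s).setv 1 1).setv 9 0 := ⟨_, rfl⟩
  have h1a : s1.arr 0 = s.arr 0 := by rw [hs1]; exact den_arr binomials s (by decide)
  have h1v : s1.var 0 = N := by
    rw [hs1]; simp only [Store.setv_var]; exact (den_var binomials s (by decide)).trans hN
  have h1b : ∀ i < N, ∀ j < N, s1.arr 17 i j = i.choose j := fun i hi j hj => by
    rw [hs1]; exact den_binomials hN hi hj
  obtain ⟨s2, hs2⟩ : ∃ s2, s2 = s1.setv 2 D := ⟨_, rfl⟩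
  have h2v : s2.var 0 = N := by rw [hs2]; simpa [Store.setv_var] using h1v
  obtain ⟨P3, hP3⟩ : ∃ P3, P3 = eval s2 (pickE 0 0 (eqE (add (loc 0) (loc 0)) (var 2))) 0
    fun _ => 0 := ⟨_, rfl⟩
  have hp3 := eval_pickE h2v (eqE (add (loc 0) (loc 0)) (var 2)) 0 (fun _ => 0)
    (P := fun i => (i : ℕ) + i = D) (fun i => by rw [truth_eqE]; simp [hs2, Store.setv_var])
  rw [← hP3] at hp3
  obtain ⟨s3, hs3⟩ : ∃ s3, s3 = (s2.setv 3 P3).setv 3 (P3 - 1) := ⟨_, rfl⟩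
  have h3v : s3.var 0 = N := by rw [hs3]; simpa [Store.setv_var] using h2v
  have h3a : s3.arr 0 = s.arr 0 := by rw [hs3, hs2]; exact h1a
  obtain ⟨R, hR⟩ : ∃ R, R = eval s3 (notE (exE 0 (notE (eqE (countE 0 (arr 0 (loc 0) (loc 1)))
    (var 2))))) 0 fun _ => 0 := ⟨_, rfl⟩
  have hR' : R ≠ 0 ↔ ∀ u : Fin N, (G.neighborSet u).ncard = D := by
    rw [hR, truth_notE, truth_exE, h3v, exists_lt_iff_fin, not_exists]
    refine forall_congr' fun u => ?_
    rw [truth_notE, not_not, truth_eqE, hc s3 h3a h3v _ _ _ u (by simp)]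
    simp [hs3, hs2, Store.setv_var]
  obtain ⟨s4, hs4⟩ : ∃ s4, s4 = s3.setv 11 R := ⟨_, rfl⟩
  have h4v : s4.var 0 = N := by rw [hs4]; simpa [Store.setv_var] using h3v
  obtain ⟨P8, hP8⟩ : ∃ P8, P8 = eval s4 (pickE 0 0 (andE (eqE (add (var 3) (var 3)) (var 2))
    (andE (var 11) (andE (ltE (var 3) (loc 0)) (eqE (add (arr 17 (loc 0) (var 3))
      (arr 17 (loc 0) (var 3))) (var 0)))))) 0 fun _ => 0 := ⟨_, rfl⟩
  have hden : params.den s = ((((s4.setv 8 P8).setv 4 (P8 - 1)).setv 6 (P8 - 1 - (P3 - 1))).setv 5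
      (P8 - 1 - (P3 - 1) + 1)).setv 7 ((P3 - 1) - ((P3 - 1) - (P8 - 1 - (P3 - 1)))) := by
    have e1 : eval s1 (countE 0 (arr 0 (const 0) (loc 0))) 0 (fun _ => 0) = D := by
      rw [hc s1 h1a h1v _ _ _ v0 (by simp [v0]), hD]
    simp only [params, den, eval_const, ← hs1, e1, ← hs2, ← hP3, eval_sub, eval_var]
    have e2 : ((s2.setv 3 P3).setv 3 ((s2.setv 3 P3).var 3 - 1)) = s3 := by
      rw [hs3]; simp [Store.setv_var]
    simp only [e2]
    simp only [← hR]
    simp only [← hs4]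
    simp only [← hP8]
    simp only [eval_add, eval_var, eval_const, Store.setv_var]
    have e3 : s4.var 3 = P3 - 1 := by simp [hs4, hs3, Store.setv_var]
    simp [e3]
  -- If no half of the degree was found, `P3 = 0` and `P3 - 1` is also `0`; repeating the test for
  -- the half discards this default when the degree is odd.
  have hp8 := eval_pickE h4v (andE (eqE (add (var 3) (var 3)) (var 2))
    (andE (var 11) (andE (ltE (var 3) (loc 0)) (eqE (add (arr 17 (loc 0) (var 3))
      (arr 17 (loc 0) (var 3))) (var 0))))) 0 (fun _ => 0)
    (P := fun t => (P3 - 1) + (P3 - 1) = D ∧ (∀ u : Fin N, (G.neighborSet u).ncard = D) ∧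
      P3 - 1 < t ∧ (t : ℕ).choose (P3 - 1) + (t : ℕ).choose (P3 - 1) = N) (fun t => by
      have e3 : s4.var 3 = P3 - 1 := by simp [hs4, hs3, Store.setv_var]
      have e2 : s4.var 2 = D := by simp [hs4, hs3, hs2, Store.setv_var]
      have e11 : s4.var 11 = R := by simp [hs4, Store.setv_var]
      have e17 : s4.arr 17 = s1.arr 17 := by rw [hs4, hs3, hs2]; rfl
      rw [truth_andE, truth_andE, truth_andE, truth_eqE, truth_eqE, truth_ltE]
      simp only [eval_add, eval_var, eval_arr, eval_loc, Function.update_self, e3, e2, e11, hR', h4v]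
      refine and_congr_right fun hPD => and_congr_right fun _ => and_congr_right fun _ => ?_
      rw [Store.get_eq h4v 17 t.2 (by omega), e17, h1b t t.2 _ (by omega)])
  rw [← hP8] at hp8
  rcases hp8 with ⟨h80, h8⟩ | ⟨t, ⟨h81, h82, h83, h84⟩, h85⟩
  · left
    refine ⟨by rw [hden]; simp [Store.setv_var, h80], ?_⟩
    rintro ⟨n, r, hp⟩
    have h2 := hp.two_le hG
    have hD2 := hp.2.2.1 v0
    rw [← hD] at hD2
    rcases hp3 with ⟨-, h3⟩ | ⟨i, h3, h3'⟩
    · exact h3 ⟨r - 1, by omega⟩ (by simp only; omega)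
    · refine h8 ⟨n, hp.lt_card hG⟩ ⟨by omega, fun u => by rw [hp.2.2.1 u, hD2], ?_, ?_⟩
      · have := hp.2.1; simp only; omega
      · have := hp.card_eq
        have e : P3 - 1 = r - 1 := by omega
        simp only [e]
        omega
  · right
    refine ⟨by rw [hden]; simp [Store.setv_var, h85], t, P3 - 1, ?_, ?_⟩
    · refine ⟨by omega, by omega, fun v => by rw [h82 v]; omega, ?_⟩
      have e : (t : ℕ) - (P3 - 1 + 1) + 1 = t - (P3 - 1) := by omega
      rw [e, Nat.choose_symm (by omega)]
      omega
    · rw [hden]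
      have e2 : s4.var 2 = D := by simp [hs4, hs3, hs2, Store.setv_var]
      have e3 : s4.var 3 = P3 - 1 := by simp [hs4, hs3, Store.setv_var]
      simp [Store.setv_var, h85, e2, e3]
      omega

theorem params_frame {N : ℕ} {s : Store} (hN : s.var 0 = N) : (params.den s).var 0 = N ∧
    (params.den s).var 1 = 1 ∧ (params.den s).var 9 = 0 ∧ (params.den s).arr 0 = s.arr 0 := by
  refine ⟨(den_var params s (by decide)).trans hN, ?_, ?_, den_arr params s (by decide)⟩
  · simp [params, den, Store.setv_var]
  · simp [params, den, Store.setv_var]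

end RAM


/-! ## Neighbours and distances -/

theorem SimpleGraph.Connected.exists_adj_dist {V : Type} {G : SimpleGraph V} (hG : G.Connected)
    {u v : V} {k : ℕ} (h : G.dist u v = k + 1) : ∃ w, G.Adj v w ∧ G.dist u w = k := by
  obtain ⟨p, hp⟩ := hG.exists_walk_length_eq_dist v u
  rw [dist_comm, h] at hp
  cases p with
  | nil => simp at hp
  | @cons _ w _ hvw p =>
    refine ⟨w, hvw, ?_⟩
    have h1 := G.dist_le p
    have h2 := hG.dist_triangle (u := u) (v := w) (w := v)
    rw [dist_eq_one_iff_adj.2 hvw.symm] at h2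
    rw [dist_comm] at h1
    simp only [Walk.length_cons] at hp
    omega

namespace RAM

open RAM.Expr RAM.Cmd

/-- The lists of the neighbours, in the columns of the matrix `3`. -/
def neighbors : Cmd := rep 20 0 (collect 3 (arr 0 (var 20) (var 21)))

open Classical in
theorem den_neighbors {N : ℕ} {G : SimpleGraph (Fin N)} {s : Store} (hN : s.var 0 = N)
    (hadj : ∀ u v : Fin N, s.arr 0 u v ≠ 0 ↔ G.Adj u v) {d : ℕ}
    (hd : ∀ v, (G.neighborSet v).ncard = d) : ∃ nb : Fin d → Fin N → Fin N,
      (∀ (j : Fin d) (v : Fin N), (neighbors.den s).arr 3 j v = nb j v) ∧ ∀ v w, G.Adj v w ↔ ∃ j, nb j v = w := by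
  have key : ∀ v : Fin N, (∀ j < d, ∃ w : Fin N, (neighbors.den s).arr 3 j v = w ∧ G.Adj v w) ∧
      ∀ w, G.Adj v w → ∃ j < d, (neighbors.den s).arr 3 j v = w := by
    have := rep_induction (x := 20) (b := 0) (s := s) (p := collect 3 (arr 0 (var 20) (var 21)))
      (fun i t => ∀ v : Fin N, (v : ℕ) < i → (∀ j < d, ∃ w : Fin N, t.arr 3 j v = w ∧ G.Adj v w) ∧
        ∀ w, G.Adj v w → ∃ j < d, t.arr 3 j v = w) (fun _ _ _ h => h) (by simp) ?_
    · rw [hN] at this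
      exact fun v => this v v.2
    · intro i hi t hv ht hti hI
      simp only [wv, wa, collect, List.mem_append, List.mem_cons, List.not_mem_nil, or_false,
        false_or] at hv ht
      have ht0 : t.var 0 = N := (hv 0 (by omega) (by omega)).trans hN
      have hi' : i < N := by omega
      have hcard : ((Finset.range N).filter fun w => ∃ h : w < N, G.Adj ⟨i, hi'⟩ ⟨w, h⟩).card = d := by
        rw [card_filter_range, ← hd ⟨i, hi'⟩, ← Set.ncard_coe_finset]
        congr 1
        ext w
        simp
      obtain ⟨-, c1, -, c2, c3⟩ := den_collect (k := 3) (c := arr 0 (var 20) (var 21)) ht0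
        (by rw [hti]; exact hi') (fun w => ∃ h : w < N, G.Adj ⟨i, hi'⟩ ⟨w, h⟩) (by
          intro w hw t' hv' htw ha'
          have ht0' : t'.var 0 = N := (hv' 0 (by omega) (by omega)).trans ht0
          have h20 : t'.var 20 = i := (hv' 20 (by omega) (by omega)).trans hti
          simp only [eval_arr, eval_var, h20, htw]
          rw [Store.get_eq ht0' 0 hi' hw, ha' 0 (by omega), ht 0 (by omega)]
          rw [hadj ⟨i, hi'⟩ ⟨w, hw⟩]
          simp [hw])
      rw [hcard, hti] at c1 c2
      rw [hti] at c3
      intro v hvi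
      rcases Nat.lt_succ_iff_lt_or_eq.1 hvi with h | h
      · have := hI v h
        simpa only [fun j => c3 j (v : ℕ) (by omega)] using this
      · obtain rfl : v = ⟨i, hi'⟩ := Fin.ext h
        constructor
        · intro j hj
          obtain ⟨h1, h2, h3⟩ := c1 j hj
          exact ⟨_, rfl, h3⟩
        · intro w hw
          exact c2 w w.2 ⟨w.2, hw⟩
  have key' : ∀ (j : Fin d) (v : Fin N), ∃ w : Fin N, (neighbors.den s).arr 3 j v = w ∧ G.Adj v w :=
    fun j v => (key v).1 j j.2
  choose nb hnb using key'
  refine ⟨nb, fun j v => (hnb j v).1, fun v w => ⟨fun h => ?_, ?_⟩⟩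
  · obtain ⟨j, hj, hjw⟩ := (key v).2 w h
    exact ⟨⟨j, hj⟩, Fin.ext ((hnb ⟨j, hj⟩ v).1.symm.trans hjw)⟩
  · rintro ⟨j, rfl⟩
    exact (hnb j v).2

/-- The distances up to the value of variable `5`, in the matrix `4`; larger distances are
replaced by that value plus one. -/
def distances : Cmd :=
  seq (fill 4 0 0 (Expr.ite (eqE (var 20) (var 21)) (const 0) (add (var 5) (const 1))))
    (rep 10 5 (upd 4 0 0 (Expr.ite (ltE (arr 4 (var 20) (var 21)) (add (var 10) (const 1)))
      (arr 4 (var 20) (var 21))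
      (Expr.ite (exE 2 (eqE (arr 4 (var 20) (arr 3 (loc 0) (var 21))) (var 10)))
        (add (var 10) (const 1)) (add (var 5) (const 1))))))

/-- Breadth-first search from all vertices at once: after round `k` the distances up to `k` are
final, and `m + 1` stands for larger ones. Stopping at `m = n - r + 2` keeps the time within the
bound. -/
theorem den_distances {N : ℕ} {G : SimpleGraph (Fin N)} (hG : G.Connected) {s : Store}
    (hN : s.var 0 = N) {d m : ℕ} (hd : s.var 2 = d) (hdN : d ≤ N) (hm : s.var 5 = m)
    {nb : Fin d → Fin N → Fin N} (hnb : ∀ (j : Fin d) (v : Fin N), s.arr 3 j v = nb j v)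
    (hadj : ∀ v w, G.Adj v w ↔ ∃ j, nb j v = w) (u v : Fin N) :
    (distances.den s).arr 4 u v = min (G.dist u v) (m + 1) := by
  obtain ⟨s1, hs1⟩ : ∃ s1, s1 = (fill 4 0 0 (Expr.ite (eqE (var 20) (var 21)) (const 0)
    (add (var 5) (const 1)))).den s := ⟨_, rfl⟩
  have hv1 : ∀ y, y ≠ 20 → y ≠ 21 → s1.var y = s.var y := by
    intro y h1 h2
    rw [hs1]
    exact den_var _ _ (by simp [fill, wv, h1, h2])
  have ha1 : ∀ k, k ≠ 4 → s1.arr k = s.arr k := by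
    intro k hk
    rw [hs1]
    exact den_arr _ _ (by simp [fill, wa, hk])
  have h0 : ∀ u v : Fin N, s1.arr 4 u v = if G.dist u v ≤ 0 then G.dist u v else m + 1 := by
    intro u v
    rw [hs1, den_fill_fin hN hN hN le_rfl le_rfl (by decide), eval_ite]
    have hle : G.dist u v ≤ 0 ↔ u = v := by rw [Nat.le_zero, hG.dist_eq_zero_iff]
    by_cases h : u = v
    · rw [if_pos ((truth_eqE _ _ _ _ _).2 (by simp [Store.setv_var, h])), if_pos (hle.2 h)]
      simp [h]
    · rw [if_neg (mt (truth_eqE _ _ _ _ _).1 (by simpa [Store.setv_var, Fin.ext_iff] using h)),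
        if_neg (mt hle.1 h)]
      simp [Store.setv_var, hm]
  have := rep_induction (x := 10) (b := 5) (s := s1)
    (p := upd 4 0 0 (Expr.ite (ltE (arr 4 (var 20) (var 21)) (add (var 10) (const 1)))
      (arr 4 (var 20) (var 21))
      (Expr.ite (exE 2 (eqE (arr 4 (var 20) (arr 3 (loc 0) (var 21))) (var 10)))
        (add (var 10) (const 1)) (add (var 5) (const 1)))))
    (fun k t => ∀ u v : Fin N, t.arr 4 u v = if G.dist u v ≤ k then G.dist u v else m + 1)
    (fun _ _ _ h => h) h0 ?_
  · rw [hv1 5 (by omega) (by omega), hm] at this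
    have h1 : distances.den s = (rep 10 5 (upd 4 0 0 (Expr.ite (ltE (arr 4 (var 20) (var 21))
      (add (var 10) (const 1))) (arr 4 (var 20) (var 21))
      (Expr.ite (exE 2 (eqE (arr 4 (var 20) (arr 3 (loc 0) (var 21))) (var 10)))
        (add (var 10) (const 1)) (add (var 5) (const 1)))))).den s1 := by
      rw [hs1, distances, den]
    rw [h1, this u v]
    split_ifs <;> omega
  · intro k hk t hv ht htk hI u v
    have hv' : ∀ y, y ≠ 10 → y ≠ 20 → y ≠ 21 → t.var y = s.var y := by
      intro y h1 h2 h3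
      rw [hv y h1 (by simp [upd, fill, wv, h2, h3]), hv1 y h2 h3]
    have ht3 : t.arr 3 = s.arr 3 := by rw [ht 3 (by decide), ha1 3 (by omega)]
    have ht0 : t.var 0 = N := (hv' 0 (by omega) (by omega) (by omega)).trans hN
    have ht2 : t.var 2 = d := (hv' 2 (by omega) (by omega) (by omega)).trans hd
    have ht5 : t.var 5 = m := (hv' 5 (by omega) (by omega) (by omega)).trans hm
    rw [hv1 5 (by omega) (by omega), hm] at hk
    have hg : ∀ k (u v : Fin N), t.get k u v = t.arr k u v := fun k u v =>
      Store.get_fin ht0 k u v le_rfl le_rfl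
    have hg3 : ∀ (j : Fin d) (v : Fin N), t.get 3 j v = nb j v := fun j v => by
      rw [Store.get_fin ht0 3 j v hdN le_rfl, ht3, hnb]
    rw [den_upd ht0 ht0 ht0 le_rfl le_rfl (by decide), eval_ite, eval_ite]
    have c1 := truth_ltE ((t.setv 20 u).setv 21 v) (arr 4 (var 20) (var 21))
      (add (var 10) (const 1)) 0 fun _ => 0
    have c2 := truth_exE ((t.setv 20 u).setv 21 v) (eqE (arr 4 (var 20) (arr 3 (loc 0) (var 21)))
      (var 10)) 0 (fun _ => 0) 2
    simp only [truth_eqE, Store.setv_var, OfNat.ofNat_ne_zero, ne_eq, not_false_eq_true,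
      Store.get_setv, eval_arr, eval_var, eval_loc, eval_add, eval_const, Function.update_self,
      if_true, Nat.reduceEqDiff, if_false, ht2, exists_lt_iff_fin, hg3, hg, htk, hI] at c1 c2
    by_cases h1 : G.dist u v ≤ k
    · rw [if_pos (c1.2 (by rw [if_pos h1]; omega)), if_pos (by omega)]
      simp only [Store.setv_var, OfNat.ofNat_ne_zero, ne_eq, not_false_eq_true,
        Store.get_setv, eval_arr, eval_var, if_true, Nat.reduceEqDiff, if_false, hg, hI, if_pos h1]
    · rw [if_neg (mt c1.1 (by rw [if_neg h1]; omega))]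
      by_cases h2 : G.dist u v = k + 1
      · obtain ⟨w, hw1, hw2⟩ := hG.exists_adj_dist h2
        obtain ⟨j, rfl⟩ := (hadj _ _).1 hw1
        rw [if_pos (c2.2 ⟨j, by rw [if_pos (by omega), hw2]⟩), if_pos (by omega)]
        simp [Store.setv_var, htk, h2]
      · rw [if_neg, if_neg (by omega)]
        · simp [Store.setv_var, ht5]
        · rw [ne_eq, c2]
          rintro ⟨j, hj⟩
          have h3 := hG.dist_triangle (u := u) (v := nb j v) (w := v)
          rw [SimpleGraph.dist_eq_one_iff_adj.2 ((hadj _ _).2 ⟨j, rfl⟩).symm] at h3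
          split_ifs at hj <;> omega

end RAM


/-! ## Antipodes and exchanges -/

theorem SimpleGraph.Connected.dist_lt_card {N : ℕ} {G : SimpleGraph (Fin N)} (hG : G.Connected)
    (u v : Fin N) : G.dist u v < N := by
  obtain ⟨p, hp, hp'⟩ := hG.exists_path_of_dist u v
  rw [← hp']
  simpa using hp.length_lt

namespace RAM

open RAM.Expr RAM.Cmd

/-- The contents of the memory after the preparations: the variables below `8` hold the parameters,
the matrices `0`, `3` and `4` hold the adjacency matrix, the lists of neighbours, and the
distances. -/
structure Ctx {N : ℕ} (G : SimpleGraph (Fin N)) (n h : ℕ) (nb : Fin (2 * h) → Fin N → Fin N)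
    (s : Store) : Prop where
  v0 : s.var 0 = N
  v1 : s.var 1 = 1
  v2 : s.var 2 = 2 * h
  v3 : s.var 3 = h
  v4 : s.var 4 = n
  v5 : s.var 5 = n - h + 1
  v6 : s.var 6 = n - h
  v7 : s.var 7 = min h (n - h)
  a0 : ∀ u v : Fin N, s.arr 0 u v ≠ 0 ↔ G.Adj u v
  a3 : ∀ (j : Fin (2 * h)) (v : Fin N), s.arr 3 j v = nb j v
  a4 : ∀ u v : Fin N, s.arr 4 u v = min (G.dist u v) (n - h + 2)

theorem Ctx.congr {N : ℕ} {G : SimpleGraph (Fin N)} {n h : ℕ} {nb : Fin (2 * h) → Fin N → Fin N}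
    {s t : Store} (H : Ctx G n h nb s) (hv : ∀ x < 8, t.var x = s.var x)
    (ha : ∀ k < 5, k ≠ 1 → k ≠ 2 → t.arr k = s.arr k) : Ctx G n h nb t where
  v0 := by rw [hv 0 (by omega), H.v0]
  v1 := by rw [hv 1 (by omega), H.v1]
  v2 := by rw [hv 2 (by omega), H.v2]
  v3 := by rw [hv 3 (by omega), H.v3]
  v4 := by rw [hv 4 (by omega), H.v4]
  v5 := by rw [hv 5 (by omega), H.v5]
  v6 := by rw [hv 6 (by omega), H.v6]
  v7 := by rw [hv 7 (by omega), H.v7]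
  a0 := by rw [ha 0 (by omega) (by omega) (by omega)]; exact H.a0
  a3 := by rw [ha 3 (by omega) (by omega) (by omega)]; exact H.a3
  a4 := by rw [ha 4 (by omega) (by omega) (by omega)]; exact H.a4

theorem Ctx.den {N : ℕ} {G : SimpleGraph (Fin N)} {n h : ℕ} {nb : Fin (2 * h) → Fin N → Fin N}
    {s : Store} (H : Ctx G n h nb s) (p : Cmd)
    (hp : (∀ x < 8, x ∉ p.wv) ∧ ∀ k < 5, k ≠ 1 → k ≠ 2 → k ∉ p.wa) : Ctx G n h nb (p.den s) :=
  H.congr (fun x hx => den_var p s (hp.1 x hx)) fun k hk h1 h2 => den_arr p s (hp.2 k hk h1 h2)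

/-- The antipodes, in the first row of the matrix `5`, from the antipode of the vertex `0`, which
is the value of variable `12`. -/
def antipodes : Cmd :=
  seq (fill 5 1 0 (Expr.ite (var 21) (const 0) (add (var 12) (const 1)))) <|
  seq (rep 10 0 (seq
      (fill 16 1 0 (pickV 2 (arr 5 (const 0) (arr 3 (loc 0) (var 21))) (arr 3 (loc 0) (var 21))))
      (upd 5 1 0 (Expr.ite (arr 5 (const 0) (var 21)) (arr 5 (const 0) (var 21))
        (Expr.ite (arr 16 (const 0) (var 21)) (pickV 2 (eqE (arr 4 (var 21) (arr 3 (loc 0)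
            (sub (arr 5 (const 0) (sub (arr 16 (const 0) (var 21)) (const 1))) (const 1)))) (var 5))
          (arr 3 (loc 0) (sub (arr 5 (const 0) (sub (arr 16 (const 0) (var 21)) (const 1)))
            (const 1)))) (const 0))))))
    (upd 5 1 0 (sub (arr 5 (const 0) (var 21)) (const 1)))

section

variable {N : ℕ} {G : SimpleGraph (Fin N)} {n h : ℕ} {nb : Fin (2 * h) → Fin N → Fin N}
  {L : Fin N → SignVec n}

theorem Ctx.get_fin {s : Store} (H : Ctx G n h nb s) (k : ℕ) (u v : Fin N) :
    s.get k u v = s.arr k u v := Store.get_fin H.v0 k u v le_rfl le_rfl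

theorem Ctx.get_zero {s : Store} (H : Ctx G n h nb s) (k : ℕ) (v : Fin N) :
    s.get k 0 v = s.arr k 0 v := Store.get_eq H.v0 k (Fin.pos v) v.2

/-- Entries are increased by one so that `0` can mean unknown. After round `k` all antipodes within
distance `k` of the vertex `0` are known. An unknown `u` first picks a neighbour `x` with known
antipode, then searches the neighbours of `a x`; the two searches are separate so that a round costs
the degree and not its square. -/
theorem den_antipodes (hL : IsOMLabeling G n (h + 1) L) (hG : G.Connected) (hpos : 0 < N)
    {a : Fin N → Fin N} (ha : ∀ v, L (a v) = -L v) (hadj : ∀ v w, G.Adj v w ↔ ∃ j, nb j v = w)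
    (hhN : 2 * h ≤ N) {s : Store} (H : Ctx G n h nb s) (h12 : s.var 12 = a ⟨0, hpos⟩) (v : Fin N) :
    (antipodes.den s).arr 5 0 v = a v := by
  have hsz := hL.le_size v
  obtain ⟨s1, hs1⟩ : ∃ s1, s1 = (fill 5 1 0 (Expr.ite (var 21) (const 0)
    (add (var 12) (const 1)))).den s := ⟨_, rfl⟩
  have H1 : Ctx G n h nb s1 := by rw [hs1]; exact H.den _ (by decide)
  have h0 : ∀ u : Fin N, (s1.arr 5 0 u = 0 ∨ s1.arr 5 0 u = a u + 1) ∧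
      (G.dist ⟨0, hpos⟩ u ≤ 0 → s1.arr 5 0 u ≠ 0) := by
    intro u
    have := den_fill_fin (k := 5) (e := Expr.ite (var 21) (const 0) (add (var 12) (const 1)))
      H.v0 H.v1 H.v0 hpos le_rfl (by decide) 0 u
    rw [← hs1, eval_ite] at this
    simp only [Fin.val_zero] at this
    rw [this, Nat.le_zero, hG.dist_eq_zero_iff]
    simp only [eval_var, eval_const, eval_add, Store.setv_var, if_true, Nat.reduceEqDiff, if_false,
      h12]
    by_cases hu : (u : ℕ) = 0
    · obtain rfl : u = ⟨0, hpos⟩ := Fin.ext hu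
      simp
    · rw [if_pos hu]
      refine ⟨Or.inl rfl, ?_⟩
      rintro rfl
      exact absurd rfl hu
  obtain ⟨s2, hs2⟩ : ∃ s2, s2 = (rep 10 0 (seq
      (fill 16 1 0 (pickV 2 (arr 5 (const 0) (arr 3 (loc 0) (var 21))) (arr 3 (loc 0) (var 21))))
      (upd 5 1 0 (Expr.ite (arr 5 (const 0) (var 21)) (arr 5 (const 0) (var 21))
        (Expr.ite (arr 16 (const 0) (var 21)) (pickV 2 (eqE (arr 4 (var 21) (arr 3 (loc 0)
            (sub (arr 5 (const 0) (sub (arr 16 (const 0) (var 21)) (const 1))) (const 1)))) (var 5))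
          (arr 3 (loc 0) (sub (arr 5 (const 0) (sub (arr 16 (const 0) (var 21)) (const 1)))
            (const 1)))) (const 0)))))).den s1 := ⟨_, rfl⟩
  have h2 : ∀ u : Fin N, (s2.arr 5 0 u = 0 ∨ s2.arr 5 0 u = a u + 1) ∧
      (G.dist ⟨0, hpos⟩ u ≤ s1.var 0 → s2.arr 5 0 u ≠ 0) := by
    rw [hs2]
    refine rep_induction (fun k t => ∀ u : Fin N, (t.arr 5 0 u = 0 ∨ t.arr 5 0 u = a u + 1) ∧
      (G.dist ⟨0, hpos⟩ u ≤ k → t.arr 5 0 u ≠ 0)) (fun _ _ _ h => h) h0 ?_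
    intro k _ t hv ht htk hI u
    have Ht : Ctx G n h nb t := H1.congr
      (fun x hx => hv x (by omega) (by revert x; decide))
      fun x hx _ _ => ht x (by revert x; decide)
    rw [den]
    obtain ⟨t1, ht1⟩ : ∃ t1, t1 = (fill 16 1 0 (pickV 2 (arr 5 (const 0)
      (arr 3 (loc 0) (var 21))) (arr 3 (loc 0) (var 21)))).den t := ⟨_, rfl⟩
    rw [← ht1]
    have Ht1 : Ctx G n h nb t1 := by rw [ht1]; exact Ht.den _ (by decide)
    have h5 : t1.arr 5 = t.arr 5 := by rw [ht1]; exact den_arr _ _ (by decide)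
    have h16 := den_fill_fin (k := 16) (e := pickV 2 (arr 5 (const 0)
      (arr 3 (loc 0) (var 21))) (arr 3 (loc 0) (var 21)))
      Ht.v0 Ht.v1 Ht.v0 hpos le_rfl (by decide) 0 u
    rw [← ht1] at h16
    have hg3 : ∀ (j : Fin (2 * h)) (v : Fin N), t.get 3 j v = nb j v := fun j v => by
      rw [Store.get_fin Ht.v0 3 j v hhN le_rfl, Ht.a3]
    have hg3' : ∀ (j : Fin (2 * h)) (v : Fin N), t1.get 3 j v = nb j v := fun j v => by
      rw [Store.get_fin Ht1.v0 3 j v hhN le_rfl, Ht1.a3]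
    have p16 := eval_pickV (s := (t.setv 20 (0 : Fin 1)).setv 21 u) (b := 2) (a := 2 * h)
      (by simp [Store.setv_var, Ht.v2]) (arr 5 (const 0) (arr 3 (loc 0) (var 21)))
      (arr 3 (loc 0) (var 21)) 0 (fun _ => 0) (P := fun j => t.arr 5 0 (nb j u) ≠ 0) (fun j => by
        simp [Store.setv_var, Store.get_setv, hg3, Ht.get_zero])
    rw [← h16] at p16
    have h5' := den_upd (k := 5) (e := Expr.ite (arr 5 (const 0) (var 21))
      (arr 5 (const 0) (var 21))
        (Expr.ite (arr 16 (const 0) (var 21)) (pickV 2 (eqE (arr 4 (var 21) (arr 3 (loc 0)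
            (sub (arr 5 (const 0) (sub (arr 16 (const 0) (var 21)) (const 1))) (const 1)))) (var 5))
          (arr 3 (loc 0) (sub (arr 5 (const 0) (sub (arr 16 (const 0) (var 21)) (const 1)))
            (const 1)))) (const 0)))
      Ht1.v0 Ht1.v1 Ht1.v0 hpos le_rfl (by decide) 0 u
    simp only [Fin.val_zero] at h5' p16
    rw [h5', eval_ite, eval_ite]
    clear h5' h16
    simp only [eval_arr, eval_var, eval_const, Store.setv_var, Store.get_setv, ne_eq,
      OfNat.ofNat_ne_zero, not_false_eq_true, if_true, Ht1.get_zero, h5, eval_loc,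
      Function.update_self, Nat.reduceEqDiff, if_false, hg3] at p16 ⊢
    by_cases hu : t.arr 5 0 u = 0
    · rw [if_neg (not_not.2 hu)]
      rcases p16 with ⟨p1, p2⟩ | ⟨j, p1, p2⟩
      · rw [if_neg (not_not.2 p1)]
        refine ⟨Or.inl rfl, fun hd => ?_⟩
        exfalso
        have hd' : G.dist ⟨0, hpos⟩ u = k + 1 := by
          have h' : ¬ G.dist ⟨0, hpos⟩ u ≤ k := fun h' => (hI u).2 h' hu
          omega
        obtain ⟨x, hx1, hx2⟩ := hG.exists_adj_dist hd'
        obtain ⟨j, rfl⟩ := (hadj _ _).1 hx1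
        exact p2 j ((hI _).2 hx2.le)
      · rw [if_pos (by omega)]
        have hx := (hadj u (nb j u)).2 ⟨j, rfl⟩
        obtain ⟨x, hxe⟩ : ∃ x, x = nb j u := ⟨_, rfl⟩
        rw [← hxe] at hx p1 p2
        have hax : t.arr 5 0 x = a x + 1 := (hI x).1.resolve_left p1
        have hX : ∀ l : Fin (2 * h), eval ((t1.setv 20 0).setv 21 u) (arr 3 (loc 0)
            (sub (arr 5 (const 0) (sub (arr 16 (const 0) (var 21)) (const 1))) (const 1))) 1
            (Function.update (fun _ => 0) 0 l) = nb l (a x) := by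
          intro l
          simp [Store.setv_var, Store.get_setv, hg3', Ht1.get_zero, h5, p2, hax]
        have p5 := eval_pickV (s := (t1.setv 20 0).setv 21 u) (b := 2) (a := 2 * h)
          (by simp [Store.setv_var, Ht1.v2]) (eqE (arr 4 (var 21) (arr 3 (loc 0)
            (sub (arr 5 (const 0) (sub (arr 16 (const 0) (var 21)) (const 1))) (const 1)))) (var 5))
          (arr 3 (loc 0) (sub (arr 5 (const 0) (sub (arr 16 (const 0) (var 21)) (const 1)))
            (const 1))) 0 (fun _ => 0) (P := fun l => nb l (a x) = a u) (fun l => by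
            rw [truth_eqE, eval_arr, hX]
            simp only [eval_var, Store.setv_var, Store.get_setv, ne_eq, OfNat.ofNat_ne_zero,
              not_false_eq_true, if_true, Nat.reduceEqDiff, if_false, Ht1.get_fin, Ht1.a4, Ht1.v5]
            -- The truncated distance decides the rule, since the cap is larger than `n - r + 2`.
            rw [← hL.anti_rule hG ha hx.symm ((hadj (a x) _).2 ⟨l, rfl⟩)]
            omega)
        rcases p5 with ⟨q1, q2⟩ | ⟨l, q1, q2⟩
        · exfalso
          obtain ⟨l, hl⟩ := (hadj (a x) (a u)).1 (hL.adj_anti ha hx.symm)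
          exact q2 l hl
        · rw [q2, hX, q1]
          exact ⟨Or.inr rfl, fun _ => by omega⟩
    · rw [if_pos hu]
      exact ⟨(hI u).1, fun _ => hu⟩
  have H2 : Ctx G n h nb s2 := by rw [hs2]; exact H1.den _ (by decide)
  have h3 := den_upd (k := 5) (e := sub (arr 5 (const 0) (var 21)) (const 1)) H2.v0 H2.v1 H2.v0
    hpos le_rfl (by decide) 0 v
  have hden : antipodes.den s = (upd 5 1 0 (sub (arr 5 (const 0) (var 21)) (const 1))).den s2 := by
    rw [hs2, hs1, antipodes, den, den]
  simp only [Fin.val_zero] at h3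
  rw [hden, h3]
  have h4 := (h2 v).1.resolve_left ((h2 v).2 (by rw [H1.v0]; exact (hG.dist_lt_card _ _).le))
  simp [Store.setv_var, Store.get_setv, H2.get_zero, h4]

/-- The pairs whose zero-supports differ by one exchange, in the matrix `6`. -/
def exchanges : Cmd :=
  fill 6 0 0 (andE (eqE (add (arr 4 (var 20) (var 21)) (arr 4 (var 21) (arr 5 (const 0) (var 20))))
    (var 5)) (andE (arr 4 (var 20) (var 21)) (notE (eqE (arr 4 (var 20) (var 21)) (var 5)))))

theorem den_exchanges (hL : IsOMLabeling G n (h + 1) L) (hG : G.Connected)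
    {a : Fin N → Fin N} (ha : ∀ v, L (a v) = -L v) {s : Store} (H : Ctx G n h nb s)
    (hA : ∀ v : Fin N, s.arr 5 0 v = a v) (u v : Fin N) :
    (exchanges.den s).arr 6 u v ≠ 0 ↔ Exchange L u v := by
  rw [exchanges, den_fill_fin H.v0 H.v0 H.v0 le_rfl le_rfl (by decide), truth_andE, truth_andE,
    truth_notE, truth_eqE, truth_eqE]
  simp only [eval_add, eval_arr, eval_var, eval_const, Store.setv_var, Store.get_setv, ne_eq,
    OfNat.ofNat_ne_zero, not_false_eq_true, if_true, Nat.reduceEqDiff, if_false, H.get_zero, hA,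
    H.get_fin, H.a4, H.v5]
  unfold Exchange
  rw [hL.coline_iff hG ha]
  have := hL.le_size u
  omega

end

end RAM


/-! ## The elements of the ground set -/

namespace IsOMLabeling

variable {N : ℕ} {G : SimpleGraph (Fin N)} {n r : ℕ} {L : Fin N → SignVec n}
  (hL : IsOMLabeling G n r L) (hG : G.Connected) {a : Fin N → Fin N} (ha : ∀ v, L (a v) = -L v)
include hL hG ha

theorem dist_le_of_exchange {v w : Fin N} (h : Exchange L v w) : G.dist v w ≤ n - r + 2 := by
  have := (hL.coline_iff hG ha).1 h
  omega

/-- The first `h` names stand for the zeros of `v`, through the lines, and the others for its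
support, through the vertices behind `u`. Distinct vertices name distinct elements, and an injective
self-map of a finite set is bijective. The dictionary `π` is used only in the proof, the program
works with the names. -/
theorem exists_elements {v : Fin N} {h : ℕ} {U : Fin h → Fin N}
    (hU : Function.Injective U) (hU' : ∀ e, IsFirst G L a v (U e)) {u : Fin N} (hu : G.Adj v u)
    {p : Fin (n - h) → Fin N} (hp : Function.Injective p) (hp' : ∀ j, Behind G L v u (p j)) :
    ∃ π : Fin n → Fin n, Function.Bijective π ∧
      (∀ (e : Fin n) (he : (e : ℕ) < h), L v (π e) = 0 ∧ L (U ⟨e, he⟩) (π e) ≠ 0) ∧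
      ∀ (e : Fin n) (he : h ≤ (e : ℕ)), L v (π e) ≠ 0 ∧ L (p ⟨e - h, by omega⟩) (π e) = 0 := by
  have h1 : ∀ e : Fin n, ∃ i, (∀ he : (e : ℕ) < h, L v i = 0 ∧ L (U ⟨e, he⟩) i ≠ 0) ∧
      ∀ he : h ≤ (e : ℕ), L v i ≠ 0 ∧ L (p ⟨e - h, by omega⟩) i = 0 := by
    intro e
    by_cases he : (e : ℕ) < h
    · obtain ⟨i, -, g1, g2, -⟩ := hL.exchange_zeros (hL.exchange_of_adj (hU' ⟨e, he⟩).1)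
      exact ⟨i, fun _ => ⟨g1, g2⟩, fun he' => by omega⟩
    · obtain ⟨-, b, -, -, g1, g2, -⟩ := hL.exchange_zeros (hp' ⟨e - h, by omega⟩).1
      exact ⟨b, fun he' => absurd he' he, fun _ => ⟨g2, g1⟩⟩
  choose π hπ1 hπ2 using h1
  refine ⟨π, Finite.injective_iff_bijective.1 ?_, hπ1, hπ2⟩
  intro e e' hee
  by_cases he : (e : ℕ) < h
  · by_cases he' : (e' : ℕ) < h
    · have g1 := hπ1 e he
      have g2 := hπ1 e' he'
      rw [← hee] at g2
      have := hU (hL.isFirst_unique hG ha (hU' _) (hU' _) g1.1 g1.2 g2.2)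
      simpa [Fin.ext_iff] using this
    · exact absurd (hee ▸ (hπ1 e he).1) (hπ2 e' (by omega)).1
  · by_cases he' : (e' : ℕ) < h
    · exact absurd (hee ▸ (hπ1 e' he').1) (hπ2 e (by omega)).1
    · have g1 := hπ2 e (by omega)
      have g2 := hπ2 e' (by omega)
      rw [← hee] at g2
      have := hp (hL.behind_unique hG hu (hp' _) (hp' _) g1.1 g1.2 g2.2)
      rw [Fin.ext_iff] at this ⊢
      simp only at this
      omega

end IsOMLabeling

namespace RAM

open RAM.Expr RAM.Cmd

/-- The memory after the computation of the antipodes `a` and the exchanges. -/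
structure Ctx' {N : ℕ} (G : SimpleGraph (Fin N)) (n h : ℕ) (nb : Fin (2 * h) → Fin N → Fin N)
    (L : Fin N → SignVec n) (a : Fin N → Fin N) (s : Store) : Prop extends Ctx G n h nb s where
  a5 : ∀ v : Fin N, s.arr 5 0 v = a v
  a6 : ∀ u v : Fin N, s.arr 6 u v ≠ 0 ↔ Exchange L u v

section

variable {N : ℕ} {G : SimpleGraph (Fin N)} {n h : ℕ} {nb : Fin (2 * h) → Fin N → Fin N}
  {L : Fin N → SignVec n} {a : Fin N → Fin N}

theorem Ctx'.congr {s t : Store} (H : Ctx' G n h nb L a s) (hv : ∀ x < 8, t.var x = s.var x)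
    (ha : ∀ k < 7, k ≠ 1 → k ≠ 2 → t.arr k = s.arr k) : Ctx' G n h nb L a t where
  toCtx := H.toCtx.congr hv fun k hk => ha k (by omega)
  a5 := by rw [ha 5 (by omega) (by omega) (by omega)]; exact H.a5
  a6 := by rw [ha 6 (by omega) (by omega) (by omega)]; exact H.a6

theorem Ctx'.den {s : Store} (H : Ctx' G n h nb L a s) (p : Cmd)
    (hp : (∀ x < 8, x ∉ p.wv) ∧ ∀ k < 7, k ≠ 1 → k ≠ 2 → k ∉ p.wa) : Ctx' G n h nb L a (p.den s) :=
  H.congr (fun x hx => den_var p s (hp.1 x hx)) fun k hk h1 h2 => den_arr p s (hp.2 k hk h1 h2)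

namespace Expr

/-- The vertex `y` lies behind the neighbour `u` of the vertex `0`. -/
def behindE (u y : Expr) : Expr :=
  andE (arr 6 (const 0) y) (eqE (arr 4 (const 0) y) (add (const 1) (arr 4 u y)))

end Expr

/-- Vertices that differ by an exchange have a distance below the cap, so truncation does not affect
the equation between distances. -/
theorem truth_behindE (hL : IsOMLabeling G n (h + 1) L) (hG : G.Connected)
    (ha : ∀ v, L (a v) = -L v) (hpos : 0 < N) {s t : Store} (H : Ctx' G n h nb L a s)
    (ht : t.get = s.get) {e f : Expr} {d : ℕ} {ρ : ℕ → ℕ} {u y : Fin N} (he : eval t e d ρ = u)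
    (hf : eval t f d ρ = y) : eval t (behindE e f) d ρ ≠ 0 ↔ Behind G L ⟨0, hpos⟩ u y := by
  have h4 := H.a4 ⟨0, hpos⟩ y
  have h6 := H.a6 ⟨0, hpos⟩ y
  rw [behindE, truth_andE, truth_eqE]
  simp only [eval_arr, eval_const, eval_add, he, hf, ht, H.get_zero, H.get_fin] at h4 h6 ⊢
  refine and_congr h6 Iff.rfl |>.trans (and_congr_right fun hy => ?_)
  have h2 := hL.dist_le_of_exchange hG ha hy
  have h3 := hL.le_size y
  rw [h4, H.a4]
  omega

open Classical in
theorem den_collect_zero {k : ℕ} {c : Expr} {s : Store} (hN : s.var 0 = N) (hpos : 0 < N)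
    {P : Fin N → Prop} (hP : ∀ (w : Fin N) (t : Store), (∀ y < 20, t.var y = s.var y) →
      t.var 21 = w → (∀ k', k' ≠ k → t.arr k' = s.arr k') → (c.eval t 0 (fun _ => 0) ≠ 0 ↔ P w))
    {m : ℕ} (hm : m ≤ (Finset.univ.filter P).card) : ∃ f : Fin m → Fin N, Function.Injective f ∧
      (∀ j, P (f j)) ∧
      ∀ j : Fin m, ((seq (set 20 (const 0)) (collect k c)).den s).arr k j 0 = f j := by
  have hcard : ((Finset.range N).filter fun w => ∃ h : w < N, P ⟨w, h⟩).card =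
      (Finset.univ.filter P).card := by
    rw [card_filter_range]
    congr 1
    ext w
    simp
  obtain ⟨-, c1, c2, -, -⟩ := den_collect (k := k) (c := c) (s := s.setv 20 0) (N := N)
    (by simpa [Store.setv_var] using hN) (by simpa [Store.setv_var] using hpos)
    (fun w => ∃ h : w < N, P ⟨w, h⟩) (by
      intro w hw t hv htw ht
      rw [hP ⟨w, hw⟩ t (fun y hy => by
        rw [hv y (by omega) (by omega), Store.setv_var, if_neg (by omega)]) htw ht]
      simp [hw])
  rw [hcard] at c1 c2
  simp only [Store.setv_var, if_true] at c1 c2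
  refine ⟨fun j => ⟨_, (c1 j (by omega)).1⟩, ?_, fun j => (c1 j (by omega)).2.2, fun j => rfl⟩
  intro j j' hjj
  simp only [Fin.mk.injEq] at hjj
  rcases lt_trichotomy (j : ℕ) j' with hlt | heq | hlt
  · have := c2 j j' hlt (by omega); omega
  · exact Fin.ext heq
  · have := c2 j' j hlt (by omega); omega

/-- The neighbours of the vertex `0` that are first in their line, in the matrix `7`. -/
def firsts : Cmd :=
  seq (set 20 (const 0)) (collect 7 (andE (arr 0 (const 0) (var 21)) (notE (exE 0
    (andE (ltE (loc 0) (var 21)) (andE (arr 0 (const 0) (loc 0))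
      (behindE (var 21) (arr 5 (const 0) (loc 0)))))))))

theorem den_firsts (hL : IsOMLabeling G n (h + 1) L) (hG : G.Connected)
    (ha : ∀ v, L (a v) = -L v) (hpos : 0 < N) {s : Store} (H : Ctx' G n h nb L a s) :
    ∃ U : Fin h → Fin N, Function.Injective U ∧ (∀ e, IsFirst G L a ⟨0, hpos⟩ (U e)) ∧
      ∀ e : Fin h, (firsts.den s).arr 7 e 0 = U e := by
  classical
  refine den_collect_zero H.v0 hpos (P := IsFirst G L a ⟨0, hpos⟩) (fun w t hv htw ht => ?_) (by
    simpa using hL.le_card_isFirst hG ha ⟨0, hpos⟩)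
  have Ht : Ctx' G n h nb L a t := H.congr (fun x hx => hv x (by omega)) fun k hk _ _ =>
    ht k (by omega)
  have h0 := Ht.a0 ⟨0, hpos⟩
  rw [truth_andE, truth_notE, truth_exE, Ht.v0, exists_lt_iff_fin]
  simp only [eval_arr, eval_const, eval_var, htw, Ht.get_zero]
  refine and_congr (h0 w) ?_
  rw [not_exists]
  refine forall_congr' fun u' => ?_
  rw [truth_andE, truth_andE, truth_behindE hL hG ha hpos Ht rfl (u := w) (y := a u')
    (by simp [htw]) (by simp [Ht.get_zero, Ht.a5]), truth_ltE]
  simp only [eval_arr, eval_const, eval_var, eval_loc, Function.update_self, htw, Ht.get_zero,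
    Fin.val_fin_lt]
  rw [← h0 u']
  simp only [not_and]

/-- The vertices behind the first neighbour of the vertex `0`, in the matrix `8`. -/
def behinds : Cmd :=
  seq (set 20 (const 0)) (collect 8 (behindE (arr 7 (const 0) (const 0)) (var 21)))

theorem den_behinds (hL : IsOMLabeling G n (h + 1) L) (hG : G.Connected)
    (ha : ∀ v, L (a v) = -L v) (hpos : 0 < N) {s : Store} (H : Ctx' G n h nb L a s) {u : Fin N}
    (hu : G.Adj ⟨0, hpos⟩ u) (h7 : s.arr 7 0 0 = u) :
    ∃ p : Fin (n - h) → Fin N, Function.Injective p ∧ (∀ e, Behind G L ⟨0, hpos⟩ u (p e)) ∧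
      ∀ j : Fin (n - h), (behinds.den s).arr 8 j 0 = p j := by
  classical
  have hs := hL.le_size u
  have hc := hL.le_card_behind hG hu
  refine den_collect_zero H.v0 hpos (P := Behind G L ⟨0, hpos⟩ u) (fun w t hv htw ht => ?_)
    (le_trans (by omega) hc)
  have Ht : Ctx' G n h nb L a t := H.congr (fun x hx => hv x (by omega)) fun k hk _ _ =>
    ht k (by omega)
  refine truth_behindE hL hG ha hpos Ht rfl ?_ (by simp [htw])
  simp only [eval_arr, eval_const]
  rw [Store.get_eq Ht.v0 7 hpos hpos, ht 7 (by omega), h7]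

end

end RAM


/-! ## The zero-supports -/

namespace RAM

open RAM.Expr RAM.Cmd

/-- The zero-supports of the vertices of level at most one, in the matrix `9`. -/
def zerosInit : Cmd :=
  fill 9 0 4 (Expr.ite (ltE (var 21) (var 3))
    (orE (eqE (var 20) (const 0)) (orE (eqE (var 20) (arr 5 (const 0) (const 0)))
      (andE (arr 6 (const 0) (var 20)) (andE (notE (behindE (arr 7 (var 21) (const 0)) (var 20)))
        (notE (behindE (arr 7 (var 21) (const 0)) (arr 5 (const 0) (var 20))))))))
    (andE (arr 6 (const 0) (var 20)) (orE (eqE (var 20) (arr 8 (sub (var 21) (var 3)) (const 0)))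
      (orE (eqE (arr 5 (const 0) (var 20)) (arr 8 (sub (var 21) (var 3)) (const 0)))
        (andE (arr 6 (var 20) (arr 8 (sub (var 21) (var 3)) (const 0)))
          (andE (notE (behindE (arr 7 (const 0) (const 0)) (var 20)))
            (notE (behindE (arr 7 (const 0) (const 0)) (arr 5 (const 0) (var 20))))))))))

/-- The levels, in the first row of the matrix `10`. -/
def levels : Cmd :=
  seq (fill 10 1 0 (Expr.ite (orE (eqE (var 21) (const 0))
      (eqE (var 21) (arr 5 (const 0) (const 0)))) (const 0) (add (var 7) (const 1))))
    (rep 10 7 (upd 10 1 0 (Expr.ite (ltE (var 10) (arr 10 (const 0) (var 21)))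
      (Expr.ite (exE 0 (andE (arr 6 (loc 0) (var 21)) (eqE (arr 10 (const 0) (loc 0)) (var 10))))
        (add (var 10) (const 1)) (add (var 7) (const 1))) (arr 10 (const 0) (var 21)))))

/-- The zero-supports of all vertices, by increasing level. -/
def zerosStep : Cmd :=
  rep 10 7 (upd 9 0 4 (Expr.ite (eqE (arr 10 (const 0) (var 20)) (add (var 10) (const 2)))
    (Expr.ite (ltE (var 21) (var 3))
      (notE (exE 0 (andE (arr 6 (loc 0) (var 20)) (andE (eqE (arr 10 (const 0) (loc 0))
        (add (var 10) (const 1))) (notE (arr 9 (loc 0) (var 21)))))))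
      (exE 0 (andE (arr 6 (loc 0) (var 20)) (andE (eqE (arr 10 (const 0) (loc 0))
        (add (var 10) (const 1))) (arr 9 (loc 0) (var 21))))))
    (arr 9 (var 20) (var 21))))

section

variable {N : ℕ} {G : SimpleGraph (Fin N)} {n h : ℕ} {nb : Fin (2 * h) → Fin N → Fin N}
  {L : Fin N → SignVec n} {a : Fin N → Fin N}

theorem level_eq_zero_iff (hL : IsOMLabeling G n (h + 1) L) (ha : ∀ v, L (a v) = -L v)
    {v y : Fin N} : ((L y).zeros \ (L v).zeros).card = 0 ↔ y = v ∨ y = a v := by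
  constructor
  · intro h0
    rw [Finset.card_eq_zero, Finset.sdiff_eq_empty_iff_subset] at h0
    exact hL.eq_or_eq_anti ha (Finset.eq_of_subset_of_card_le h0 (hL.card_zeros_eq v y).le)
  · rintro (rfl | rfl)
    · simp
    · rw [ha, SignVec.zeros_neg]; simp

theorem den_zerosInit (hL : IsOMLabeling G n (h + 1) L) (hG : G.Connected)
    (ha : ∀ v, L (a v) = -L v) (hpos : 0 < N) (hnN : n ≤ N) {s : Store} (H : Ctx' G n h nb L a s)
    (hh : 0 < h) {U : Fin h → Fin N} (hU : ∀ e, IsFirst G L a ⟨0, hpos⟩ (U e))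
    (h7 : ∀ e : Fin h, s.arr 7 e 0 = U e) {p : Fin (n - h) → Fin N}
    (hp : ∀ j, Behind G L ⟨0, hpos⟩ (U ⟨0, hh⟩) (p j)) (h8 : ∀ j : Fin (n - h), s.arr 8 j 0 = p j)
    {π : Fin n → Fin n}
    (hπ1 : ∀ (e : Fin n) (he : (e : ℕ) < h), L ⟨0, hpos⟩ (π e) = 0 ∧ L (U ⟨e, he⟩) (π e) ≠ 0)
    (hπ2 : ∀ (e : Fin n) (he : h ≤ (e : ℕ)), L ⟨0, hpos⟩ (π e) ≠ 0 ∧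
      L (p ⟨e - h, by omega⟩) (π e) = 0) (y : Fin N) (e : Fin n)
    (hy : ((L y).zeros \ (L ⟨0, hpos⟩).zeros).card ≤ 1) :
    (zerosInit.den s).arr 9 y e ≠ 0 ↔ L y (π e) = 0 := by
  rw [zerosInit, den_fill_fin H.v0 H.v0 H.v4 le_rfl hnN (by decide)]
  obtain ⟨t, ht⟩ : ∃ t, t = (s.setv 20 y).setv 21 e := ⟨_, rfl⟩
  have htg : t.get = s.get := by rw [ht, Store.get_setv _ (by omega), Store.get_setv _ (by omega)]
  have t20 : t.var 20 = y := by simp [ht, Store.setv_var]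
  have t21 : t.var 21 = e := by simp [ht, Store.setv_var]
  have t3 : t.var 3 = h := by simp [ht, Store.setv_var, H.v3]
  rw [← ht]
  have hsz := hL.le_size y
  have g7 : ∀ (e : ℕ) (he : e < h), s.get 7 e 0 = U ⟨e, he⟩ := fun e he => by
    rw [Store.get_eq H.v0 7 (by omega) hpos, h7 ⟨e, he⟩]
  have g8 : ∀ (j : ℕ) (hj : j < n - h), s.get 8 j 0 = p ⟨j, hj⟩ := fun j hj => by
    rw [Store.get_eq H.v0 8 (by omega) hpos, h8 ⟨j, hj⟩]
  have g5 : s.get 5 0 0 = a ⟨0, hpos⟩ := by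
    rw [Store.get_eq H.v0 5 hpos hpos, ← H.a5 ⟨0, hpos⟩]
  have g6 : s.arr 6 0 y ≠ 0 ↔ Exchange L ⟨0, hpos⟩ y := H.a6 ⟨0, hpos⟩ y
  have hv0 : ∀ x : Fin N, (x : ℕ) = 0 ↔ x = ⟨0, hpos⟩ := fun x => by rw [Fin.ext_iff]
  have hlev := level_eq_zero_iff hL ha (v := ⟨0, hpos⟩) (y := y)
  have hlev1 : Exchange L ⟨0, hpos⟩ y ↔ ((L y).zeros \ (L ⟨0, hpos⟩).zeros).card = 1 :=
    hL.exchange_comm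
  by_cases he : (e : ℕ) < h
  · rw [eval_ite, if_pos ((truth_ltE _ _ _ _ _).2 (by simp [t21, t3, he]))]
    rw [truth_orE, truth_orE, truth_andE, truth_andE, truth_notE, truth_notE, truth_eqE, truth_eqE,
      truth_behindE hL hG ha hpos H htg (u := U ⟨e, he⟩) (y := y) (by simp [t21, htg, g7 e he])
        (by simp [t20]),
      truth_behindE hL hG ha hpos H htg (u := U ⟨e, he⟩) (y := a y) (by simp [t21, htg, g7 e he])
        (by simp [t20, htg, H.get_zero, H.a5])]
    simp only [eval_var, eval_const, eval_arr, htg, t20, g5, hv0, ← Fin.ext_iff]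
    by_cases hy0 : ((L y).zeros \ (L ⟨0, hpos⟩).zeros).card = 0
    · rw [← or_assoc]
      refine iff_of_true (Or.inl (hlev.1 hy0)) ?_
      rcases hlev.1 hy0 with h1 | h1
      · rw [h1]; exact (hπ1 e he).1
      · rw [h1, ha, Pi.neg_apply, (hπ1 e he).1]; rfl
    · have hex := hlev1.2 (by omega)
      rw [hL.zero_iff_not_behind hG ha (hU ⟨e, he⟩).1 hex (hπ1 e he).1 (hπ1 e he).2, H.get_zero,
        g6]
      rw [← or_assoc, or_iff_right (mt hlev.2 hy0), and_iff_right hex]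
  · have heh : h ≤ (e : ℕ) := by omega
    have hj : (e : ℕ) - h < n - h := by omega
    rw [eval_ite, if_neg (mt (truth_ltE _ _ _ _ _).1 (by simp [t21, t3, heh]))]
    rw [truth_andE, truth_orE, truth_orE, truth_andE, truth_andE, truth_notE, truth_notE, truth_eqE,
      truth_eqE,
      truth_behindE hL hG ha hpos H htg (u := U ⟨0, hh⟩) (y := y) (by simp [htg, g7 0 hh])
        (by simp [t20]),
      truth_behindE hL hG ha hpos H htg (u := U ⟨0, hh⟩) (y := a y) (by simp [htg, g7 0 hh])
        (by simp [t20, htg, H.get_zero, H.a5])]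
    simp only [eval_var, eval_const, eval_arr, eval_sub, htg, t20, t21, t3, g8 _ hj,
      H.get_zero, H.a5, H.get_fin, H.a6, ← Fin.ext_iff]
    rw [g6]
    by_cases hy0 : ((L y).zeros \ (L ⟨0, hpos⟩).zeros).card = 0
    · have hex : ¬ Exchange L ⟨0, hpos⟩ y := by rw [hlev1]; omega
      refine iff_of_false (fun h => hex h.1) ?_
      rcases hlev.1 hy0 with h1 | h1
      · rw [h1]; exact (hπ2 e heh).1
      · rw [h1, ha, Pi.neg_apply]
        simpa using (hπ2 e heh).1
    · have hex := hlev1.2 (by omega)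
      rw [hL.zero_iff_behind hG ha (hU ⟨0, hh⟩).1 (hp _) hex (hπ2 e heh).1 (hπ2 e heh).2,
        and_iff_right hex]

/-- One exchange changes the level by at most one, and each positive level has an exchange to the
previous one. So levels are found by breadth-first search over exchanges from the vertex `0` and its
antipode; `K + 1`, larger than any level, means unknown. -/
theorem den_levels (hL : IsOMLabeling G n (h + 1) L) (ha : ∀ v, L (a v) = -L v) (hpos : 0 < N)
    {s : Store} (H : Ctx' G n h nb L a s) (y : Fin N) :
    (levels.den s).arr 10 0 y = ((L y).zeros \ (L ⟨0, hpos⟩).zeros).card := by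
  obtain ⟨B, hBdef⟩ : ∃ B, B = (L ⟨0, hpos⟩).zeros := ⟨_, rfl⟩
  have hB : B.card + 1 = h + 1 := hBdef ▸ hL.card_zeros _
  obtain ⟨s1, hs1⟩ : ∃ s1, s1 = (fill 10 1 0 (Expr.ite (orE (eqE (var 21) (const 0))
      (eqE (var 21) (arr 5 (const 0) (const 0)))) (const 0) (add (var 7) (const 1)))).den s :=
    ⟨_, rfl⟩
  have H1 : Ctx' G n h nb L a s1 := by rw [hs1]; exact H.den _ (by decide)
  obtain ⟨K, hK⟩ : ∃ K, K = min h (n - h) := ⟨_, rfl⟩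
  have h0 : ∀ y : Fin N, s1.arr 10 0 y = if ((L y).zeros \ B).card ≤ 0 then
      ((L y).zeros \ B).card else K + 1 := by
    intro y
    have := den_fill_fin (k := 10) (e := Expr.ite (orE (eqE (var 21) (const 0))
      (eqE (var 21) (arr 5 (const 0) (const 0)))) (const 0) (add (var 7) (const 1)))
      H.v0 H.v1 H.v0 hpos le_rfl (by decide) 0 y
    rw [← hs1, eval_ite] at this
    simp only [Fin.val_zero] at this
    rw [this]
    have c := truth_orE ((s.setv 20 0).setv 21 y) (eqE (var 21) (const 0))
      (eqE (var 21) (arr 5 (const 0) (const 0))) 0 fun _ => 0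
    have g5 : s.get 5 0 0 = a ⟨0, hpos⟩ := by
      rw [Store.get_eq H.v0 5 hpos hpos, ← H.a5 ⟨0, hpos⟩]
    have hv0 : ∀ x : Fin N, (x : ℕ) = 0 ↔ x = ⟨0, hpos⟩ := fun x => by rw [Fin.ext_iff]
    simp only [truth_eqE, eval_var, eval_const, eval_arr, Store.setv_var, if_true, Store.get_setv,
      ne_eq, OfNat.ofNat_ne_zero, not_false_eq_true, g5, hv0, ← Fin.ext_iff,
      ← level_eq_zero_iff hL ha, ← hBdef] at c
    by_cases hy : ((L y).zeros \ B).card = 0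
    · rw [if_pos (c.2 hy), if_pos hy.le, hy]; rfl
    · rw [if_neg (mt c.1 hy), if_neg (by omega)]
      simp [Store.setv_var, H.v7, hK]
  have := rep_induction (x := 10) (b := 7) (s := s1) (p := upd 10 1 0
    (Expr.ite (ltE (var 10) (arr 10 (const 0) (var 21)))
      (Expr.ite (exE 0 (andE (arr 6 (loc 0) (var 21)) (eqE (arr 10 (const 0) (loc 0)) (var 10))))
        (add (var 10) (const 1)) (add (var 7) (const 1))) (arr 10 (const 0) (var 21))))
    (fun k t => ∀ y : Fin N, t.arr 10 0 y = if ((L y).zeros \ B).card ≤ k then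
      ((L y).zeros \ B).card else K + 1) (fun _ _ _ h => h) h0 ?_
  · have hden : levels.den s = (rep 10 7 (upd 10 1 0
      (Expr.ite (ltE (var 10) (arr 10 (const 0) (var 21)))
      (Expr.ite (exE 0 (andE (arr 6 (loc 0) (var 21)) (eqE (arr 10 (const 0) (loc 0)) (var 10))))
        (add (var 10) (const 1)) (add (var 7) (const 1))) (arr 10 (const 0) (var 21))))).den s1 := by
      rw [hs1, levels, Cmd.den]
    have hle := hL.card_sdiff_le hB y
    rw [hden, this y, H1.v7, ← hBdef, if_pos]
    have := hL.le_size y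
    omega
  · intro k hk t hv ht htk hI y
    have Ht : Ctx' G n h nb L a t := H1.congr (fun x hx => hv x (by omega) (by revert x; decide))
      fun x hx _ _ => ht x (by revert x; decide)
    rw [H1.v7] at hk
    have h1 := den_upd (k := 10) (e := Expr.ite (ltE (var 10) (arr 10 (const 0) (var 21)))
      (Expr.ite (exE 0 (andE (arr 6 (loc 0) (var 21)) (eqE (arr 10 (const 0) (loc 0)) (var 10))))
        (add (var 10) (const 1)) (add (var 7) (const 1))) (arr 10 (const 0) (var 21)))
      Ht.v0 Ht.v1 Ht.v0 hpos le_rfl (by decide) 0 y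
    simp only [Fin.val_zero] at h1
    rw [h1, eval_ite, eval_ite]
    have c1 := truth_ltE ((t.setv 20 0).setv 21 y) (var 10) (arr 10 (const 0) (var 21)) 0 fun _ => 0
    have c2 := truth_exE ((t.setv 20 0).setv 21 y) (andE (arr 6 (loc 0) (var 21))
      (eqE (arr 10 (const 0) (loc 0)) (var 10))) 0 (fun _ => 0) 0
    simp only [truth_andE, truth_eqE, Store.setv_var, OfNat.ofNat_ne_zero, OfNat.zero_ne_ofNat,
      ne_eq, not_false_eq_true, Store.get_setv, eval_arr, eval_var, eval_loc, eval_const,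
      Function.update_self, if_true, Nat.reduceEqDiff, if_false, Ht.v0, exists_lt_iff_fin,
      Ht.get_fin, Ht.get_zero, htk, hI] at c1 c2
    by_cases h2 : ((L y).zeros \ B).card ≤ k
    · rw [if_neg (mt c1.1 (by rw [if_pos h2]; omega)), if_pos (by omega)]
      simp only [eval_arr, eval_const, eval_var, Store.setv_var, if_true, Store.get_setv, ne_eq,
        OfNat.ofNat_ne_zero, not_false_eq_true, Ht.get_zero, hI, if_pos h2]
    · rw [if_pos (c1.2 (by rw [if_neg h2]; omega))]
      by_cases h3 : ((L y).zeros \ B).card = k + 1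
      · obtain ⟨w, w1, w2, -⟩ := hL.exists_level_pred hB h3
        rw [if_pos (c2.2 ⟨w, (Ht.a6 w y).2 w1, by rw [w2, if_pos le_rfl]⟩), if_pos (by omega)]
        simp [Store.setv_var, htk, h3]
      · rw [if_neg, if_neg (by omega)]
        · simp [Store.setv_var, Ht.v7, hK]
        · rw [ne_eq, c2]
          rintro ⟨w, w1, w2⟩
          have h4 := hL.level_le B ((Ht.a6 w y).1 w1)
          split_ifs at w2 with h5 <;> omega

/-- Round `k` treats level `k + 2` by means of level `k + 1`. Levels zero and one come from
`zerosInit`, as the rules for going up a level need a second element to exchange. -/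
theorem den_zerosStep (hL : IsOMLabeling G n (h + 1) L) (hpos : 0 < N) (hnN : n ≤ N) {s : Store}
    (H : Ctx' G n h nb L a s) {π : Fin n → Fin n}
    (hπ : ∀ e : Fin n, (e : ℕ) < h ↔ L ⟨0, hpos⟩ (π e) = 0)
    (h10 : ∀ y : Fin N, s.arr 10 0 y = ((L y).zeros \ (L ⟨0, hpos⟩).zeros).card)
    (h9 : ∀ (y : Fin N) (e : Fin n), ((L y).zeros \ (L ⟨0, hpos⟩).zeros).card ≤ 1 →
      (s.arr 9 y e ≠ 0 ↔ L y (π e) = 0)) (y : Fin N) (e : Fin n) :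
    (zerosStep.den s).arr 9 y e ≠ 0 ↔ L y (π e) = 0 := by
  obtain ⟨B, hBdef⟩ : ∃ B, B = (L ⟨0, hpos⟩).zeros := ⟨_, rfl⟩
  have hB : B.card + 1 = h + 1 := hBdef ▸ hL.card_zeros _
  rw [← hBdef] at h10 h9
  have := rep_induction (x := 10) (b := 7) (s := s) (p := upd 9 0 4 (Expr.ite
    (eqE (arr 10 (const 0) (var 20)) (add (var 10) (const 2)))
    (Expr.ite (ltE (var 21) (var 3))
      (notE (exE 0 (andE (arr 6 (loc 0) (var 20)) (andE (eqE (arr 10 (const 0) (loc 0))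
        (add (var 10) (const 1))) (notE (arr 9 (loc 0) (var 21)))))))
      (exE 0 (andE (arr 6 (loc 0) (var 20)) (andE (eqE (arr 10 (const 0) (loc 0))
        (add (var 10) (const 1))) (arr 9 (loc 0) (var 21))))))
    (arr 9 (var 20) (var 21))))
    (fun k t => ∀ (y : Fin N) (e : Fin n), ((L y).zeros \ B).card ≤ k + 1 →
      (t.arr 9 y e ≠ 0 ↔ L y (π e) = 0)) (fun _ _ _ h => h) h9 ?_
  · have hle := hL.card_sdiff_le hB y
    refine this y e ?_
    have := hL.le_size y
    rw [H.v7]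
    omega
  · intro k hk t hv ht htk hI y e hy
    have Ht : Ctx' G n h nb L a t := H.congr (fun x hx => hv x (by omega) (by revert x; decide))
      fun x hx _ _ => ht x (by revert x; decide)
    have ht10 : t.arr 10 = s.arr 10 := ht 10 (by decide)
    rw [den_upd Ht.v0 Ht.v0 Ht.v4 le_rfl hnN (by decide), eval_ite, eval_ite]
    have g9 : ∀ (y : Fin N) (e : Fin n), t.get 9 y e = t.arr 9 y e := fun y e =>
      Store.get_fin Ht.v0 9 y e le_rfl hnN
    have c1 : eval ((t.setv 20 y).setv 21 e) (eqE (arr 10 (const 0) (var 20))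
        (add (var 10) (const 2))) 0 (fun _ => 0) ≠ 0 ↔ ((L y).zeros \ B).card = k + 2 := by
      simp only [truth_eqE, Store.setv_var, OfNat.ofNat_ne_zero, ne_eq, not_false_eq_true,
        Store.get_setv, eval_arr, eval_var, eval_const, eval_add, if_true, Nat.reduceEqDiff,
        if_false, Ht.get_zero, htk, ht10, h10]
    have c2 : eval ((t.setv 20 y).setv 21 e) (ltE (var 21) (var 3)) 0 (fun _ => 0) ≠ 0 ↔
        (e : ℕ) < h := by
      simp only [truth_ltE, Store.setv_var, ne_eq, eval_var, if_true, Nat.reduceEqDiff, if_false,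
        Ht.v3]
    have c3 : eval ((t.setv 20 y).setv 21 e) (notE (exE 0 (andE (arr 6 (loc 0) (var 20))
        (andE (eqE (arr 10 (const 0) (loc 0)) (add (var 10) (const 1)))
        (notE (arr 9 (loc 0) (var 21))))))) 0 (fun _ => 0) ≠ 0 ↔ ¬ ∃ w : Fin N, t.arr 6 w y ≠ 0 ∧
        ((L w).zeros \ B).card = k + 1 ∧ ¬ t.arr 9 w e ≠ 0 := by
      simp only [truth_andE, truth_eqE, truth_notE, truth_exE, Store.setv_var, OfNat.ofNat_ne_zero,
        OfNat.zero_ne_ofNat, ne_eq, not_false_eq_true, Store.get_setv, eval_arr, eval_var,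
        eval_loc, eval_const, eval_add, Function.update_self, if_true, Nat.reduceEqDiff, if_false,
        Ht.v0, exists_lt_iff_fin, Ht.get_fin, Ht.get_zero, htk, ht10, h10, g9]
    have c4 : eval ((t.setv 20 y).setv 21 e) (exE 0 (andE (arr 6 (loc 0) (var 20))
        (andE (eqE (arr 10 (const 0) (loc 0)) (add (var 10) (const 1)))
        (arr 9 (loc 0) (var 21))))) 0 (fun _ => 0) ≠ 0 ↔ ∃ w : Fin N, t.arr 6 w y ≠ 0 ∧
        ((L w).zeros \ B).card = k + 1 ∧ t.arr 9 w e ≠ 0 := by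
      simp only [truth_andE, truth_eqE, truth_exE, Store.setv_var, OfNat.ofNat_ne_zero,
        OfNat.zero_ne_ofNat, ne_eq, not_false_eq_true, Store.get_setv, eval_arr, eval_var,
        eval_loc, eval_const, eval_add, Function.update_self, if_true, Nat.reduceEqDiff, if_false,
        Ht.v0, exists_lt_iff_fin, Ht.get_fin, Ht.get_zero, htk, ht10, h10, g9]
    by_cases h2 : ((L y).zeros \ B).card = k + 2
    · rw [if_pos (c1.2 h2)]
      by_cases he : (e : ℕ) < h
      · rw [if_pos (c2.2 he), c3,
          hL.zero_iff_of_mem hB h2 (by rw [hBdef, SignVec.mem_zeros]; exact (hπ e).1 he)]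
        simp only [not_exists, not_and]
        refine forall_congr' fun w => ?_
        rw [Ht.a6, not_not]
        refine forall_congr' fun _ => forall_congr' fun hw => ?_
        exact hI w e hw.le
      · rw [if_neg (mt c2.1 he), c4,
          hL.zero_iff_of_notMem hB h2 (by rw [hBdef, SignVec.mem_zeros]; exact mt (hπ e).2 he)]
        refine exists_congr fun w => ?_
        rw [Ht.a6]
        refine and_congr_right fun _ => and_congr_right fun hw => ?_
        exact hI w e hw.le
    · rw [if_neg (mt c1.1 h2)]
      simp only [eval_arr, eval_var, Store.setv_var, if_true, Store.get_setv, ne_eq, if_false,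
        OfNat.ofNat_ne_zero, not_false_eq_true, g9, Nat.reduceEqDiff]
      exact hI y e (by omega)

end

end RAM


/-! ## The signs -/

/-- Since `r ≤ n`, there are `r - 1` elements other than `f`, and these form the zero set of some
cocircuit. -/
theorem IsOMLabeling.exists_apply_ne_zero {N : ℕ} {G : SimpleGraph (Fin N)} {n r : ℕ}
    {L : Fin N → SignVec n} (hL : IsOMLabeling G n r L) (v : Fin N) (f : Fin n) :
    ∃ y, L y f ≠ 0 := by
  have h1 := hL.card_zeros v
  have h2 := hL.le_size v
  obtain ⟨B, hB1, hB2⟩ := Finset.exists_subset_card_eq (s := Finset.univ.erase f) (n := r - 1) (by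
    rw [Finset.card_erase_of_mem (Finset.mem_univ f), Finset.card_univ, Fintype.card_fin]; omega)
  obtain ⟨_, ⟨y, rfl⟩, -, hy⟩ := hL.modular.exists_zeros_eq (B := B) (by omega)
    (fun hf => (Finset.mem_erase.1 (hB1 hf)).1 rfl) (s := 1) (by decide)
  exact ⟨y, by rw [hy]; decide⟩

namespace RAM

open RAM.Expr RAM.Cmd

theorem signCode_ne_zero {s : SignType} : signCode s ≠ 0 ↔ s ≠ 0 := by
  revert s; decide

theorem signCode_neg {s : SignType} (hs : s ≠ 0) : signCode (-s) = 3 - signCode s := by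
  revert s; decide

theorem signCode_mul_self {s : SignType} (hs : s ≠ 0) : signCode (s * s) = 1 := by
  revert s; decide

theorem signCode_mul_neg_self {s : SignType} (hs : s ≠ 0) : signCode (s * -s) = 2 := by
  revert s; decide

/-- A vertex that is nonzero on a given element, in the first row of the matrix `15`. -/
def seeds : Cmd := fill 15 1 4 (sub (pickE 0 0 (notE (arr 9 (loc 0) (var 21)))) (const 1))

/-- The signs of these vertices and of their antipodes, in the matrix `11`. -/
def signsInit : Cmd :=
  fill 11 0 4 (Expr.ite (eqE (var 20) (arr 15 (const 0) (var 21))) (const 1)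
    (Expr.ite (eqE (var 20) (arr 5 (const 0) (arr 15 (const 0) (var 21)))) (const 2) (const 0)))

/-- One round in the propagation of the signs. -/
def signsRound : Cmd :=
  seq (fill 12 0 4 (pickE 0 0 (andE (arr 6 (var 20) (loc 0)) (arr 11 (loc 0) (var 21)))))
    (upd 11 0 4 (Expr.ite (arr 11 (var 20) (var 21)) (arr 11 (var 20) (var 21))
      (Expr.ite (arr 12 (var 20) (var 21)) (Expr.ite (arr 9 (var 20) (var 21)) (const 0)
        (Expr.ite (exE 0 (andE (arr 6 (loc 0) (var 20))
            (andE (arr 6 (loc 0) (sub (arr 12 (var 20) (var 21)) (const 1)))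
            (andE (arr 9 (loc 0) (var 21)) (eqE (add (arr 4 (var 20) (loc 0))
              (arr 4 (loc 0) (sub (arr 12 (var 20) (var 21)) (const 1))))
              (arr 4 (var 20) (sub (arr 12 (var 20) (var 21)) (const 1))))))))
          (sub (const 3) (arr 11 (sub (arr 12 (var 20) (var 21)) (const 1)) (var 21)))
          (arr 11 (sub (arr 12 (var 20) (var 21)) (const 1)) (var 21)))) (const 0))))

section

variable {N : ℕ} {G : SimpleGraph (Fin N)} {n h : ℕ} {nb : Fin (2 * h) → Fin N → Fin N}
  {L : Fin N → SignVec n} {a : Fin N → Fin N}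

theorem den_seeds (hL : IsOMLabeling G n (h + 1) L) (hpos : 0 < N) (hnN : n ≤ N) {s : Store}
    (H : Ctx' G n h nb L a s) {π : Fin n → Fin n}
    (h9 : ∀ (y : Fin N) (e : Fin n), s.arr 9 y e ≠ 0 ↔ L y (π e) = 0) :
    ∃ z : Fin n → Fin N, ∀ e : Fin n, (seeds.den s).arr 15 0 e = z e ∧ L (z e) (π e) ≠ 0 := by
  have key : ∀ e : Fin n, ∃ z : Fin N, (seeds.den s).arr 15 0 e = z ∧ L z (π e) ≠ 0 := by
    intro e
    have h1 := den_fill_fin (k := 15) (e := sub (pickE 0 0 (notE (arr 9 (loc 0) (var 21))))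
      (const 1)) H.v0 H.v1 H.v4 hpos hnN (by decide) 0 e
    simp only [Fin.val_zero] at h1
    rw [seeds, h1, eval_sub, eval_const]
    rcases eval_pickE (s := (s.setv 20 0).setv 21 e) (b := 0) (a := N)
      (by simp [Store.setv_var, H.v0]) (notE (arr 9 (loc 0) (var 21))) 0 (fun _ => 0)
      (P := fun y => L y (π e) ≠ 0) (fun y => by
        refine (truth_notE _ _ _ _).trans (not_congr (Iff.trans ?_ (h9 y e)))
        simp [Store.setv_var, Store.get_setv, Store.get_fin H.v0 9 y e le_rfl hnN])
      with ⟨-, h2⟩ | ⟨y, hy, h2⟩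
    · obtain ⟨y, hy⟩ := hL.exists_apply_ne_zero ⟨0, hpos⟩ (π e)
      exact absurd hy (h2 y)
    · exact ⟨y, by rw [h2]; simp, hy⟩
  choose z hz using key
  exact ⟨z, hz⟩

theorem den_signsInit (hL : IsOMLabeling G n (h + 1) L) (ha : ∀ v, L (a v) = -L v) (hpos : 0 < N)
    (hnN : n ≤ N) {s : Store}
    (H : Ctx' G n h nb L a s) {π : Fin n → Fin n} {z : Fin n → Fin N}
    (hz : ∀ e : Fin n, s.arr 15 0 e = z e ∧ L (z e) (π e) ≠ 0) (y : Fin N) (e : Fin n) :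
    ((signsInit.den s).arr 11 y e = 0 ∨
      (signsInit.den s).arr 11 y e = signCode (L (z e) (π e) * L y (π e))) ∧
    (((L y).zeros \ (L (z e)).zeros).card ≤ 0 → (signsInit.den s).arr 11 y e ≠ 0) := by
  rw [signsInit, den_fill_fin H.v0 H.v0 H.v4 le_rfl hnN (by decide), eval_ite, eval_ite]
  have g15 : s.get 15 0 e = z e := by
    rw [Store.get_eq H.v0 15 hpos (by omega), (hz e).1]
  have c1 : eval ((s.setv 20 y).setv 21 e) (eqE (var 20) (arr 15 (const 0) (var 21))) 0
      (fun _ => 0) ≠ 0 ↔ y = z e := by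
    rw [truth_eqE, Fin.ext_iff]
    simp [Store.setv_var, Store.get_setv, g15]
  have c2 : eval ((s.setv 20 y).setv 21 e) (eqE (var 20) (arr 5 (const 0)
      (arr 15 (const 0) (var 21)))) 0 (fun _ => 0) ≠ 0 ↔ y = a (z e) := by
    rw [truth_eqE, Fin.ext_iff]
    simp [Store.setv_var, Store.get_setv, g15, H.get_zero, H.a5]
  have hne := (hz e).2
  rw [Nat.le_zero, level_eq_zero_iff hL ha]
  by_cases h1 : y = z e
  · rw [if_pos (c1.2 h1), h1, signCode_mul_self hne]
    simp
  · rw [if_neg (mt c1.1 h1)]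
    by_cases h2 : y = a (z e)
    · rw [if_pos (c2.2 h2), h2, ha, Pi.neg_apply, signCode_mul_neg_self hne]
      simp
    · rw [if_neg (mt c2.1 h2)]
      simp [h1, h2]

/-- For each element `e` the levels are taken with respect to the zero set of its own seed, which
does not contain `e`. By `exists_level_pred` a vertex that is nonzero at `e` has a partner one level
lower that is also nonzero, and `mem_sep_iff` tells whether their signs agree. Any partner with a
known sign will do; storing one in matrix `12` first avoids a nested search. -/
theorem den_signsRound (hL : IsOMLabeling G n (h + 1) L) (hG : G.Connected)
    (ha : ∀ v, L (a v) = -L v)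
    (hnN : n ≤ N) {s : Store} (H : Ctx' G n h nb L a s) {π : Fin n → Fin n}
    (h9 : ∀ (y : Fin N) (e : Fin n), s.arr 9 y e ≠ 0 ↔ L y (π e) = 0) {z : Fin n → Fin N}
    (hz : ∀ e : Fin n, L (z e) (π e) ≠ 0) {k : ℕ}
    (hk : ∀ (y : Fin N) (e : Fin n), (s.arr 11 y e = 0 ∨
      s.arr 11 y e = signCode (L (z e) (π e) * L y (π e))) ∧
      (((L y).zeros \ (L (z e)).zeros).card ≤ k → L y (π e) ≠ 0 → s.arr 11 y e ≠ 0))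
    (y : Fin N) (e : Fin n) :
    ((signsRound.den s).arr 11 y e = 0 ∨
      (signsRound.den s).arr 11 y e = signCode (L (z e) (π e) * L y (π e))) ∧
    (((L y).zeros \ (L (z e)).zeros).card ≤ k + 1 → L y (π e) ≠ 0 →
      (signsRound.den s).arr 11 y e ≠ 0) := by
  rw [signsRound, Cmd.den]
  have h12 := den_fill_fin (k := 12) (e := pickE 0 0 (andE (arr 6 (var 20) (loc 0))
    (arr 11 (loc 0) (var 21)))) H.v0 H.v0 H.v4 le_rfl hnN (by decide) y e
  have g11 : ∀ (y : Fin N) (e : Fin n), s.get 11 y e = s.arr 11 y e := fun y e =>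
    Store.get_fin H.v0 11 y e le_rfl hnN
  have p12 := eval_pickE (s := (s.setv 20 y).setv 21 e) (b := 0) (a := N)
    (by simp [Store.setv_var, H.v0]) (andE (arr 6 (var 20) (loc 0)) (arr 11 (loc 0) (var 21))) 0
    (fun _ => 0) (P := fun w => Exchange L y w ∧ s.arr 11 w e ≠ 0) (fun w => by
      rw [truth_andE, ← H.a6]
      simp [Store.setv_var, Store.get_setv, H.get_fin, g11])
  rw [← h12] at p12
  clear h12
  obtain ⟨t, ht⟩ : ∃ t, t = (fill 12 0 4 (pickE 0 0 (andE (arr 6 (var 20) (loc 0))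
    (arr 11 (loc 0) (var 21))))).den s := ⟨_, rfl⟩
  rw [← ht] at p12 ⊢
  have Ht : Ctx' G n h nb L a t := by rw [ht]; exact H.den _ (by decide)
  have t9 : t.arr 9 = s.arr 9 := by rw [ht]; exact den_arr _ _ (by decide)
  have t11 : t.arr 11 = s.arr 11 := by rw [ht]; exact den_arr _ _ (by decide)
  have g : ∀ k (y : Fin N) (e : Fin n), t.get k y e = t.arr k y e := fun k y e =>
    Store.get_fin Ht.v0 k y e le_rfl hnN
  rw [den_upd Ht.v0 Ht.v0 Ht.v4 le_rfl hnN (by decide), eval_ite, eval_ite, eval_ite, eval_ite,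
    eval_sub]
  obtain ⟨t', ht'⟩ : ∃ t', t' = (t.setv 20 y).setv 21 e := ⟨_, rfl⟩
  have e9 : eval t' (arr 9 (var 20) (var 21)) 0 (fun _ => 0) = s.arr 9 y e := by
    simp [ht', Store.setv_var, Store.get_setv, g, t9]
  have e11 : eval t' (arr 11 (var 20) (var 21)) 0 (fun _ => 0) = s.arr 11 y e := by
    simp [ht', Store.setv_var, Store.get_setv, g, t11]
  have e12 : eval t' (arr 12 (var 20) (var 21)) 0 (fun _ => 0) = t.arr 12 y e := by
    simp [ht', Store.setv_var, Store.get_setv, g]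
  rw [← ht', e9, e11, e12, eval_const, eval_const]
  by_cases h11 : s.arr 11 y e = 0
  swap
  · rw [if_pos h11]
    exact ⟨(hk y e).1, fun _ _ => h11⟩
  rw [if_neg (not_not.2 h11)]
  rcases p12 with ⟨p1, p2⟩ | ⟨w, ⟨hw1, hw2⟩, hw3⟩
  · rw [if_neg (not_not.2 p1)]
    refine ⟨Or.inl rfl, fun hy1 hy2 => ?_⟩
    exfalso
    have hy3 : ((L y).zeros \ (L (z e)).zeros).card = k + 1 := by
      have h' : ¬ ((L y).zeros \ (L (z e)).zeros).card ≤ k := fun h' => (hk y e).2 h' hy2 h11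
      omega
    obtain ⟨w, w1, w2, w3⟩ := hL.exists_level_pred (hL.card_zeros (z e)) hy3
    exact p2 w ⟨hL.exchange_comm.1 w1, (hk w e).2 w2.le
      (w3 _ (by rw [SignVec.mem_zeros]; exact hz e) hy2)⟩
  · rw [if_pos (by rw [hw3]; omega)]
    by_cases hy : L y (π e) = 0
    · rw [if_pos ((h9 y e).2 hy)]
      exact ⟨Or.inl rfl, fun _ h => absurd hy h⟩
    rw [if_neg (mt (h9 y e).1 hy)]
    have hcode := (hk w e).1.resolve_left hw2
    have hwc : L (z e) (π e) * L w (π e) ≠ 0 := by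
      rw [← signCode_ne_zero, ← hcode]; exact hw2
    have hw0 : L w (π e) ≠ 0 := right_ne_zero_of_mul hwc
    have eW : eval t' (arr 11 (sub (arr 12 (var 20) (var 21)) (const 1)) (var 21)) 0 (fun _ => 0) =
        s.arr 11 w e := by
      rw [eval_arr, eval_sub, e12, hw3]
      simp [ht', Store.setv_var, Store.get_setv, g, t11]
    have c : eval t' (exE 0 (andE (arr 6 (loc 0) (var 20))
            (andE (arr 6 (loc 0) (sub (arr 12 (var 20) (var 21)) (const 1)))
            (andE (arr 9 (loc 0) (var 21)) (eqE (add (arr 4 (var 20) (loc 0))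
              (arr 4 (loc 0) (sub (arr 12 (var 20) (var 21)) (const 1))))
              (arr 4 (var 20) (sub (arr 12 (var 20) (var 21)) (const 1)))))))) 0 (fun _ => 0) ≠ 0 ↔
        π e ∈ SignVec.sep (L y) (L w) := by
      rw [hL.mem_sep_iff hG hw1 hy, truth_exE, ht']
      simp only [Store.setv_var, OfNat.zero_ne_ofNat, if_false, Ht.v0, exists_lt_iff_fin]
      refine exists_congr fun x => ?_
      have eW' : eval ((t.setv 20 y).setv 21 e) (sub (arr 12 (var 20) (var 21)) (const 1)) 1
          (Function.update (fun _ => 0) 0 x) = w := by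
        simp [Store.setv_var, Store.get_setv, g, hw3]
      rw [truth_andE, truth_andE, truth_andE, truth_eqE]
      simp only [eval_add, eval_arr _ _ (sub _ _), eW']
      simp only [eval_arr, eval_var, eval_loc, Function.update_self, Store.setv_var, Store.get_setv,
        ne_eq, OfNat.ofNat_ne_zero, not_false_eq_true, if_true, Nat.reduceEqDiff, if_false,
        Ht.get_fin, g, t9]
      rw [← ne_eq, ← ne_eq, ← ne_eq, Ht.a6, Ht.a6, h9, Ht.a4, Ht.a4, Ht.a4]
      refine and_congr_right fun hx1 => and_congr_right fun hx2 => and_congr_right fun _ => ?_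
      have d1 := hL.dist_le_of_exchange hG ha hw1
      have d2 := hL.dist_le_of_exchange hG ha hx2
      have d3 := hL.dist_le_of_exchange hG ha (hL.exchange_comm.1 hx1)
      have hsz := hL.le_size y
      omega
    rw [eW]
    by_cases hsep : π e ∈ SignVec.sep (L y) (L w)
    · rw [if_pos (c.2 hsep)]
      have h1 := (SignVec.mem_sep.1 hsep).2
      have h2 : L y (π e) = -L w (π e) := by rw [h1, neg_neg]
      rw [h2, mul_neg, signCode_neg hwc, ← hcode]
      refine ⟨Or.inr rfl, fun _ _ => ?_⟩
      rw [hcode, ← signCode_neg hwc, signCode_ne_zero, ← mul_neg, ← h2]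
      exact mul_ne_zero (hz e) hy
    · rw [if_neg (mt c.1 hsep)]
      have h2 : L y (π e) = L w (π e) := by
        rw [SignVec.mem_sep] at hsep
        revert hsep hy hw0
        generalize L y (π e) = x
        generalize L w (π e) = x'
        revert x x'
        decide
      rw [h2, ← hcode]
      exact ⟨Or.inr rfl, fun _ _ => hw2⟩

theorem den_signs (hL : IsOMLabeling G n (h + 1) L) (hG : G.Connected)
    (ha : ∀ v, L (a v) = -L v) (hpos : 0 < N) (hnN : n ≤ N) {s : Store} (H : Ctx' G n h nb L a s)
    {π : Fin n → Fin n} (h9 : ∀ (y : Fin N) (e : Fin n), s.arr 9 y e ≠ 0 ↔ L y (π e) = 0) :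
    ∃ ε : Fin n → SignType, (∀ e, ε e ≠ 0) ∧ ∀ (y : Fin N) (e : Fin n),
      ((seq seeds (seq signsInit (rep 10 7 signsRound))).den s).arr 11 y e =
        signCode (ε e * L y (π e)) := by
  obtain ⟨z, hz⟩ := den_seeds hL hpos hnN H h9
  refine ⟨fun e => L (z e) (π e), fun e => (hz e).2, fun y e => ?_⟩
  have H1 : Ctx' G n h nb L a (seeds.den s) := H.den _ (by decide)
  have h0 := den_signsInit hL ha hpos hnN H1 hz
  have H2 : Ctx' G n h nb L a (signsInit.den (seeds.den s)) := H1.den _ (by decide)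
  have h2 := rep_induction (x := 10) (b := 7) (s := signsInit.den (seeds.den s)) (p := signsRound)
    (fun k t => ∀ (y : Fin N) (e : Fin n), (t.arr 11 y e = 0 ∨
      t.arr 11 y e = signCode (L (z e) (π e) * L y (π e))) ∧
      (((L y).zeros \ (L (z e)).zeros).card ≤ k → L y (π e) ≠ 0 → t.arr 11 y e ≠ 0))
    (fun _ _ _ h => h) (fun y e => ⟨(h0 y e).1, fun h _ => (h0 y e).2 h⟩) (by
      intro k hk t hv ht htk hI
      have Ht : Ctx' G n h nb L a t := H2.congr (fun x hx => hv x (by omega) (by revert x; decide))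
        fun x hx _ _ => ht x (by revert x; decide)
      have t9 : t.arr 9 = s.arr 9 := by
        rw [ht 9 (by decide), den_arr signsInit _ (by decide), den_arr seeds _ (by decide)]
      exact den_signsRound hL hG ha hnN Ht (by rw [t9]; exact h9) (fun e => (hz e).2) hI)
  obtain ⟨h3, h4⟩ := h2 y e
  rw [Cmd.den, Cmd.den]
  by_cases hy : L y (π e) = 0
  · rcases h3 with h3 | h3
    · rw [h3, hy, mul_zero]; rfl
    · exact h3
  · refine h3.resolve_left (h4 ?_ hy)
    have h5 := hL.card_sdiff_le (hL.card_zeros (z e)) y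
    have h6 := hL.le_size y
    rw [H2.v7]
    omega

end

end RAM


/-! ## Verification -/

theorem SignVec.sep_self {n : ℕ} (X : SignVec n) : SignVec.sep X X = ∅ := by
  rw [Finset.eq_empty_iff_forall_notMem]
  intro e
  rw [SignVec.mem_sep]
  generalize X e = x
  revert x
  decide

theorem IsOMLabeling.card_sdiff_of_symmDiff {N : ℕ} {G : SimpleGraph (Fin N)} {n r : ℕ}
    {L : Fin N → SignVec n} (hL : IsOMLabeling G n r L) {v w : Fin N}
    (h : (symmDiff (L v).zeros (L w).zeros).card = 2) :
    ((L v).zeros \ (L w).zeros).card = 1 := by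
  have h2 := Finset.card_sdiff_comm (hL.card_zeros_eq v w)
  have h3 : (symmDiff (L v).zeros (L w).zeros).card =
      ((L v).zeros \ (L w).zeros).card + ((L w).zeros \ (L v).zeros).card :=
    Finset.card_union_of_disjoint disjoint_sdiff_sdiff
  omega

open SignVec in
/-- Relabelling the ground set and reorientation preserve labelings. -/
theorem IsOMLabeling.reorient {N : ℕ} {G : SimpleGraph (Fin N)} (hG : G.Connected) {n r : ℕ}
    {L : Fin N → SignVec n} (hL : IsOMLabeling G n r L) {π : Fin n → Fin n}
    (hπ : Function.Bijective π) {ε : Fin n → SignType} (hε : ∀ e, ε e ≠ 0) :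
    IsOMLabeling G n r fun v e => ε e * L v (π e) := by
  have hpos : 0 < N := Fin.pos hG.nonempty.some
  have hz : ∀ v, zeros (fun e => ε e * L v (π e)) =
      (L v).zeros.map (Equiv.ofBijective π hπ).symm.toEmbedding := by
    intro v
    ext e
    simp [mem_zeros, Finset.mem_map_equiv, hε e]
  have hs : ∀ v w, sep (fun e => ε e * L v (π e)) (fun e => ε e * L w (π e)) =
      (sep (L v) (L w)).map (Equiv.ofBijective π hπ).symm.toEmbedding := by
    intro v w
    ext e
    simp only [mem_sep, Finset.mem_map_equiv, Equiv.symm_symm, Equiv.ofBijective_apply]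
    have := hε e
    revert this
    generalize ε e = x
    generalize L v (π e) = y
    generalize L w (π e) = z
    revert x y z
    decide
  have hd : ∀ v w, symmDiff (zeros fun e => ε e * L v (π e)) (zeros fun e => ε e * L w (π e)) =
      (symmDiff (L v).zeros (L w).zeros).map (Equiv.ofBijective π hπ).symm.toEmbedding := by
    intro v w
    rw [hz, hz]
    ext e
    simp only [Finset.mem_symmDiff, Finset.mem_map_equiv]
  have hp := hL.hasParameters ⟨0, hpos⟩
  have happ : ∀ v w, (∀ e, ε e * L v (π e) = ε e * L w (π e)) → L v = L w := by
    intro v w h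
    funext f
    obtain ⟨e, rfl⟩ := hπ.2 f
    exact mul_left_cancel₀ (hε e) (h e)
  -- All conditions on pairs involve only zero sets and separators, which are transported by the
  -- relabelling.
  refine IsOMLabeling.of_pairs hG hp.2.1 hp.2.2.2 (fun v => ?_) (fun v w h => ?_) (fun v w h => ?_)
    (fun v w => ?_) fun v w h => ?_
  · have h1 := card_zeros_add_card_supp fun e => ε e * L v (π e)
    rw [hz, Finset.card_map] at h1
    have h2 := hL.card_zeros v
    have h3 := hp.2.1
    omega
  · exact hL.injective (happ v w fun e => congrFun h e)
  · rw [hz, hz, Finset.map_inj] at h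
    rcases hL.modular.eq_or_eq_neg ⟨v, rfl⟩ ⟨w, rfl⟩ h with h1 | h1
    · exact Or.inl (by rw [h1])
    · refine Or.inr ?_
      funext e
      simp [h1]
  · rw [hL.adj_iff, Near, Near, hd, hs, Finset.card_map, Finset.map_eq_empty]
  · rw [hd, Finset.card_map] at h
    rw [hs, Finset.card_map]
    exact (hL.dist_eq hG (hL.card_sdiff_of_symmDiff h)).le

namespace RAM

open RAM.Expr RAM.Cmd

/-- The comparison of two vertices, in terms of the matrices `13` and `14`. -/
def pairE : Expr :=
  andE (orE (eqE (loc 0) (loc 1)) (orE (arr 13 (loc 0) (loc 1)) (arr 14 (loc 0) (loc 1)))) <|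
  andE (orE (arr 13 (loc 0) (loc 1)) (orE (eqE (arr 14 (loc 0) (loc 1)) (const 0))
    (eqE (arr 14 (loc 0) (loc 1)) (var 6)))) <|
  andE (Expr.ite (andE (eqE (arr 13 (loc 0) (loc 1)) (const 2))
      (eqE (arr 14 (loc 0) (loc 1)) (const 0)))
    (arr 0 (loc 0) (loc 1)) (notE (arr 0 (loc 0) (loc 1)))) <|
  orE (notE (eqE (arr 13 (loc 0) (loc 1)) (const 2)))
    (notE (ltE (add (arr 14 (loc 0) (loc 1)) (const 1)) (arr 4 (loc 0) (loc 1))))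

/-- The sizes of the symmetric differences of the zero-supports, in the matrix `13`. -/
def compareZeros : Cmd :=
  fill 13 0 0 (countE 4 (Expr.ite (arr 11 (var 20) (loc 0))
    (notE (arr 11 (var 21) (loc 0))) (arr 11 (var 21) (loc 0))))

/-- The sizes of the separators, in the matrix `14`. -/
def compareSigns : Cmd :=
  fill 14 0 0 (countE 4 (andE (arr 11 (var 20) (loc 0)) (andE (arr 11 (var 21) (loc 0))
    (notE (eqE (arr 11 (var 20) (loc 0)) (arr 11 (var 21) (loc 0)))))))

/-- The matrix `11` is a labeling. -/
def verifyE : Expr :=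
  andE (notE (exE 0 (exE 4 (ltE (const 2) (arr 11 (loc 0) (loc 1))))))
    (andE (notE (exE 0 (notE (eqE (countE 4 (arr 11 (loc 0) (loc 1))) (var 6)))))
      (notE (exE 0 (exE 0 (notE pairE)))))

/-- The verification that the matrix `11` is a labeling, with the outcome in variable `9`. -/
def verify : Cmd :=
  seq (seq compareZeros compareSigns) (set 9 (Expr.ite verifyE (const 1) (const 0)))

section

variable {N : ℕ} {G : SimpleGraph (Fin N)} {n h : ℕ} {nb : Fin (2 * h) → Fin N → Fin N}

theorem truth_pairE {s : Store} (H : Ctx G n h nb s) {X : Fin N → SignVec n}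
    (h13 : ∀ v w : Fin N, s.arr 13 v w = (symmDiff (X v).zeros (X w).zeros).card)
    (h14 : ∀ v w : Fin N, s.arr 14 v w = (SignVec.sep (X v) (X w)).card) (v w : Fin N)
    {ρ : ℕ → ℕ} (h0 : ρ 0 = v) (h1 : ρ 1 = w) : eval s pairE 2 ρ ≠ 0 ↔
      (v = w ∨ (symmDiff (X v).zeros (X w).zeros).card ≠ 0 ∨
        (SignVec.sep (X v) (X w)).card ≠ 0) ∧
      ((symmDiff (X v).zeros (X w).zeros).card ≠ 0 ∨ (SignVec.sep (X v) (X w)).card = 0 ∨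
        (SignVec.sep (X v) (X w)).card = n - h) ∧ (G.Adj v w ↔ SignVec.Near (X v) (X w)) ∧
      ((symmDiff (X v).zeros (X w).zeros).card = 2 →
        min (G.dist v w) (n - h + 2) ≤ (SignVec.sep (X v) (X w)).card + 1) := by
  have e13 : eval s (arr 13 (loc 0) (loc 1)) 2 ρ = (symmDiff (X v).zeros (X w).zeros).card := by
    rw [eval_arr, eval_loc, eval_loc, h0, h1, H.get_fin, h13]
  have e14 : eval s (arr 14 (loc 0) (loc 1)) 2 ρ = (SignVec.sep (X v) (X w)).card := by
    rw [eval_arr, eval_loc, eval_loc, h0, h1, H.get_fin, h14]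
  have e0 : eval s (arr 0 (loc 0) (loc 1)) 2 ρ ≠ 0 ↔ G.Adj v w := by
    rw [eval_arr, eval_loc, eval_loc, h0, h1, H.get_fin, H.a0]
  have e4 : eval s (arr 4 (loc 0) (loc 1)) 2 ρ = min (G.dist v w) (n - h + 2) := by
    rw [eval_arr, eval_loc, eval_loc, h0, h1, H.get_fin, H.a4]
  have c3 : eval s (Expr.ite (andE (eqE (arr 13 (loc 0) (loc 1)) (const 2))
      (eqE (arr 14 (loc 0) (loc 1)) (const 0))) (arr 0 (loc 0) (loc 1))
      (notE (arr 0 (loc 0) (loc 1)))) 2 ρ ≠ 0 ↔ (G.Adj v w ↔ SignVec.Near (X v) (X w)) := by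
    have c : eval s (andE (eqE (arr 13 (loc 0) (loc 1)) (const 2))
      (eqE (arr 14 (loc 0) (loc 1)) (const 0))) 2 ρ ≠ 0 ↔ SignVec.Near (X v) (X w) := by
      rw [truth_andE, truth_eqE, truth_eqE, e13, e14, SignVec.Near, ← Finset.card_eq_zero]
      rfl
    rw [eval_ite]
    split_ifs with h
    · rw [e0]
      simp [c.1 h]
    · rw [truth_notE, e0]
      simp [mt c.2 h]
  rw [pairE, truth_andE, truth_andE, truth_andE]
  refine and_congr ?_ (and_congr ?_ (and_congr c3 ?_))
  · rw [truth_orE, truth_orE, truth_eqE, e13, e14, eval_loc, eval_loc, h0, h1, ← Fin.ext_iff]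
  · rw [truth_orE, truth_orE, truth_eqE, truth_eqE, e13, e14, eval_const, eval_var, H.v6]
  · rw [truth_orE, truth_notE, truth_notE, truth_eqE, truth_ltE, eval_add, e13, e14, e4,
      eval_const, eval_const, not_lt, imp_iff_not_or]

theorem signCode_le (s : SignType) : signCode s ≤ 2 := by
  revert s; decide

theorem exists_signCode {k : ℕ} (hk : k ≤ 2) : ∃ s, signCode s = k := by
  interval_cases k
  exacts [⟨0, rfl⟩, ⟨1, rfl⟩, ⟨-1, rfl⟩]

theorem den_verify_le (s : Store) : (verify.den s).var 9 ≤ 1 := by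
  simp only [verify, den, Store.setv_var, if_true, eval_ite, eval_const]
  split_ifs <;> omega

/-- These conditions are numerical and can be tested from two tables. For equal zero sets, a
separator of size `0` means equality and one of size `n - h` means antipodes. -/
theorem isOMLabeling_iff (hG : G.Connected) (hp : HasParameters G n (h + 1))
    {X : Fin N → SignVec n} : IsOMLabeling G n (h + 1) X ↔ (∀ v, (X v).supp.card = n - h) ∧
      ∀ v w, (v = w ∨ (symmDiff (X v).zeros (X w).zeros).card ≠ 0 ∨
        (SignVec.sep (X v) (X w)).card ≠ 0) ∧
      ((symmDiff (X v).zeros (X w).zeros).card ≠ 0 ∨ (SignVec.sep (X v) (X w)).card = 0 ∨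
        (SignVec.sep (X v) (X w)).card = n - h) ∧ (G.Adj v w ↔ SignVec.Near (X v) (X w)) ∧
      ((symmDiff (X v).zeros (X w).zeros).card = 2 →
        min (G.dist v w) (n - h + 2) ≤ (SignVec.sep (X v) (X w)).card + 1) := by
  have hle := hp.2.1
  constructor
  · intro hL
    have hsupp : ∀ v, (X v).supp.card = n - h := fun v => by
      have h1 := SignVec.card_zeros_add_card_supp (X v)
      have h2 := hL.card_zeros v
      omega
    have hz : ∀ v w, (symmDiff (X v).zeros (X w).zeros).card = 0 →
        (X v = X w ∧ (SignVec.sep (X v) (X w)).card = 0) ∨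
          (SignVec.sep (X v) (X w)).card = n - h := by
      intro v w h1
      rw [Finset.card_eq_zero, ← Finset.bot_eq_empty, symmDiff_eq_bot] at h1
      rcases hL.modular.eq_or_eq_neg ⟨v, rfl⟩ ⟨w, rfl⟩ h1 with h2 | h2
      · refine Or.inl ⟨h2, ?_⟩
        rw [h2, Finset.card_eq_zero, SignVec.sep_self]
      · refine Or.inr ?_
        rw [h2, SignVec.sep_neg_left, ← hsupp w, ← SignVec.sep_neg_left]
        congr 1
        ext e
        rw [SignVec.mem_sep, SignVec.mem_supp, Pi.neg_apply, neg_neg]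
        simp
    refine ⟨hsupp, fun v w => ⟨?_, ?_, hL.adj_iff v w, fun h => ?_⟩⟩
    · by_contra! h1
      rcases hz v w h1.2.1 with h2 | h2
      · exact h1.1 (hL.injective h2.1)
      · omega
    · by_contra! h1
      rcases hz v w h1.1 with h2 | h2 <;> omega
    · refine (min_le_left _ _).trans (hL.dist_eq hG ?_).le
      exact hL.card_sdiff_of_symmDiff h
  · rintro ⟨h1, h2⟩
    have hq : n - (h + 1) + 1 = n - h := by omega
    refine IsOMLabeling.of_pairs hG hp.2.1 hp.2.2.2 (fun v => by rw [h1, hq]) ?_ ?_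
      (fun v w => (h2 v w).2.2.1) ?_
    · intro v w hvw
      have := (h2 v w).1
      rw [hvw, symmDiff_self, SignVec.sep_self] at this
      simpa using this
    · intro v w hvw
      have h5 : ∀ e, X v e = 0 ↔ X w e = 0 := fun e => by
        rw [← SignVec.mem_zeros, hvw, SignVec.mem_zeros]
      rcases (h2 v w).2.1 with h3 | h3 | h3
      · simp [hvw] at h3
      · left
        rw [Finset.card_eq_zero, Finset.eq_empty_iff_forall_notMem] at h3
        funext e
        have h4 := h3 e
        have h5 := h5 e
        rw [SignVec.mem_sep] at h4
        revert h4 h5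
        generalize X v e = x
        generalize X w e = y
        revert x y
        decide
      · right
        have h6 : SignVec.sep (X v) (X w) = (X v).supp := by
          refine Finset.eq_of_subset_of_card_le (fun e he => ?_) (by rw [h1, h3])
          rw [SignVec.mem_supp]
          exact (SignVec.mem_sep.1 he).1
        funext e
        have h4 : e ∈ SignVec.sep (X v) (X w) ↔ X v e ≠ 0 := by rw [h6, SignVec.mem_supp]
        have h5 := h5 e
        rw [SignVec.mem_sep] at h4
        rw [Pi.neg_apply]
        revert h4 h5
        generalize X v e = x
        generalize X w e = y
        revert x y
        decide
    · intro v w hvw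
      have h3 := (h2 v w).2.2.2 hvw
      -- So the right side of `h3` is at most `n - h + 1`, below the cap, and the truncated distance
      -- may be replaced by the distance.
      have h4 : (SignVec.sep (X v) (X w)).card ≤ n - h := by
        rw [← h1 v]
        refine Finset.card_le_card fun e he => ?_
        rw [SignVec.mem_supp]
        exact (SignVec.mem_sep.1 he).1
      omega

theorem den_verify_fill (hnN : n ≤ N) {s : Store} (H : Ctx G n h nb s) {X : Fin N → SignVec n}
    (hX : ∀ (v : Fin N) (e : Fin n), s.arr 11 v e = signCode (X v e)) (v w : Fin N) :
    ((seq compareZeros compareSigns).den s).arr 13 v w =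
      (symmDiff (X v).zeros (X w).zeros).card ∧
    ((seq compareZeros compareSigns).den s).arr 14 v w = (SignVec.sep (X v) (X w)).card := by
  classical
  rw [den]
  have H1 : Ctx G n h nb (compareZeros.den s) := H.den _ (by decide)
  have t1a : (compareZeros.den s).arr 11 = s.arr 11 := den_arr _ _ (by decide)
  have g11 : ∀ t, Ctx G n h nb t → t.arr 11 = s.arr 11 → ∀ (v : Fin N) (e : Fin n),
      t.get 11 v e = s.arr 11 v e := fun t H ht v e => by
    rw [Store.get_fin H.v0 11 v e le_rfl hnN, ht]
  constructor
  · rw [den_arr compareSigns _ (by decide), compareZeros,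
      den_fill_fin H.v0 H.v0 H.v0 le_rfl le_rfl (by decide),
      eval_countE (a := n) (by simp [Store.setv_var, H.v4])
      (P := fun e : Fin n => e ∈ symmDiff (X v).zeros (X w).zeros)]
    · congr 1
      ext e
      simp
    · intro e
      have g1 := g11 s H rfl v e
      have g2 := g11 s H rfl w e
      rw [hX] at g1 g2
      simp only [eval_ite, notE, eval_const, eval_arr, eval_var, eval_loc, Store.setv_var, if_true,
        Function.update_self, Store.get_setv, ne_eq, OfNat.ofNat_ne_zero, not_false_eq_true,
        Nat.reduceEqDiff, if_false, g1, g2]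
      rw [Finset.mem_symmDiff, SignVec.mem_zeros, SignVec.mem_zeros]
      generalize X v e = x
      generalize X w e = y
      revert x y
      decide
  · rw [compareSigns, den_fill_fin H1.v0 H1.v0 H1.v0 le_rfl le_rfl (by decide),
      eval_countE (a := n) (by simp [Store.setv_var, H1.v4])
      (P := fun e : Fin n => e ∈ SignVec.sep (X v) (X w))]
    · congr 1
      ext e
      simp
    · intro e
      have g1 := g11 _ H1 t1a v e
      have g2 := g11 _ H1 t1a w e
      rw [hX] at g1 g2
      rw [truth_andE, truth_andE, truth_notE, truth_eqE]
      simp only [eval_arr, eval_var, eval_loc, Store.setv_var, if_true, Function.update_self,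
        Store.get_setv, ne_eq, OfNat.ofNat_ne_zero, not_false_eq_true, Nat.reduceEqDiff, if_false,
        g1, g2]
      rw [SignVec.mem_sep]
      generalize X v e = x
      generalize X w e = y
      revert x y
      decide

theorem truth_verifyE (hnN : n ≤ N) {t : Store} (Ht : Ctx G n h nb t) :
    eval t verifyE 0 (fun _ => 0) ≠ 0 ↔ (∀ (v : Fin N) (e : Fin n), t.arr 11 v e ≤ 2) ∧
      (∀ v : Fin N, (Finset.univ.filter fun e : Fin n => t.arr 11 v e ≠ 0).card = n - h) ∧
      ∀ v w : Fin N, eval t pairE 2 (Function.update (Function.update (fun _ => 0) 0 v) 1 w) ≠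
        0 := by
  have g11 : ∀ (v : Fin N) (e : Fin n), t.get 11 v e = t.arr 11 v e := fun v e =>
    Store.get_fin Ht.v0 11 v e le_rfl hnN
  rw [verifyE, truth_andE, truth_andE, truth_notE, truth_notE, truth_notE, truth_exE, truth_exE,
    truth_exE, Ht.v0, exists_lt_iff_fin, exists_lt_iff_fin, exists_lt_iff_fin, not_exists,
    not_exists, not_exists]
  refine and_congr (forall_congr' fun v => ?_) (and_congr (forall_congr' fun v => ?_)
    (forall_congr' fun v => ?_))
  · rw [truth_exE, Ht.v4, exists_lt_iff_fin, not_exists]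
    refine forall_congr' fun e => ?_
    rw [truth_ltE]
    simp [g11]
  · rw [truth_notE, not_not, truth_eqE, eval_countE Ht.v4
      (P := fun e : Fin n => t.arr 11 v e ≠ 0) _ _ _ (fun e => by simp [g11]),
      eval_var, Ht.v6]
    congr!
  · rw [truth_exE, Ht.v0, exists_lt_iff_fin, not_exists]
    refine forall_congr' fun w => ?_
    rw [truth_notE, not_not]

/-- Nothing is assumed about matrix `11`, which may hold arbitrary numbers after a wrong guess; the
test that the entries are at most `2` makes it encode sign vectors. -/
theorem den_verify (hG : G.Connected) (hp : HasParameters G n (h + 1)) {s : Store}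
    (H : Ctx G n h nb s) : (verify.den s).var 9 ≠ 0 ↔
      ∃ X : Fin N → SignVec n, IsOMLabeling G n (h + 1) X ∧
        ∀ (v : Fin N) (e : Fin n), s.arr 11 v e = signCode (X v e) := by
  have hnN : n ≤ N := (hp.lt_card hG).le
  have hfill := fun X => den_verify_fill hnN H (X := X)
  obtain ⟨t, ht⟩ : ∃ t, t = (seq compareZeros compareSigns).den s := ⟨_, rfl⟩
  have Ht : Ctx G n h nb t := by rw [ht]; exact H.den _ (by decide)
  have ta : t.arr 11 = s.arr 11 := by rw [ht]; exact den_arr _ _ (by decide)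
  have hden : (verify.den s).var 9 ≠ 0 ↔ eval t verifyE 0 (fun _ => 0) ≠ 0 := by
    rw [verify, den, ← ht, den, Store.setv_var, if_pos rfl, eval_ite, eval_const, eval_const]
    split_ifs with h <;> simp [h]
  rw [← ht] at hfill
  have hX : ∀ X : Fin N → SignVec n, (∀ (v : Fin N) (e : Fin n), s.arr 11 v e =
      signCode (X v e)) → ((verify.den s).var 9 ≠ 0 ↔ IsOMLabeling G n (h + 1) X) := by
    intro X hX
    have hle2 : ∀ (v : Fin N) (e : Fin n), s.arr 11 v e ≤ 2 := fun v e => by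
      rw [hX]; exact signCode_le _
    have hsupp : ∀ v : Fin N, (Finset.univ.filter fun e : Fin n => s.arr 11 v e ≠ 0) =
        (X v).supp := by
      intro v
      ext e
      rw [SignVec.mem_supp, Finset.mem_filter, hX, signCode_ne_zero]
      simp
    rw [hden, truth_verifyE hnN Ht, ta, isOMLabeling_iff hG hp, and_iff_right hle2]
    refine and_congr (forall_congr' fun v => by rw [hsupp]) (forall_congr' fun v =>
      forall_congr' fun w => ?_)
    exact truth_pairE Ht (fun v w => (hfill X hX v w).1) (fun v w => (hfill X hX v w).2) v w (by simp)
      (by simp)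
  constructor
  · intro h9
    have h1 := (truth_verifyE hnN Ht).1 (hden.1 h9)
    rw [ta] at h1
    choose X hX' using fun (v : Fin N) (e : Fin n) => exists_signCode (h1.1 v e)
    exact ⟨X, (hX X fun v e => (hX' v e).symm).1 h9, fun v e => (hX' v e).symm⟩
  · rintro ⟨X, hL, hX'⟩
    exact (hX X hX').2 hL

end

end RAM


/-! ## The search for a labeling -/

namespace RAM

open RAM.Expr RAM.Cmd

/-- The computation of the labeling from the antipode of the vertex `0`. -/
def reconstruct : Cmd :=
  seq antipodes <| seq exchanges <| seq firsts <| seq behinds <| seq zerosInit <| seq levels <|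
  seq zerosStep <| seq seeds <| seq signsInit <| rep 10 7 signsRound

/-- The reconstruction and verification, for all candidates. -/
def search : Cmd :=
  rep 12 0 (Cmd.ite (andE (notE (var 9)) (eqE (arr 4 (const 0) (var 12)) (var 5)))
    (seq reconstruct verify) skip)

/-- The output of the matrix `11` row by row. -/
def output : Cmd :=
  seq (set 14 (const 0)) (rep 15 0 (rep 16 4 (seq (emit (var 14) (arr 11 (var 15) (var 16)))
    (set 14 (add (var 14) (const 1))))))

section

variable {N : ℕ} {G : SimpleGraph (Fin N)} {n h : ℕ} {nb : Fin (2 * h) → Fin N → Fin N}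

/-- The labeling `L` is unknown to the program, which recovers it from the antipode of the vertex
`0` up to the names `π` of the elements and their orientations `ε`. -/
theorem den_reconstruct {L : Fin N → SignVec n} {a : Fin N → Fin N}
    (hL : IsOMLabeling G n (h + 1) L) (hG : G.Connected) (hpos : 0 < N)
    (ha : ∀ v, L (a v) = -L v) (hadj : ∀ v w, G.Adj v w ↔ ∃ j, nb j v = w) (hnN : n ≤ N)
    (hhN : 2 * h ≤ N) {s : Store} (H : Ctx G n h nb s) (h12 : s.var 12 = a ⟨0, hpos⟩) :
    ∃ X : Fin N → SignVec n, IsOMLabeling G n (h + 1) X ∧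
      ∀ (v : Fin N) (e : Fin n), (reconstruct.den s).arr 11 v e = signCode (X v e) := by
  have hh : 0 < h := by have := hL.two_le_rank hG; omega
  have hA := den_antipodes hL hG hpos ha hadj hhN H h12
  have H1 : Ctx G n h nb (antipodes.den s) := H.den _ (by decide)
  have h6 := den_exchanges hL hG ha H1 hA
  have H2 : Ctx' G n h nb L a (exchanges.den (antipodes.den s)) :=
    { H1.den exchanges (by decide) with
      a5 := by rw [den_arr exchanges _ (by decide)]; exact hA
      a6 := h6 }
  obtain ⟨s2, hs2⟩ : ∃ s2, s2 = exchanges.den (antipodes.den s) := ⟨_, rfl⟩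
  rw [← hs2] at H2
  obtain ⟨U, hU1, hU2, hU3⟩ := den_firsts hL hG ha hpos H2
  have H3 : Ctx' G n h nb L a (firsts.den s2) := H2.den _ (by decide)
  obtain ⟨s3, hs3⟩ : ∃ s3, s3 = firsts.den s2 := ⟨_, rfl⟩
  rw [← hs3] at H3 hU3
  obtain ⟨p, hp1, hp2, hp3⟩ := den_behinds hL hG ha hpos H3 (hU2 ⟨0, hh⟩).1 (hU3 ⟨0, hh⟩)
  have H4 : Ctx' G n h nb L a (behinds.den s3) := H3.den _ (by decide)
  have h7 : ∀ e : Fin h, (behinds.den s3).arr 7 e 0 = U e := by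
    rw [den_arr behinds _ (by decide)]; exact hU3
  obtain ⟨s4, hs4⟩ : ∃ s4, s4 = behinds.den s3 := ⟨_, rfl⟩
  rw [← hs4] at H4 hp3 h7
  obtain ⟨π, hπ, hπ1, hπ2⟩ := hL.exists_elements hG ha hU1 hU2 (hU2 ⟨0, hh⟩).1 hp1 hp2
  have h9 := fun y e => den_zerosInit hL hG ha hpos hnN H4 hh hU2 h7 hp2 hp3 hπ1 hπ2 y e
  have H5 : Ctx' G n h nb L a (zerosInit.den s4) := H4.den _ (by decide)
  obtain ⟨s5, hs5⟩ : ∃ s5, s5 = zerosInit.den s4 := ⟨_, rfl⟩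
  rw [← hs5] at H5 h9
  have h10 := den_levels hL ha hpos H5
  have H6 : Ctx' G n h nb L a (levels.den s5) := H5.den _ (by decide)
  have h9' : (levels.den s5).arr 9 = s5.arr 9 := den_arr _ _ (by decide)
  obtain ⟨s6, hs6⟩ : ∃ s6, s6 = levels.den s5 := ⟨_, rfl⟩
  rw [← hs6] at H6 h10 h9'
  rw [← h9'] at h9
  have hz := den_zerosStep hL hpos hnN H6 (π := π) (fun e => by
    by_cases he : (e : ℕ) < h
    · exact iff_of_true he (hπ1 e he).1
    · exact iff_of_false he (hπ2 e (by omega)).1) h10 h9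
  have H7 : Ctx' G n h nb L a (zerosStep.den s6) := H6.den _ (by decide)
  obtain ⟨ε, hε, hs⟩ := den_signs hL hG ha hpos hnN H7 hz
  refine ⟨_, hL.reorient hG hπ hε, fun v e => ?_⟩
  rw [← hs, reconstruct]
  simp only [den, hs6, hs5, hs4, hs3, hs2]

/-- Verification makes an acceptance sound. Conversely, for any labeling the antipode of the vertex
`0` is among the candidates, and when it is tried the reconstruction succeeds, unless an earlier
candidate did. Variable `9` then blocks later rounds, so that matrix `11` is kept. -/
theorem den_search (hG : G.Connected) (hpos : 0 < N) (hp : HasParameters G n (h + 1))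
    (hadj : ∀ v w, G.Adj v w ↔ ∃ j, nb j v = w) {s : Store} (H : Ctx G n h nb s)
    (h9 : s.var 9 = 0) : (search.den s).var 9 ≤ 1 ∧
      ((search.den s).var 9 ≠ 0 → ∃ X : Fin N → SignVec n, IsOMLabeling G n (h + 1) X ∧
        ∀ (v : Fin N) (e : Fin n), (search.den s).arr 11 v e = signCode (X v e)) ∧
      ((∃ X : Fin N → SignVec n, IsOMLabeling G n (h + 1) X) → (search.den s).var 9 ≠ 0) := by
  have hnN : n ≤ N := (hp.lt_card hG).le
  have hhN : 2 * h ≤ N := by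
    have h1 := hp.2.2.1 ⟨0, hpos⟩
    have h2 := Set.ncard_le_card (G.neighborSet ⟨0, hpos⟩)
    rw [Nat.card_eq_fintype_card, Fintype.card_fin] at h2
    omega
  have := rep_induction (x := 12) (b := 0) (s := s)
    (p := Cmd.ite (andE (notE (var 9)) (eqE (arr 4 (const 0) (var 12)) (var 5)))
      (seq reconstruct verify) skip)
    (fun i t => t.var 9 ≤ 1 ∧
      (t.var 9 ≠ 0 → ∃ X : Fin N → SignVec n, IsOMLabeling G n (h + 1) X ∧
        ∀ (v : Fin N) (e : Fin n), t.arr 11 v e = signCode (X v e)) ∧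
      ∀ (L : Fin N → SignVec n) (a : Fin N → Fin N), IsOMLabeling G n (h + 1) L →
        (∀ v, L (a v) = -L v) → (a ⟨0, hpos⟩ : ℕ) < i → t.var 9 ≠ 0)
    (fun _ _ _ h => by simpa [Store.setv_var] using h) (by simp [h9]) ?_
  · rw [H.v0] at this
    refine ⟨this.1, this.2.1, ?_⟩
    rintro ⟨L, hL⟩
    choose a ha using hL.exists_neg
    exact this.2.2 L a hL ha (a _).2
  · rintro i hi t hv ht hti ⟨h1, h2, h3⟩
    have Ht : Ctx G n h nb t := H.congr (fun x hx => hv x (by omega) (by revert x; decide))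
      fun x hx hx1 hx2 => ht x (by revert x; decide)
    rw [H.v0] at hi
    have c : eval t (andE (notE (var 9)) (eqE (arr 4 (const 0) (var 12)) (var 5))) 0 (fun _ => 0) ≠ 0
        ↔ t.var 9 = 0 ∧ G.dist ⟨0, hpos⟩ ⟨i, hi⟩ = n - h + 1 := by
      have h4 := Ht.a4 ⟨0, hpos⟩ ⟨i, hi⟩
      simp only at h4
      rw [truth_andE, truth_notE, truth_eqE, eval_arr, eval_var, eval_var, eval_var, eval_const, hti,
        not_not, Store.get_eq Ht.v0 4 hpos hi, h4, Ht.v5]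
      refine and_congr_right fun _ => ?_
      omega
    have hdist : ∀ (L : Fin N → SignVec n) (a : Fin N → Fin N), IsOMLabeling G n (h + 1) L →
        (∀ v, L (a v) = -L v) → G.dist ⟨0, hpos⟩ (a ⟨0, hpos⟩) = n - h + 1 := by
      intro L a hL ha
      have := hL.dist_anti hG ha ⟨0, hpos⟩
      have := hp.2.1
      omega
    rw [den]
    by_cases hc : t.var 9 = 0 ∧ G.dist ⟨0, hpos⟩ ⟨i, hi⟩ = n - h + 1
    · rw [if_pos (c.2 hc), den]
      have H' : Ctx G n h nb (reconstruct.den t) := Ht.den _ (by decide)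
      have hver := den_verify hG hp H'
      refine ⟨den_verify_le _, ?_, ?_⟩
      · rw [den_arr verify _ (by decide)]
        exact hver.1
      · intro L a hL ha hai
        rcases Nat.lt_succ_iff_lt_or_eq.1 hai with h4 | h4
        · exact absurd hc.1 (h3 L a hL ha h4)
        · exact hver.2 (den_reconstruct hL hG hpos ha hadj hnN hhN Ht (hti.trans h4.symm))
    · rw [if_neg (mt c.1 hc)]
      refine ⟨h1, h2, fun L a hL ha hai => ?_⟩
      rcases Nat.lt_succ_iff_lt_or_eq.1 hai with h4 | h4
      · exact h3 L a hL ha h4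
      · intro h5
        refine hc ⟨h5, ?_⟩
        have : (⟨i, hi⟩ : Fin N) = a ⟨0, hpos⟩ := Fin.ext h4.symm
        rw [this]
        exact hdist L a hL ha

end

theorem den_output {N n : ℕ} {s : Store} (h0 : s.var 0 = N) (h4 : s.var 4 = n) (hnN : n ≤ N)
    (i : Fin N) (e : Fin n) : (output.den s).out (i * n + e) = s.arr 11 i e := by
  have := rep_induction (x := 15) (b := 0) (s := s.setv 14 0)
    (p := rep 16 4 (seq (emit (var 14) (arr 11 (var 15) (var 16)))
      (set 14 (add (var 14) (const 1)))))
    (fun i t => t.var 14 = i * n ∧ ∀ i' < i, ∀ e < n, t.out (i' * n + e) = s.arr 11 i' e)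
    (fun _ _ _ h => by simpa [Store.setv] using h) (by simp [Store.setv]) ?_
  · simp only [Store.setv_var, OfNat.zero_ne_ofNat, if_false, h0] at this
    exact this.2 i i.2 e e.2
  · rintro i hi t hv ht hti ⟨h1, h2⟩
    simp only [Store.setv_var, OfNat.zero_ne_ofNat, if_false, h0] at hi
    have t0 : t.var 0 = N := by rw [hv 0 (by decide) (by decide)]; simp [Store.setv_var, h0]
    have t4 : t.var 4 = n := by rw [hv 4 (by decide) (by decide)]; simp [Store.setv_var, h4]
    have t11 : t.arr 11 = s.arr 11 := by rw [ht 11 (by decide)]; rfl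
    have := rep_induction (x := 16) (b := 4) (s := t)
      (p := seq (emit (var 14) (arr 11 (var 15) (var 16))) (set 14 (add (var 14) (const 1))))
      (fun j t => t.var 14 = i * n + j ∧ (∀ i' < i, ∀ e < n, t.out (i' * n + e) = s.arr 11 i' e) ∧
        ∀ e < j, t.out (i * n + e) = s.arr 11 i e)
      (fun _ _ _ h => by simpa [Store.setv] using h) (by simpa [h1] using h2) ?_
    · rw [t4] at this
      refine ⟨by rw [this.1]; ring, fun i' hi' e he => ?_⟩
      rcases Nat.lt_succ_iff_lt_or_eq.1 hi' with h | rfl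
      · exact this.2.1 i' h e he
      · exact this.2.2 e he
    · rintro j hj t' hv' ht' htj ⟨g1, g2, g3⟩
      rw [t4] at hj
      have e0 : t'.var 0 = N := by rw [hv' 0 (by decide) (by decide), t0]
      have e15 : t'.var 15 = i := by rw [hv' 15 (by decide) (by decide), hti]
      have e11 : t'.get 11 i j = s.arr 11 i j := by
        rw [Store.get_eq e0 11 hi (by omega), ht' 11 (by decide), t11]
      simp only [den, eval_var, eval_arr, eval_add, eval_const, e15, htj, e11, g1]
      refine ⟨?_, fun i' hi' e he => ?_, fun e he => ?_⟩
      · simp [Store.setv, Store.emit, g1]; ring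
      · have : i' * n + e ≠ i * n + j := by nlinarith
        simp only [Store.setv, Store.emit, Function.update_of_ne this]
        exact g2 i' hi' e he
      · simp only [Store.setv, Store.emit]
        rcases Nat.lt_succ_iff_lt_or_eq.1 he with h | rfl
        · rw [Function.update_of_ne (by omega)]
          exact g3 e h
        · rw [Function.update_self]

end RAM


/-! ## The algorithm and its running time -/

namespace RAM

open RAM.Expr RAM.Cmd

/-- In the search only the rounds of candidates are expensive, so the rounds need individual bounds,
which `cost_le` does not provide. -/
theorem Cmd.cost_rep_le {x b : ℕ} {p : Cmd} {s : Store} (f : ℕ → ℕ)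
    (h : ∀ i < s.var b, ∀ t : Store, (∀ y, y ≠ x → y ∉ p.wv → t.var y = s.var y) →
      (∀ k, k ∉ p.wa → t.arr k = s.arr k) → t.var x = i → p.cost t ≤ f i) :
    (rep x b p).cost s ≤ ∑ i ∈ Finset.range (s.var b), (f i + 40) + 40 := by
  have key : ∀ i, (∀ y, y ≠ x → y ∉ p.wv → (iter p.den x s i).var y = s.var y) ∧
      ∀ k, k ∉ p.wa → (iter p.den x s i).arr k = s.arr k := by
    intro i
    induction i with
    | zero => exact ⟨fun _ _ _ => rfl, fun _ _ => rfl⟩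
    | succ i ih =>
      refine ⟨fun y hy hyp => ?_, fun k hk => ?_⟩
      · simp only [iter]
        rw [den_var _ _ hyp, Store.setv_var, if_neg hy, ih.1 y hy hyp]
      · simp only [iter]
        rw [den_arr _ _ hk]
        exact ih.2 k hk
  have h1 : ∀ i ∈ Finset.range (s.var b), p.cost ((iter p.den x s i).setv x i) + 40 ≤ f i + 40 := by
    intro i hi
    refine Nat.add_le_add_right (h i (Finset.mem_range.1 hi)
      ((iter p.den x s i).setv x i) (fun y hy hyp => ?_) (key i).2 ?_) _
    · rw [Store.setv_var, if_neg hy, (key i).1 y hy hyp]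
    · rw [Store.setv_var, if_pos rfl]
  simp only [cost]
  exact Nat.add_le_add_right (Finset.sum_le_sum h1) _

theorem cost_params {s : Store} {N : ℕ} (hN : s.var 0 = N) (hpos : 0 < N) :
    params.cost s ≤ params.wt * (4 * N ^ 2) := by
  refine Cmd.cost_le (by decide) [[0, 0]] (by decide) ?_
  simp only [List.mem_singleton, forall_eq, List.map_cons, List.map_nil, List.prod_cons,
    List.prod_nil, hN]
  nlinarith

theorem cost_neighbors {s : Store} {N : ℕ} (hN : s.var 0 = N) (hpos : 0 < N) :
    neighbors.cost s ≤ neighbors.wt * (4 * N ^ 2) := by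
  refine Cmd.cost_le (by decide) [[0, 0]] (by decide) ?_
  simp only [List.mem_singleton, forall_eq, List.map_cons, List.map_nil, List.prod_cons,
    List.prod_nil, hN]
  nlinarith

section

variable {N n h : ℕ}

theorem mul_succ_le {a b c d : ℕ} (hab : a ≤ c) (hbd : b ≤ d) (hN : 0 < N) :
    (N + 1) * (N + 1) * (a * b) ≤ 4 * (c * d) * N ^ 2 := by
  have h1 : (N + 1) * (N + 1) ≤ 4 * N ^ 2 := by nlinarith
  have h2 : a * b ≤ c * d := Nat.mul_le_mul hab hbd
  calc _ ≤ 4 * N ^ 2 * (c * d) := Nat.mul_le_mul h1 h2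
    _ = _ := by ring

theorem cost_distances {s : Store} (h0 : s.var 0 = N) (h2 : s.var 2 = 2 * h)
    (h5 : s.var 5 = n - h + 1) (hpos : 0 < N) (hhn : h < n) :
    distances.cost s ≤ distances.wt * (24 * ((h + 1) * (n - h)) * N ^ 2) := by
  refine Cmd.cost_le (by decide) [[0, 0, 2, 5]] (by decide) ?_
  simp only [List.mem_singleton, forall_eq, List.map_cons, List.map_nil, List.prod_cons,
    List.prod_nil, h0, h2, h5]
  -- The factor `24` is `4 * 2 * 3`: `4` for two loops over vertices, `2` for the degree and `3` for
  -- the rounds.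
  have := mul_succ_le (N := N) (a := 2 * h + 1) (b := n - h + 1 + 1) (c := 2 * (h + 1))
    (d := 3 * (n - h)) (by omega) (by omega) hpos
  linarith

theorem cost_output {s : Store} (h0 : s.var 0 = N) (h4 : s.var 4 = n) (hpos : 0 < N)
    (hnN : n < N) : output.cost s ≤ output.wt * (4 * N ^ 2) := by
  refine Cmd.cost_le (by decide) [[0, 4]] (by decide) ?_
  simp only [List.mem_singleton, forall_eq, List.map_cons, List.map_nil, List.prod_cons,
    List.prod_nil, h0, h4]
  nlinarith

/-- Up to constants `n` is the larger of `h` and `n - h`, and the product of the larger and the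
smaller one is `h * (n - h)`. -/
theorem succ_mul_min_le (hh : 0 < h) (hhn : h < n) :
    (n + 1) * (min h (n - h) + 1) ≤ 6 * ((h + 1) * (n - h)) := by
  obtain ⟨q, rfl⟩ : ∃ q, n = h + q := ⟨n - h, by omega⟩
  rw [Nat.add_sub_cancel_left]
  have hq : 0 < q := by omega
  rcases le_total h q with h1 | h1
  · rw [min_eq_left h1]
    nlinarith
  · rw [min_eq_right h1]
    nlinarith

theorem cost_candidate {s : Store} (h0 : s.var 0 = N) (h1 : s.var 1 = 1) (h2 : s.var 2 = 2 * h)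
    (h4 : s.var 4 = n) (h7 : s.var 7 = min h (n - h)) (hh : 0 < h) (hhn : h < n) (hnN : n < N) :
    (seq reconstruct verify).cost s ≤
      (seq reconstruct verify).wt * (24 * ((h + 1) * (n - h)) * N ^ 2) := by
  have hpos : 0 < N := by omega
  have hm := succ_mul_min_le hh hhn
  -- The templates belong to the antipodes, to the levels, to the seeds, and to the rounds for zero
  -- sets and signs; the nests of all other parts are contained in these.
  refine Cmd.cost_le (by decide) [[0, 1, 0, 2], [7, 1, 0, 0], [1, 4, 0], [7, 0, 4, 0]]
    (by decide) ?_
  simp only [List.mem_cons, List.not_mem_nil, or_false, forall_eq_or_imp, forall_eq, List.map_cons,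
    List.map_nil, List.prod_cons, List.prod_nil, h0, h1, h2, h4, h7]
  have hK : 1 ≤ n - h := by omega
  have k1 := mul_succ_le (N := N) (a := 2) (b := 2 * h + 1) (c := 3 * (n - h))
    (d := 2 * (h + 1)) (by omega) (by omega) hpos
  have k2 := mul_succ_le (N := N) (a := min h (n - h) + 1) (b := 2) (c := h + 1)
    (d := 6 * (n - h)) (by omega) (by omega) hpos
  have k3 := mul_succ_le (N := N) (a := (n + 1) * (min h (n - h) + 1)) (b := 1)
    (c := 6 * ((h + 1) * (n - h))) (d := 1) hm le_rfl hpos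
  have k4 : (1 + 1) * ((n + 1) * ((N + 1) * 1)) ≤
      (N + 1) * (N + 1) * ((min h (n - h) + 1) * 2) := by
    calc (1 + 1) * ((n + 1) * ((N + 1) * 1)) = (N + 1) * (n + 1) * (1 * 2) := by ring
      _ ≤ _ := by gcongr <;> omega
  refine ⟨?_, ?_, ?_, ?_⟩ <;> linarith

end

end RAM


/-! ### The time of the search, and the complete program. -/

namespace RAM

open RAM.Expr RAM.Cmd

theorem cost_search {N : ℕ} {G : SimpleGraph (Fin N)} {n h : ℕ}
    {nb : Fin (2 * h) → Fin N → Fin N} {s : Store} (H : Ctx G n h nb s) (hpos : 0 < N)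
    (hh : 0 < h) (hhn : h < n) (hnN : n < N) : search.cost s ≤ 1000 * N +
      (antipodeCandidates G n (h + 1) ⟨0, hpos⟩).ncard *
        ((seq reconstruct verify).wt * (24 * ((h + 1) * (n - h)) * N ^ 2)) := by
  classical
  obtain ⟨B, hB⟩ : ∃ B, B = (seq reconstruct verify).wt * (24 * ((h + 1) * (n - h)) * N ^ 2) :=
    ⟨_, rfl⟩
  rw [← hB]
  have h1 := cost_rep_le (x := 12) (b := 0) (s := s)
    (p := Cmd.ite (andE (notE (var 9)) (eqE (arr 4 (const 0) (var 12)) (var 5)))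
      (seq reconstruct verify) skip)
    -- A round that tries no candidate costs at most `850` for its condition, `40` for the branching
    -- and `1` for `skip`.
    (fun i => 900 + if ∃ hi : i < N, G.dist ⟨0, hpos⟩ ⟨i, hi⟩ = n - h + 1 then B else 0) (by
    intro i hi t hv ht hti
    rw [H.v0] at hi
    have Ht : Ctx G n h nb t := H.congr (fun x hx => hv x (by omega) (by revert x; decide))
      fun x hx hx1 hx2 => ht x (by revert x; decide)
    have c : eval t (andE (notE (var 9)) (eqE (arr 4 (const 0) (var 12)) (var 5))) 0 (fun _ => 0) ≠ 0
        → ∃ hi : i < N, G.dist ⟨0, hpos⟩ ⟨i, hi⟩ = n - h + 1 := by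
      have h4 := Ht.a4 ⟨0, hpos⟩ ⟨i, hi⟩
      simp only at h4
      rw [truth_andE, truth_eqE, eval_arr, eval_var, eval_var, eval_const, hti,
        Store.get_eq Ht.v0 4 hpos hi, h4, Ht.v5]
      intro h5
      exact ⟨hi, by omega⟩
    have hec : ec t.var (andE (notE (var 9)) (eqE (arr 4 (const 0) (var 12)) (var 5))) ≤ 850 := by
      simp [andE, notE, eqE, ec]
    have hcand := cost_candidate Ht.v0 Ht.v1 Ht.v2 Ht.v4 Ht.v7 hh hhn hnN
    rw [← hB] at hcand
    rw [cost]
    split_ifs with h2 h3 h3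
    · omega
    · exact absurd (c h2) h3
    · simp only [cost]; omega
    · simp only [cost]; omega)
  rw [H.v0] at h1
  refine h1.trans ?_
  simp only [Finset.sum_add_distrib, Finset.sum_const, Finset.card_range, smul_eq_mul,
    ← Finset.sum_filter]
  rw [card_filter_range]
  have h2 : (Finset.univ.filter fun i : Fin N => ∃ hi : (i : ℕ) < N,
      G.dist ⟨0, hpos⟩ ⟨i, hi⟩ = n - h + 1).card =
      (antipodeCandidates G n (h + 1) ⟨0, hpos⟩).ncard := by
    rw [← Set.ncard_coe_finset]
    congr 1
    ext w
    have : n - (h + 1) + 2 = n - h + 1 := by omega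
    simp [antipodeCandidates, this]
  rw [h2]
  omega

/-- The algorithm, without the preparation of the memory. -/
def algorithm : Cmd :=
  seq params (Cmd.ite (var 8) (seq neighbors (seq distances (seq search output))) skip)

open Classical in
theorem exists_algorithm_bound : ∃ c : ℕ, ∀ (N : ℕ) (G : SimpleGraph (Fin N)), G.Connected →
    ∀ (hpos : 0 < N) (s : Store), s.var 0 = N →
    (∀ i j : Fin N, s.arr 0 i j = if G.Adj i j then 1 else 0) →
    ((¬ ∃ n r, HasParameters G n r) ∧ (algorithm.den s).var 9 = 0 ∧
      algorithm.cost s ≤ c * N ^ 2) ∨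
    ∃ n h, HasParameters G n (h + 1) ∧ (algorithm.den s).var 3 = h ∧ (algorithm.den s).var 4 = n ∧
      (algorithm.den s).var 9 ≤ 1 ∧ ((algorithm.den s).var 9 ≠ 0 →
        ∃ X : Fin N → SignVec n, IsOMLabeling G n (h + 1) X ∧ ∀ (i : Fin N) (e : Fin n),
          (algorithm.den s).out (i * n + e) = signCode (X i e)) ∧
      ((∃ X : Fin N → SignVec n, IsOMLabeling G n (h + 1) X) → (algorithm.den s).var 9 ≠ 0) ∧
      algorithm.cost s ≤ c * ((1 + (antipodeCandidates G n (h + 1) ⟨0, hpos⟩).ncard) *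
        ((h + 1) * (n - h)) * N ^ 2) := by
  -- The constant adds up the weights of the parts with their factors; `1081` covers the `80` steps
  -- of the branching and the `1000 * N` steps of the search for rounds without candidates.
  refine ⟨params.wt * 4 + 1081 + neighbors.wt * 4 + distances.wt * 24 + output.wt * 4 +
    (seq reconstruct verify).wt * 24, ?_⟩
  intro N G hG hpos s hN hadj
  obtain ⟨f0, f1, f9, fa⟩ := params_frame hN
  have hcp := cost_params hN hpos
  have hN2 : 1 ≤ N ^ 2 := Nat.one_le_pow _ _ hpos
  have hNN : N ≤ N ^ 2 := by nlinarith
  rcases den_params hG hN hadj with ⟨h8, hno⟩ | ⟨h8, n, h, hp, p2, p3, p4, p5, p6, p7⟩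
  · left
    have hden : algorithm.den s = params.den s := by
      simp [algorithm, den, h8]
    refine ⟨hno, by rw [hden, f9], ?_⟩
    simp only [algorithm, cost, eval_var, h8, ne_eq, not_true_eq_false, if_false, ec]
    nlinarith
  · right
    have hhn : h < n := hp.2.1
    have hh : 0 < h := by have := hp.two_le hG; omega
    have hnN := hp.lt_card hG
    have hhN : 2 * h ≤ N := by
      have h1 := hp.2.2.1 ⟨0, hpos⟩
      have h2 := Set.ncard_le_card (G.neighborSet ⟨0, hpos⟩)
      rw [Nat.card_eq_fintype_card, Fintype.card_fin] at h2
      omega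
    obtain ⟨s1, hs1⟩ : ∃ s1, s1 = params.den s := ⟨_, rfl⟩
    rw [← hs1] at f0 f1 f9 fa h8 p2 p3 p4 p5 p6 p7
    have ha1 : ∀ u v : Fin N, s1.arr 0 u v ≠ 0 ↔ G.Adj u v := fun u v => by
      rw [fa, hadj]; simp
    obtain ⟨nb, hnb1, hnb2⟩ := den_neighbors f0 ha1 (d := 2 * h) (fun v => by
      rw [hp.2.2.1 v]; omega)
    obtain ⟨s2, hs2⟩ : ∃ s2, s2 = neighbors.den s1 := ⟨_, rfl⟩
    have v2 : ∀ x < 10, s2.var x = s1.var x := fun x hx => by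
      rw [hs2]; exact den_var _ _ (by revert x; decide)
    rw [← hs2] at hnb1
    have a2 : s2.arr 0 = s1.arr 0 := by rw [hs2]; exact den_arr _ _ (by decide)
    have hdist := den_distances hG ((v2 0 (by omega)).trans f0) ((v2 2 (by omega)).trans p2) hhN
      ((v2 5 (by omega)).trans p5) hnb1 hnb2
    obtain ⟨s3, hs3⟩ : ∃ s3, s3 = distances.den s2 := ⟨_, rfl⟩
    have v3 : ∀ x < 10, s3.var x = s1.var x := fun x hx => by
      rw [← v2 x hx, hs3]; exact den_var _ _ (by revert x; decide)
    rw [← hs3] at hdist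
    have H3 : Ctx G n h nb s3 :=
      { v0 := by rw [v3 0 (by omega), f0]
        v1 := by rw [v3 1 (by omega), f1]
        v2 := by rw [v3 2 (by omega), p2]
        v3 := by rw [v3 3 (by omega), p3]
        v4 := by rw [v3 4 (by omega), p4]
        v5 := by rw [v3 5 (by omega), p5]
        v6 := by rw [v3 6 (by omega), p6]
        v7 := by rw [v3 7 (by omega), p7]
        a0 := by
          rw [hs3, den_arr distances _ (by decide), a2]
          exact ha1
        a3 := by
          rw [hs3, den_arr distances _ (by decide)]
          exact hnb1
        a4 := hdist }
    have hse := den_search hG hpos hp hnb2 H3 (by rw [v3 9 (by omega), f9])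
    obtain ⟨s4, hs4⟩ : ∃ s4, s4 = search.den s3 := ⟨_, rfl⟩
    have H4 : Ctx G n h nb s4 := by rw [hs4]; exact H3.den _ (by decide)
    rw [← hs4] at hse
    have hden : algorithm.den s = output.den s4 := by
      simp only [algorithm, den, eval_var, ← hs1]
      rw [if_pos h8, ← hs2, ← hs3, ← hs4]
    have v5 : ∀ x < 10, (output.den s4).var x = s4.var x := fun x hx =>
      den_var _ _ (by revert x; decide)
    rw [hden, v5 3 (by omega), v5 4 (by omega), v5 9 (by omega)]
    refine ⟨n, h, hp, H4.v3, H4.v4, hse.1, fun h9 => ?_, hse.2.2, ?_⟩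
    · obtain ⟨X, hX1, hX2⟩ := hse.2.1 h9
      exact ⟨X, hX1, fun i e => by rw [den_output H4.v0 H4.v4 hnN.le, hX2]⟩
    · have c2 := cost_neighbors f0 hpos
      have c3 := cost_distances ((v2 0 (by omega)).trans f0) ((v2 2 (by omega)).trans p2)
        ((v2 5 (by omega)).trans p5) hpos hhn
      have c4 := cost_search H3 hpos hh hhn hnN
      have c5 := cost_output H4.v0 H4.v4 hpos hnN
      have hcost : algorithm.cost s = params.cost s + (80 + (neighbors.cost s1 +
          (distances.cost s2 + (search.cost s3 + output.cost s4)))) := by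
        simp only [algorithm, cost, eval_var, ec, ← hs1]
        rw [if_pos h8, ← hs2, ← hs3, ← hs4]
      rw [hcost]
      obtain ⟨K, hK⟩ : ∃ K, K = (h + 1) * (n - h) * N ^ 2 := ⟨_, rfl⟩
      have hKN : N ^ 2 ≤ K := by
        rw [hK]
        have : 1 ≤ (h + 1) * (n - h) := Nat.mul_pos (by omega) (by omega)
        nlinarith
      generalize (antipodeCandidates G n (h + 1) ⟨0, hpos⟩).ncard = D at c4 ⊢
      rw [mul_assoc 24, ← hK] at c3 c4
      rw [mul_assoc (1 + D), ← hK]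
      generalize params.wt = w1 at *
      generalize neighbors.wt = w2 at *
      generalize distances.wt = w3 at *
      generalize (seq reconstruct verify).wt = w4 at *
      generalize output.wt = w5 at *
      have g1 : w1 * (4 * N ^ 2) ≤ w1 * (4 * K) := by gcongr
      have g2 : w2 * (4 * N ^ 2) ≤ w2 * (4 * K) := by gcongr
      have g5 : w5 * (4 * N ^ 2) ≤ w5 * (4 * K) := by gcongr
      have g6 : (w1 * 4 + 1081 + w2 * 4 + w3 * 24 + w5 * 4 + w4 * 24) * ((1 + D) * K) =
        w1 * (4 * K) + w2 * (4 * K) + w3 * (24 * K) + w5 * (4 * K) + D * (w4 * (24 * K)) +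
          1081 * K + (D * ((w1 * 4 + 1081 + w2 * 4 + w3 * 24 + w5 * 4) * K) + w4 * 24 * K) := by
        ring
      rw [g6]
      have g7 := Nat.zero_le (D * ((w1 * 4 + 1081 + w2 * 4 + w3 * 24 + w5 * 4) * K) + w4 * 24 * K)
      linarith

/-- The complete program. -/
def program : Prog :=
  Prog.seq prologue <| Prog.seq algorithm.compile <| Prog.seq (Prog.assign 0 (Term.reg (4 * 9))) <|
  Prog.seq (Prog.assign 1 (Term.add (Term.reg (4 * 3)) (Term.const 1))) <|
  Prog.seq (Prog.assign 2 (Term.reg (4 * 4))) (Prog.assign 3 (Term.reg (4 * numArr + 1)))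

theorem runs_program {N : ℕ} (hpos : 0 < N) (G : SimpleGraph (Fin N)) {T : ℕ}
    {Q : Store → Prop} (h : ∀ s : Store, s.var 0 = N →
      (∀ i j : Fin N, s.arr 0 i j = open Classical in if G.Adj i j then 1 else 0) →
      algorithm.cost s ≤ T ∧ Q (algorithm.den s)) :
    Runs program (input G) (30 * N + 220 + T) fun σ => ∃ t : Store, Q t ∧ σ.reg 0 = t.var 9 ∧
      σ.reg 1 = t.var 3 + 1 ∧ σ.reg 2 = t.var 4 ∧ ∀ i, σ.mem (σ.reg 3 + i) = t.out i := by
  refine ((runs_prologue hpos G).seq (T' := T + 20) fun σ hσ => ?_).mono (by omega) fun _ h => h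
  obtain ⟨s, hr, hs0, hsa⟩ := hσ
  obtain ⟨h1, h2⟩ := h s hs0 hsa
  refine (((algorithm.runs_compile s σ (by decide) hr).mono h1 fun _ h => h).seq (T' := 20)
    fun τ hτ => ?_)
  -- The results are moved to the registers `0` to `3` only at the end; none of the registers read
  -- here is among these, so the order does no harm. The output tape starts behind the last matrix.
  refine ⟨_, _, Exec.seq (Exec.assign _ _ _) (Exec.seq (Exec.assign _ _ _)
    (Exec.seq (Exec.assign _ _ _) (Exec.assign _ _ _))), by simp [Term.cost], algorithm.den s, h2,
      ?_⟩
  have e3 := hτ.var 3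
  have e4 := hτ.var 4
  have e9 := hτ.var 9
  have eb := hτ.base numArr le_rfl
  have eo := hτ.out
  simp only [numArr, Nat.reduceMul, Nat.reduceAdd] at e3 e4 e9 eb eo
  simp [Term.eval, Function.update, numArr, e3, e4, e9, eb, eo]

end RAM

/-! ### The main theorem. -/

theorem one_add_ncard_antipodeCandidates_le {N : ℕ} {G : SimpleGraph (Fin N)} {n r : ℕ}
    (v : Fin N) : 1 + (antipodeCandidates G n r v).ncard ≤ N := by
  have h1 : v ∉ antipodeCandidates G n r v := by
    simp [antipodeCandidates]
  have h2 := Set.ncard_le_card (insert v (antipodeCandidates G n r v))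
  rw [Set.ncard_insert_of_notMem h1, Nat.card_eq_fintype_card, Fintype.card_fin] at h2
  omega

theorem mainTheorem2 :
    ∃ (P : RAM.Prog) (c : ℕ), ∀ (N : ℕ) (G : SimpleGraph (Fin N)), G.Connected →
      ∃ (t : ℕ) (s : RAM.State), RAM.Exec P (RAM.input G) t s ∧
        (IsCocircuitGraph G →
          ∃ (n r : ℕ) (L : Fin N → SignVec n), IsOMLabeling G n r L ∧ s.Returns n r L) ∧
        (¬ IsCocircuitGraph G → s.Rejects) ∧
        (∀ n r : ℕ, HasParameters G n r → t ≤ c * (r * (n - r + 1) * N ^ 3)) ∧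
        (∀ n r : ℕ, HasParameters G n r → ∃ v : Fin N,
          t ≤ c * ((1 + (antipodeCandidates G n r v).ncard) * r * (n - r + 1) * N ^ 2)) ∧
        ((¬ ∃ n r : ℕ, HasParameters G n r) → t ≤ c * N ^ 2) := by
  obtain ⟨c, hc⟩ := RAM.exists_algorithm_bound
  -- The additional `250` absorbs the `30 * N + 220` steps spent outside the compiled algorithm.
  refine ⟨RAM.program, c + 250, fun N G hG => ?_⟩
  have hpos : 0 < N := Fin.pos hG.nonempty.some
  have hN2 : 1 ≤ N ^ 2 := Nat.one_le_pow _ _ hpos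
  have hNN : N ≤ N ^ 2 := by nlinarith
  by_cases hp : ∃ n r, HasParameters G n r
  · obtain ⟨n, h, hp'⟩ : ∃ n h, HasParameters G n (h + 1) := by
      obtain ⟨n, r, hp⟩ := hp
      exact ⟨n, r - 1, by rwa [Nat.sub_add_cancel hp.1]⟩
    have hq : n - (h + 1) + 1 = n - h := by have := hp'.2.1; omega
    obtain ⟨t, σ, hex, ht, s, ⟨h3, h4, h9, h5, h6⟩, r0, r1, r2, r3⟩ := RAM.runs_program hpos G
      (T := c * ((1 + (antipodeCandidates G n (h + 1) ⟨0, hpos⟩).ncard) * ((h + 1) * (n - h)) *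
        N ^ 2))
      (Q := fun t => t.var 3 = h ∧ t.var 4 = n ∧ t.var 9 ≤ 1 ∧ (t.var 9 ≠ 0 →
        ∃ X : Fin N → SignVec n, IsOMLabeling G n (h + 1) X ∧ ∀ (i : Fin N) (e : Fin n),
          t.out (i * n + e) = RAM.signCode (X i e)) ∧
        ((∃ X : Fin N → SignVec n, IsOMLabeling G n (h + 1) X) → t.var 9 ≠ 0)) (by
      intro s hs hadj
      rcases hc N G hG hpos s hs hadj with ⟨hno, -⟩ | ⟨n', h', hp'', h3, h4, h9, h5, h6, h7⟩
      · exact absurd hp hno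
      · obtain ⟨rfl, hr⟩ := hp'.unique hG hp''
        obtain rfl : h = h' := by omega
        exact ⟨h7, h3, h4, h9, h5, h6⟩)
    have hbound : t ≤ (c + 250) * ((1 + (antipodeCandidates G n (h + 1) ⟨0, hpos⟩).ncard) *
        (h + 1) * (n - (h + 1) + 1) * N ^ 2) := by
      have h1 : 1 ≤ (h + 1) * (n - h) := Nat.mul_pos (by omega) (by omega)
      rw [hq, mul_assoc (1 + _) (h + 1)]
      generalize (antipodeCandidates G n (h + 1) ⟨0, hpos⟩).ncard = D at ht ⊢
      have h2 : 1 ≤ (1 + D) * ((h + 1) * (n - h)) := Nat.mul_pos (by omega) h1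
      nlinarith
    refine ⟨t, σ, hex, fun hcg => ?_, fun hcg => ?_, fun n' r' hp'' => ?_, fun n' r' hp'' => ?_,
      fun hno => absurd hp hno⟩
    · obtain ⟨n', r', L, hL⟩ := hcg.exists_isOMLabeling
      obtain ⟨rfl, rfl⟩ := hp'.unique hG (hL.hasParameters ⟨0, hpos⟩)
      have h9' := h6 ⟨L, hL⟩
      obtain ⟨X, hX1, hX2⟩ := h5 h9'
      refine ⟨n, h + 1, X, hX1, by omega, by omega, by omega, fun i e => ?_⟩
      rw [r3, hX2]
    · rw [RAM.State.Rejects, r0]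
      by_contra h9'
      obtain ⟨X, hX1, -⟩ := h5 h9'
      exact hcg hX1.isCocircuitGraph
    · obtain ⟨rfl, rfl⟩ := hp'.unique hG hp''
      -- The vertex `0` is no candidate for its own antipode, so `1 + |D|` is at most `N` and the
      -- cubic bound follows from the finer one.
      refine hbound.trans (Nat.mul_le_mul_left _ ?_)
      calc _ ≤ N * (h + 1) * (n - (h + 1) + 1) * N ^ 2 := by
            gcongr
            exact one_add_ncard_antipodeCandidates_le _
        _ = _ := by ring
    · obtain ⟨rfl, rfl⟩ := hp'.unique hG hp''
      exact ⟨⟨0, hpos⟩, hbound⟩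
  · obtain ⟨t, σ, hex, ht, s, h9, r0, -⟩ := RAM.runs_program hpos G (T := c * N ^ 2)
      (Q := fun t => t.var 9 = 0) (by
      intro s hs hadj
      rcases hc N G hG hpos s hs hadj with ⟨-, h9, h7⟩ | ⟨n', h', hp'', -⟩
      · exact ⟨h7, h9⟩
      · exact absurd ⟨n', h' + 1, hp''⟩ hp)
    refine ⟨t, σ, hex, fun hcg => ?_, fun _ => ?_, fun n r h => absurd ⟨n, r, h⟩ hp,
      fun n r h => absurd ⟨n, r, h⟩ hp, fun _ => ?_⟩
    · obtain ⟨n, r, L, hL⟩ := hcg.exists_isOMLabeling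
      exact absurd ⟨n, r, hL.hasParameters ⟨0, hpos⟩⟩ hp
    · rw [RAM.State.Rejects, r0, h9]
    · nlinarith
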